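/- **Setting.** Let $\Lambda>0$ and $a\in\mathbb R$ satisfy $a^2\Lambda/3\le 7-4\sqrt3$. Put $E=1+\frac{a^2\Lambda}{3}$, $\Delta_\vartheta=1+\frac{a^2\Lambda}{3}\cos^2\vartheta$, $D=-i\partial$, and let $\sigma_1,\sigma_2,\sigma_3$ be the Pauli matrices. For $\lambda\in\mathbb C$ consider $$A_{\mathbb S^2}(\lambda)=\sqrt{\Delta_\vartheta}\Big[\sigma_1\Big(D_\vartheta+\frac{i\Lambda a^2\sin 2\vartheta}{12\Delta_\vartheta}\Big)-\sigma_2\frac{E}{\Delta_\vartheta\sin\vartheta}D_\varphi\Big]+\lambda\frac{a\sin\vartheta}{\sqrt{\Delta_\vartheta}}\,\sigma_2$$ on $L^2(\mathbb S^2)=L^2((0,\pi)\times(0,2\pi),d\vartheta\, d\varphi;\mathbb C^2)$ with antiperiodic conditions in $\varphi$. The domain is the Sobolev space $H^1(\mathbb S^2)$ of spinors $u$ with $u,\nabla_\vartheta u,\nabla_\varphi u\in L^2$, where $\nabla_\vartheta=\partial_\vartheta-\frac{\cot\vartheta}2$ and $\nabla_\varphi=\frac1{\sin\vartheta}(\partial_\varphi+\frac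 i2\cos\vartheta\,\sigma_3)$. For $k\in\frac12+\mathbb Z$ let $\mathcal D'_k=\{u:(D_\varphi-k)u=0\}$. For $\lambda\in\mathbb R$ and $l\in\mathbb Z\setminus\{0\}$ let $\mu_{k,l}(\lambda)$ be the $l$-th positive eigenvalue (for $l>0$), or the $|l|$-th negative eigenvalue counted from $0$ downwards (for $l<0$), of $A_{\mathbb S^2}(\lambda)$ on $\mathcal D'_k$. A family $R(\lambda,\omega)$ of operators is called meromorphic on $\mathbb C^2$ with poles of finite rank if near each $(\lambda_0,\omega_0)$ it has the form $S+K^{-1}F$ with $S,F,K$ holomorphic, $F$ of finite rank, $K$ scalar, $K(\lambda_0,\cdot)\not\equiv0$ near $\omega_0$, and the zeros of $K$ exactly the poles of the family (the points where it is not defined). **Proposition (angular resolvent estimates).** There is a two-sided inverse $R_\vartheta(\lambda,\omega)=(A_{\mathbb S^2}(\lambda)-\omega)^{-1}:L^2(\mathbb S^2)\to H^1(\mathbb S^2)$, $(\lambda,\omega)\in\mathbb C^2$, defined wherever $A_{\mathbb S^2}(\lambda)-\omega$ is invertible, with the following properties. 1. $R_\vartheta$ is meromorphic on $\mathbb C^2$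 with poles of finite rank. The same holds for each $k\in\frac12+\mathbb Z$ for the inverse $R_{\vartheta,k}(\lambda,\omega):L^2(\mathbb S^2)\cap\mathcal D'_k\to H^1(\mathbb S^2)$ of the restriction of $A_{\mathbb S^2}(\lambda)-\omega$ to $\mathcal D'_k$, and $R_{\vartheta,k}$ is the restriction of $R_\vartheta$ wherever the latter is defined. For all $\Lambda>0$, $k\in\frac12+\mathbb Z$, $l\in\mathbb Z\setminus\{0\}$ there is a continuous function $\rho:\mathbb R\to(0,\infty)$, independent of $a$, such that for every admissible $a$ the function $\mu_{k,l}$ extends holomorphically to $\{|\operatorname{Im}\lambda|<\rho(\operatorname{Re}\lambda)\}$, and on $\{|\operatorname{Im}\lambda|<\rho(\operatorname{Re}\lambda),\ |\omega-\mu_{k,l}(\lambda)|<\rho(\operatorname{Re}\lambda)\}$ the poles of $R_{\vartheta,k}$ are exactly the points with $\omega=\mu_{k,l}(\lambda)$ and $$R_{\vartheta,k}(\lambda,\omega)=\frac{S_\vartheta(\lambda,\omega)}{\omega-\mu_{k,l}(\lambda)}$$ with $S_\vartheta$ holomorphic there. Moreover there are constants $C_1,C_2$ such that for all admissible $\Lambda,a$,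 all $\lambda\in\mathbb R$, $k\in\frac12+\mathbb Z$ and integers $l\ge1$ $$(2-e^{1/26})(|k|-\tfrac12+l)-C_1|k|-C_2-|a\lambda|\le\mu_{k,l}(\lambda)\le e^{1/26}(|k|-\tfrac12+l)+C_1|k|+C_2+|a\lambda|.$$ 2. There is a constant $C_\vartheta>0$ such that for all admissible $\Lambda,a$, all $k\in\frac12+\mathbb Z$ and $\lambda,\omega\in\mathbb C$ $$\|R_{\vartheta,k}(\lambda,\omega)\|_{L^2\cap\mathcal D'_k\to L^2}\le\frac{C_\vartheta}{|k|}\quad\text{if } |\omega|\le0.4|k|,\ |k|\ge C_\vartheta|a\lambda|;$$ and $$\|R_{\vartheta,k}(\lambda,\omega)\|_{L^2\cap\mathcal D'_k\to L^2}\le\frac1{|\operatorname{Im}\omega|-|a||\operatorname{Im}\lambda|}\ \Big(\le\frac2{|\operatorname{Im}\omega|}\Big)\quad\text{if } |\operatorname{Im}\omega|>2|a||\operatorname{Im}\lambda|.$$ 3. For every $\psi>0$ there is a constant $C_\psi>0$ such that for all admissible $\Lambda,a$, all $k\in\frac12+\mathbb Z$ and $\lambda,\omega\in\mathbb C$ $$\|R_{\vartheta,k}(\lambda,\omega)\|_{L^2\cap\mathcal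 D'_k\to L^2}\le\frac{C_\psi}{|\omega|}\quad\text{if } \psi\le|\arg\omega|\le\pi-\psi,\ |\omega|\ge C_\psi|a\lambda|.$$ In 2 and 3 it is part of the claim that $(\lambda,\omega)$ is not a pole of $R_{\vartheta,k}$. -/

import Mathlib

open MeasureTheory Set Filter Topology

noncomputable section

namespace KerrAngular

/-- Values of two-component spinors. -/
abbrev Spinor : Type := EuclideanSpace ℂ (Fin 2)

/-- Lebesgue measure `dθ dφ` on the coordinate domain `(0, π) × (0, 2π)` of the sphere; a point is
written `x = (θ, φ)`. -/
def sphereMeasure : Measure (ℝ × ℝ) :=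
  volume.restrict (Ioo 0 Real.pi ×ˢ Ioo 0 (2 * Real.pi))

/-- The Hilbert space `L²(S², dθ dφ; ℂ²)`. -/
abbrev L2S : Type := Lp Spinor 2 sphereMeasure

/-- The action of a Pauli-type matrix on a spinor. -/
def act (M : Matrix (Fin 2) (Fin 2) ℂ) (v : Spinor) : Spinor := WithLp.toLp 2 (M.mulVec v.ofLp)

def sigma1 : Matrix (Fin 2) (Fin 2) ℂ := !![0, 1; 1, 0]
def sigma2 : Matrix (Fin 2) (Fin 2) ℂ := !![0, -Complex.I; Complex.I, 0]
def sigma3 : Matrix (Fin 2) (Fin 2) ℂ := !![1, 0; 0, -1]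

/-- Test spinor fields on the sphere minus the poles: smooth, antiperiodic in `φ` (a spinor changes
sign after a full rotation) and vanishing near the poles `θ = 0` and `θ = π`. -/
structure IsTestField (ψ : ℝ × ℝ → Spinor) : Prop where
  smooth : ContDiff ℝ (⊤ : ℕ∞) ψ
  antiperiodic : ∀ θ φ : ℝ, ψ (θ, φ + 2 * Real.pi) = -ψ (θ, φ)
  support : ∃ ε > 0, ∀ x : ℝ × ℝ, x.1 ∉ Icc ε (Real.pi - ε) → ψ x = 0

/-- The derivatives `∂_θ ψ` and `∂_φ ψ`. -/
def dTheta (ψ : ℝ × ℝ → Spinor) (x : ℝ × ℝ) : Spinor := fderiv ℝ ψ x (1, 0)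
def dPhi (ψ : ℝ × ℝ → Spinor) (x : ℝ × ℝ) : Spinor := fderiv ℝ ψ x (0, 1)

/-- `(∂_θ + (cot θ)/2) ψ`, minus the formal adjoint in `L²(dθ dφ)` of the covariant derivative
`∇_θ = ∂_θ - (cot θ)/2` along the unit vector `∂_θ`. (Spinors `φ` on the round sphere are written
as `u = (sin θ)^{1/2} φ`, which turns `sin θ dθ dφ` into `dθ dφ` and `∂_θ` into
`∂_θ - (cot θ)/2`.) -/
def adjNablaTheta (ψ : ℝ × ℝ → Spinor) (x : ℝ × ℝ) : Spinor :=
  dTheta ψ x + ((Real.cos x.1 / Real.sin x.1 / 2 : ℝ) : ℂ) • ψ x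

/-- The covariant derivative `(sin θ)⁻¹ (∂_φ + (i/2) cos θ σ₃) ψ` along the unit vector
`(sin θ)⁻¹ ∂_φ`, for the spin connection of the round sphere with Clifford matrices `σ₁, -σ₂`. It is
formally skew-adjoint in `L²(dθ dφ)`. The standard Dirac operator of the sphere,
`σ₁ D_θ - σ₂ (sin θ)⁻¹ D_φ`, equals `-i (σ₁ ∇_θ - σ₂ ∇_φ)`. -/
def nablaPhi (ψ : ℝ × ℝ → Spinor) (x : ℝ × ℝ) : Spinor :=
  (((Real.sin x.1)⁻¹ : ℝ) : ℂ) •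
    (dPhi ψ x + (Complex.I / 2 * ((Real.cos x.1 : ℝ) : ℂ)) • act sigma3 (ψ x))

/-- `Δ_θ = 1 + (a² Λ / 3) cos² θ`. -/
def DeltaTheta (a Λ θ : ℝ) : ℝ := 1 + a ^ 2 * Λ / 3 * Real.cos θ ^ 2

/-- The differential expression
`A(λ) = √Δ_θ [σ₁ (D_θ + i Λ a² sin 2θ / (12 Δ_θ)) - σ₂ E / (Δ_θ sin θ) D_φ] + λ a sin θ / √Δ_θ σ₂`
with `D = -i ∂` and `E = 1 + a² Λ / 3`, applied to a smooth field. -/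
def angularExpr (a Λ : ℝ) (lam : ℂ) (ψ : ℝ × ℝ → Spinor) (x : ℝ × ℝ) : Spinor :=
  ((√(DeltaTheta a Λ x.1) : ℝ) : ℂ) •
      (act sigma1 ((-Complex.I) • dTheta ψ x
          + (Complex.I * ((Λ * a ^ 2 * Real.sin (2 * x.1) / (12 * DeltaTheta a Λ x.1) : ℝ) : ℂ))
              • ψ x)
        - (((1 + a ^ 2 * Λ / 3) / (DeltaTheta a Λ x.1 * Real.sin x.1) : ℝ) : ℂ)
            • act sigma2 ((-Complex.I) • dPhi ψ x))
    + (lam * ((a * Real.sin x.1 / √(DeltaTheta a Λ x.1) : ℝ) : ℂ)) • act sigma2 (ψ x)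

section Integrability

theorem dTheta_continuous {ψ : ℝ × ℝ → Spinor} (h : IsTestField ψ) : Continuous (dTheta ψ) := by
  have := h.smooth.continuous_fderiv (by simp)
  unfold dTheta
  fun_prop

theorem dPhi_continuous {ψ : ℝ × ℝ → Spinor} (h : IsTestField ψ) : Continuous (dPhi ψ) := by
  have := h.smooth.continuous_fderiv (by simp)
  unfold dPhi
  fun_prop

theorem deriv_support {ψ : ℝ × ℝ → Spinor} (h : IsTestField ψ) :
    ∃ ε > 0, ∀ x : ℝ × ℝ, x.1 ∉ Icc ε (Real.pi - ε) →
      ψ x = 0 ∧ dTheta ψ x = 0 ∧ dPhi ψ x = 0 := by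
  obtain ⟨ε, hε, hs⟩ := h.support
  refine ⟨ε, hε, fun x hx => ⟨hs x hx, ?_⟩⟩
  have ho : IsOpen {y : ℝ × ℝ | y.1 ∉ Icc ε (Real.pi - ε)} :=
    (isClosed_Icc.preimage continuous_fst).isOpen_compl
  have he : ψ =ᶠ[𝓝 x] fun _ => 0 :=
    Filter.eventually_of_mem (ho.mem_nhds hx) fun y hy => hs y hy
  have hf : fderiv ℝ ψ x = 0 := by
    rw [he.fderiv_eq]; simp
  exact ⟨by simp [dTheta, hf], by simp [dPhi, hf]⟩

/-- A field continuous away from the poles and vanishing near them pairs with every `L²` field. -/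
theorem integrable_pair {g : ℝ × ℝ → Spinor} (hg : ContinuousOn g (Ioo 0 Real.pi ×ˢ univ))
    (hs : ∃ ε > 0, ∀ x : ℝ × ℝ, x.1 ∉ Icc ε (Real.pi - ε) → g x = 0) (u : L2S) :
    Integrable (fun x => inner ℂ (g x) (u x)) sphereMeasure := by
  obtain ⟨ε, hε, hs⟩ := hs
  have hm : MemLp g 2 sphereMeasure := by
    have hfin : IsFiniteMeasure sphereMeasure := by
      refine ⟨?_⟩
      simp only [sphereMeasure, Measure.restrict_apply_univ]
      rw [Measure.volume_eq_prod, Measure.prod_prod]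
      simp [ENNReal.mul_lt_top]
    have hmeas : AEStronglyMeasurable g sphereMeasure := by
      refine (hg.mono ?_).aestronglyMeasurable (measurableSet_Ioo.prod measurableSet_Ioo)
      exact prod_mono_right (subset_univ _)
    have hc : IsCompact (Icc ε (Real.pi - ε) ×ˢ Icc 0 (2 * Real.pi)) :=
      isCompact_Icc.prod isCompact_Icc
    have hcont : ContinuousOn g (Icc ε (Real.pi - ε) ×ˢ Icc 0 (2 * Real.pi)) := by
      refine hg.mono ?_
      rintro ⟨x, y⟩ ⟨hx, -⟩
      exact ⟨⟨by linarith [hx.1], by linarith [hx.2]⟩, mem_univ _⟩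
    obtain ⟨C, hC⟩ := hc.exists_bound_of_continuousOn hcont
    refine MemLp.of_bound hmeas (max C 0) ?_
    refine (ae_restrict_mem (measurableSet_Ioo.prod measurableSet_Ioo)).mono ?_
    rintro ⟨x, y⟩ ⟨hx, hy⟩
    by_cases h : x ∈ Icc ε (Real.pi - ε)
    · exact (hC _ ⟨h, Ioo_subset_Icc_self hy⟩).trans (le_max_left _ _)
    · rw [hs (x, y) h]; simp
  have := L2.integrable_inner (𝕜 := ℂ) (hm.toLp g) u
  refine this.congr ?_
  filter_upwards [hm.coeFn_toLp] with x hx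
  rw [hx]

theorem integral_pair_add {g : ℝ × ℝ → Spinor} (hg : ContinuousOn g (Ioo 0 Real.pi ×ˢ univ))
    (hs : ∃ ε > 0, ∀ x : ℝ × ℝ, x.1 ∉ Icc ε (Real.pi - ε) → g x = 0) (u v : L2S) :
    ∫ x, inner ℂ (g x) ((u + v : L2S) x) ∂sphereMeasure
      = ∫ x, inner ℂ (g x) (u x) ∂sphereMeasure + ∫ x, inner ℂ (g x) (v x) ∂sphereMeasure := by
  rw [← integral_add (integrable_pair hg hs u) (integrable_pair hg hs v)]
  refine integral_congr_ae ?_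
  filter_upwards [Lp.coeFn_add u v] with x hx
  rw [hx, Pi.add_apply, inner_add_right]

theorem integral_pair_smul (g : ℝ × ℝ → Spinor) (c : ℂ) (u : L2S) :
    ∫ x, inner ℂ (g x) ((c • u : L2S) x) ∂sphereMeasure
      = c * ∫ x, inner ℂ (g x) (u x) ∂sphereMeasure := by
  rw [← integral_const_mul]
  refine integral_congr_ae ?_
  filter_upwards [Lp.coeFn_smul c u] with x hx
  rw [hx, Pi.smul_apply, inner_smul_right]

theorem integral_pair_zero (g : ℝ × ℝ → Spinor) :
    ∫ x, inner ℂ (g x) ((0 : L2S) x) ∂sphereMeasure = 0 := by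
  have := integral_pair_smul g 0 0
  simpa using this

theorem sin_ne_zero_on : ∀ x ∈ (Ioo 0 Real.pi ×ˢ univ : Set (ℝ × ℝ)), Real.sin x.1 ≠ 0 :=
  fun _ hx => (Real.sin_pos_of_pos_of_lt_pi hx.1.1 hx.1.2).ne'

theorem act_continuous (M : Matrix (Fin 2) (Fin 2) ℂ) : Continuous (act M) := by
  unfold act
  fun_prop

theorem test_ok {ψ : ℝ × ℝ → Spinor} (h : IsTestField ψ) :
    ContinuousOn ψ (Ioo 0 Real.pi ×ˢ univ) ∧
      ∃ ε > 0, ∀ x : ℝ × ℝ, x.1 ∉ Icc ε (Real.pi - ε) → ψ x = 0 :=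
  ⟨h.smooth.continuous.continuousOn, h.support⟩

theorem adjNablaTheta_ok {ψ : ℝ × ℝ → Spinor} (h : IsTestField ψ) :
    ContinuousOn (adjNablaTheta ψ) (Ioo 0 Real.pi ×ˢ univ) ∧
      ∃ ε > 0, ∀ x : ℝ × ℝ, x.1 ∉ Icc ε (Real.pi - ε) → adjNablaTheta ψ x = 0 := by
  constructor
  · have h1 := (dTheta_continuous h).continuousOn (s := (Ioo 0 Real.pi ×ˢ univ : Set (ℝ × ℝ)))
    have h2 := h.smooth.continuous.continuousOn (s := (Ioo 0 Real.pi ×ˢ univ : Set (ℝ × ℝ)))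
    unfold adjNablaTheta
    have h3 : ContinuousOn (fun x : ℝ × ℝ => Real.cos x.1 / Real.sin x.1 / 2)
        (Ioo 0 Real.pi ×ˢ univ) :=
      ContinuousOn.div_const (ContinuousOn.div (by fun_prop) (by fun_prop) sin_ne_zero_on) _
    have h4 := Complex.continuous_ofReal.comp_continuousOn h3
    exact h1.add (h4.smul h2)
  · obtain ⟨ε, hε, hs⟩ := deriv_support h
    exact ⟨ε, hε, fun x hx => by simp [adjNablaTheta, hs x hx]⟩

theorem nablaPhi_ok {ψ : ℝ × ℝ → Spinor} (h : IsTestField ψ) :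
    ContinuousOn (nablaPhi ψ) (Ioo 0 Real.pi ×ˢ univ) ∧
      ∃ ε > 0, ∀ x : ℝ × ℝ, x.1 ∉ Icc ε (Real.pi - ε) → nablaPhi ψ x = 0 := by
  constructor
  · have h1 := (dPhi_continuous h).continuousOn (s := (Ioo 0 Real.pi ×ˢ univ : Set (ℝ × ℝ)))
    have h2 := ((act_continuous sigma3).comp h.smooth.continuous).continuousOn
      (s := (Ioo 0 Real.pi ×ˢ univ : Set (ℝ × ℝ)))
    unfold nablaPhi
    have h3 : ContinuousOn (fun x : ℝ × ℝ => (Real.sin x.1)⁻¹) (Ioo 0 Real.pi ×ˢ univ) :=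
      ContinuousOn.inv₀ (by fun_prop) sin_ne_zero_on
    have h4 := Complex.continuous_ofReal.comp_continuousOn h3
    have h5 : ContinuousOn (fun x : ℝ × ℝ => Complex.I / 2 * ((Real.cos x.1 : ℝ) : ℂ))
        (Ioo 0 Real.pi ×ˢ univ) := by fun_prop
    exact h4.smul (h1.add (h5.smul h2))
  · obtain ⟨ε, hε, hs⟩ := deriv_support h
    exact ⟨ε, hε, fun x hx => by simp [nablaPhi, hs x hx, act]⟩

theorem dPhi_sub_ok {ψ : ℝ × ℝ → Spinor} (h : IsTestField ψ) (k : ℝ) :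
    ContinuousOn (fun x => (-Complex.I) • dPhi ψ x - (k : ℂ) • ψ x) (Ioo 0 Real.pi ×ˢ univ) ∧
      ∃ ε > 0, ∀ x : ℝ × ℝ, x.1 ∉ Icc ε (Real.pi - ε) →
        (-Complex.I) • dPhi ψ x - (k : ℂ) • ψ x = 0 := by
  constructor
  · have h1 := dPhi_continuous h
    have h2 := h.smooth.continuous
    fun_prop
  · obtain ⟨ε, hε, hs⟩ := deriv_support h
    exact ⟨ε, hε, fun x hx => by simp [hs x hx]⟩

end Integrability

/-- The Sobolev space `H¹(S²)` of spinors. Its elements are recorded as triples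
`(u, ∇_θ u, ∇_φ u)` of `L²` fields, the last two being the weak covariant derivatives of the
first, so that the norm is `(‖u‖² + ‖∇_θ u‖² + ‖∇_φ u‖²)^{1/2}`. (Test fields vanishing near the
two poles suffice, as points have zero `H¹` capacity in dimension two.) -/
def H1 : Submodule ℂ (PiLp 2 fun _ : Fin 3 => L2S) where
  carrier := {p | ∀ ψ : ℝ × ℝ → Spinor, IsTestField ψ →
    ∫ x, inner ℂ (ψ x) (p 1 x) ∂sphereMeasure
        = -∫ x, inner ℂ (adjNablaTheta ψ x) (p 0 x) ∂sphereMeasure ∧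
    ∫ x, inner ℂ (ψ x) (p 2 x) ∂sphereMeasure
        = -∫ x, inner ℂ (nablaPhi ψ x) (p 0 x) ∂sphereMeasure}
  add_mem' := by
    intro p q hp hq ψ hψ
    obtain ⟨hp1, hp2⟩ := hp ψ hψ
    obtain ⟨hq1, hq2⟩ := hq ψ hψ
    have ht := test_ok hψ
    have hn := adjNablaTheta_ok hψ
    have hm := nablaPhi_ok hψ
    simp only [PiLp.add_apply]
    rw [integral_pair_add ht.1 ht.2, integral_pair_add ht.1 ht.2, integral_pair_add hn.1 hn.2,
      integral_pair_add hm.1 hm.2, hp1, hp2, hq1, hq2]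
    constructor <;> ring
  zero_mem' := by
    intro ψ hψ
    simp only [PiLp.zero_apply, integral_pair_zero, neg_zero, and_self]
  smul_mem' := by
    intro c p hp ψ hψ
    obtain ⟨hp1, hp2⟩ := hp ψ hψ
    simp only [PiLp.smul_apply, integral_pair_smul]
    rw [hp1, hp2]
    constructor <;> ring

/-- The inclusion `H¹(S²) → L²(S²)`. -/
def H1.toL2 : H1 →L[ℂ] L2S :=
  (PiLp.proj 2 (𝕜 := ℂ) (fun _ : Fin 3 => L2S) 0) ∘L H1.subtypeL

/-- `L²(S²) ∩ 𝒟'_k`: the `L²` fields `u` with `(D_φ - k) u = 0` in the sense of distributions. -/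
def modeSpace (k : ℝ) : Submodule ℂ L2S where
  carrier := {u | ∀ ψ : ℝ × ℝ → Spinor, IsTestField ψ →
    ∫ x, inner ℂ ((-Complex.I) • dPhi ψ x - (k : ℂ) • ψ x) (u x) ∂sphereMeasure = 0}
  add_mem' := by
    intro u v hu hv ψ hψ
    have h := dPhi_sub_ok hψ k
    rw [integral_pair_add h.1 h.2, hu ψ hψ, hv ψ hψ, add_zero]
  zero_mem' := by
    intro ψ hψ
    exact integral_pair_zero _
  smul_mem' := by
    intro c u hu ψ hψ
    rw [integral_pair_smul, hu ψ hψ, mul_zero]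

/-- `k ∈ 1/2 + ℤ`. -/
def IsHalfInteger (k : ℝ) : Prop := ∃ j : ℤ, k = j + 1 / 2

/-- `(A(λ) - ω) u = f` for `u ∈ H¹(S²)` and `f ∈ L²(S²)`, the differential operator acting in the
sense of distributions. The formal adjoint of `A(λ)` is `A(conj λ)`. -/
def ResolventEq (a Λ : ℝ) (lam ω : ℂ) (u : H1) (f : L2S) : Prop :=
  ∀ ψ : ℝ × ℝ → Spinor, IsTestField ψ →
    ∫ x, inner ℂ (ψ x) ((f + ω • H1.toL2 u : L2S) x) ∂sphereMeasure
      = ∫ x, inner ℂ (angularExpr a Λ (starRingEnd ℂ lam) ψ x) (H1.toL2 u x) ∂sphereMeasure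

/-- `T : L²(S²) → H¹(S²)` is a two-sided inverse of `A(λ) - ω : H¹(S²) → L²(S²)`; the second part
contains that `A(λ) - ω` is defined on all of `H¹(S²)`. Here `p = (λ, ω)`. -/
def IsTwoSidedInverse (a Λ : ℝ) (p : ℂ × ℂ) (T : L2S →L[ℂ] H1) : Prop :=
  (∀ f : L2S, ResolventEq a Λ p.1 p.2 (T f) f) ∧
    ∀ u : H1, ∃ f : L2S, ResolventEq a Λ p.1 p.2 u f ∧ T f = u

/-- The same for the restriction of `A(λ) - ω` to the angular mode `𝒟'_k`. -/
def IsModeInverse (a Λ k : ℝ) (p : ℂ × ℂ) (T : modeSpace k →L[ℂ] H1) : Prop :=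
  (∀ f : modeSpace k, H1.toL2 (T f) ∈ modeSpace k ∧ ResolventEq a Λ p.1 p.2 (T f) f) ∧
    ∀ u : H1, H1.toL2 u ∈ modeSpace k →
      ∃ f : modeSpace k, ResolventEq a Λ p.1 p.2 u f ∧ T f = u

/-- The points `(λ, ω)` at which `A(λ) - ω` is invertible. -/
def regularSet (a Λ : ℝ) : Set (ℂ × ℂ) := {p | ∃ T, IsTwoSidedInverse a Λ p T}

/-- The points `(λ, ω)` at which the restriction of `A(λ) - ω` to `𝒟'_k` is invertible. -/
def modeRegularSet (a Λ k : ℝ) : Set (ℂ × ℂ) := {p | ∃ T, IsModeInverse a Λ k p T}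

open Classical in
/-- The angular resolvent `R(λ, ω) = (A(λ) - ω)⁻¹ : L²(S²) → H¹(S²)` (meaningful on
`regularSet a Λ`, and `0` elsewhere). -/
def angularResolvent (a Λ : ℝ) (p : ℂ × ℂ) : L2S →L[ℂ] H1 :=
  if h : ∃ T, IsTwoSidedInverse a Λ p T then h.choose else 0

open Classical in
/-- The angular resolvent on the mode `𝒟'_k` (meaningful on `modeRegularSet a Λ k`, and `0`
elsewhere). -/
def modeResolvent (a Λ k : ℝ) (p : ℂ × ℂ) : modeSpace k →L[ℂ] H1 :=
  if h : ∃ T, IsModeInverse a Λ k p T then h.choose else 0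

/-- A family of operators `R(λ, ω)`, defined for `(λ, ω) ∈ Ω`, is meromorphic on `ℂ²` with poles of
finite rank: near every point `R = S + K⁻¹ F` with `S`, `F`, `K` holomorphic, `F` of finite rank and
`K` scalar, where the zeros of `K` are exactly the points outside `Ω` and `K(λ₀, ·)` does not vanish
identically near `ω₀`. -/
def IsMeromorphicFiniteRank {V W : Type*} [NormedAddCommGroup V] [NormedSpace ℂ V]
    [NormedAddCommGroup W] [NormedSpace ℂ W] (Ω : Set (ℂ × ℂ)) (R : ℂ × ℂ → V →L[ℂ] W) : Prop :=
  ∀ p₀ : ℂ × ℂ, ∃ (S F : ℂ × ℂ → V →L[ℂ] W) (K : ℂ × ℂ → ℂ),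
    AnalyticAt ℂ S p₀ ∧ AnalyticAt ℂ F p₀ ∧ AnalyticAt ℂ K p₀ ∧
    (¬ ∀ᶠ ω in 𝓝 p₀.2, K (p₀.1, ω) = 0) ∧
    ∀ᶠ p in 𝓝 p₀, FiniteDimensional ℂ (LinearMap.range (F p).toLinearMap) ∧
      (p ∈ Ω ↔ K p ≠ 0) ∧ (p ∈ Ω → R p = S p + (K p)⁻¹ • F p)

/-- `μ` is an eigenvalue of the restriction of `A(λ)` to `𝒟'_k`. -/
def IsEigenvalue (a Λ k : ℝ) (lam μ : ℂ) : Prop :=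
  ∃ u : H1, u ≠ 0 ∧ H1.toL2 u ∈ modeSpace k ∧ ResolventEq a Λ lam μ u 0

/-- For real `λ` and `l ∈ ℤ \ {0}`: `μ` is the eigenvalue `μ_{k,l}(λ)`, that is the `l`-th positive
eigenvalue of `A(λ)` on `𝒟'_k` if `l > 0`, and the `|l|`-th negative one, counted from zero
downwards, if `l < 0`. -/
def IsNthEigenvalue (a Λ k : ℝ) (l : ℤ) (lam μ : ℝ) : Prop :=
  IsEigenvalue a Λ k lam μ ∧
    ((0 < l ∧ 0 < μ ∧
        {ν : ℝ | 0 < ν ∧ ν ≤ μ ∧ IsEigenvalue a Λ k lam ν}.ncard = l.natAbs) ∨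
      (l < 0 ∧ μ < 0 ∧
        {ν : ℝ | μ ≤ ν ∧ ν < 0 ∧ IsEigenvalue a Λ k lam ν}.ncard = l.natAbs))

/-- The standing condition on the cosmological constant and the rotation parameter. -/
def Admissible (Λ a : ℝ) : Prop := 0 < Λ ∧ a ^ 2 * Λ / 3 ≤ 7 - 4 * √3

end KerrAngular

end

noncomputable section

namespace KerrAngular

open Real
open Complex (I I_mul_I I_ne_zero abs_im_le_norm conjCLE conj_I conj_eq_iff_im conj_ofReal
  continuous_re exp_int_mul_two_pi_mul_I norm_I norm_exp_ofReal_mul_I norm_real ofRealCLM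
  ofReal_ne_zero ofReal_neg ofReal_sub)
open ENNReal (ofReal ofReal_add ofReal_le_ofReal ofReal_lt_top ofReal_mul ofReal_ne_top
  ofReal_pow)
open ContinuousLinearMap (adjoint adjoint_inner_left adjoint_inner_right comp_apply compL fst
  norm_id_le opNorm_comp_le opNorm_le_bound proj snd)
open EuclideanSpace (single)
open intervalIntegral (continuousOn_primitive_interval' integral_add_adjacent_intervals
  integral_hasDerivAt_right integral_of_le integral_same integral_symm)
open LinearMap renaming range → lrange
open Module (finrank)
open Ring (inverse)

set_option linter.unusedSectionVars false

section FinApprox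

variable {E F G : Type*} [NormedAddCommGroup E] [NormedSpace ℂ E] [NormedAddCommGroup F]
  [NormedSpace ℂ F] [NormedAddCommGroup G] [NormedSpace ℂ G]

/-- Operators of finite rank. -/
def FinRank (T : E →L[ℂ] F) : Prop := FiniteDimensional ℂ (lrange T.toLinearMap)

/-- Operators that are norm limits of operators of finite rank. -/
def FinApprox (T : E →L[ℂ] F) : Prop := T ∈ closure {Q | FinRank Q}

theorem FinRank.comp_left {T : E →L[ℂ] F} (hT : FinRank T) (A : F →L[ℂ] G) : FinRank (A ∘L T) := by
  have : FiniteDimensional ℂ (lrange T.toLinearMap) := hT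
  change FiniteDimensional ℂ (lrange (A.toLinearMap ∘ₗ T.toLinearMap))
  rw [LinearMap.range_comp]
  infer_instance

theorem FinRank.comp_right {T : F →L[ℂ] G} (hT : FinRank T) (A : E →L[ℂ] F) : FinRank (T ∘L A) :=
  have : FiniteDimensional ℂ (lrange T.toLinearMap) := hT
  Submodule.finiteDimensional_of_le (LinearMap.range_comp_le_range A.toLinearMap T.toLinearMap)

theorem FinRank.add {T S : E →L[ℂ] F} (hT : FinRank T) (hS : FinRank S) : FinRank (T + S) :=
  have : FiniteDimensional ℂ (lrange T.toLinearMap) := hT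
  have : FiniteDimensional ℂ (lrange S.toLinearMap) := hS
  Submodule.finiteDimensional_of_le (LinearMap.range_add_le T.toLinearMap S.toLinearMap)

theorem FinRank.zero : FinRank (0 : E →L[ℂ] F) := by
  change FiniteDimensional ℂ (lrange (0 : E →ₗ[ℂ] F))
  rw [LinearMap.range_zero]
  infer_instance

theorem FinRank.isCompactOperator {T : E →L[ℂ] F} (hT : FinRank T) : IsCompactOperator T := by
  have : FiniteDimensional ℂ (lrange T.toLinearMap) := hT
  have : ProperSpace (lrange T.toLinearMap) := FiniteDimensional.proper ℂ _
  have hc : IsCompactOperator T.rangeRestrict :=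
    isCompactOperator_of_locallyCompactSpace_dom T.rangeRestrict
  exact hc.clm_comp (lrange T.toLinearMap).subtypeL

theorem FinApprox.comp_left {T : E →L[ℂ] F} (hT : FinApprox T) (A : F →L[ℂ] G) :
    FinApprox (A ∘L T) :=
  map_mem_closure (f := (A ∘L ·)) (by fun_prop) hT fun _ hQ => hQ.comp_left A

theorem FinApprox.comp_right {T : F →L[ℂ] G} (hT : FinApprox T) (A : E →L[ℂ] F) :
    FinApprox (T ∘L A) :=
  map_mem_closure (f := (· ∘L A)) (by fun_prop) hT fun _ hQ => hQ.comp_right A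

theorem FinApprox.add {T S : E →L[ℂ] F} (hT : FinApprox T) (hS : FinApprox S) : FinApprox (T + S) :=
  map_mem_closure₂ continuous_add hT hS fun _ hP _ hQ => hP.add hQ

theorem FinApprox.smul {T : E →L[ℂ] F} (hT : FinApprox T) (c : ℂ) : FinApprox (c • T) :=
  hT.comp_left (c • ContinuousLinearMap.id ℂ F)

theorem FinApprox.sub {T S : E →L[ℂ] F} (hT : FinApprox T) (hS : FinApprox S) :
    FinApprox (T - S) := by simpa [sub_eq_add_neg] using hT.add (hS.smul (-1))

theorem FinApprox.sum {ι : Type*} (s : Finset ι) {T : ι → E →L[ℂ] F}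
    (hT : ∀ i ∈ s, FinApprox (T i)) : FinApprox (∑ i ∈ s, T i) :=
  Finset.sum_induction _ _ (fun _ _ => .add) (subset_closure FinRank.zero) hT

theorem FinApprox.of_approx {T : E →L[ℂ] F}
    (h : ∀ ε > 0, ∃ S : E →L[ℂ] F, FinApprox S ∧ ‖T - S‖ ≤ ε) : FinApprox T := by
  refine closure_closure.subset (Metric.mem_closure_iff.mpr fun ε hε => ?_)
  obtain ⟨S, hS, hle⟩ := h (ε / 2) (by positivity)
  exact ⟨S, hS, by rw [dist_eq_norm]; linarith⟩

theorem FinApprox.isCompactOperator [CompleteSpace F] {T : E →L[ℂ] F} (hT : FinApprox T) :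
    IsCompactOperator T :=
  closure_minimal (s := {Q | FinRank Q}) (fun _ => FinRank.isCompactOperator)
    isClosed_setOfPred_isCompactOperator hT

theorem isUnit_one_sub_of_injective [CompleteSpace E] {N : E →L[ℂ] E} (hN : FinApprox N)
    (hi : ∀ x, N x = x → x = 0) : IsUnit (1 - N) := by
  rcases hN.isCompactOperator.hasEigenvalue_or_mem_resolventSet (one_ne_zero (α := ℂ)) with h | h
  · obtain ⟨x, hx⟩ := h.exists_hasEigenvector
    exact (hx.2 (hi x (by simpa using hx.apply_eq_smul))).elim
  · simpa [spectrum.mem_resolventSet_iff] using h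

end FinApprox

section Inverse

variable {E : Type*} [NormedAddCommGroup E] [NormedSpace ℂ E]

theorem isUnit_apply_inverse {A : E →L[ℂ] E} (h : IsUnit A) (x : E) : A (inverse A x) = x :=
  DFunLike.congr_fun (Ring.mul_inverse_cancel A h) x

theorem isUnit_inverse_apply {A : E →L[ℂ] E} (h : IsUnit A) (x : E) : inverse A (A x) = x :=
  DFunLike.congr_fun (Ring.inverse_mul_cancel A h) x

theorem isUnit_of_inverse {A B : E →L[ℂ] E} (h1 : A * B = 1) (h2 : B * A = 1) :
    IsUnit A ∧ inverse A = B :=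
  ⟨⟨⟨A, B, h1, h2⟩, rfl⟩, Ring.inverse_unit ⟨A, B, h1, h2⟩⟩

variable [CompleteSpace E]

theorem analyticAt_ringInverse {V : Type*} [NormedAddCommGroup V] [NormedSpace ℂ V]
    {Y : V → E →L[ℂ] E} {p : V} (hY : AnalyticAt ℂ Y p) (hu : IsUnit (Y p)) :
    AnalyticAt ℂ (fun q => inverse (Y q)) p := by
  obtain ⟨u, hu⟩ := hu
  have := analyticAt_inverse (𝕜 := ℂ) u
  rw [hu] at this
  exact this.comp hY

theorem eventually_isUnit {V : Type*} [TopologicalSpace V] {Y : V → E →L[ℂ] E} {p : V}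
    (hY : ContinuousAt Y p) (hu : IsUnit (Y p)) : ∀ᶠ q in 𝓝 p, IsUnit (Y q) :=
  hY.eventually (Units.isOpen.mem_nhds hu)

end Inverse

section AnalyticFredholm

variable {E : Type*} [NormedAddCommGroup E] [NormedSpace ℂ E]

theorem exists_factorization {Q : E →L[ℂ] E} (hQ : FinRank Q) :
    ∃ (n : ℕ) (i : (Fin n → ℂ) →L[ℂ] E) (c : E →L[ℂ] (Fin n → ℂ)),
      Function.Injective i ∧ Q = i ∘L c := by
  have : FiniteDimensional ℂ (lrange Q.toLinearMap) := hQ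
  let b := Module.finBasis ℂ (lrange Q.toLinearMap)
  refine ⟨_, (lrange Q.toLinearMap).subtypeL ∘L b.equivFunL.symm.toContinuousLinearMap,
    b.equivFunL.toContinuousLinearMap ∘L Q.rangeRestrict, ?_, ?_⟩
  · exact Subtype.val_injective.comp b.equivFunL.symm.injective
  · ext x
    change Q x = ((b.equivFunL.symm (b.equivFunL (Q.rangeRestrict x)) : lrange Q.toLinearMap) : E)
    rw [ContinuousLinearEquiv.symm_apply_apply]
    rfl

theorem AnalyticAt.matrix_det {V : Type*} [NormedAddCommGroup V] [NormedSpace ℂ V] {n : ℕ}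
    {D : V → Matrix (Fin n) (Fin n) ℂ} {p : V} (hD : ∀ i j, AnalyticAt ℂ (fun q => D q i j) p) :
    AnalyticAt ℂ (fun q => (D q).det) p := by
  simp only [Matrix.det_apply]
  refine Finset.analyticAt_fun_sum _ fun σ _ => ?_
  simp only [Units.smul_def, zsmul_eq_mul]
  fun_prop

theorem AnalyticAt.matrix_adjugate {V : Type*} [NormedAddCommGroup V] [NormedSpace ℂ V] {n : ℕ}
    {D : V → Matrix (Fin n) (Fin n) ℂ} {p : V} (hD : ∀ i j, AnalyticAt ℂ (fun q => D q i j) p)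
    (i j : Fin n) : AnalyticAt ℂ (fun q => (D q).adjugate i j) p := by
  simp only [Matrix.adjugate_apply]
  refine AnalyticAt.matrix_det fun k l => ?_
  by_cases h : k = j
  · subst h; simp only [Matrix.updateRow_self]; exact analyticAt_const
  · simp only [Matrix.updateRow_ne h]; exact hD k l

variable [CompleteSpace E]

/-- The local form of the inverse of `1 - N(p)` for an analytic family of compact operators. -/
theorem exists_meromorphic_inverse {N : ℂ × ℂ → E →L[ℂ] E} {p₀ : ℂ × ℂ}
    (hN : AnalyticAt ℂ N p₀) (hF : FinApprox (N p₀)) :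
    ∃ (S F : ℂ × ℂ → E →L[ℂ] E) (K : ℂ × ℂ → ℂ),
      AnalyticAt ℂ S p₀ ∧ AnalyticAt ℂ F p₀ ∧ AnalyticAt ℂ K p₀ ∧
      ∀ᶠ p in 𝓝 p₀, FinRank (F p) ∧ (IsUnit (1 - N p) ↔ K p ≠ 0) ∧
        (IsUnit (1 - N p) → inverse (1 - N p) = S p + (K p)⁻¹ • F p) := by
  obtain ⟨Q, hQ, hQe⟩ := Metric.mem_closure_iff.mp hF 1 one_pos
  rw [dist_eq_norm] at hQe
  obtain ⟨n, i, c, hi, rfl⟩ := exists_factorization hQ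
  set M : ℂ × ℂ → E →L[ℂ] E := fun p => 1 - (N p - i ∘L c) with hM
  have hMa : AnalyticAt ℂ M p₀ := analyticAt_const.sub (hN.sub analyticAt_const)
  have hM0 : IsUnit (M p₀) := isUnit_one_sub_of_norm_lt_one (by linarith)
  set G : ℂ × ℂ → E →L[ℂ] E := fun p => inverse (M p) with hG
  have hGa : AnalyticAt ℂ G p₀ := analyticAt_ringInverse hMa hM0
  let e : Fin n → Fin n → ℂ := fun j => Pi.single j 1
  let D : ℂ × ℂ → Matrix (Fin n) (Fin n) ℂ := fun p =>
    1 - Matrix.of fun k l => c (G p (i (e l))) k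
  have hDa : ∀ k l, AnalyticAt ℂ (fun p => D p k l) p₀ := by
    intro k l
    let φ : (E →L[ℂ] E) →L[ℂ] ℂ := (proj (R := ℂ) k ∘L c) ∘L
      (ContinuousLinearMap.apply ℂ E (i (e l)))
    have h : AnalyticAt ℂ (fun p => φ (G p)) p₀ := φ.analyticAt (G p₀) |>.comp hGa
    exact analyticAt_const.sub h
  let A : Fin n → Fin n → E →L[ℂ] E := fun k l =>
    i ∘L (ContinuousLinearMap.single ℂ (fun _ => ℂ) k ∘L proj (R := ℂ) l) ∘L c
  let F : ℂ × ℂ → E →L[ℂ] E := fun p =>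
    ∑ k, ∑ l, (D p).adjugate k l • (G p * A k l * G p)
  have hFx : ∀ p x, F p x = G p (i ((D p).adjugate.mulVec (c (G p x)))) := by
    intro p x
    simp only [F, sum_apply, smul_apply, A]
    have hv : (D p).adjugate.mulVec (c (G p x)) = ∑ k, ∑ l, (D p).adjugate k l •
        (Pi.single k (c (G p x) l) : Fin n → ℂ) := by
      ext m
      simp [Matrix.mulVec, dotProduct, Finset.sum_apply, Pi.single_apply]
    rw [hv]
    simp [map_sum]
  have hDv : ∀ p v, (D p).mulVec v = v - c (G p (i v)) := by
    intro p v
    have hv : i v = ∑ l, v l • i (e l) := by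
      conv_lhs => rw [← Finset.univ_sum_single v]
      rw [map_sum]
      refine Finset.sum_congr rfl fun l _ => ?_
      rw [← map_smul]
      congr 1
      ext m
      simp [e, Pi.single_apply]
    ext k
    rw [hv]
    simp [D, Matrix.mulVec, dotProduct, Matrix.one_apply, mul_comm, mul_sub, Finset.sum_sub_distrib]
  refine ⟨G, F, fun p => (D p).det, hGa, ?_, AnalyticAt.matrix_det hDa, ?_⟩
  · refine Finset.analyticAt_fun_sum _ fun k _ => Finset.analyticAt_fun_sum _ fun l _ => ?_
    exact (AnalyticAt.matrix_adjugate hDa k l).smul ((hGa.mul analyticAt_const).mul hGa)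
  filter_upwards [eventually_isUnit hMa.continuousAt hM0] with p hp
  have h1 : ∀ x, (1 - N p) x = M p x - i (c x) := by grind
  have hfin : FinRank (F p) := by
    have : FiniteDimensional ℂ (lrange (G p ∘L i).toLinearMap) := inferInstance
    refine Submodule.finiteDimensional_of_le (S₂ := lrange (G p ∘L i).toLinearMap) ?_
    rintro _ ⟨x, rfl⟩
    exact ⟨_, (hFx p x).symm⟩
  have hinv : (D p).det ≠ 0 → IsUnit (1 - N p) ∧ inverse (1 - N p) = G p + ((D p).det)⁻¹ • F p := by
    intro hK
    refine isUnit_of_inverse ?_ ?_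
    · ext x
      set v := ((D p).det)⁻¹ • (D p).adjugate.mulVec (c (G p x)) with hv
      have h3 : (G p + ((D p).det)⁻¹ • F p) x = G p (x + i v) := by simp [hFx, hv]
      have h4 : v - c (G p (i v)) = c (G p x) := by
        rw [← hDv, hv, Matrix.mulVec_smul, Matrix.mulVec_mulVec, Matrix.mul_adjugate,
          Matrix.smul_mulVec, Matrix.one_mulVec, smul_smul, inv_mul_cancel₀ hK, one_smul]
      rw [mul_apply_eq_comp, h3, h1]
      have h5 : M p (G p (x + i v)) = x + i v := isUnit_apply_inverse hp _
      rw [h5, map_add, map_add, map_add, ← h4]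
      simp
    · ext x
      rw [mul_apply_eq_comp]
      have h2 : G p (M p x) = x := isUnit_inverse_apply hp x
      have h3 : G p ((1 - N p) x) = x - G p (i (c x)) := by rw [h1, map_sub, h2]
      have h4 : c (x - G p (i (c x))) = (D p).mulVec (c x) := by rw [map_sub, hDv]
      rw [add_apply, smul_apply, hFx, h3, h4,
        Matrix.mulVec_mulVec, Matrix.adjugate_mul, Matrix.smul_mulVec, Matrix.one_mulVec,
        map_smul, map_smul, smul_smul, inv_mul_cancel₀ hK, one_smul]
      simp
  have hne : IsUnit (1 - N p) → (D p).det ≠ 0 := by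
    intro hu hK
    obtain ⟨v, hv0, hv⟩ := Matrix.exists_mulVec_eq_zero_iff.mpr hK
    rw [hDv, sub_eq_zero] at hv
    have h2 : M p (G p (i v)) = i v := isUnit_apply_inverse hp _
    have h3 : (1 - N p) (G p (i v)) = 0 := by rw [h1, h2, ← hv, sub_self]
    rw [← isUnit_inverse_apply hu (G p (i v)), h3, map_zero, map_zero] at h2
    exact hv0 (hi (by rw [← h2, map_zero]))
  exact ⟨hfin, ⟨hne, fun hK => (hinv hK).1⟩, fun hu => (hinv (hne hu)).2⟩

/-- An analytic family `1 - N(λ₀, ω)` of Fredholm operators which is invertible for one `ω` is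
invertible outside a discrete set. -/
theorem not_eventually_not_isUnit {N : ℂ × ℂ → E →L[ℂ] E} (hN : ∀ p, AnalyticAt ℂ N p)
    (hF : ∀ p, FinApprox (N p)) {lam ω₁ : ℂ} (h1 : IsUnit (1 - N (lam, ω₁))) (ω₀ : ℂ) :
    ¬ ∀ᶠ ω in 𝓝 ω₀, ¬ IsUnit (1 - N (lam, ω)) := by
  let Z : Set ℂ := {ω | ∀ᶠ ω' in 𝓝 ω, ¬ IsUnit (1 - N (lam, ω'))}
  have hopen : IsOpen Z := isOpen_setOfPred_eventually_nhds
  have hclosed : IsClosed Z := by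
    rw [← closure_subset_iff_isClosed]
    intro ω hω
    obtain ⟨S, F, K, -, -, hK, hev⟩ := exists_meromorphic_inverse (hN (lam, ω)) (hF (lam, ω))
    have hc : Tendsto (fun z : ℂ => (lam, z)) (𝓝 ω) (𝓝 (lam, ω)) :=
      (Continuous.prodMk_right lam).tendsto ω
    have hk : AnalyticAt ℂ (fun z => K (lam, z)) ω :=
      AnalyticAt.comp (f := fun z : ℂ => (lam, z)) hK (analyticAt_const.prod analyticAt_id)
    have hev' := hc.eventually hev
    rcases hk.eventually_eq_zero_or_eventually_ne_zero with h | h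
    · filter_upwards [h, hev'] with z hz hz' hu; grind
    · rw [eventually_nhdsWithin_iff] at h
      obtain ⟨z, hzZ, hz⟩ := ((mem_closure_iff_frequently.mp hω).and_eventually
        (h.and hev').eventually_nhds).exists
      have h4 : ∀ᶠ w in 𝓝 z, w = ω := by
        filter_upwards [hzZ, hz] with w hw hw2
        by_contra hne
        exact hw (hw2.2.2.1.mpr (hw2.1 hne))
      have h5 : ∃ᶠ w in 𝓝 z, w ≠ ω := mem_closure_iff_frequently.mp (dense_compl_singleton ω z)
      obtain ⟨w, hw, hw'⟩ := (h5.and_eventually h4).exists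
      exact (hw hw').elim
  intro h
  have huniv : Z = univ := IsClopen.eq_univ ⟨hclosed, hopen⟩ ⟨ω₀, h⟩
  have : ω₁ ∈ Z := huniv ▸ mem_univ _
  exact this.self_of_nhds h1

theorem isMeromorphicFiniteRank_of_inverse {V W : Type*} [NormedAddCommGroup V] [NormedSpace ℂ V]
    [NormedAddCommGroup W] [NormedSpace ℂ W] [CompleteSpace V] {N : ℂ × ℂ → V →L[ℂ] V}
    (hN : ∀ p, AnalyticAt ℂ N p) (hF : ∀ p, FinApprox (N p))
    (h1 : ∀ lam, ∃ ω, IsUnit (1 - N (lam, ω))) (L : V →L[ℂ] W) {Ω : Set (ℂ × ℂ)}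
    (hΩ : ∀ p, p ∈ Ω ↔ IsUnit (1 - N p)) {R : ℂ × ℂ → V →L[ℂ] W}
    (hR : ∀ p ∈ Ω, R p = L ∘L inverse (1 - N p)) :
    IsMeromorphicFiniteRank Ω R := by
  intro p₀
  obtain ⟨S, F, K, hS, hFa, hK, hev⟩ := exists_meromorphic_inverse (hN p₀) (hF p₀)
  let Lc : (V →L[ℂ] V) →L[ℂ] (V →L[ℂ] W) := compL ℂ V V W L
  refine ⟨fun p => L ∘L S p, fun p => L ∘L F p, K, (Lc.analyticAt _).comp hS,
    (Lc.analyticAt _).comp hFa, hK, ?_, ?_⟩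
  · intro h
    obtain ⟨ω₁, hω₁⟩ := h1 p₀.1
    refine not_eventually_not_isUnit hN hF hω₁ p₀.2 ?_
    have hc : Tendsto (fun z : ℂ => (p₀.1, z)) (𝓝 p₀.2) (𝓝 p₀) :=
      (Continuous.prodMk_right p₀.1).tendsto p₀.2
    filter_upwards [h, hc.eventually hev] with z hz hz' hu
    grind
  · filter_upwards [hev] with p hp
    refine ⟨hp.1.comp_left L, by grind, fun h => ?_⟩
    rw [hR p h, hp.2.2 ((hΩ p).mp h)]
    ext x
    simp

end AnalyticFredholm

section Pencil

variable {E : Type*} [NormedAddCommGroup E] [InnerProductSpace ℂ E]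

local notation "⟪" x ", " y "⟫" => inner ℂ x y

/-- The operator `(ω - λ B) T`. If `T = A⁻¹`, then `A + λ B - ω = (1 - (ω - λ B) T) A`. -/
def pencilN (T B : E →L[ℂ] E) (p : ℂ × ℂ) : E →L[ℂ] E := p.2 • T - p.1 • (B * T)

theorem pencilN_apply (T B : E →L[ℂ] E) (p : ℂ × ℂ) (x : E) :
    pencilN T B p x = p.2 • T x - p.1 • B (T x) := rfl

theorem pencilN_analyticAt (T B : E →L[ℂ] E) (p : ℂ × ℂ) : AnalyticAt ℂ (pencilN T B) p :=
  (analyticAt_snd.smul analyticAt_const).sub (analyticAt_fst.smul analyticAt_const)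

/-- `T` is the inverse of a self-adjoint operator with compact resolvent, `B` is a bounded
self-adjoint perturbation. -/
structure IsPencil (T B : E →L[ℂ] E) (b : ℝ) : Prop where
  symT : ∀ x y, ⟪T x, y⟫ = ⟪x, T y⟫
  symB : ∀ x y, ⟪B x, y⟫ = ⟪x, B y⟫
  inj : ∀ x, T x = 0 → x = 0
  fin : FinApprox T
  normB : ‖B‖ ≤ b

variable {T B : E →L[ℂ] E} {b : ℝ}

theorem pencilN_finApprox (hT : FinApprox T) (p : ℂ × ℂ) : FinApprox (pencilN T B p) :=
  (hT.smul _).sub ((hT.comp_left B).smul _)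

theorem IsPencil.eq_of_fixed {p : ℂ × ℂ} {y : E} (hy : pencilN T B p y = y) :
    T y = T (0 + p.2 • T y - p.1 • B (T y)) := by nth_rewrite 1 [← hy]; rw [pencilN_apply, zero_add]

variable (h : IsPencil T B b)
include h

theorem IsPencil.normB_apply (x : E) : ‖B x‖ ≤ b * ‖x‖ :=
  (B.le_opNorm x).trans (by gcongr; exact h.normB)

theorem IsPencil.nonneg : 0 ≤ b := (norm_nonneg _).trans h.normB

theorem IsPencil.im_bound {lam ω : ℂ} {u f : E}
    (hu : u = T (f + ω • u - lam • B u)) : (|ω.im| - b * |lam.im|) * ‖u‖ ≤ ‖f‖ := by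
  set y := f + ω • u - lam • B u with hy
  have h1 : (⟪u, y⟫).im = 0 := by
    have : (starRingEnd ℂ) ⟪u, y⟫ = ⟪u, y⟫ := by
      rw [inner_conj_symm]
      nth_rewrite 1 [hu]
      rw [← h.symT, ← hu]
    exact conj_eq_iff_im.mp this
  have h2 : (⟪u, B u⟫).im = 0 := by
    have : (starRingEnd ℂ) ⟪u, B u⟫ = ⟪u, B u⟫ := by rw [inner_conj_symm, h.symB]
    exact conj_eq_iff_im.mp this
  have h3 : ⟪u, u⟫ = ((‖u‖ ^ 2 : ℝ) : ℂ) := by simp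
  have h4 : (⟪u, f⟫).im + ω.im * ‖u‖ ^ 2 - lam.im * (⟪u, B u⟫).re = 0 := by
    rw [hy, inner_sub_right, inner_add_right, inner_smul_right, inner_smul_right, h3] at h1
    simp only [Complex.sub_im, Complex.add_im, Complex.mul_im, Complex.ofReal_im,
      Complex.ofReal_re, h2] at h1
    linarith
  have h5 : |(⟪u, f⟫).im| ≤ ‖u‖ * ‖f‖ := (abs_im_le_norm _).trans (norm_inner_le_norm _ _)
  have h6 : |(⟪u, B u⟫).re| ≤ b * ‖u‖ ^ 2 := by
    refine (Complex.abs_re_le_norm _).trans ((norm_inner_le_norm _ _).trans ?_)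
    calc ‖u‖ * ‖B u‖ ≤ ‖u‖ * (b * ‖u‖) := by gcongr; exact h.normB_apply u
      _ = b * ‖u‖ ^ 2 := by ring
  have h7 : |ω.im| * ‖u‖ ^ 2 ≤ ‖u‖ * ‖f‖ + |lam.im| * (b * ‖u‖ ^ 2) := by
    have h8 : ω.im * ‖u‖ ^ 2 = lam.im * (⟪u, B u⟫).re - (⟪u, f⟫).im := by linarith
    have h9 : |ω.im| * ‖u‖ ^ 2 = |lam.im * (⟪u, B u⟫).re - (⟪u, f⟫).im| := by grind
    rw [h9]
    refine (abs_sub _ _).trans ?_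
    rw [abs_mul]
    have := mul_le_mul_of_nonneg_left h6 (abs_nonneg lam.im)
    linarith
  rcases (norm_nonneg u).eq_or_lt with h0 | h0
  · rw [← h0]; simp
  nlinarith

variable [CompleteSpace E]

theorem IsPencil.isUnit_of {p : ℂ × ℂ}
    (hi : ∀ u, u = T (0 + p.2 • u - p.1 • B u) → u = 0) : IsUnit (1 - pencilN T B p) := by
  refine isUnit_one_sub_of_injective (pencilN_finApprox h.fin p) fun y hy => ?_
  exact h.inj y (hi _ (IsPencil.eq_of_fixed hy))

theorem IsPencil.isUnit_of_im {p : ℂ × ℂ}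
    (hp : b * |p.1.im| < |p.2.im|) : IsUnit (1 - pencilN T B p) := by
  refine h.isUnit_of fun u hu => ?_
  have := h.im_bound hu
  rw [norm_zero] at this
  by_contra h0
  have : 0 < (|p.2.im| - b * |p.1.im|) * ‖u‖ := mul_pos (by linarith) (norm_pos_iff.mpr h0)
  linarith

omit h in
theorem inverse_spec {p : ℂ × ℂ} (hp : IsUnit (1 - pencilN T B p)) (f : E) :
    T (inverse (1 - pencilN T B p) f) = T (f + p.2 • T (inverse (1 - pencilN T B p) f)
        - p.1 • B (T (inverse (1 - pencilN T B p) f))) := by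
  set y := inverse (1 - pencilN T B p) f with hy
  have h1 : (1 - pencilN T B p) y = f := isUnit_apply_inverse hp f
  have h2 : y = f + p.2 • T y - p.1 • B (T y) := by
    rw [← h1]
    change y = y - (p.2 • T y - p.1 • B (T y)) + p.2 • T y - p.1 • B (T y)
    abel
  exact congrArg T h2

theorem IsPencil.norm_le_of_im {p : ℂ × ℂ} (hp : b * |p.1.im| < |p.2.im|) :
    ‖T * inverse (1 - pencilN T B p)‖ ≤ 1 / (|p.2.im| - b * |p.1.im|) := by
  have h0 : 0 < |p.2.im| - b * |p.1.im| := by linarith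
  refine opNorm_le_bound _ (by positivity) fun f => ?_
  have := h.im_bound (inverse_spec (h.isUnit_of_im hp) f)
  rw [one_div, ← div_eq_inv_mul, le_div_iff₀ h0]
  rw [mul_comm]
  exact this

theorem IsPencil.small_bound {κ : ℝ} (hκ : 0 < κ) (hT : ‖T‖ ≤ 1 / κ)
    {lam ω : ℂ} {u f : E} (hu : u = T (f + ω • u - lam • B u)) :
    (κ - ‖ω‖ - b * ‖lam‖) * ‖u‖ ≤ ‖f‖ := by
  have h1 : ‖u‖ ≤ 1 / κ * (‖f‖ + ‖ω‖ * ‖u‖ + ‖lam‖ * (b * ‖u‖)) := by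
    nth_rewrite 1 [hu]
    refine (T.le_opNorm _).trans ?_
    gcongr
    refine (norm_sub_le _ _).trans ?_
    gcongr
    · refine (norm_add_le _ _).trans ?_; rw [norm_smul]
    · rw [norm_smul]; gcongr; exact h.normB_apply u
  rw [one_div, ← div_eq_inv_mul, le_div_iff₀ hκ] at h1
  linarith

theorem IsPencil.small {κ : ℝ} (hκ : 0 < κ) (hT : ‖T‖ ≤ 1 / κ)
    {p : ℂ × ℂ} (hp : ‖p.2‖ + b * ‖p.1‖ < κ) :
    IsUnit (1 - pencilN T B p) ∧
      ‖T * inverse (1 - pencilN T B p)‖ ≤ 1 / (κ - ‖p.2‖ - b * ‖p.1‖) := by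
  have h0 : 0 < κ - ‖p.2‖ - b * ‖p.1‖ := by linarith
  have hu : IsUnit (1 - pencilN T B p) := by
    refine h.isUnit_of fun u hu => ?_
    have := h.small_bound hκ hT hu
    rw [norm_zero] at this
    by_contra hne
    have := mul_pos h0 (norm_pos_iff.mpr hne)
    linarith
  refine ⟨hu, opNorm_le_bound _ (by positivity) fun f => ?_⟩
  have := h.small_bound hκ hT (inverse_spec hu f)
  rw [one_div, ← div_eq_inv_mul, le_div_iff₀ h0, mul_comm]
  exact this

end Pencil

section Spectral

variable {E : Type*} [NormedAddCommGroup E] [InnerProductSpace ℂ E]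

local notation "⟪" x ", " y "⟫" => inner ℂ x y

theorem norm_sq_sum_of_orthogonal {ι : Type*} (s : Finset ι) (u : ι → E)
    (hu : ∀ i ∈ s, ∀ j ∈ s, i ≠ j → ⟪u i, u j⟫ = 0) :
    ‖∑ i ∈ s, u i‖ ^ 2 = ∑ i ∈ s, ‖u i‖ ^ 2 := by
  classical
  have h : ((‖∑ i ∈ s, u i‖ ^ 2 : ℝ) : ℂ) = ((∑ i ∈ s, ‖u i‖ ^ 2 : ℝ) : ℂ) := by
    have h1 : ∀ x : E, ((‖x‖ ^ 2 : ℝ) : ℂ) = ⟪x, x⟫ := fun x => by simp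
    rw [h1, sum_inner, Complex.ofReal_sum]
    refine Finset.sum_congr rfl fun i hi => ?_
    rw [h1, inner_sum]
    exact Finset.sum_eq_single_of_mem i hi fun j hj hne => hu i hi j hj hne.symm
  exact_mod_cast h

theorem norm_sum_le_of_orthogonal {ι : Type*} (s : Finset ι) (u v : ι → E)
    (hu : ∀ i ∈ s, ∀ j ∈ s, i ≠ j → ⟪u i, u j⟫ = 0)
    (hv : ∀ i ∈ s, ∀ j ∈ s, i ≠ j → ⟪v i, v j⟫ = 0) (huv : ∀ i ∈ s, ‖u i‖ ≤ ‖v i‖) :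
    ‖∑ i ∈ s, u i‖ ≤ ‖∑ i ∈ s, v i‖ := by
  refine le_of_sq_le_sq ?_ (norm_nonneg _)
  rw [norm_sq_sum_of_orthogonal s u hu, norm_sq_sum_of_orthogonal s v hv]
  bound

theorem lincomb_injective {m : ℕ} {v : Fin m → E} (h0 : ∀ i, v i ≠ 0)
    (ho : ∀ i j, i ≠ j → ⟪v i, v j⟫ = 0) {c : Fin m → ℂ} (hc : ∑ i, c i • v i = 0) : c = 0 := by
  ext i
  have h2 : ⟪v i, ∑ j, c j • v j⟫ = c i * ⟪v i, v i⟫ := by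
    rw [inner_sum, Finset.sum_eq_single i]
    · rw [inner_smul_right]
    · intro j _ hj; rw [inner_smul_right, ho i j hj.symm, mul_zero]
    · simp
  rw [hc, inner_zero_right] at h2
  exact (mul_eq_zero.mp h2.symm).resolve_right (inner_self_ne_zero.mpr (h0 i))

theorem norm_lincomb_le {m : ℕ} {v w : Fin m → E} (hv : ∀ i j, i ≠ j → ⟪v i, v j⟫ = 0)
    (hw : ∀ i j, i ≠ j → ⟪w i, w j⟫ = 0) {C : ℝ} (hC : 0 ≤ C) (hwv : ∀ i, ‖w i‖ ≤ C * ‖v i‖)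
    (c : Fin m → ℂ) : ‖∑ i, c i • w i‖ ≤ C * ‖∑ i, c i • v i‖ := by
  have h1 : C * ‖∑ i, c i • v i‖ = ‖∑ i, (C : ℂ) • (c i • v i)‖ := by
    rw [← Finset.smul_sum, norm_smul, norm_real, norm_of_nonneg hC]
  rw [h1]
  refine norm_sum_le_of_orthogonal _ _ _ ?_ ?_ ?_
  · intro i _ j _ hij; simp [hw i j hij]
  · intro i _ j _ hij; simp [hv i j hij]
  · intro i _
    rw [norm_smul, norm_smul, norm_smul, norm_real, norm_of_nonneg hC]
    calc ‖c i‖ * ‖w i‖ ≤ ‖c i‖ * (C * ‖v i‖) := by gcongr; exact hwv i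
      _ = _ := by ring

variable [CompleteSpace E]

theorem eigen_orthogonal {T : E →L[ℂ] E} (hT : ∀ x y, ⟪T x, y⟫ = ⟪x, T y⟫) {r s : ℂ} {x y : E}
    (hx : T x = r • x) (hy : T y = s • y) (hrs : r ≠ s) : ⟪x, y⟫ = 0 := by
  have h := LinearMap.IsSymmetric.orthogonalFamily_eigenspaces (𝕜 := ℂ) (E := E)
    (T := T.toLinearMap) hT
  exact h hrs ⟨x, Module.End.mem_eigenspace_iff.mpr hx⟩ ⟨y, Module.End.mem_eigenspace_iff.mpr hy⟩

theorem eigen_real {T : E →L[ℂ] E} (hT : ∀ x y, ⟪T x, y⟫ = ⟪x, T y⟫) {s : ℂ} {x : E}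
    (hx : T x = s • x) (h0 : x ≠ 0) : (s.re : ℂ) = s := by
  have h1 := hT x x
  rw [hx, inner_smul_left, inner_smul_right] at h1
  have h2 : ⟪x, x⟫ ≠ 0 := inner_self_ne_zero.mpr h0
  exact Complex.conj_eq_iff_re.mp (mul_right_cancel₀ h2 h1)

/-- For operators which are diagonal with respect to the eigenspaces of a compact self-adjoint
operator, norm inequalities may be checked on eigenvectors. -/
theorem norm_le_of_eigen {T X Y : E →L[ℂ] E} (hT : ∀ x y, ⟪T x, y⟫ = ⟪x, T y⟫)
    (hc : IsCompactOperator T)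
    (h : ∀ (s : ℂ) (z : E), T z = s • z →
      T (X z) = s • X z ∧ T (Y z) = s • Y z ∧ ‖X z‖ ≤ ‖Y z‖) (z : E) : ‖X z‖ ≤ ‖Y z‖ := by
  classical
  have hspec := ContinuousLinearMap.orthogonalComplement_iSup_eigenspaces_eq_bot hc hT
  have hdense := Submodule.topologicalClosure_eq_top_iff.mpr hspec
  have hcl : IsClosed {z | ‖X z‖ ≤ ‖Y z‖} := isClosed_le (by fun_prop) (by fun_prop)
  have hz : z ∈ closure ((⨆ μ, Module.End.eigenspace T.toLinearMap μ : Submodule ℂ E) : Set E) := by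
    rw [← Submodule.topologicalClosure_coe, hdense]
    trivial
  refine closure_minimal ?_ hcl hz
  intro w hw
  obtain ⟨f, hf, rfl⟩ := (Submodule.mem_iSup_iff_exists_finsupp _ _).mp hw
  have hev : ∀ s, T (f s) = s • f s := fun s => Module.End.mem_eigenspace_iff.mp (hf s)
  change ‖X (f.sum fun _ x => x)‖ ≤ ‖Y (f.sum fun _ x => x)‖
  rw [Finsupp.sum, map_sum, map_sum]
  refine norm_sum_le_of_orthogonal _ _ _ ?_ ?_ ?_
  · intro i _ j _ hij; exact eigen_orthogonal hT (h i _ (hev i)).1 (h j _ (hev j)).1 hij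
  · intro i _ j _ hij; exact eigen_orthogonal hT (h i _ (hev i)).2.1 (h j _ (hev j)).2.1 hij
  grind

end Spectral

section Counting

variable {E : Type*} [NormedAddCommGroup E] [InnerProductSpace ℂ E]

local notation "⟪" x ", " y "⟫" => inner ℂ x y

/-- `ω` is an eigenvalue of `T⁻¹ + λ B`. -/
def PEig (T B : E →L[ℂ] E) (lam ω : ℂ) : Prop := ∃ u, u ≠ 0 ∧ u = T (ω • u - lam • B u)

/-- A pencil with the spectral symmetry given by `S`, without eigenvalue zero and with simple
eigenvalues for real parameters. -/
structure IsSimplePencil (T B S : E →L[ℂ] E) (b : ℝ) : Prop extends IsPencil T B b where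
  flip : ∀ x, S (S x) = x
  flipT : ∀ x, S (T x) = -T (S x)
  flipB : ∀ x, S (B x) = -B (S x)
  noZero : ∀ t : ℝ, ¬ PEig T B t 0
  simple : ∀ (t ν : ℝ) (u v : E), u ≠ 0 → u = T ((ν : ℂ) • u - (t : ℂ) • B u) →
    v = T ((ν : ℂ) • v - (t : ℂ) • B v) → ∃ c : ℂ, v = c • u
  unbounded : ∀ l : ℕ, ∃ (c : ℝ) (v w : Fin l → E), 0 < c ∧ (∀ i, T (w i) = v i) ∧
    (∀ i, v i ≠ 0) ∧ (∀ i j, i ≠ j → ⟪v i, v j⟫ = 0) ∧ (∀ i j, i ≠ j → ⟪w i, w j⟫ = 0) ∧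
    ∀ i, ‖w i‖ ≤ c * ‖v i‖

variable {T B S : E →L[ℂ] E} {b : ℝ}

theorem IsPencil.orthogonal (h : IsPencil T B b) {t μ ν : ℝ} {u v : E}
    (hu : u = T ((μ : ℂ) • u - (t : ℂ) • B u)) (hv : v = T ((ν : ℂ) • v - (t : ℂ) • B v))
    (hne : μ ≠ ν) : ⟪u, v⟫ = 0 := by
  have h1 : ⟪(μ : ℂ) • u - (t : ℂ) • B u, v⟫ = ⟪u, (ν : ℂ) • v - (t : ℂ) • B v⟫ := by
    have h2 := h.symT ((μ : ℂ) • u - (t : ℂ) • B u) ((ν : ℂ) • v - (t : ℂ) • B v)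
    grind
  rw [inner_sub_left, inner_sub_right, inner_smul_left, inner_smul_left, inner_smul_right,
    inner_smul_right, h.symB, conj_ofReal, conj_ofReal] at h1
  have h2 : ((μ : ℂ) - ν) * ⟪u, v⟫ = 0 := by linear_combination h1
  rcases mul_eq_zero.mp h2 with h3 | h3
  · exact (hne (by exact_mod_cast sub_eq_zero.mp h3)).elim
  · exact h3

/-- The number of eigenvalues in `[-μ, μ]` is bounded by the rank of a good approximation of
`T`. -/
theorem IsPencil.card_le (h : IsPencil T B b) {t μ : ℝ} {m n : ℕ} {ν : Fin m → ℝ}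
    (hν : Function.Injective ν) (hμ : ∀ i, |ν i| ≤ μ) (he : ∀ i, PEig T B t (ν i))
    {F : E →L[ℂ] E} (hF : FinRank F) (hn : finrank ℂ (lrange F.toLinearMap) ≤ n)
    (hlt : ‖T - F‖ * (μ + b * |t|) < 1) : m ≤ n := by
  classical
  by_contra! hmn
  have : FiniteDimensional ℂ (lrange F.toLinearMap) := hF
  choose u hu0 hu using he
  have horth : ∀ i j, i ≠ j → ⟪u i, u j⟫ = 0 := fun i j hij =>
    h.orthogonal (hu i) (hu j) (hν.ne hij)
  let w : Fin m → E := fun i => (ν i : ℂ) • u i - (t : ℂ) • B (u i)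
  let Φ : (Fin m → ℂ) →ₗ[ℂ] lrange F.toLinearMap :=
    (F.toLinearMap.rangeRestrict) ∘ₗ (Fintype.linearCombination ℂ w)
  have hker : LinearMap.ker Φ ≠ ⊥ := by
    refine LinearMap.ker_ne_bot_of_finrank_lt ?_
    simpa using lt_of_le_of_lt hn hmn
  obtain ⟨c, hc, hc0⟩ := Submodule.exists_mem_ne_zero_of_ne_bot hker
  have hFw : F (∑ i, c i • w i) = 0 := by
    have := congrArg Subtype.val (LinearMap.mem_ker.mp hc)
    bound
  set v := ∑ i, c i • u i with hv
  set x := ∑ i, c i • w i with hx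
  have hTx : T x = v := by
    rw [hx, map_sum]
    refine Finset.sum_congr rfl fun i _ => ?_
    rw [map_smul, ← hu i]
  have hμ0 : 0 ≤ μ := by
    have : 0 < m := by omega
    exact (abs_nonneg _).trans (hμ ⟨0, this⟩)
  have hx' : x = ∑ i, c i • ((ν i : ℂ) • u i) - (t : ℂ) • B v := by
    rw [hx, hv, map_sum, Finset.smul_sum, ← Finset.sum_sub_distrib]
    refine Finset.sum_congr rfl fun i _ => ?_
    rw [map_smul, smul_sub, smul_comm (t : ℂ) (c i)]
  have hn1 : ‖∑ i, c i • ((ν i : ℂ) • u i)‖ ≤ μ * ‖v‖ := by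
    refine norm_lincomb_le horth (fun i j hij => by simp [horth i j hij]) hμ0 (fun i => ?_) c
    rw [norm_smul, norm_real, norm_eq_abs]
    exact mul_le_mul_of_nonneg_right (hμ i) (norm_nonneg _)
  have hxn : ‖x‖ ≤ (μ + b * |t|) * ‖v‖ := by
    rw [hx']
    refine (norm_sub_le _ _).trans ?_
    rw [norm_smul, norm_real, norm_eq_abs]
    have := mul_le_mul_of_nonneg_left (h.normB_apply v) (abs_nonneg t)
    linarith
  have hv0 : 0 < ‖v‖ := norm_pos_iff.mpr fun h0 => hc0 (lincomb_injective hu0 horth h0)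
  have hfin : ‖v‖ ≤ ‖T - F‖ * ((μ + b * |t|) * ‖v‖) := by
    have : v = (T - F) x := by change v = T x - F x; rw [hFw, hTx, sub_zero]
    nth_rewrite 1 [this]
    exact ((T - F).le_opNorm x).trans (by gcongr)
  nlinarith

theorem IsPencil.finite_eig (h : IsPencil T B b) (t μ : ℝ) :
    {ν : ℝ | |ν| ≤ μ ∧ PEig T B t ν}.Finite := by
  by_contra hinf
  rw [← Set.not_infinite, not_not] at hinf
  have : 0 ≤ μ := by obtain ⟨ν, hν⟩ := hinf.nonempty; grind
  have := h.nonneg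
  obtain ⟨F, hF, hFe⟩ := Metric.mem_closure_iff.mp h.fin (1 / (μ + b * |t| + 1)) (by positivity)
  rw [dist_eq_norm] at hFe
  obtain ⟨s, hs, hcard⟩ := hinf.exists_subset_card_eq (finrank ℂ (lrange F.toLinearMap) + 1)
  let ν : Fin (finrank ℂ (lrange F.toLinearMap) + 1) → ℝ :=
    fun i => (s.equivFinOfCardEq hcard).symm i
  have hν : Function.Injective ν :=
    Subtype.val_injective.comp (s.equivFinOfCardEq hcard).symm.injective
  have hmem : ∀ i, ν i ∈ {ν : ℝ | |ν| ≤ μ ∧ PEig T B t ν} := fun i =>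
    hs ((s.equivFinOfCardEq hcard).symm i).2
  have := h.card_le hν (fun i => (hmem i).1) (fun i => (hmem i).2) hF le_rfl (by
    calc ‖T - F‖ * (μ + b * |t|) ≤ (1 / (μ + b * |t| + 1)) * (μ + b * |t|) := by gcongr
      _ < 1 := by
        rw [one_div, inv_mul_lt_iff₀ (by positivity)]
        linarith)
  omega

variable [CompleteSpace E]

/-- The inverse of `T⁻¹ + t B`. -/
def invAt (T B : E →L[ℂ] E) (t : ℝ) : E →L[ℂ] E := T * inverse (1 - pencilN T B ((t : ℂ), 0))

variable (h : IsSimplePencil T B S b)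
include h

theorem IsSimplePencil.isUnit_zero (t : ℝ) : IsUnit (1 - pencilN T B ((t : ℂ), 0)) := by
  refine h.isUnit_of fun u hu => ?_
  by_contra h0
  exact h.noZero t ⟨u, h0, by simpa using hu⟩

theorem IsSimplePencil.exists_pre (t : ℝ) (z : E) :
    ∃ y, z = y + (t : ℂ) • B (T y) ∧ invAt T B t z = T y := by
  refine ⟨inverse (1 - pencilN T B ((t : ℂ), 0)) z, ?_, rfl⟩
  have := isUnit_apply_inverse (h.isUnit_zero t) z
  nth_rewrite 1 [← this]
  simp [pencilN]

theorem IsSimplePencil.invAt_apply (t : ℝ) (y : E) : invAt T B t (y + (t : ℂ) • B (T y)) = T y := by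
  have := isUnit_inverse_apply (h.isUnit_zero t) y
  have h2 : (1 - pencilN T B ((t : ℂ), 0)) y = y + (t : ℂ) • B (T y) := by simp [pencilN]
  rw [h2] at this
  exact congrArg T this

theorem IsSimplePencil.invAt_symm (t : ℝ) (x y : E) : ⟪invAt T B t x, y⟫ = ⟪x, invAt T B t y⟫ := by
  obtain ⟨p, rfl, hp⟩ := h.exists_pre t x
  obtain ⟨q, rfl, hq⟩ := h.exists_pre t y
  rw [hp, hq, inner_add_right, inner_add_left, inner_smul_right, inner_smul_left, h.symB, h.symT,
    conj_ofReal]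

theorem IsSimplePencil.invAt_fin (t : ℝ) : FinApprox (invAt T B t) := h.fin.comp_right _

theorem IsSimplePencil.invAt_inj (t : ℝ) {x : E} (hx : invAt T B t x = 0) : x = 0 := by
  obtain ⟨p, rfl, hp⟩ := h.exists_pre t x
  have := h.inj p (by rw [← hp, hx])
  simp [this]

theorem IsSimplePencil.eig_iff (t : ℝ) {ν : ℂ} (hν : ν ≠ 0) (u : E) :
    u = T (ν • u - (t : ℂ) • B u) ↔ invAt T B t u = ν⁻¹ • u := by
  constructor
  · intro hu
    have h1 := h.invAt_apply t (ν • u - (t : ℂ) • B u)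
    rw [← hu, sub_add_cancel, map_smul] at h1
    rw [eq_inv_smul_iff₀ hν]
    exact h1
  · intro hu
    obtain ⟨y, hy, hTy⟩ := h.exists_pre t u
    rw [hTy] at hu
    rw [hu] at hy
    have h2 : ν • u - (t : ℂ) • B u = ν • y := by
      nth_rewrite 1 [hy]
      rw [map_smul, smul_add, smul_comm (t : ℂ), smul_inv_smul₀ hν, add_sub_cancel_right]
    rw [h2, map_smul, hu, smul_inv_smul₀ hν]

theorem IsSimplePencil.exists_eig (t : ℝ) {s : ℂ} {z : E}
    (hz : invAt T B t z = s • z) (h0 : z ≠ 0) :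
    ∃ ν : ℝ, ν ≠ 0 ∧ s = (ν : ℂ)⁻¹ ∧ z = T ((ν : ℂ) • z - (t : ℂ) • B z) := by
  have hs0 : s ≠ 0 := by rintro rfl; exact h0 (h.invAt_inj t (by rw [hz, zero_smul]))
  have hre := eigen_real (h.invAt_symm t) hz h0
  have hre0 : s.re ≠ 0 := by intro h1; rw [h1] at hre; exact hs0 (by simpa using hre.symm)
  have hs : s = ((s.re⁻¹ : ℝ) : ℂ)⁻¹ := by rw [Complex.ofReal_inv, inv_inv, hre]
  refine ⟨s.re⁻¹, inv_ne_zero hre0, hs, ?_⟩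
  rw [h.eig_iff t (by grind), ← hs]
  exact hz

theorem IsSimplePencil.le_ncard {t : ℝ} {m : ℕ} {C C' : ℝ}
    (hC' : 0 < C') (hCC : C' < C) (z : (Fin m → ℂ) →ₗ[ℂ] E) (hz : Function.Injective z)
    (hle : ∀ c, C * ‖z c‖ ≤ ‖invAt T B t (z c)‖) :
    m ≤ {ν : ℝ | |ν| ≤ 1 / C' ∧ PEig T B t ν}.ncard := by
  classical
  by_contra! hlt
  have hfin := h.finite_eig t (1 / C')
  set Z := {ν : ℝ | |ν| ≤ 1 / C' ∧ PEig T B t ν} with hZ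
  have : Fintype Z := hfin.fintype
  have hchoose : ∀ ν : Z, ∃ u, u ≠ 0 ∧ u = T (((ν : ℝ) : ℂ) • u - (t : ℂ) • B u) := fun ν => ν.2.2
  choose e he0 he using hchoose
  let Φ : (Fin m → ℂ) →ₗ[ℂ] (Z → ℂ) := LinearMap.pi fun ν => (innerSL ℂ (e ν)).toLinearMap ∘ₗ z
  have hker : LinearMap.ker Φ ≠ ⊥ := by
    refine LinearMap.ker_ne_bot_of_finrank_lt ?_
    rw [Module.finrank_fintype_fun_eq_card, Module.finrank_fintype_fun_eq_card, Fintype.card_fin,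
      ← Nat.card_eq_fintype_card]
    exact hlt
  obtain ⟨c, hc, hc0⟩ := Submodule.exists_mem_ne_zero_of_ne_bot hker
  have hperp : ∀ ν, ⟪e ν, z c⟫ = 0 := fun ν => congrFun (LinearMap.mem_ker.mp hc) ν
  have hz0 : z c ≠ 0 := fun h1 => hc0 (hz (by rw [h1, map_zero]))
  let U : Submodule ℂ E := Submodule.span ℂ (Set.range e)
  have hUfin : FiniteDimensional ℂ U := FiniteDimensional.span_of_finite ℂ (Set.finite_range e)
  let P : E →L[ℂ] E := U.starProjection
  have hPmem : ∀ x ∈ U, P x = x := fun x hx => Submodule.starProjection_eq_self_iff.mpr hx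
  have hPperp : ∀ x, (∀ ν, ⟪e ν, x⟫ = 0) → P x = 0 := by
    intro x hx
    rw [Submodule.starProjection_apply_eq_zero_iff]
    rw [Submodule.mem_orthogonal]
    intro y hy
    induction hy using Submodule.span_induction with
    | mem y hy => grind
    | zero => simp
    | add y w _ _ h1 h2 => rw [inner_add_left, h1, h2, add_zero]
    | smul a y _ h1 => rw [inner_smul_left, h1, mul_zero]
  have key := norm_le_of_eigen (T := invAt T B t) (X := invAt T B t * (1 - P))
    (Y := (C' : ℂ) • (1 : E →L[ℂ] E)) (h.invAt_symm t) (h.invAt_fin t).isCompactOperator ?_ (z c)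
  · have hX : (invAt T B t * (1 - P)) (z c) = invAt T B t (z c) := by
      change invAt T B t (z c - P (z c)) = _
      rw [hPperp _ hperp, sub_zero]
    rw [hX] at key
    have h2 : ‖((C' : ℂ) • (1 : E →L[ℂ] E)) (z c)‖ = C' * ‖z c‖ := by
      change ‖(C' : ℂ) • z c‖ = _
      rw [norm_smul, norm_real, norm_of_nonneg hC'.le]
    rw [h2] at key
    have h3 := norm_pos_iff.mpr hz0
    have := hle c
    nlinarith
  · intro s x hx
    have hY : ((C' : ℂ) • (1 : E →L[ℂ] E)) x = (C' : ℂ) • x := rfl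
    have hX : (invAt T B t * (1 - P)) x = invAt T B t (x - P x) := rfl
    rw [hY, hX]
    have hTY : invAt T B t ((C' : ℂ) • x) = s • (C' : ℂ) • x := by rw [map_smul, hx, smul_comm]
    by_cases hx0 : x = 0
    · subst hx0; simp
    obtain ⟨ν, hν0, hs, hxν⟩ := h.exists_eig t hx hx0
    by_cases hνZ : ν ∈ Z
    · obtain ⟨a, ha⟩ := h.simple t ν _ x (he0 ⟨ν, hνZ⟩) (he ⟨ν, hνZ⟩) hxν
      have : x ∈ U := ha ▸ U.smul_mem a (Submodule.subset_span ⟨_, rfl⟩)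
      rw [hPmem x this, sub_self, map_zero]
      exact ⟨by simp, hTY, by simp⟩
    · have hP0 : P x = 0 := hPperp x fun ν' => h.orthogonal (he ν') hxν (by
        rintro rfl
        exact hνZ ν'.2)
      rw [hP0, sub_zero]
      refine ⟨by rw [hx, map_smul, hx], hTY, ?_⟩
      rw [hx, norm_smul, norm_smul]
      gcongr
      have h4 : 1 / C' < |ν| := by by_contra! h5; exact hνZ ⟨h5, x, hx0, hxν⟩
      rw [hs, norm_inv, norm_real, norm_real, norm_eq_abs, norm_of_nonneg hC'.le]
      rw [one_div, inv_lt_comm₀ hC' (abs_pos.mpr hν0)] at h4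
      exact h4.le

end Counting

section Sequence

variable {E : Type*} [NormedAddCommGroup E] [InnerProductSpace ℂ E] [CompleteSpace E]

local notation "⟪" x ", " y "⟫" => inner ℂ x y

variable {T B S T' B' S' : E →L[ℂ] E} {b b' : ℝ}

/-- The eigenvalues of `T⁻¹ + t B` in `(0, c]`. -/
def posEig (T B : E →L[ℂ] E) (t c : ℝ) : Set ℝ := {ν | 0 < ν ∧ ν ≤ c ∧ PEig T B t ν}

/-- `m` is the `l`-th positive eigenvalue of `T⁻¹ + t B`. -/
def IsNthPos (T B : E →L[ℂ] E) (t : ℝ) (l : ℕ) (m : ℝ) : Prop :=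
  0 < m ∧ PEig T B t m ∧ (posEig T B t m).ncard = l

theorem posEig_mono (T B : E →L[ℂ] E) (t : ℝ) {c d : ℝ} (hcd : c ≤ d) :
    posEig T B t c ⊆ posEig T B t d := fun _ hν => ⟨hν.1, hν.2.1.trans hcd, hν.2.2⟩

variable (h : IsSimplePencil T B S b)
include h

theorem IsSimplePencil.neg_eig {t : ℝ} {ν : ℂ} (hν : PEig T B t ν) : PEig T B t (-ν) := by
  obtain ⟨u, hu0, hu⟩ := hν
  refine ⟨S u, fun h0 => hu0 ?_, ?_⟩
  · rw [← h.flip u, h0, map_zero]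
  · nth_rewrite 1 [hu]
    rw [h.flipT, map_sub, map_smul, map_smul, h.flipB, ← map_neg]
    congr 1
    module

theorem IsSimplePencil.posEig_finite (t c : ℝ) : (posEig T B t c).Finite :=
  (h.finite_eig t c).subset fun ν hν => ⟨by rw [abs_of_pos hν.1]; exact hν.2.1, hν.2.2⟩

theorem IsSimplePencil.ncard_eq (t c : ℝ) :
    {ν : ℝ | |ν| ≤ c ∧ PEig T B t ν}.ncard = 2 * (posEig T B t c).ncard := by
  have hU : {ν : ℝ | |ν| ≤ c ∧ PEig T B t ν}
      = posEig T B t c ∪ (fun x => -x) '' posEig T B t c := by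
    ext ν
    constructor
    · rintro ⟨h1, h2⟩
      rcases lt_trichotomy ν 0 with h3 | h3 | h3
      · right
        refine ⟨-ν, ⟨by linarith, by rwa [abs_of_neg h3] at h1, ?_⟩, by simp⟩
        have := h.neg_eig h2
        push_cast
        exact this
      · subst h3; exact (h.noZero t (by simpa using h2)).elim
      · left; exact ⟨h3, by rwa [abs_of_pos h3] at h1, h2⟩
    · rintro (h1 | ⟨μ, h1, rfl⟩)
      · exact ⟨by rw [abs_of_pos h1.1]; exact h1.2.1, h1.2.2⟩
      · refine ⟨by simp only [abs_neg]; rw [abs_of_pos h1.1]; exact h1.2.1, ?_⟩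
        have := h.neg_eig h1.2.2
        push_cast
        exact this
  have hd : Disjoint (posEig T B t c) ((fun x => -x) '' posEig T B t c) := by
    rw [Set.disjoint_left]
    rintro ν h1 ⟨μ, h2, rfl⟩
    have := h1.1
    have := h2.1
    simp only at *
    linarith
  rw [hU, Set.ncard_union_eq hd (h.posEig_finite t c) ((h.posEig_finite t c).image _),
    Set.ncard_image_of_injective _ neg_injective]
  ring

theorem IsSimplePencil.exists_family (t c : ℝ) :
    ∃ (ν : Fin (2 * (posEig T B t c).ncard) → ℝ) (u : Fin (2 * (posEig T B t c).ncard) → E),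
      Function.Injective ν ∧ (∀ i, |ν i| ≤ c) ∧ (∀ i, u i ≠ 0) ∧
      ∀ i, u i = T ((ν i : ℂ) • u i - (t : ℂ) • B (u i)) := by
  have hfin := h.finite_eig t c
  have hcard : hfin.toFinset.card = 2 * (posEig T B t c).ncard := by
    rw [← h.ncard_eq, Set.ncard_eq_toFinset_card _ hfin]
  let ν : Fin (2 * (posEig T B t c).ncard) → ℝ :=
    fun i => (hfin.toFinset.equivFinOfCardEq hcard).symm i
  have hmem : ∀ i, |ν i| ≤ c ∧ PEig T B t (ν i) := fun i =>
    hfin.mem_toFinset.mp ((hfin.toFinset.equivFinOfCardEq hcard).symm i).2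
  choose u hu0 hu using fun i => (hmem i).2
  exact ⟨ν, u, Subtype.val_injective.comp (hfin.toFinset.equivFinOfCardEq hcard).symm.injective,
    fun i => (hmem i).1, hu0, hu⟩

theorem IsSimplePencil.ncard_le {t c : ℝ} {n : ℕ} {F : E →L[ℂ] E}
    (hF : FinRank F) (hn : finrank ℂ (lrange F.toLinearMap) ≤ 2 * n)
    (hlt : ‖T - F‖ * (c + b * |t|) < 1) : (posEig T B t c).ncard ≤ n := by
  obtain ⟨ν, u, hν, hc, hu0, hu⟩ := h.exists_family t c
  have := h.card_le hν hc (fun i => ⟨u i, hu0 i, hu i⟩) hF hn hlt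
  omega

theorem IsSimplePencil.le_posEig {t : ℝ} {l : ℕ} {C C' : ℝ}
    (hC' : 0 < C') (hCC : C' < C) (z : (Fin (2 * l) → ℂ) →ₗ[ℂ] E) (hz : Function.Injective z)
    (hle : ∀ c, C * ‖z c‖ ≤ ‖invAt T B t (z c)‖) : l ≤ (posEig T B t (1 / C')).ncard := by
  have := h.le_ncard hC' hCC z hz hle
  rw [h.ncard_eq] at this
  omega

theorem IsSimplePencil.le_posEig_of_trial (t : ℝ) {l : ℕ} {c d : ℝ}
    {v w : Fin (2 * l) → E} (hc : 0 < c) (hTw : ∀ i, T (w i) = v i) (hv0 : ∀ i, v i ≠ 0)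
    (hv : ∀ i j, i ≠ j → ⟪v i, v j⟫ = 0) (hw : ∀ i j, i ≠ j → ⟪w i, w j⟫ = 0)
    (hwv : ∀ i, ‖w i‖ ≤ c * ‖v i‖) (hd : c + b * |t| < d) : l ≤ (posEig T B t d).ncard := by
  have hb := h.nonneg
  have hbt : 0 ≤ b * |t| := by positivity
  let z : (Fin (2 * l) → ℂ) →ₗ[ℂ] E := Fintype.linearCombination ℂ fun i => w i + (t : ℂ) • B (v i)
  have hz : ∀ a, z a = ∑ i, a i • w i + (t : ℂ) • B (∑ i, a i • v i) := by
    intro a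
    rw [map_sum, Finset.smul_sum, ← Finset.sum_add_distrib]
    refine (Fintype.linearCombination_apply ℂ _ _).trans (Finset.sum_congr rfl fun i _ => ?_)
    rw [map_smul, smul_add, smul_comm (t : ℂ) (a i)]
  have hTz : ∀ a : Fin (2 * l) → ℂ, T (∑ i, a i • w i) = ∑ i, a i • v i := by
    intro a
    rw [map_sum]
    exact Finset.sum_congr rfl fun i _ => by rw [map_smul, hTw]
  have hIz : ∀ a, invAt T B t (z a) = ∑ i, a i • v i := by intro a; rw [hz, ← hTz, h.invAt_apply]
  have hd0 : 0 < d := by linarith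
  have := h.le_posEig (t := t) (C' := 1 / d) (C := 1 / (c + b * |t|)) (by positivity)
    (one_div_lt_one_div_of_lt (by linarith) hd) z ?_ ?_
  · simpa using this
  · rw [← LinearMap.ker_eq_bot, LinearMap.ker_eq_bot']
    intro a ha
    refine lincomb_injective hv0 hv ?_
    rw [← hIz, ha, map_zero]
  · intro a
    rw [hIz, one_div, ← div_eq_inv_mul, div_le_iff₀ (by linarith), hz]
    refine (norm_add_le _ _).trans ?_
    have h1 := norm_lincomb_le hv hw hc.le hwv a
    have h2 := h.normB_apply (∑ i, a i • v i)
    rw [norm_smul, norm_real, norm_eq_abs]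
    have := mul_le_mul_of_nonneg_left h2 (abs_nonneg t)
    linarith

theorem IsSimplePencil.exists_nth (t : ℝ) {l : ℕ} (hl : 1 ≤ l) : ∃ m, IsNthPos T B t l m := by
  obtain ⟨c, v, w, hc, h1, h2, h3, h4, h5⟩ := h.unbounded (2 * l)
  have hle := h.le_posEig_of_trial t hc h1 h2 h3 h4 h5 (lt_add_one _)
  set d := c + b * |t| + 1
  have hfin := h.posEig_finite t d
  rw [Set.ncard_eq_toFinset_card _ hfin] at hle
  set s := hfin.toFinset
  let i : Fin s.card := ⟨l - 1, by omega⟩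
  let f := s.orderEmbOfFin rfl
  have hmem : f i ∈ posEig T B t d := hfin.mem_toFinset.mp (s.orderEmbOfFin_mem rfl i)
  refine ⟨f i, hmem.1, hmem.2.2, ?_⟩
  have hset : posEig T B t (f i) = ((Finset.Iic i).map f.toEmbedding : Finset ℝ) := by
    ext ν
    simp only [Finset.coe_map, Set.mem_image, Finset.coe_Iic, Set.mem_Iic]
    constructor
    · intro hν
      have hνs : ν ∈ s := hfin.mem_toFinset.mpr ⟨hν.1, hν.2.1.trans hmem.2.1, hν.2.2⟩
      have : ν ∈ Set.range f := by rw [Finset.range_orderEmbOfFin]; exact hνs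
      obtain ⟨j, rfl⟩ := this
      exact ⟨j, f.le_iff_le.mp hν.2.1, rfl⟩
    · rintro ⟨j, hj, rfl⟩
      have hm : f j ∈ posEig T B t d := hfin.mem_toFinset.mp (s.orderEmbOfFin_mem rfl j)
      exact ⟨hm.1, f.le_iff_le.mpr hj, hm.2.2⟩
  rw [hset, Set.ncard_coe_finset, Finset.card_map, Fin.card_Iic]
  show l - 1 + 1 = l
  omega

theorem IsSimplePencil.nth_le {t m c : ℝ} {l : ℕ}
    (hm : IsNthPos T B t l m) (hc : l ≤ (posEig T B t c).ncard) : m ≤ c := by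
  by_contra! hlt
  have : (posEig T B t c).ncard < (posEig T B t m).ncard := by
    refine Set.ncard_lt_ncard ⟨posEig_mono T B t hlt.le, fun hsub => ?_⟩ (h.posEig_finite t m)
    have := (hsub ⟨hm.1, le_rfl, hm.2.1⟩ : m ∈ posEig T B t c).2.1
    linarith
  rw [hm.2.2] at this
  omega

theorem IsSimplePencil.nth_lt {t m m' : ℝ} {l l' : ℕ}
    (hm : IsNthPos T B t l m) (hm' : IsNthPos T B t l' m') (hl : l < l') : m < m' := by
  by_contra! hle
  have := Set.ncard_le_ncard (posEig_mono T B t hle) (h.posEig_finite t m)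
  rw [hm.2.2, hm'.2.2] at this
  omega

open Classical in
/-- The sequence of positive eigenvalues of `T⁻¹ + t B`, preceded by `0`. -/
def eigSeq (T B : E →L[ℂ] E) (t : ℝ) (l : ℕ) : ℝ :=
  if h : ∃ m, IsNthPos T B t l m then h.choose else 0

theorem IsSimplePencil.eigSeq_spec (t : ℝ) {l : ℕ} (hl : 1 ≤ l) :
    IsNthPos T B t l (eigSeq T B t l) := by
  have := h.exists_nth t hl
  rw [eigSeq, dif_pos this]
  exact this.choose_spec

theorem IsSimplePencil.eigSeq_zero (t : ℝ) : eigSeq T B t 0 = 0 := by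
  rw [eigSeq, dif_neg]
  rintro ⟨m, hm⟩
  have := (Set.ncard_eq_zero (h.posEig_finite t m)).mp hm.2.2
  have h2 : m ∈ posEig T B t m := ⟨hm.1, le_rfl, hm.2.1⟩
  rw [this] at h2
  exact h2

theorem IsSimplePencil.eq_eigSeq {t m : ℝ} {l : ℕ} (hl : 1 ≤ l)
    (hm : IsNthPos T B t l m) : m = eigSeq T B t l :=
  le_antisymm (h.nth_le hm (h.eigSeq_spec t hl).2.2.ge) (h.nth_le (h.eigSeq_spec t hl) hm.2.2.ge)

theorem IsSimplePencil.eigSeq_pos (t : ℝ) {l : ℕ} (hl : 1 ≤ l) :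
    0 < eigSeq T B t l := (h.eigSeq_spec t hl).1

theorem IsSimplePencil.eigSeq_strictMono (t : ℝ) : StrictMono (eigSeq T B t) := by
  intro i j hij
  rcases Nat.eq_zero_or_pos i with rfl | hi
  · rw [h.eigSeq_zero]; exact h.eigSeq_pos t hij
  · exact h.nth_lt (h.eigSeq_spec t hi) (h.eigSeq_spec t (by omega)) hij

omit h in
/-- The distance of the `l`-th positive eigenvalue to the rest of the spectrum. -/
def eigGap (T B : E →L[ℂ] E) (t : ℝ) (l : ℕ) : ℝ :=
  min (eigSeq T B t (l + 1) - eigSeq T B t l) (eigSeq T B t l - eigSeq T B t (l - 1))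

theorem IsSimplePencil.eigGap_pos (t : ℝ) {l : ℕ} (hl : 1 ≤ l) : 0 < eigGap T B t l :=
  lt_min (sub_pos.mpr (h.eigSeq_strictMono t (by omega)))
    (sub_pos.mpr (h.eigSeq_strictMono t (by omega)))

theorem IsSimplePencil.eigGap_le {t : ℝ} {l : ℕ} (hl : 1 ≤ l) {ν : ℝ}
    (hν : PEig T B t ν) (hne : ν ≠ eigSeq T B t l) : eigGap T B t l ≤ |ν - eigSeq T B t l| := by
  have : 0 ≤ eigSeq T B t (l - 1) := by
    rw [← h.eigSeq_zero t]
    exact (h.eigSeq_strictMono t).monotone (Nat.zero_le _)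
  rcases lt_or_ge 0 ν with h0 | h0
  · have hN : IsNthPos T B t (posEig T B t ν).ncard ν := ⟨h0, hν, rfl⟩
    have hpos : 1 ≤ (posEig T B t ν).ncard := by
      refine (Set.ncard_pos (h.posEig_finite t ν)).mpr ?_
      exact ⟨ν, h0, le_rfl, hν⟩
    have heq := h.eq_eigSeq hpos hN
    set j := (posEig T B t ν).ncard
    rcases lt_trichotomy j l with hj | hj | hj
    · have := (h.eigSeq_strictMono t).monotone (show j ≤ l - 1 by omega)
      refine (min_le_right _ _).trans ?_
      rw [abs_sub_comm]
      exact le_trans (by linarith) (le_abs_self _)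
    · rw [hj] at heq; exact (hne heq).elim
    · have := (h.eigSeq_strictMono t).monotone (show l + 1 ≤ j by omega)
      refine (min_le_left _ _).trans ?_
      exact le_trans (by linarith) (le_abs_self _)
  · refine (min_le_right _ _).trans ?_
    rw [abs_sub_comm]
    exact le_trans (by linarith) (le_abs_self _)

theorem IsSimplePencil.eigSeq_weyl_aux (h' : IsSimplePencil T' B' S' b')
    (t t' : ℝ) {l : ℕ} (hl : 1 ≤ l) :
    1 / eigSeq T B t l - ‖invAt T B t - invAt T' B' t'‖ ≤ 1 / eigSeq T' B' t' l := by
  have hm := h.eigSeq_spec t hl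
  have hm' := h'.eigSeq_spec t' hl
  set m := eigSeq T B t l
  set m' := eigSeq T' B' t' l
  set d := ‖invAt T B t - invAt T' B' t'‖ with hd
  have hm0 := hm.1
  have hm0' := hm'.1
  refine le_of_forall_lt_imp_le_of_dense fun C' hC' => ?_
  rcases le_or_gt C' 0 with h0 | h0
  · exact h0.trans (by positivity)
  obtain ⟨ν, u, hν, hc, hu0, hu⟩ := h.exists_family t m
  have horth : ∀ i j, i ≠ j → ⟪u i, u j⟫ = 0 := fun i j hij =>
    h.orthogonal (hu i) (hu j) (hν.ne hij)
  have hν0 : ∀ i, (ν i : ℂ) ≠ 0 := by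
    intro i h1
    refine h.noZero t ⟨u i, hu0 i, ?_⟩
    rw [← h1]
    exact hu i
  have hTu : ∀ i, invAt T B t (u i) = (ν i : ℂ)⁻¹ • u i := fun i =>
    (h.eig_iff t (hν0 i) _).mp (hu i)
  have key := h'.le_posEig (t := t') h0 hC' (Fintype.linearCombination ℂ u) ?_ ?_
  · rw [hm.2.2] at key; have := h'.nth_le hm' key; rwa [le_one_div h0 hm0']
  · rw [← LinearMap.ker_eq_bot, LinearMap.ker_eq_bot']
    intro a ha
    exact lincomb_injective hu0 horth (by rwa [Fintype.linearCombination_apply] at ha)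
  · intro a
    rw [Fintype.linearCombination_apply]
    set x := ∑ i, a i • u i with hx
    have h1 : ‖x‖ ≤ m * ‖invAt T B t x‖ := by
      have h2 : invAt T B t x = ∑ i, a i • ((ν i : ℂ)⁻¹ • u i) := by
        rw [hx, map_sum]
        exact Finset.sum_congr rfl fun i _ => by rw [map_smul, hTu]
      rw [h2, hx]
      refine norm_lincomb_le (fun i j hij => by simp [horth i j hij]) horth hm0.le (fun i => ?_) a
      rw [norm_smul, norm_inv, norm_real, norm_eq_abs, ← mul_assoc]
      have h3 : 0 < |ν i| := by rw [abs_pos]; exact_mod_cast hν0 i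
      have : 1 ≤ m * |ν i|⁻¹ := by rw [← div_eq_mul_inv, one_le_div h3]; exact hc i
      nlinarith [norm_nonneg (u i)]
    have : ‖invAt T B t x‖ ≤ ‖invAt T' B' t' x‖ + d * ‖x‖ := by
      have h6 : invAt T B t x = invAt T' B' t' x + (invAt T B t - invAt T' B' t') x := by
        change _ = _ + (invAt T B t x - invAt T' B' t' x)
        abel
      rw [h6]
      exact (norm_add_le _ _).trans (by gcongr; exact ContinuousLinearMap.le_opNorm _ _)
    have : 1 / m * ‖x‖ ≤ ‖invAt T B t x‖ := by
      rw [one_div, ← div_eq_inv_mul, div_le_iff₀ hm0]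
      linarith
    linarith

theorem IsSimplePencil.eigSeq_weyl (h' : IsSimplePencil T' B' S' b')
    (t t' : ℝ) {l : ℕ} (hl : 1 ≤ l) :
    |1 / eigSeq T B t l - 1 / eigSeq T' B' t' l| ≤ ‖invAt T B t - invAt T' B' t'‖ := by
  rw [abs_sub_le_iff]
  have := h.eigSeq_weyl_aux h' t t' hl
  have h2 := h'.eigSeq_weyl_aux h t' t hl
  rw [norm_sub_rev] at h2
  constructor <;> linarith

omit h in
theorem continuous_eigSeq {X : Type*} [TopologicalSpace X] {T B S : X → E →L[ℂ] E} {b : X → ℝ}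
    (h : ∀ x, IsSimplePencil (T x) (B x) (S x) (b x)) {t : X → ℝ} (ht : Continuous t)
    (hT : Continuous T) (hB : Continuous B) (l : ℕ) :
    Continuous fun x => eigSeq (T x) (B x) (t x) l := by
  rcases Nat.eq_zero_or_pos l with rfl | hl
  · simp only [(h _).eigSeq_zero]; exact continuous_const
  have hinv : Continuous fun x => invAt (T x) (B x) (t x) := by
    refine hT.mul (continuous_iff_continuousAt.mpr fun x => ?_)
    have hN : Continuous fun x => 1 - pencilN (T x) (B x) ((t x : ℂ), 0) := by
      unfold pencilN
      fun_prop
    obtain ⟨u, hu⟩ := (h x).isUnit_zero (t x)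
    have := NormedRing.inverse_continuousAt u
    rw [hu] at this
    exact ContinuousAt.comp (f := fun x => 1 - pencilN (T x) (B x) ((t x : ℂ), 0)) this
      hN.continuousAt
  have h1 : Continuous fun x => 1 / eigSeq (T x) (B x) (t x) l := by
    rw [continuous_iff_continuousAt]
    intro x
    rw [ContinuousAt, tendsto_iff_dist_tendsto_zero]
    refine squeeze_zero (fun _ => dist_nonneg) (fun y => (h y).eigSeq_weyl (h x) (t y) (t x) hl) ?_
    have h2 := (tendsto_iff_norm_sub_tendsto_zero.mp (hinv.tendsto x))
    exact h2
  have h3 : (fun x => eigSeq (T x) (B x) (t x) l)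
      = fun x => (1 / eigSeq (T x) (B x) (t x) l)⁻¹ := by funext x; rw [one_div, inv_inv]
  rw [h3]
  exact h1.inv₀ fun x => (one_div_pos.mpr ((h x).eigSeq_pos _ hl)).ne'

end Sequence

section Branch

variable {E : Type*} [NormedAddCommGroup E] [InnerProductSpace ℂ E] [CompleteSpace E]

local notation "⟪" x ", " y "⟫" => inner ℂ x y

variable {T B S : E →L[ℂ] E} {b : ℝ}

/-- The functional `A ↦ ⟨e, A e⟩`. -/
def expect (e : E) : (E →L[ℂ] E) →L[ℂ] ℂ := (innerSL ℂ e) ∘L (ContinuousLinearMap.apply ℂ E e)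

theorem expect_apply (e : E) (A : E →L[ℂ] E) : expect e A = ⟪e, A e⟫ := rfl

/-- The operator `x ↦ ⟨e, x⟩ e`. -/
def rankOneProj (e : E) : E →L[ℂ] E := (innerSL ℂ e).smulRight e

/-- `(T⁻¹ + λ B - ω + δ ⟨e, ·⟩ e) T`. -/
def deflated (T B : E →L[ℂ] E) (e : E) (δ : ℝ) (p : ℂ × ℂ) : E →L[ℂ] E :=
  1 - pencilN T B p + (δ : ℂ) • (rankOneProj e * T)

theorem deflated_apply (T B : E →L[ℂ] E) (e : E) (δ : ℝ) (p : ℂ × ℂ) (x : E) :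
    deflated T B e δ p x = x - (p.2 • T x - p.1 • B (T x)) + (δ : ℂ) • ⟪e, T x⟫ • e := rfl

theorem deflated_analyticAt (T B : E →L[ℂ] E) (e : E) (δ : ℝ) (p : ℂ × ℂ) :
    AnalyticAt ℂ (deflated T B e δ) p :=
  (analyticAt_const.sub (pencilN_analyticAt T B p)).add analyticAt_const

theorem IsSimplePencil.gap_bound (h : IsSimplePencil T B S b) {t m δ : ℝ} {e : E} (hδ : 0 < δ)
    (he1 : ‖e‖ = 1) (he : e = T ((m : ℂ) • e - (t : ℂ) • B e))
    (hgap : ∀ ν : ℝ, PEig T B t ν → ν ≠ m → δ ≤ |ν - m|) (w : E) :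
    δ * ‖T w‖ ≤ ‖deflated T B e δ ((t : ℂ), (m : ℂ)) w‖ := by
  have he0 : e ≠ 0 := by intro h0; rw [h0, norm_zero] at he1; exact zero_ne_one he1
  set R := invAt T B t with hR
  have key := norm_le_of_eigen (T := R) (X := (δ : ℂ) • R)
    (Y := 1 - (m : ℂ) • R + (δ : ℂ) • (rankOneProj e * R)) (h.invAt_symm t)
    (h.invAt_fin t).isCompactOperator ?_ (w + (t : ℂ) • B (T w))
  · have h1 : R (w + (t : ℂ) • B (T w)) = T w := h.invAt_apply t w
    have h2 : ((δ : ℂ) • R) (w + (t : ℂ) • B (T w)) = (δ : ℂ) • T w :=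
      congrArg (fun x => (δ : ℂ) • x) h1
    have h3 : (1 - (m : ℂ) • R + (δ : ℂ) • (rankOneProj e * R)) (w + (t : ℂ) • B (T w))
        = deflated T B e δ ((t : ℂ), (m : ℂ)) w := by
      rw [deflated_apply]
      change w + (t : ℂ) • B (T w) - (m : ℂ) • R (w + (t : ℂ) • B (T w))
        + (δ : ℂ) • ⟪e, R (w + (t : ℂ) • B (T w))⟫ • e = _
      rw [h1]
      abel_nf
    rw [h2, h3, norm_smul, norm_real, norm_of_nonneg hδ.le] at key
    exact key
  · intro s z hz
    have hX : ((δ : ℂ) • R) z = (δ : ℂ) • s • z := by rw [← hz]; rfl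
    have hY : (1 - (m : ℂ) • R + (δ : ℂ) • (rankOneProj e * R)) z
        = z - (m : ℂ) • s • z + (δ : ℂ) • ⟪e, s • z⟫ • e := by rw [← hz]; rfl
    rw [hX, hY]
    refine ⟨by rw [map_smul, map_smul, hz]; module, ?_⟩
    by_cases hz0 : z = 0
    · subst hz0; simp
    obtain ⟨ν, hν0, hs, hzν⟩ := h.exists_eig t hz hz0
    have hν0' : (ν : ℂ) ≠ 0 := by exact_mod_cast hν0
    by_cases hνm : ν = m
    · subst hνm
      obtain ⟨c, rfl⟩ := h.simple t ν e z he0 he hzν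
      have hee : ⟪e, e⟫ = 1 := by rw [inner_self_eq_norm_sq_to_K, he1]; norm_num
      have hRe : R e = s • e := by rw [hs]; exact (h.eig_iff t hν0' e).mp he
      have h1 : c • e - (ν : ℂ) • s • c • e + (δ : ℂ) • ⟪e, s • c • e⟫ • e
          = (δ : ℂ) • s • c • e := by
        rw [inner_smul_right, inner_smul_right, hee, hs, smul_inv_smul₀ hν0', sub_self, zero_add,
          mul_one, mul_smul]
      rw [h1]
      refine ⟨?_, le_rfl⟩
      rw [map_smul, map_smul, map_smul, hRe]
      module
    · have horth : ⟪e, z⟫ = 0 := h.orthogonal he hzν (Ne.symm hνm)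
      rw [inner_smul_right, horth, mul_zero, zero_smul, smul_zero, add_zero]
      refine ⟨by rw [map_sub, map_smul, map_smul, hz]; module, ?_⟩
      have h2 : z - (m : ℂ) • s • z = (((ν - m : ℝ) : ℂ)) • s • z := by
        have h3 : z = (ν : ℂ) • s • z := by rw [hs, smul_inv_smul₀ hν0']
        nth_rewrite 1 [h3]
        rw [← sub_smul]
        push_cast
        rfl
      rw [h2, norm_smul, norm_smul (((ν - m : ℝ) : ℂ)), norm_real, norm_real,
        norm_of_nonneg hδ.le, norm_eq_abs]
      gcongr
      exact hgap ν ⟨z, hz0, hzν⟩ hνm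

section Local

variable {t m δ : ℝ} {e : E}

local notation "D" => deflated T B e δ

/-- `m` is an eigenvalue of `T⁻¹ + t B` with unit eigenvector `e`, and the distance to the rest of
the spectrum is at least `δ`. -/
structure IsIsolated (T B : E →L[ℂ] E) (b t m δ : ℝ) (e : E) : Prop extends IsPencil T B b where
  pos : 0 < δ
  unit : ‖e‖ = 1
  eig : e = T ((m : ℂ) • e - (t : ℂ) • B e)
  gap : ∀ w, δ * ‖T w‖ ≤ ‖deflated T B e δ ((t : ℂ), (m : ℂ)) w‖

/-- `T (deflated p)⁻¹`, the inverse of `T⁻¹ + λ B - ω + δ ⟨e, ·⟩ e`. -/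
def deflatedInv (T B : E →L[ℂ] E) (e : E) (δ : ℝ) (p : ℂ × ℂ) : E →L[ℂ] E :=
  T * inverse (deflated T B e δ p)

/-- The function whose fixed points in `ω` are the eigenvalues near `m`. -/
def branchMap (T B : E →L[ℂ] E) (e : E) (t m δ : ℝ) (p : ℂ × ℂ) : ℂ :=
  m + δ * (p.1 - t) * expect e (B * deflatedInv T B e δ p)

/-- The divided difference of `branchMap` in `ω`. -/
def branchSlope (T B : E →L[ℂ] E) (e : E) (t δ : ℝ) (lam ω ω' : ℂ) : ℂ :=
  δ * (lam - t) * expect e (B * deflatedInv T B e δ (lam, ω) * deflatedInv T B e δ (lam, ω'))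

local notation "G" => deflatedInv T B e δ

local notation "β" => branchMap T B e t m δ

variable (h : IsIsolated T B b t m δ e)
include h

theorem IsIsolated.expect_norm (A : E →L[ℂ] E) : ‖expect e (B * A)‖ ≤ b * ‖A‖ := by
  rw [expect_apply]
  refine (norm_inner_le_norm _ _).trans ?_
  rw [h.unit, one_mul]
  refine (h.normB_apply _).trans ?_
  have := A.le_opNorm e
  rw [h.unit, mul_one] at this
  exact mul_le_mul_of_nonneg_left this h.nonneg

section Near

variable {p : ℂ × ℂ} (hp : ‖p.2 - m‖ + b * ‖p.1 - t‖ ≤ δ / 2)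
include hp

theorem IsIsolated.deflated_bound (w : E) : δ / 2 * ‖T w‖ ≤ ‖D p w‖ := by
  have h1 : D ((t : ℂ), (m : ℂ)) w = D p w + ((p.2 - m) • T w - (p.1 - t) • B (T w)) := by
    rw [deflated_apply, deflated_apply]
    module
  have : ‖(p.2 - m) • T w - (p.1 - t) • B (T w)‖ ≤ δ / 2 * ‖T w‖ := by
    refine (norm_sub_le _ _).trans ?_
    rw [norm_smul, norm_smul]
    have := mul_le_mul_of_nonneg_left (h.normB_apply (T w)) (norm_nonneg (p.1 - t))
    nlinarith [norm_nonneg (T w)]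
  have h3 := h.gap w
  rw [h1] at h3
  have := norm_add_le (D p w) ((p.2 - m) • T w - (p.1 - t) • B (T w))
  linarith

theorem IsIsolated.deflated_isUnit : IsUnit (D p) := by
  have := h.pos
  have h1 : D p = 1 - (pencilN T B p - (δ : ℂ) • (rankOneProj e * T)) := by rw [deflated]; abel
  rw [h1]
  refine isUnit_one_sub_of_injective
    ((pencilN_finApprox h.fin p).sub ((h.fin.comp_left _).smul _)) fun x hx => ?_
  have h2 : D p x = 0 := by grind
  have h3 := h.deflated_bound hp x
  rw [h2, norm_zero] at h3
  refine h.inj x (norm_le_zero_iff.mp ?_)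
  nlinarith

theorem IsIsolated.deflatedInv_norm : ‖G p‖ ≤ 2 / δ := by
  have hδ := h.pos
  have hu := h.deflated_isUnit hp
  refine opNorm_le_bound _ (by positivity) fun f => ?_
  have h1 := h.deflated_bound hp (inverse (D p) f)
  rw [isUnit_apply_inverse hu] at h1
  have h2 : ‖G p f‖ = ‖T (inverse (D p) f)‖ := rfl
  rw [h2, div_mul_eq_mul_div, le_div_iff₀ hδ]
  linarith

theorem IsIsolated.deflatedInv_analyticAt : AnalyticAt ℂ G p := analyticAt_const.mul
    (analyticAt_ringInverse (deflated_analyticAt T B e δ p) (h.deflated_isUnit hp))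

theorem IsIsolated.branchMap_analyticAt : AnalyticAt ℂ β p := by
  have h1 : AnalyticAt ℂ (fun p => B * G p) p := analyticAt_const.mul (h.deflatedInv_analyticAt hp)
  have h2 : AnalyticAt ℂ (fun p => expect e (B * G p)) p := ((expect e).analyticAt _).comp h1
  exact analyticAt_const.add ((analyticAt_const.mul (analyticAt_fst.sub analyticAt_const)).mul h2)

theorem IsIsolated.branchMap_eq : (m - p.2 + δ) * (1 - δ * expect e (G p)) = β p - p.2 := by
  have hu := h.deflated_isUnit hp
  set y := inverse (D p) e with hy
  have hY : D p y = e := isUnit_apply_inverse hu e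
  have hee : ⟪e, e⟫ = 1 := by rw [inner_self_eq_norm_sq_to_K, h.unit]; norm_num
  have : ⟪e, y⟫ = m * ⟪e, T y⟫ - t * ⟪e, B (T y)⟫ := by
    nth_rewrite 1 [h.eig]
    rw [h.symT, inner_sub_left, inner_smul_left, inner_smul_left, conj_ofReal, conj_ofReal, h.symB]
  have : ⟪e, y⟫ - (p.2 * ⟪e, T y⟫ - p.1 * ⟪e, B (T y)⟫) + δ * ⟪e, T y⟫ = 1 := by
    have h3 : ⟪e, D p y⟫ = 1 := by rw [hY, hee]
    rw [deflated_apply, inner_add_right, inner_sub_right, inner_sub_right, inner_smul_right,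
      inner_smul_right, inner_smul_right, inner_smul_right, hee, mul_one] at h3
    exact h3
  have h4 : expect e (G p) = ⟪e, T y⟫ := rfl
  have h5 : expect e (B * G p) = ⟪e, B (T y)⟫ := rfl
  rw [branchMap, h4, h5]
  grind

theorem IsIsolated.isUnit_iff_expect {K : ℂ} (hK : K = 1 - δ * expect e (G p)) :
    (IsUnit (1 - pencilN T B p) ↔ K ≠ 0) ∧ (K ≠ 0 → inverse (1 - pencilN T B p)
      = inverse (D p) + (δ / K) • (inverse (D p) * rankOneProj e * G p)) := by
  have hu := h.deflated_isUnit hp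
  set Y := D p with hY
  set I := inverse Y with hI
  set g := ⟪e, T (I e)⟫ with hg
  have hK' : K = 1 - δ * g := hK
  have hYI : ∀ x, Y (I x) = x := isUnit_apply_inverse hu
  have hIY : ∀ x, I (Y x) = x := isUnit_inverse_apply hu
  have hN : ∀ x, (1 - pencilN T B p) x = Y x - (δ * ⟪e, T x⟫) • e := by
    intro x
    rw [hY, deflated_apply, mul_smul]
    change x - (p.2 • T x - p.1 • B (T x)) = _
    abel
  have hZ : ∀ x, (I + (δ / K) • (I * rankOneProj e * G p)) x
      = I x + (δ / K * ⟪e, T (I x)⟫) • I e := by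
    intro x
    change I x + (δ / K) • I (⟪e, T (I x)⟫ • e) = _
    rw [map_smul, mul_smul]
  have hinv : K ≠ 0 → IsUnit (1 - pencilN T B p) ∧ inverse (1 - pencilN T B p)
      = I + (δ / K) • (I * rankOneProj e * G p) := by
    intro hK0
    refine isUnit_of_inverse ?_ ?_
    · ext x
      change (1 - pencilN T B p) ((I + (δ / K) • (I * rankOneProj e * G p)) x) = x
      rw [hZ, hN, map_add, map_smul, hYI, hYI, map_add, map_smul, inner_add_right,
        inner_smul_right, ← hg, add_sub_assoc, ← sub_smul]
      have : δ / K * ⟪e, T (I x)⟫ - δ * (⟪e, T (I x)⟫ + δ / K * ⟪e, T (I x)⟫ * g) = 0 := by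
        rw [hK'] at hK0 ⊢
        field_simp
        ring
      rw [this, zero_smul, add_zero]
    · ext x
      change (I + (δ / K) • (I * rankOneProj e * G p)) ((1 - pencilN T B p) x) = x
      rw [hZ, hN, map_sub, map_smul, hIY, map_sub, map_smul, inner_sub_right, inner_smul_right,
        ← hg, sub_add, ← sub_smul]
      have : δ * ⟪e, T x⟫ - δ / K * (⟪e, T x⟫ - δ * ⟪e, T x⟫ * g) = 0 := by
        rw [hK'] at hK0 ⊢
        field_simp
        ring
      rw [this, zero_smul, sub_zero]
  refine ⟨⟨fun hunit hK0 => ?_, fun hK0 => (hinv hK0).1⟩, fun hK0 => (hinv hK0).2⟩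
  have h1 : (1 - pencilN T B p) (I e) = K • e := by rw [hN, hYI, ← hg, hK', sub_smul, one_smul]
  rw [hK0, zero_smul] at h1
  have h2 : I e = 0 := by rw [← isUnit_inverse_apply hunit (I e), h1, map_zero]
  have h3 := hYI e
  rw [h2, map_zero] at h3
  have he1 := h.unit
  rw [← h3, norm_zero] at he1
  exact zero_ne_one he1

theorem IsIsolated.branchMap_norm : ‖β p - m‖ ≤ 2 * (b * ‖p.1 - t‖) := by
  have hδ := h.pos
  have := h.deflatedInv_norm hp
  have h4 := h.expect_norm (G p)
  have := h.nonneg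
  rw [branchMap, add_sub_cancel_left, norm_mul, norm_mul, norm_real, norm_of_nonneg hδ.le]
  calc δ * ‖p.1 - t‖ * _ ≤ δ * ‖p.1 - t‖ * (b * (2 / δ)) := by gcongr; exact h4.trans (by gcongr)
    _ = 2 * (b * ‖p.1 - t‖) := by field_simp

end Near

theorem IsIsolated.deflated_resolvent {lam ω ω' : ℂ}
    (hp : ‖ω - m‖ + b * ‖lam - t‖ ≤ δ / 2) (hp' : ‖ω' - m‖ + b * ‖lam - t‖ ≤ δ / 2) :
    G (lam, ω) - G (lam, ω') = (ω - ω') • (G (lam, ω) * G (lam, ω')) := by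
  have hu := h.deflated_isUnit (p := (lam, ω)) hp
  have hu' := h.deflated_isUnit (p := (lam, ω')) hp'
  ext f
  set y' := inverse (D (lam, ω')) f with hy'
  have h1 : D (lam, ω') y' = f := isUnit_apply_inverse hu' f
  have h2 : f = D (lam, ω) y' + (ω - ω') • T y' := by
    rw [← h1, deflated_apply, deflated_apply]
    module
  have h3 : inverse (D (lam, ω)) f = y' + (ω - ω') • inverse (D (lam, ω)) (T y') := by
    nth_rewrite 1 [h2]
    rw [map_add, isUnit_inverse_apply hu, map_smul]
  change T (inverse (D (lam, ω)) f) - T y' = (ω - ω') • T (inverse (D (lam, ω)) (T y'))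
  rw [h3, map_add, map_smul]
  abel

theorem IsIsolated.branchMap_sub {lam ω ω' : ℂ}
    (hp : ‖ω - m‖ + b * ‖lam - t‖ ≤ δ / 2) (hp' : ‖ω' - m‖ + b * ‖lam - t‖ ≤ δ / 2) :
    β (lam, ω) - β (lam, ω') = (ω - ω') * branchSlope T B e t δ lam ω ω' := by
  have h1 := h.deflated_resolvent hp hp'
  have : expect e (B * G (lam, ω)) - expect e (B * G (lam, ω')) = (ω - ω') *
        expect e (B * G (lam, ω) * G (lam, ω')) := by
    rw [← map_sub, ← mul_sub, h1, mul_smul_comm, map_smul, smul_eq_mul, mul_assoc B]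
  simp only [branchMap, branchSlope]
  grind

theorem IsIsolated.branchSlope_norm {lam ω ω' : ℂ}
    (hlam : b * ‖lam - t‖ < δ / 16) (hω : ‖ω - m‖ ≤ δ / 4) (hω' : ‖ω' - m‖ ≤ δ / 4) :
    ‖branchSlope T B e t δ lam ω ω'‖ ≤ 1 / 4 := by
  have hδ := h.pos
  have := h.deflatedInv_norm (p := (lam, ω)) (by simp only; linarith)
  have := h.deflatedInv_norm (p := (lam, ω')) (by simp only; linarith)
  have : ‖G (lam, ω) * G (lam, ω')‖ ≤ 2 / δ * (2 / δ) := (norm_mul_le _ _).trans (by gcongr)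
  have h4 := h.expect_norm (G (lam, ω) * G (lam, ω'))
  rw [branchSlope, norm_mul, norm_mul, norm_real, norm_of_nonneg hδ.le, mul_assoc B]
  have := h.nonneg
  calc δ * ‖lam - t‖ * _ ≤ δ * ‖lam - t‖ * (b * (2 / δ * (2 / δ))) := by
        gcongr
        exact h4.trans (by gcongr)
    _ = (b * ‖lam - t‖) * (4 / δ) := by field_simp; ring
    _ ≤ (δ / 16) * (4 / δ) := by gcongr
    _ = 1 / 4 := by field_simp; norm_num

theorem IsIsolated.branchSlope_analyticAt {x : ℂ × ℂ × ℂ}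
    (hp : ‖x.2.1 - m‖ + b * ‖x.1 - t‖ ≤ δ / 2) (hp' : ‖x.2.2 - m‖ + b * ‖x.1 - t‖ ≤ δ / 2) :
    AnalyticAt ℂ (fun x : ℂ × ℂ × ℂ => branchSlope T B e t δ x.1 x.2.1 x.2.2) x := by
  have h1 := (h.deflatedInv_analyticAt (p := (x.1, x.2.1)) hp).comp_of_eq
    (analyticAt_fst.prod (analyticAt_fst.comp analyticAt_snd)) rfl
  have h2 := (h.deflatedInv_analyticAt (p := (x.1, x.2.2)) hp').comp_of_eq
    (analyticAt_fst.prod (analyticAt_snd.comp analyticAt_snd)) rfl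
  exact (analyticAt_const.mul (analyticAt_fst.sub analyticAt_const)).mul
    (((expect e).analyticAt _).comp ((analyticAt_const.mul h1).mul h2))

end Local

end Branch

section BranchExistence

variable {E : Type*} [NormedAddCommGroup E] [InnerProductSpace ℂ E] [CompleteSpace E]

variable {T B S : E →L[ℂ] E} {b : ℝ} {t m δ : ℝ} {e : E}

local notation "D" => deflated T B e δ

local notation "G" => deflatedInv T B e δ

local notation "β" => branchMap T B e t m δ

theorem IsIsolated.branchMap_contract (h : IsIsolated T B b t m δ e) {lam ω ω' : ℂ}
    (hlam : b * ‖lam - t‖ < δ / 16) (hω : ‖ω - m‖ ≤ δ / 4) (hω' : ‖ω' - m‖ ≤ δ / 4) :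
    ‖β (lam, ω) - β (lam, ω')‖ ≤ 1 / 4 * ‖ω - ω'‖ := by
  have := h.pos
  rw [h.branchMap_sub (by linarith) (by linarith), norm_mul, mul_comm]
  gcongr
  exact h.branchSlope_norm hlam hω hω'

theorem IsIsolated.exists_fixed (h : IsIsolated T B b t m δ e) {lam : ℂ}
    (hlam : b * ‖lam - t‖ < δ / 16) :
    ∃ ω : ℂ, ‖ω - m‖ ≤ 2 * (b * ‖lam - t‖) ∧ β (lam, ω) = ω := by
  have := h.pos
  have hn : ∀ ω ∈ Metric.closedBall (m : ℂ) (δ / 4),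
      ‖β (lam, ω) - m‖ ≤ 2 * (b * ‖lam - t‖) := fun ω hω => by
    rw [mem_closedBall_iff_norm] at hω
    exact h.branchMap_norm (p := (lam, ω)) (by dsimp only; linarith)
  have hmap : MapsTo (fun ω => β (lam, ω)) (Metric.closedBall (m : ℂ) (δ / 4))
      (Metric.closedBall (m : ℂ) (δ / 4)) := fun ω hω =>
    mem_closedBall_iff_norm.mpr ((hn ω hω).trans (by linarith))
  obtain ⟨ω, hω, hfix, -⟩ := ContractingWith.exists_fixedPoint' (K := 1 / 4)
    Metric.isClosed_closedBall.isComplete hmap ⟨by norm_num, LipschitzWith.of_dist_le_mul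
      fun x y => by
        rw [Subtype.dist_eq, Subtype.dist_eq, dist_eq_norm, dist_eq_norm]
        exact_mod_cast h.branchMap_contract hlam (mem_closedBall_iff_norm.mp x.2)
          (mem_closedBall_iff_norm.mp y.2)⟩
    (Metric.mem_closedBall_self (by positivity)) (edist_ne_top _ _)
  have e1 : β (lam, ω) = ω := hfix
  exact ⟨ω, by simpa only [e1] using hn ω hω, e1⟩

theorem IsIsolated.differentiableOn_fixed (h : IsIsolated T B b t m δ e) {μ : ℂ → ℂ}
    (hμ : ∀ lam : ℂ, b * ‖lam - t‖ < δ / 16 → ‖μ lam - m‖ ≤ δ / 4 ∧ β (lam, μ lam) = μ lam) :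
    DifferentiableOn ℂ μ {lam | b * ‖lam - t‖ < δ / 16} := by
  have hδ := h.pos
  have hU : IsOpen {lam : ℂ | b * ‖lam - t‖ < δ / 16} := isOpen_lt (by fun_prop) continuous_const
  intro lam (hl : b * ‖lam - t‖ < δ / 16)
  obtain ⟨hm, hfix⟩ := hμ lam hl
  let g : ℂ → ℂ := fun z => β (z, μ lam)
  let s : ℂ → ℂ := fun z => branchSlope T B e t δ z (μ z) (μ lam)
  have hg : DifferentiableAt ℂ g lam :=
    (h.branchMap_analyticAt (p := (lam, μ lam)) (by dsimp only; linarith)).differentiableAt.comp lam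
      (f := fun z => (z, μ lam)) (by fun_prop)
  have hs : ∀ z : ℂ, b * ‖z - t‖ < δ / 16 → ‖s z‖ ≤ 1 / 4 ∧ (1 - s z) * (μ z - μ lam) = g z - g lam :=
    fun z hz => by
      have h1 := h.branchMap_sub (lam := z) (ω := μ z) (ω' := μ lam) (by linarith [(hμ z hz).1])
        (by linarith)
      rw [(hμ z hz).2] at h1
      have h2 : g lam = μ lam := hfix
      exact ⟨h.branchSlope_norm hz (hμ z hz).1 hm, by linear_combination h1 + h2⟩
  have hμc : ContinuousAt μ lam := by
    rw [ContinuousAt, tendsto_iff_norm_sub_tendsto_zero]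
    have h1 := (tendsto_iff_norm_sub_tendsto_zero.mp hg.continuousAt).const_mul 2
    rw [mul_zero] at h1
    refine squeeze_zero' (.of_forall fun _ => norm_nonneg _) ?_ h1
    filter_upwards [hU.mem_nhds hl] with z hz
    obtain ⟨h2, h3⟩ := hs z hz
    rw [← h3, norm_mul]
    have := norm_sub_norm_le 1 (s z)
    rw [norm_one] at this
    nlinarith [norm_nonneg (μ z - μ lam)]
  have hsc : ContinuousAt s lam := ContinuousAt.comp (f := fun z => (z, μ z, μ lam))
    (h.branchSlope_analyticAt (x := (lam, μ lam, μ lam)) (by dsimp only; linarith)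
      (by dsimp only; linarith)).continuousAt (by fun_prop)
  have hne : ∀ z : ℂ, b * ‖z - t‖ < δ / 16 → 1 - s z ≠ 0 := fun z hz h0 => by
    have := (hs z hz).1
    rw [← sub_eq_zero.mp h0, norm_one] at this
    norm_num at this
  have hlim := ((continuousAt_const.sub hsc).inv₀ (hne lam hl)).tendsto.mono_left
    (nhdsWithin_le_nhds (s := {lam}ᶜ)) |>.mul (hasDerivAt_iff_tendsto_slope.mp hg.hasDerivAt)
  refine (hasDerivAt_iff_tendsto_slope.mpr (hlim.congr' ?_)).differentiableAt.differentiableWithinAt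
  filter_upwards [mem_nhdsWithin_of_mem_nhds (hU.mem_nhds hl)] with z hz
  rw [slope_def_field, slope_def_field, ← (hs z hz).2, mul_div_assoc]
  exact inv_mul_cancel_left₀ (hne z hz) _

/-- The eigenvalue branch through an isolated simple eigenvalue `m` at a real parameter `t`. -/
theorem IsSimplePencil.exists_branch (h : IsSimplePencil T B S b) (hδ : 0 < δ)
    (hm : PEig T B t m) (hgap : ∀ ν : ℝ, PEig T B t ν → ν ≠ m → δ ≤ |ν - m|) :
    ∃ (μ : ℂ → ℂ) (Z : ℂ × ℂ → E →L[ℂ] E), μ t = m ∧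
      DifferentiableOn ℂ μ {lam | b * ‖lam - t‖ < δ / 16} ∧
      (∀ lam : ℂ, b * ‖lam - t‖ < δ / 16 → ‖μ lam - m‖ ≤ 2 * (b * ‖lam - t‖)) ∧
      (∀ p : ℂ × ℂ, b * ‖p.1 - t‖ < δ / 16 → ‖p.2 - m‖ < δ / 4 →
        AnalyticAt ℂ Z p ∧ (IsUnit (1 - pencilN T B p) ↔ p.2 ≠ μ p.1) ∧
        (p.2 ≠ μ p.1 → inverse (1 - pencilN T B p) = (p.2 - μ p.1)⁻¹ • Z p)) := by
  classical
  obtain ⟨u, hu0, hu⟩ := hm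
  obtain ⟨e, he1, he⟩ : ∃ e : E, ‖e‖ = 1 ∧ e = T ((m : ℂ) • e - (t : ℂ) • B e) := by
    refine ⟨((‖u‖⁻¹ : ℝ) : ℂ) • u, ?_, ?_⟩
    · rw [norm_smul, norm_real, norm_inv, norm_norm,
        inv_mul_cancel₀ (norm_ne_zero_iff.mpr hu0)]
    · generalize ((‖u‖⁻¹ : ℝ) : ℂ) = c
      have h1 : (m : ℂ) • c • u - (t : ℂ) • B (c • u) = c • ((m : ℂ) • u - (t : ℂ) • B u) := by
        rw [map_smul]
        module
      rw [h1, map_smul, ← hu]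
  have hP : IsIsolated T B b t m δ e := ⟨h.toIsPencil, hδ, he1, he, h.gap_bound hδ he1 he hgap⟩
  let U : Set ℂ := {lam | b * ‖lam - t‖ < δ / 16}
  have hU : IsOpen U := isOpen_lt (by fun_prop) continuous_const
  have hfix := fun (lam : ℂ) (hl : lam ∈ U) => hP.exists_fixed hl
  let μ : ℂ → ℂ := fun lam => if hl : lam ∈ U then (hfix lam hl).choose else 0
  have hμ : ∀ lam ∈ U, ‖μ lam - m‖ ≤ 2 * (b * ‖lam - t‖) ∧
      branchMap T B e t m δ (lam, μ lam) = μ lam := by grind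
  have hdiff : DifferentiableOn ℂ μ U := hP.differentiableOn_fixed fun lam hl =>
    ⟨(hμ lam hl).1.trans (by linarith), (hμ lam hl).2⟩
  have htU : (t : ℂ) ∈ U := by
    simp only [U, mem_ofPred_eq, sub_self, norm_zero, mul_zero]
    positivity
  let Z : ℂ × ℂ → E →L[ℂ] E := fun p =>
    (p.2 - μ p.1) • inverse (deflated T B e δ p)
      - (δ * (m - p.2 + δ) / (1 - branchSlope T B e t δ p.1 p.2 (μ p.1))) •
        (inverse (deflated T B e δ p) * rankOneProj e * deflatedInv T B e δ p)
  refine ⟨μ, Z, ?_, hdiff, fun lam hl => (hμ lam hl).1, ?_⟩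
  · have := (hμ t htU).1
    simp only [sub_self, norm_zero, mul_zero] at this
    exact sub_eq_zero.mp (norm_le_zero_iff.mp this)
  intro p hp1 hp2
  have hpU : p.1 ∈ U := hp1
  obtain ⟨hμ1, hμ2⟩ := hμ p.1 hpU
  have hμ4 : ‖μ p.1 - m‖ ≤ δ / 4 := by linarith
  have hp : ‖p.2 - m‖ + b * ‖p.1 - t‖ ≤ δ / 2 := by linarith
  have hpμ : ‖μ p.1 - m‖ + b * ‖p.1 - t‖ ≤ δ / 2 := by linarith
  have hslope := hP.branchSlope_norm hp1 hp2.le hμ4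
  have hΨ : 1 - branchSlope T B e t δ p.1 p.2 (μ p.1) ≠ 0 := by
    intro h0
    rw [← sub_eq_zero.mp h0, norm_one] at hslope
    norm_num at hslope
  have hmδ : (m : ℂ) - p.2 + δ ≠ 0 := by
    intro h0
    have h1 : (p.2 - m : ℂ) = δ := by grind
    rw [h1, norm_real, norm_of_nonneg hδ.le] at hp2
    linarith
  set K := 1 - δ * expect e (deflatedInv T B e δ p) with hK
  have hKeq : (m - p.2 + δ) * K = (p.2 - μ p.1) * (branchSlope T B e t δ p.1 p.2 (μ p.1) - 1) := by
    rw [hK, hP.branchMap_eq hp]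
    have h5 := hP.branchMap_sub (lam := p.1) hp hpμ
    grind
  have hKμ : K ≠ 0 ↔ p.2 ≠ μ p.1 := by grind
  have hmain := hP.isUnit_iff_expect hp hK
  refine ⟨?_, hmain.1.trans hKμ, fun hne => ?_⟩
  · have hμa : AnalyticAt ℂ (fun q : ℂ × ℂ => μ q.1) p :=
      ((hdiff.analyticOnNhd hU) p.1 hpU).comp analyticAt_fst
    have hI : AnalyticAt ℂ (fun q => inverse (deflated T B e δ q)) p :=
      analyticAt_ringInverse (deflated_analyticAt T B e δ p) (hP.deflated_isUnit hp)
    have hG : AnalyticAt ℂ (deflatedInv T B e δ) p := hP.deflatedInv_analyticAt hp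
    have hsl : AnalyticAt ℂ (fun q : ℂ × ℂ => branchSlope T B e t δ q.1 q.2 (μ q.1)) p :=
      (hP.branchSlope_analyticAt (x := (p.1, p.2, μ p.1)) hp hpμ).comp_of_eq
        (analyticAt_fst.prod (analyticAt_snd.prod hμa)) rfl
    have h9 : AnalyticAt ℂ (fun q : ℂ × ℂ => inverse (deflated T B e δ q) * rankOneProj e *
        deflatedInv T B e δ q) p := (hI.mul analyticAt_const).mul hG
    have h10 : AnalyticAt ℂ (fun q : ℂ × ℂ => δ * (m - q.2 + δ) /
        (1 - branchSlope T B e t δ q.1 q.2 (μ q.1))) p := ?_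
    · exact ((analyticAt_snd.sub hμa).smul hI).sub (h10.smul h9)
    exact (analyticAt_const.mul ((analyticAt_const.sub analyticAt_snd).add analyticAt_const)).div
      (analyticAt_const.sub hsl) hΨ
  · rw [hmain.2 (hKμ.mpr hne)]
    have hne' : p.2 - μ p.1 ≠ 0 := sub_ne_zero.mpr hne
    have h8 : (δ : ℂ) / K = (p.2 - μ p.1)⁻¹ *
        -(δ * (m - p.2 + δ) / (1 - branchSlope T B e t δ p.1 p.2 (μ p.1))) := by
      have hK0 := hKμ.mpr hne
      rw [← sub_eq_zero] at hKeq ⊢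
      field_simp
      linear_combination (δ : ℂ) * hKeq
    simp only [Z]
    rw [h8, smul_sub, smul_smul, inv_mul_cancel₀ hne', one_smul, smul_smul]
    rw [mul_neg, neg_smul, ← sub_eq_add_neg]

theorem IsSimplePencil.exists_global_branch (h : IsSimplePencil T B S b) {m δ : ℝ → ℝ}
    (hmc : Continuous m) (hδc : Continuous δ) (hδ : ∀ t, 0 < δ t)
    (hm : ∀ t : ℝ, PEig T B t (m t))
    (hgap : ∀ t ν : ℝ, PEig T B t ν → ν ≠ m t → δ t ≤ |ν - m t|) :
    ∃ (μ : ℂ → ℂ) (Z : ℂ × ℂ → E →L[ℂ] E), (∀ t : ℝ, μ t = m t) ∧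
      AnalyticOnNhd ℂ μ {lam | b * |lam.im| < δ lam.re / 16} ∧
      ∀ p : ℂ × ℂ, b * |p.1.im| < δ p.1.re / 16 → ‖p.2 - μ p.1‖ < δ p.1.re / 16 →
        AnalyticAt ℂ Z p ∧ (IsUnit (1 - pencilN T B p) ↔ p.2 ≠ μ p.1) ∧
        (p.2 ≠ μ p.1 → inverse (1 - pencilN T B p) = (p.2 - μ p.1)⁻¹ • Z p) := by
  choose M Z hMt hMd hMn hMZ using fun t => h.exists_branch (hδ t) (hm t) (hgap t)
  have him : ∀ z : ℂ, ‖z - (z.re : ℂ)‖ = |z.im| := by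
    intro z
    rw [show z - (z.re : ℂ) = z.im * I by apply Complex.ext <;> simp]
    simp
  have hloc : ∀ z : ℂ, b * |z.im| < δ z.re / 16 → ∀ᶠ w in 𝓝 z,
      b * ‖w - (z.re : ℂ)‖ < δ z.re / 16 ∧ b * ‖w - (w.re : ℂ)‖ < δ w.re / 16 ∧
      M w.re w = M z.re w := by
    intro z hz
    have h1 : ∀ᶠ w in 𝓝 z, b * ‖w - (z.re : ℂ)‖ < δ z.re / 16 := by
      have hc : ContinuousAt (fun w : ℂ => b * ‖w - (z.re : ℂ)‖) z := by fun_prop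
      exact hc.eventually_lt_const (by grind)
    have h2 : ∀ᶠ w in 𝓝 z, b * ‖w - (w.re : ℂ)‖ < δ w.re / 16 := by
      have hc : ContinuousAt (fun w : ℂ => δ w.re / 16 - b * ‖w - (w.re : ℂ)‖) z := by fun_prop
      filter_upwards [hc.eventually_const_lt (show 0 < δ z.re / 16 - b * ‖z - (z.re : ℂ)‖ by
        rw [him]; linarith)] with w hw
      linarith
    have h3 : ∀ᶠ w in 𝓝 z, 2 * (b * ‖w - (z.re : ℂ)‖) + |m z.re - m w.re| - δ w.re / 4 < 0 := by
      have hc : ContinuousAt (fun w : ℂ =>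
          2 * (b * ‖w - (z.re : ℂ)‖) + |m z.re - m w.re| - δ w.re / 4) z := by fun_prop
      refine hc.eventually_lt_const ?_
      simp only [him, sub_self, abs_zero]
      grind
    filter_upwards [h1, h2, h3] with w hw1 hw2 hw3
    refine ⟨hw1, hw2, ?_⟩
    have := hMn z.re w hw1
    have h5 : ‖M z.re w - m z.re‖ < δ z.re / 4 := by have := hδ z.re; linarith
    have := (hMZ z.re (w, M z.re w) hw1 h5).2.1
    have h7 : ‖M z.re w - m w.re‖ < δ w.re / 4 := by
      have h8 : M z.re w - m w.re = (M z.re w - m z.re) + ((m z.re - m w.re : ℝ) : ℂ) := by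
        push_cast; ring
      rw [h8]
      refine (norm_add_le _ _).trans_lt ?_
      rw [norm_real, norm_eq_abs]
      linarith
    have h8 := (hMZ w.re (w, M z.re w) hw2 h7).2.1
    grind
  have hU : ∀ t : ℝ, IsOpen {lam : ℂ | b * ‖lam - t‖ < δ t / 16} := fun t =>
    isOpen_lt (by fun_prop) continuous_const
  have hlim : ∀ (t : ℝ) (q : ℂ × ℂ), b * ‖q.1 - t‖ < δ t / 16 → ‖q.2 - m t‖ < δ t / 4 →
      Tendsto (fun ω => (ω - M t q.1) • inverse (1 - pencilN T B (q.1, ω))) (𝓝[≠] q.2)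
        (𝓝 (Z t q)) := by
    intro t q hq1 hq2
    have hl : Tendsto (fun ω : ℂ => (q.1, ω)) (𝓝[≠] q.2) (𝓝 q) :=
      ((Continuous.prodMk_right q.1).tendsto q.2).mono_left nhdsWithin_le_nhds
    have hne : ∀ᶠ ω in 𝓝[≠] q.2, ω ≠ M t q.1 := nhdsNE_le_cofinite q.2 (eventually_cofinite_ne _)
    have hc : ContinuousAt (fun ω : ℂ => ‖ω - m t‖) q.2 := by fun_prop
    refine ((hMZ t q hq1 hq2).1.continuousAt.tendsto.comp hl).congr' ?_
    filter_upwards [(hc.eventually_lt_const hq2).filter_mono nhdsWithin_le_nhds, hne] with ω h1 h2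
    rw [(hMZ t (q.1, ω) hq1 h1).2.2 h2, smul_inv_smul₀ (sub_ne_zero.mpr h2)]
    rfl
  refine ⟨fun z => M z.re z, fun p => limUnder (𝓝[≠] p.2) fun ω =>
    (ω - M p.1.re p.1) • inverse (1 - pencilN T B (p.1, ω)), fun t => ?_, ?_, ?_⟩
  · simp [hMt]
  · intro z hz
    refine (((hMd z.re).analyticOnNhd (hU z.re)) z (by rwa [mem_ofPred_eq, him])).congr ?_
    filter_upwards [hloc z hz] with w hw
    exact hw.2.2.symm
  · intro p hp1 hp2
    have hp1' : b * ‖p.1 - (p.1.re : ℂ)‖ < δ p.1.re / 16 := by rwa [him]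
    have hp3 : ‖p.2 - m p.1.re‖ < δ p.1.re / 4 := by
      have h1 := hMn p.1.re p.1 hp1'
      have h2 := norm_sub_le_norm_sub_add_norm_sub p.2 (M p.1.re p.1) (m p.1.re)
      have := hδ p.1.re
      linarith
    obtain ⟨hZa, hiff, hZ⟩ := hMZ p.1.re p hp1' hp3
    have hev : (fun q : ℂ × ℂ => limUnder (𝓝[≠] q.2) fun ω => (ω - M q.1.re q.1) •
        inverse (1 - pencilN T B (q.1, ω))) =ᶠ[𝓝 p] Z p.1.re := by
      have hc : ContinuousAt (fun q : ℂ × ℂ => ‖q.2 - m p.1.re‖) p := by fun_prop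
      filter_upwards [(continuous_fst.tendsto p).eventually (hloc p.1 hp1),
        hc.eventually_lt_const hp3] with q hq1 hq2
      rw [hq1.2.2]
      exact (hlim p.1.re q hq1.1 hq2).limUnder_eq
    exact ⟨hZa.congr hev.symm, hiff, fun hne => (hZ hne).trans (by rw [hev.self_of_nhds])⟩

end BranchExistence

section LpOperators

variable {X Y : Type*} [MeasurableSpace X] [MeasurableSpace Y] {μ : Measure X} {ν : Measure Y}
  {F G : Type*} [NormedAddCommGroup F] [NormedSpace ℂ F] [NormedAddCommGroup G] [NormedSpace ℂ G]

theorem eLpNorm_two_sq (f : X → F) : eLpNorm f 2 μ ^ 2 = ∫⁻ x, ‖f x‖ₑ ^ 2 ∂μ := by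
  have := eLpNorm_nnreal_pow_eq_lintegral (f := f) (μ := μ) (p := 2) (by norm_num)
  simp only [NNReal.coe_ofNat, ENNReal.rpow_ofNat, ENNReal.coe_ofNat] at this
  exact this

theorem eLpNorm_two_le_of_sq {f : X → F} {g : Y → G} {c : ℝ} (hc : 0 ≤ c)
    (h : ∫⁻ x, ‖f x‖ₑ ^ 2 ∂μ ≤ ofReal (c ^ 2) * ∫⁻ y, ‖g y‖ₑ ^ 2 ∂ν) :
    eLpNorm f 2 μ ≤ ofReal c * eLpNorm g 2 ν := by
  rw [← eLpNorm_two_sq, ← eLpNorm_two_sq, ofReal_pow hc, ← mul_pow] at h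
  by_contra hlt
  exact absurd h (not_le.mpr (ENNReal.pow_lt_pow_left (by norm_num) (not_le.mp hlt)))

/-- The bounded operator on `L²` given by a formula that is linear and bounded up to null sets. -/
theorem exists_clm_of_ae (Φ : Lp F 2 μ → Y → G)
    (hadd : ∀ u v, Φ (u + v) =ᵐ[ν] fun y => Φ u y + Φ v y)
    (hsmul : ∀ (c : ℂ) u, Φ (c • u) =ᵐ[ν] fun y => c • Φ u y)
    (hmeas : ∀ u, AEStronglyMeasurable (Φ u) ν) {c : ℝ} (hc : 0 ≤ c)
    (hb : ∀ u : Lp F 2 μ, eLpNorm (Φ u) 2 ν ≤ ofReal c * eLpNorm u 2 μ) :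
    ∃ M : Lp F 2 μ →L[ℂ] Lp G 2 ν, ‖M‖ ≤ c ∧ ∀ u, M u =ᵐ[ν] Φ u := by
  have hmem : ∀ u, MemLp (Φ u) 2 ν := fun u =>
    ⟨hmeas u, (hb u).trans_lt (ENNReal.mul_lt_top ofReal_lt_top (Lp.eLpNorm_lt_top u))⟩
  let L : Lp F 2 μ →ₗ[ℂ] Lp G 2 ν :=
    { toFun := fun u => (hmem u).toLp
      map_add' := fun u v => by rw [← MemLp.toLp_add]; exact MemLp.toLp_congr _ _ (hadd u v)
      map_smul' := fun a u => by
        rw [RingHom.id_apply, ← MemLp.toLp_const_smul]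
        exact MemLp.toLp_congr _ _ (hsmul a u) }
  have hL : ∀ u, ‖L u‖ ≤ c * ‖u‖ := fun u => by
    change ‖(hmem u).toLp‖ ≤ _
    rw [Lp.norm_toLp, Lp.norm_def]
    refine (ENNReal.toReal_mono ?_ (hb u)).trans_eq ?_
    · exact ENNReal.mul_ne_top ofReal_ne_top (Lp.eLpNorm_ne_top u)
    · rw [ENNReal.toReal_mul, ENNReal.toReal_ofReal hc]
  exact ⟨L.mkContinuous c hL, L.mkContinuous_norm_le hc hL, fun u => (hmem u).coeFn_toLp⟩

/-- Multiplication by an operator-valued function. -/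
def multOp (μ : Measure X) (m : X → F →L[ℂ] G) : Lp F 2 μ →L[ℂ] Lp G 2 μ :=
  Classical.epsilon fun M => ∀ u, M u =ᵐ[μ] fun x => m x (u x)

theorem exists_multOp {m : X → F →L[ℂ] G} (hm : AEStronglyMeasurable m μ) {c : ℝ} (hc : 0 ≤ c)
    (hb : ∀ᵐ x ∂μ, ‖m x‖ ≤ c) :
    ∃ M : Lp F 2 μ →L[ℂ] Lp G 2 μ, ‖M‖ ≤ c ∧ ∀ u, M u =ᵐ[μ] fun x => m x (u x) := by
  refine exists_clm_of_ae (fun u x => m x (u x)) (fun u v => ?_) (fun a u => ?_) (fun u => ?_) hc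
    (fun u => ?_)
  · filter_upwards [Lp.coeFn_add u v] with x hx; rw [hx, Pi.add_apply, map_add]
  · filter_upwards [Lp.coeFn_smul a u] with x hx; rw [hx, Pi.smul_apply, map_smul]
  · exact (ContinuousLinearMap.id ℂ (F →L[ℂ] G)).aestronglyMeasurable_comp₂ hm
      (Lp.aestronglyMeasurable u)
  · refine eLpNorm_le_mul_eLpNorm_of_ae_le_mul ?_ 2
    filter_upwards [hb] with x hx
    exact (m x).le_of_opNorm_le hx _

theorem multOp_ae {m : X → F →L[ℂ] G} (hm : AEStronglyMeasurable m μ) {c : ℝ}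
    (hb : ∀ᵐ x ∂μ, ‖m x‖ ≤ c) (u : Lp F 2 μ) : multOp μ m u =ᵐ[μ] fun x => m x (u x) := by
  obtain ⟨M, -, hM⟩ := exists_multOp hm (le_max_right c 0)
    (hb.mono fun x hx => hx.trans (le_max_left c 0))
  exact Classical.epsilon_spec (p := fun M : Lp F 2 μ →L[ℂ] Lp G 2 μ => ∀ u, M u =ᵐ[μ] _) ⟨M, hM⟩ u

theorem multOp_norm_le {m : X → F →L[ℂ] G} (hm : AEStronglyMeasurable m μ) {c : ℝ} (hc : 0 ≤ c)
    (hb : ∀ᵐ x ∂μ, ‖m x‖ ≤ c) : ‖multOp μ m‖ ≤ c := by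
  obtain ⟨M, hM, hM'⟩ := exists_multOp hm hc hb
  have : multOp μ m = M := by ext1 u; exact Lp.ext ((multOp_ae hm hb u).trans (hM' u).symm)
  rwa [this]

end LpOperators

section Schur

variable {X Y : Type*} [MeasurableSpace X] [MeasurableSpace Y] {μ : Measure X} {ν : Measure Y}
  [SFinite μ] [SFinite ν]

theorem schur_test {k : X → Y → ENNReal} (hk : Measurable (Function.uncurry k)) {r : X → ENNReal}
    {p v : Y → ENNReal} (hr : Measurable r) (hp : Measurable p) (hv : AEMeasurable v ν)
    (hp0 : ∀ᵐ y ∂ν, p y ≠ 0) (hpt : ∀ᵐ y ∂ν, p y ≠ ⊤) {A B : ENNReal}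
    (hA : ∀ᵐ x ∂μ, ∫⁻ y, k x y * p y ∂ν ≤ A * r x)
    (hB : ∀ᵐ y ∂ν, ∫⁻ x, k x y * r x ∂μ ≤ B * p y) :
    ∫⁻ x, (∫⁻ y, k x y * v y ∂ν) ^ 2 ∂μ ≤ A * B * ∫⁻ y, v y ^ 2 ∂ν := by
  have hkx : ∀ x, Measurable (k x) := fun x => hk.of_uncurry_left
  have hv2 : AEMeasurable (fun y => v y ^ 2 / p y) ν := (hv.pow_const 2).div hp.aemeasurable
  have hpt1 : ∀ x, (∫⁻ y, k x y * v y ∂ν) ^ 2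
      ≤ (∫⁻ y, k x y * p y ∂ν) * ∫⁻ y, k x y * (v y ^ 2 / p y) ∂ν := by
    intro x
    have h1 := ENNReal.lintegral_mul_le_Lp_mul_Lq ν HolderConjugate.two_two
      (f := fun y => (k x y * p y) ^ (1 / 2 : ℝ))
      (g := fun y => (k x y * (v y ^ 2 / p y)) ^ (1 / 2 : ℝ))
      (((hkx x).mul hp).pow_const _).aemeasurable
      (AEMeasurable.pow_const (f := fun y => k x y * (v y ^ 2 / p y))
        ((hkx x).aemeasurable.mul hv2) _)
    have h2 : ∫⁻ y, k x y * v y ∂ν = ∫⁻ y, ((fun y => (k x y * p y) ^ (1 / 2 : ℝ)) *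
        fun y => (k x y * (v y ^ 2 / p y)) ^ (1 / 2 : ℝ)) y ∂ν := by
      refine lintegral_congr_ae ?_
      filter_upwards [hp0, hpt] with y h0 ht
      simp only [Pi.mul_apply]
      rw [← ENNReal.mul_rpow_of_nonneg _ _ (by norm_num)]
      have : k x y * p y * (k x y * (v y ^ 2 / p y)) = (k x y * v y) ^ (2 : ℝ) := by
        rw [ENNReal.rpow_two, mul_pow, div_eq_mul_inv]
        have := ENNReal.mul_inv_cancel h0 ht
        calc k x y * p y * (k x y * (v y ^ 2 * (p y)⁻¹))
            = k x y ^ 2 * v y ^ 2 * (p y * (p y)⁻¹) := by ring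
          _ = _ := by rw [this, mul_one]
      rw [this, ← ENNReal.rpow_mul]
      norm_num
    rw [h2]
    refine (ENNReal.pow_le_pow_left h1).trans_eq ?_
    simp_rw [← ENNReal.rpow_mul]
    norm_num
    rw [mul_pow, ← ENNReal.rpow_natCast, ← ENNReal.rpow_natCast, ← ENNReal.rpow_mul,
      ← ENNReal.rpow_mul]
    norm_num
  calc ∫⁻ x, (∫⁻ y, k x y * v y ∂ν) ^ 2 ∂μ
      ≤ ∫⁻ x, A * (r x * ∫⁻ y, k x y * (v y ^ 2 / p y) ∂ν) ∂μ := by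
        refine lintegral_mono_ae ?_
        filter_upwards [hA] with x hx
        rw [← mul_assoc]
        exact (hpt1 x).trans (mul_le_mul_left hx _)
    _ ≤ A * ∫⁻ x, (r x * ∫⁻ y, k x y * (v y ^ 2 / p y) ∂ν) ∂μ := by
        rw [lintegral_const_mul'']
        fun_prop
    _ = A * ∫⁻ x, (∫⁻ y, r x * (k x y * (v y ^ 2 / p y)) ∂ν) ∂μ := by
        congr 1
        refine lintegral_congr fun x => ?_
        exact (lintegral_const_mul'' (r x) ((hkx x).aemeasurable.mul hv2)).symm
    _ = A * ∫⁻ y, (∫⁻ x, r x * (k x y * (v y ^ 2 / p y)) ∂μ) ∂ν := by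
        congr 1
        refine lintegral_lintegral_swap ?_
        fun_prop
    _ = A * ∫⁻ y, (∫⁻ x, k x y * r x ∂μ) * (v y ^ 2 / p y) ∂ν := by
        congr 1
        refine lintegral_congr fun y => ?_
        refine Eq.trans ?_ (lintegral_mul_const _ (hk.of_uncurry_right.mul hr))
        grind
    _ ≤ A * ∫⁻ y, B * v y ^ 2 ∂ν := by
        gcongr A * ?_
        refine lintegral_mono_ae ?_
        filter_upwards [hB, hp0, hpt] with y hy h0 ht
        refine (mul_le_mul_left hy _).trans_eq ?_
        rw [mul_assoc, ENNReal.mul_div_cancel h0 ht]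
    _ = A * B * ∫⁻ y, v y ^ 2 ∂ν := by rw [lintegral_const_mul'' _ (hv.pow_const 2), mul_assoc]

/-- The operator with kernel `k`. -/
def IsKernelOp (μ : Measure X) (k : X → X → ℝ) (K : Lp ℂ 2 μ →L[ℂ] Lp ℂ 2 μ) : Prop :=
  ∀ v : Lp ℂ 2 μ, (∀ᵐ x ∂μ, Integrable (fun y => (k x y : ℂ) * v y) μ) ∧
    K v =ᵐ[μ] fun x => ∫ y, (k x y : ℂ) * v y ∂μ

/-- The hypotheses of Schur's test with constant weights. -/
structure IsSchur (μ : Measure X) (k : X → X → ℝ) (c : ℝ) : Prop where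
  meas : Measurable (Function.uncurry k)
  pos : 0 ≤ c
  row : ∀ᵐ x ∂μ, ∫⁻ y, ‖k x y‖ₑ ∂μ ≤ ofReal c
  col : ∀ᵐ y ∂μ, ∫⁻ x, ‖k x y‖ₑ ∂μ ≤ ofReal c

variable {k : X → X → ℝ} {c : ℝ}

theorem IsSchur.swap (h : IsSchur μ k c) : IsSchur μ (fun x y => k y x) c :=
  ⟨h.meas.comp measurable_swap, h.pos, h.col, h.row⟩

theorem IsSchur.aemeasurable_lintegral (h : IsSchur μ k c) (v : Lp ℂ 2 μ) :
    AEMeasurable (fun x => ∫⁻ y, ‖k x y‖ₑ * ‖v y‖ₑ ∂μ) μ :=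
  AEMeasurable.lintegral_prod_right' (f := fun z : X × X => ‖k z.1 z.2‖ₑ * ‖v z.2‖ₑ)
    (h.meas.enorm.aemeasurable.mul (Lp.aestronglyMeasurable v).enorm.comp_snd)

theorem lintegral_enorm_sq_lt_top (v : Lp ℂ 2 μ) : ∫⁻ y, ‖v y‖ₑ ^ 2 ∂μ < ⊤ := by
  rw [← eLpNorm_two_sq]
  exact ENNReal.pow_lt_top (Lp.eLpNorm_lt_top v)

theorem IsSchur.lintegral_le (h : IsSchur μ k c) (v : Lp ℂ 2 μ) :
    ∫⁻ x, (∫⁻ y, ‖k x y‖ₑ * ‖v y‖ₑ ∂μ) ^ 2 ∂μ ≤ ofReal (c ^ 2) * ∫⁻ y, ‖v y‖ₑ ^ 2 ∂μ := by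
  have := schur_test (μ := μ) (ν := μ) (k := fun x y => ‖k x y‖ₑ) (r := 1) (p := 1)
    (v := fun y => ‖v y‖ₑ) h.meas.enorm measurable_const measurable_const
    (Lp.aestronglyMeasurable v).enorm (by simp) (by simp)
    (A := ofReal c) (B := ofReal c) (by simpa using h.row) (by simpa using h.col)
  rwa [pow_two c, ofReal_mul h.pos]

theorem IsSchur.lintegral_lt_top (h : IsSchur μ k c) (v : Lp ℂ 2 μ) :
    ∫⁻ x, (∫⁻ y, ‖k x y‖ₑ * ‖v y‖ₑ ∂μ) ^ 2 ∂μ < ⊤ :=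
  (h.lintegral_le v).trans_lt (ENNReal.mul_lt_top ofReal_lt_top (lintegral_enorm_sq_lt_top v))

theorem enorm_ofReal_mul (x : ℝ) (z : ℂ) : ‖(x : ℂ) * z‖ₑ = ‖x‖ₑ * ‖z‖ₑ := by
  rw [enorm_mul, ← ofReal_norm, norm_real, ofReal_norm]

theorem IsSchur.exists_op (h : IsSchur μ k c) :
    ∃ K : Lp ℂ 2 μ →L[ℂ] Lp ℂ 2 μ, ‖K‖ ≤ c ∧ IsKernelOp μ k K := by
  have hint : ∀ v : Lp ℂ 2 μ, ∀ᵐ x ∂μ, Integrable (fun y => (k x y : ℂ) * v y) μ := by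
    intro v
    filter_upwards [ae_lt_top' ((h.aemeasurable_lintegral v).pow_const 2)
      (h.lintegral_lt_top v).ne] with x hx
    refine ⟨(Complex.measurable_ofReal.comp h.meas.of_uncurry_left).aestronglyMeasurable.mul
      (Lp.aestronglyMeasurable v), ?_⟩
    simp only [HasFiniteIntegral, enorm_ofReal_mul]
    simpa using hx
  suffices hK : ∃ K : Lp ℂ 2 μ →L[ℂ] Lp ℂ 2 μ, ‖K‖ ≤ c ∧
      ∀ v, K v =ᵐ[μ] fun x => ∫ y, (k x y : ℂ) * v y ∂μ by
    obtain ⟨K, hK, hK'⟩ := hK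
    exact ⟨K, hK, fun v => ⟨hint v, hK' v⟩⟩
  refine exists_clm_of_ae (fun v x => ∫ y, (k x y : ℂ) * v y ∂μ) (fun u v => ?_) (fun a u => ?_)
    (fun u => ?_) h.pos (fun u => ?_)
  · filter_upwards [hint u, hint v] with x hu hv
    rw [← integral_add hu hv]
    refine integral_congr_ae ?_
    filter_upwards [Lp.coeFn_add u v] with y hy
    rw [hy, Pi.add_apply, mul_add]
  · refine .of_forall fun x => ?_
    simp only [smul_eq_mul]
    rw [← integral_const_mul]
    refine integral_congr_ae ?_
    filter_upwards [Lp.coeFn_smul a u] with y hy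
    rw [hy, Pi.smul_apply, smul_eq_mul, mul_left_comm]
  · exact AEStronglyMeasurable.integral_prod_right'
      (f := fun z : X × X => (k z.1 z.2 : ℂ) * u z.2)
      ((Complex.measurable_ofReal.comp h.meas).aestronglyMeasurable.mul
        (Lp.aestronglyMeasurable u).comp_snd)
  · refine eLpNorm_two_le_of_sq h.pos (le_trans (lintegral_mono fun x => ?_) (h.lintegral_le u))
    refine ENNReal.pow_le_pow_left ((enorm_integral_le_lintegral_enorm _).trans_eq ?_)
    simp only [enorm_ofReal_mul]

/-- The bounded operator with kernel `k`. -/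
def kernelOp (μ : Measure X) (k : X → X → ℝ) : Lp ℂ 2 μ →L[ℂ] Lp ℂ 2 μ :=
  Classical.epsilon (IsKernelOp μ k)

theorem IsSchur.norm_le (h : IsSchur μ k c) {K : Lp ℂ 2 μ →L[ℂ] Lp ℂ 2 μ}
    (hK : IsKernelOp μ k K) : ‖K‖ ≤ c := by
  obtain ⟨K', h1, h2⟩ := h.exists_op
  have : K = K' := by ext1 v; exact Lp.ext ((hK v).2.trans (h2 v).2.symm)
  rwa [this]

theorem IsSchur.isKernelOp (h : IsSchur μ k c) : IsKernelOp μ k (kernelOp μ k) :=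
  Classical.epsilon_spec (h.exists_op.imp fun _ => And.right)

theorem IsSchur.norm_kernelOp_le (h : IsSchur μ k c) : ‖kernelOp μ k‖ ≤ c := h.norm_le h.isKernelOp

theorem IsKernelOp.sub {k' : X → X → ℝ} {K K' : Lp ℂ 2 μ →L[ℂ] Lp ℂ 2 μ}
    (h : IsKernelOp μ k K) (h' : IsKernelOp μ k' K') :
    IsKernelOp μ (fun x y => k x y - k' x y) (K - K') := by
  intro v
  have h1 : ∀ x y, ((k x y - k' x y : ℝ) : ℂ) * v y = (k x y : ℂ) * v y - (k' x y : ℂ) * v y := by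
    intro x y; push_cast; ring
  simp only [h1]
  constructor
  · filter_upwards [(h v).1, (h' v).1] with x hx hx' using hx.sub hx'
  · filter_upwards [(h v).1, (h' v).1, (h v).2, (h' v).2, Lp.coeFn_sub (K v) (K' v)]
      with x hx hx' e e' e''
    rw [_root_.sub_apply, e'', Pi.sub_apply, e, e', integral_sub hx hx']

end Schur

section KernelAdjoint

variable {X : Type*} [MeasurableSpace X] {μ : Measure X} [SFinite μ]

theorem IsSchur.inner_eq {k : X → X → ℝ} {c : ℝ} (h : IsSchur μ k c) (u v : Lp ℂ 2 μ) :
    inner ℂ (kernelOp μ k u) v = inner ℂ u (kernelOp μ (fun x y => k y x) v) := by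
  have hmu := Lp.aestronglyMeasurable u
  have hmv := Lp.aestronglyMeasurable v
  have hm : AEStronglyMeasurable
      (fun z : X × X => (k z.1 z.2 : ℂ) * (starRingEnd ℂ (u z.2) * v z.1)) (μ.prod μ) :=
    (Complex.measurable_ofReal.comp h.meas).aestronglyMeasurable.mul
      ((RCLike.continuous_conj.comp_aestronglyMeasurable hmu.comp_snd).mul hmv.comp_fst)
  have hno : ∀ x y, ‖(k x y : ℂ) * (starRingEnd ℂ (u y) * v x)‖ₑ
      = ‖v x‖ₑ * (‖k x y‖ₑ * ‖u y‖ₑ) := by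
    intro x y
    rw [enorm_ofReal_mul, enorm_mul, ← ofReal_norm (starRingEnd ℂ (u y)), RCLike.norm_conj,
      ofReal_norm]
    ring
  have hint : Integrable (fun z : X × X => (k z.1 z.2 : ℂ) * (starRingEnd ℂ (u z.2) * v z.1))
      (μ.prod μ) := by
    refine ⟨hm, ?_⟩
    rw [HasFiniteIntegral, lintegral_prod _ hm.enorm]
    simp only [hno]
    have h1 : ∀ x, ∫⁻ y, ‖v x‖ₑ * (‖k x y‖ₑ * ‖u y‖ₑ) ∂μ
        = ‖v x‖ₑ * ∫⁻ y, ‖k x y‖ₑ * ‖u y‖ₑ ∂μ := fun x =>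
      lintegral_const_mul'' _ (h.meas.of_uncurry_left.enorm.aemeasurable.mul hmu.enorm)
    simp only [h1]
    refine (ENNReal.lintegral_mul_le_Lp_mul_Lq μ HolderConjugate.two_two hmv.enorm
      (h.aemeasurable_lintegral u)).trans_lt ?_
    simp only [ENNReal.rpow_two]
    exact ENNReal.mul_lt_top
      (ENNReal.rpow_lt_top_of_nonneg (by norm_num) (lintegral_enorm_sq_lt_top v).ne)
      (ENNReal.rpow_lt_top_of_nonneg (by norm_num) (h.lintegral_lt_top u).ne)
  have e1 : inner ℂ (kernelOp μ k u) v
      = ∫ x, ∫ y, (k x y : ℂ) * (starRingEnd ℂ (u y) * v x) ∂μ ∂μ := by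
    rw [L2.inner_def]
    refine integral_congr_ae ?_
    filter_upwards [(h.isKernelOp u).2] with x hx
    rw [hx, RCLike.inner_apply, ← integral_conj, ← integral_const_mul]
    refine integral_congr_ae (.of_forall fun y => ?_)
    simp only [map_mul, conj_ofReal]
    ring
  have e2 : inner ℂ u (kernelOp μ (fun x y => k y x) v)
      = ∫ y, ∫ x, (k x y : ℂ) * (starRingEnd ℂ (u y) * v x) ∂μ ∂μ := by
    rw [L2.inner_def]
    refine integral_congr_ae ?_
    filter_upwards [(h.swap.isKernelOp v).2] with x hx
    rw [hx, RCLike.inner_apply, ← integral_mul_const]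
    refine integral_congr_ae (.of_forall fun y => ?_)
    ring
  rw [e1, e2]
  exact integral_integral_swap hint

theorem IsKernelOp.weight {k : X → X → ℝ} {w : X → ℝ} {K K' : Lp ℂ 2 μ →L[ℂ] Lp ℂ 2 μ}
    (h : IsKernelOp μ k K) (h' : IsKernelOp μ (fun x y => w x * k x y) K') (v : Lp ℂ 2 μ) :
    K' v =ᵐ[μ] fun x => (w x : ℂ) * K v x := by
  filter_upwards [(h v).2, (h' v).2] with x hx hx'
  rw [hx, hx', ← integral_const_mul]
  refine integral_congr_ae (.of_forall fun y => ?_)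
  push_cast
  ring

end KernelAdjoint

section Tortoise

/-- Lebesgue measure on `(0, π)`. -/
def arcMeasure : Measure ℝ := volume.restrict (Ioo 0 π)

/-- The Hilbert space `L²((0, π), dθ)`. -/
abbrev ArcL2 : Type := Lp ℂ 2 arcMeasure

instance : IsFiniteMeasure arcMeasure := by unfold arcMeasure; infer_instance

/-- `Δ` as a function of `α = a² Λ / 3`. -/
def dlt (α θ : ℝ) : ℝ := 1 + α * cos θ ^ 2

/-- `Δ^{-1/4}`. -/
def quart (α θ : ℝ) : ℝ := (√(√(dlt α θ)))⁻¹

/-- The primitive of `sin / Δ` vanishing at the equator. -/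
def sinPrim (α θ : ℝ) : ℝ := ∫ s in (π / 2)..θ, sin s / dlt α s

/-- The primitive of `E / (Δ sin)` vanishing at the equator. -/
def tort (α θ : ℝ) : ℝ := log (tan (θ / 2)) + α * sinPrim α θ

/-- `E / (Δ sin)`. -/
def tortD (α θ : ℝ) : ℝ := (1 + α) / (dlt α θ * sin θ)

variable {α κ θ s : ℝ}

theorem dlt_contDiff {n : WithTop ℕ∞} : ContDiff ℝ n (dlt α) := by unfold dlt; fun_prop

theorem dlt_continuous : Continuous (dlt α) := dlt_contDiff (n := 0).continuous

theorem quart_sq : quart α θ ^ 2 = (√(dlt α θ))⁻¹ := by unfold quart; simp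

theorem sinPrim_reflect (α θ : ℝ) : sinPrim α (π - θ) = -sinPrim α θ := by
  unfold sinPrim
  have h := intervalIntegral.integral_comp_sub_left (a := π / 2) (b := θ)
    (fun s => sin s / dlt α s) π
  have h2 : ∀ s, sin (π - s) / dlt α (π - s) = sin s / dlt α s := by
    intro s
    rw [sin_pi_sub, dlt, cos_pi_sub, neg_sq, dlt]
  simp only [h2] at h
  rw [h, integral_symm]
  congr 2
  ring

theorem tan_half_pos (hθ : θ ∈ Ioo 0 π) : 0 < tan (θ / 2) :=
  tan_pos_of_pos_of_lt_pi_div_two (by linarith [hθ.1]) (by linarith [hθ.2])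

theorem sin_pos_of_mem (hθ : θ ∈ Ioo 0 π) : 0 < sin θ := sin_pos_of_pos_of_lt_pi hθ.1 hθ.2

theorem cos_half_pos (hθ : θ ∈ Ioo 0 π) : 0 < cos (θ / 2) :=
  cos_pos_of_mem_Ioo ⟨by grind, by linarith [hθ.2]⟩

theorem sin_eq_half (θ : ℝ) : sin θ = 2 * sin (θ / 2) * cos (θ / 2) := by
  rw [← sin_two_mul, mul_div_cancel₀ _ two_ne_zero]

theorem log_tan_hasDerivAt (hθ : θ ∈ Ioo 0 π) :
    HasDerivAt (fun x => log (tan (x / 2))) (sin θ)⁻¹ θ := by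
  have hc := (cos_half_pos hθ).ne'
  have : sin (θ / 2) ≠ 0 := (sin_pos_of_pos_of_lt_pi (by linarith [hθ.1]) (by grind)).ne'
  have h1 : HasDerivAt (fun x : ℝ => x / 2) (1 / 2) θ := (hasDerivAt_id θ).div_const 2
  have h2 := (HasDerivAt.comp (h₂ := tan) θ (hasDerivAt_tan hc) h1).log (tan_half_pos hθ).ne'
  refine h2.congr_deriv ?_
  rw [sin_eq_half θ, Function.comp_apply, tan_eq_sin_div_cos]
  field_simp

theorem tort_reflect (α θ : ℝ) : tort α (π - θ) = -tort α θ := by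
  unfold tort
  rw [sinPrim_reflect]
  have : (π - θ) / 2 = π / 2 - θ / 2 := by ring
  rw [this, tan_pi_div_two_sub, log_inv]
  ring

theorem quart_reflect (α θ : ℝ) : quart α (π - θ) = quart α θ := by unfold quart dlt; simp

theorem lintegral_deriv_le {u u' : ℝ → ℝ} {x y m M : ℝ} (hxy : x < y)
    (hd : ∀ s ∈ Ioo x y, HasDerivAt u (u' s) s) (h0 : ∀ s ∈ Ioo x y, 0 ≤ u' s)
    (hm : ∀ s ∈ Ioo x y, m ≤ u s ∧ u s ≤ M) :
    ∫⁻ s in Ioo x y, ofReal (u' s) ≤ ofReal (M - m) := by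
  have hmono : MonotoneOn u (Ioo x y) := by
    refine monotoneOn_of_hasDerivWithinAt_nonneg (convex_Ioo _ _)
      (fun s hs => (hd s hs).continuousAt.continuousWithinAt) (f' := u') (fun s hs => ?_)
      fun s hs => h0 s (interior_subset hs)
    exact (hd s (interior_subset hs)).hasDerivWithinAt
  obtain ⟨g, hg, hgu⟩ := hmono.exists_monotone_extension
    ⟨m, forall_mem_image.2 fun s hs => (hm s hs).1⟩ ⟨M, forall_mem_image.2 fun s hs => (hm s hs).2⟩
  have hmM : m ≤ M := by
    have := hm ((x + y) / 2) ⟨by linarith, by linarith⟩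
    linarith
  let w : ℝ → ℝ := fun s => max m (min M (g s))
  have hw : MonotoneOn w (uIcc x y) := (monotone_const.max (monotone_const.min hg)).monotoneOn _
  have hdw : ∀ s ∈ Ioo x y, deriv w s = u' s := by
    intro s hs
    refine HasDerivAt.deriv ((hd s hs).congr_of_eventuallyEq ?_)
    filter_upwards [Ioo_mem_nhds hs.1 hs.2] with t ht
    simp [w, ← hgu ht, hm t ht]
  have h1 := hw.intervalIntegral_deriv_mem_uIcc
  have h2 := hw.intervalIntegrable_deriv
  have hwxy : w y - w x ≤ M - m := sub_le_sub (max_le hmM (min_le_left _ _)) (le_max_left _ _)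
  have hw0 : 0 ≤ w y - w x := sub_nonneg.2 (hw left_mem_uIcc right_mem_uIcc hxy.le)
  rw [uIcc_of_le hw0] at h1
  rw [intervalIntegrable_iff_integrableOn_Ioo_of_le hxy.le] at h2
  have h3 : IntegrableOn u' (Ioo x y) := h2.congr_fun hdw measurableSet_Ioo
  rw [← ofReal_integral_eq_lintegral_ofReal h3
    ((ae_restrict_mem measurableSet_Ioo).mono fun s hs => h0 s hs)]
  refine ofReal_le_ofReal (le_trans (le_of_eq ?_) (h1.2.trans hwxy))
  rw [integral_of_le hxy.le, integral_Ioc_eq_integral_Ioo]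
  exact setIntegral_congr_fun measurableSet_Ioo fun s hs => (hdw s hs).symm

variable (hα : 0 ≤ α)
include hα

theorem one_le_dlt : 1 ≤ dlt α θ := by unfold dlt; nlinarith

theorem dlt_le : dlt α θ ≤ 1 + α := by
  have := mul_le_mul_of_nonneg_left (cos_sq_le_one θ) hα
  unfold dlt
  linarith

theorem dlt_pos : 0 < dlt α θ := one_pos.trans_le (one_le_dlt hα)

theorem quart_pos : 0 < quart α θ := by have := dlt_pos (θ := θ) hα; unfold quart; positivity

theorem quart_le_one : quart α θ ≤ 1 := by
  unfold quart
  refine inv_le_one_of_one_le₀ ?_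
  rw [one_le_sqrt, one_le_sqrt]
  exact one_le_dlt hα

theorem quart_contDiff {n : WithTop ℕ∞} : ContDiff ℝ n (quart α) := by
  unfold quart
  have h1 : ∀ θ, dlt α θ ≠ 0 := fun θ => (dlt_pos hα).ne'
  have h2 : ∀ θ, √(dlt α θ) ≠ 0 := fun θ => (sqrt_pos.mpr (dlt_pos hα)).ne'
  have h3 : ∀ θ, √(√(dlt α θ)) ≠ 0 := fun θ =>
    (sqrt_pos.mpr (sqrt_pos.mpr (dlt_pos hα))).ne'
  exact ((dlt_contDiff.sqrt h1).sqrt h2).inv h3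

theorem sinPrim_hasDerivAt (θ : ℝ) : HasDerivAt (sinPrim α) (sin θ / dlt α θ) θ := by
  have hc : Continuous fun s => sin s / dlt α s :=
    continuous_sin.div dlt_continuous fun s => (dlt_pos hα).ne'
  exact integral_hasDerivAt_right (hc.intervalIntegrable _ _)
    (hc.stronglyMeasurableAtFilter _ _) hc.continuousAt

theorem sinPrim_contDiff : ContDiff ℝ (⊤ : ℕ∞) (sinPrim α) := by
  rw [contDiff_infty_iff_deriv]
  refine ⟨fun θ => (sinPrim_hasDerivAt hα θ).differentiableAt, ?_⟩
  have : deriv (sinPrim α) = fun θ => sin θ / dlt α θ :=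
    funext fun θ => (sinPrim_hasDerivAt hα θ).deriv
  rw [this]
  exact contDiff_sin.div dlt_contDiff fun θ => (dlt_pos hα).ne'

theorem sinPrim_continuous : Continuous (sinPrim α) := (sinPrim_contDiff hα).continuous

theorem sinPrim_monotoneOn : MonotoneOn (sinPrim α) (Icc 0 π) := by
  refine monotoneOn_of_hasDerivWithinAt_nonneg (convex_Icc _ _) (sinPrim_continuous hα).continuousOn
    (fun θ _ => (sinPrim_hasDerivAt hα θ).hasDerivWithinAt) fun θ hθ => ?_
  have := interior_subset hθ
  exact div_nonneg (sin_nonneg_of_mem_Icc this) (dlt_pos hα).le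

theorem tort_hasDerivAt (hθ : θ ∈ Ioo 0 π) : HasDerivAt (tort α) (tortD α θ) θ := by
  have h := (log_tan_hasDerivAt hθ).add ((sinPrim_hasDerivAt hα θ).const_mul α)
  refine h.congr_deriv ?_
  have := (dlt_pos (θ := θ) hα).ne'
  have := (sin_pos_of_mem hθ).ne'
  unfold tortD
  field_simp
  unfold dlt
  linear_combination α * sin_sq_add_cos_sq θ

theorem inv_sin_le_tortD (hθ : θ ∈ Ioo 0 π) : (sin θ)⁻¹ ≤ tortD α θ := by
  have := dlt_pos (θ := θ) hα
  have h2 := sin_pos_of_mem hθ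
  unfold tortD
  rw [inv_eq_one_div, div_le_div_iff₀ h2 (by positivity), one_mul]
  exact mul_le_mul_of_nonneg_right (dlt_le hα) h2.le

theorem one_le_tortD (hθ : θ ∈ Ioo 0 π) : 1 ≤ tortD α θ :=
  (one_le_inv_iff₀.mpr ⟨sin_pos_of_mem hθ, sin_le_one θ⟩).trans (inv_sin_le_tortD hα hθ)

theorem tort_continuousOn : ContinuousOn (tort α) (Ioo 0 π) :=
  fun _ hθ => (tort_hasDerivAt hα hθ).continuousAt.continuousWithinAt

theorem tort_strictMonoOn : StrictMonoOn (tort α) (Ioo 0 π) := by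
  refine strictMonoOn_of_hasDerivWithinAt_pos (convex_Ioo _ _) (tort_continuousOn hα)
    (f' := tortD α) (fun θ hθ => ?_) fun θ hθ => ?_
  · exact (tort_hasDerivAt hα (interior_subset hθ)).hasDerivWithinAt
  · exact one_pos.trans_le (one_le_tortD hα (interior_subset hθ))

theorem tort_contDiffAt (hθ : θ ∈ Ioo 0 π) : ContDiffAt ℝ (⊤ : ℕ∞) (tort α) θ := by
  have h1 : ContDiffAt ℝ (⊤ : ℕ∞) (fun x : ℝ => x / 2) θ := by fun_prop
  have h2 : ContDiffAt ℝ (⊤ : ℕ∞) (fun x => tan (x / 2)) θ :=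
    ContDiffAt.comp (g := tan) θ (contDiffAt_tan.mpr (cos_half_pos hθ).ne') h1
  exact (h2.log (tan_half_pos hθ).ne').add (contDiffAt_const.mul (sinPrim_contDiff hα).contDiffAt)

theorem measurable_tort : Measurable (tort α) := by
  have := (sinPrim_continuous hα).measurable
  have h : Measurable tan := by
    have : tan = fun x => sin x / cos x := funext tan_eq_sin_div_cos
    rw [this]
    fun_prop
  unfold tort
  fun_prop

theorem log_tan_sub_le (hs : s ∈ Ioo 0 π) (hθ : θ ∈ Ioo 0 π)
    (h : s ≤ θ) : log (tan (θ / 2)) - log (tan (s / 2)) ≤ tort α θ - tort α s := by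
  have := sinPrim_monotoneOn hα (Ioo_subset_Icc_self hs) (Ioo_subset_Icc_self hθ) h
  unfold tort
  nlinarith

end Tortoise

section Volterra

variable {α κ θ s : ℝ}

/-- The kernel of the Volterra operator solving the radial equation from the pole `θ = 0`. -/
def volK (α κ θ s : ℝ) : ℝ :=
  if s < θ then quart α θ * quart α s * exp (-(κ * (tort α θ - tort α s))) else 0

theorem volK_measurable (hα : 0 ≤ α) (κ : ℝ) : Measurable (Function.uncurry (volK α κ)) := by
  have : Measurable (quart α) := (quart_contDiff hα (n := 0)).continuous.measurable
  have := measurable_tort hα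
  refine Measurable.ite (measurableSet_lt measurable_snd measurable_fst) ?_ measurable_const
  fun_prop

theorem volK_nonneg (hα : 0 ≤ α) : 0 ≤ volK α κ θ s := by
  have := quart_pos (θ := θ) hα
  have := quart_pos (θ := s) hα
  unfold volK
  positivity

theorem volK_le (hα : 0 ≤ α) (h : s < θ) : volK α κ θ s ≤ exp (-(κ * (tort α θ - tort α s))) := by
  rw [volK, if_pos h]
  have h2 := quart_pos (θ := s) hα
  refine mul_le_of_le_one_left (exp_pos _).le ?_
  exact mul_le_one₀ (quart_le_one hα) h2.le (quart_le_one hα)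

theorem volK_reflect (α κ θ s : ℝ) : volK α κ (π - θ) (π - s) = volK α κ s θ := by
  unfold volK
  simp only [quart_reflect, tort_reflect, sub_lt_sub_iff_left]
  grind

theorem lintegral_arc_le {f g : ℝ → ENNReal} {x y : ℝ} (hxy : Ioo x y ⊆ Ioo 0 π)
    (h : ∀ s ∈ Ioo x y, f s ≤ g s) (h0 : ∀ s ∈ Ioo 0 π, s ∉ Ioo x y → f s = 0) :
    ∫⁻ s, f s ∂arcMeasure ≤ ∫⁻ s in Ioo x y, g s := by
  have h1 : ∫⁻ s, f s ∂arcMeasure ≤ ∫⁻ s in Ioo 0 π, (Ioo x y).indicator g s := by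
    refine setLIntegral_mono' measurableSet_Ioo fun s hs => ?_
    by_cases hsx : s ∈ Ioo x y
    · rw [indicator_of_mem hsx]; exact h s hsx
    · rw [h0 s hs hsx]; exact zero_le
  rw [setLIntegral_indicator measurableSet_Ioo, inter_eq_left.mpr hxy] at h1
  exact h1

theorem lintegral_reflect (f : ℝ → ENNReal) (x y : ℝ) :
    ∫⁻ s in Ioo x y, f (π - s) = ∫⁻ s in Ioo (π - y) (π - x), f s := by
  have h := (Measure.measurePreserving_sub_left volume π).setLIntegral_comp_preimage_emb
    (MeasurableEquiv.subLeft π).measurableEmbedding f (Ioo (π - y) (π - x))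
  rwa [preimage_const_sub_Ioo, sub_sub_cancel, sub_sub_cancel] at h

theorem lintegral_arc_reflect (f : ℝ → ENNReal) :
    ∫⁻ s, f (π - s) ∂arcMeasure = ∫⁻ s, f s ∂arcMeasure := by
  rw [arcMeasure, lintegral_reflect, sub_self, sub_zero]

theorem pi_sub_mem (hθ : θ ∈ Ioo 0 π) : π - θ ∈ Ioo 0 π := ⟨by linarith [hθ.2], by linarith [hθ.1]⟩

theorem ae_arc {p : ℝ → Prop} (h : ∀ θ ∈ Ioo 0 π, p θ) : ∀ᵐ θ ∂arcMeasure, p θ :=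
  (ae_restrict_mem measurableSet_Ioo).mono h

theorem tortD_reflect (α θ : ℝ) : tortD α (π - θ) = tortD α θ := by
  rw [tortD, dlt, cos_pi_sub, neg_sq, sin_pi_sub, tortD, dlt]

theorem enorm_real_le {x y : ℝ} (h0 : 0 ≤ x) (h : x ≤ y) : ‖x‖ₑ ≤ ofReal y := by
  rw [enorm_eq_ofReal h0]
  exact ofReal_le_ofReal h

/-- The kernel `volK` with the weight of the covariant derivative along the parallels. -/
def volW (α κ θ s : ℝ) : ℝ := (κ + cos θ / 2) / sin θ * volK α κ θ s

theorem weight_nonneg (hκ : 1 / 2 ≤ κ) (hθ : θ ∈ Ioo 0 π) : 0 ≤ (κ + cos θ / 2) / sin θ :=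
  div_nonneg (by linarith [neg_one_le_cos θ]) (sin_pos_of_mem hθ).le

theorem sin_mul_tan_half (hθ : θ ∈ Ioo 0 π) : sin θ * tan (θ / 2) = 1 - cos θ := by
  have := (cos_half_pos hθ).ne'
  have h4 : cos θ = 2 * cos (θ / 2) ^ 2 - 1 := by rw [← cos_two_mul]; congr 1; ring
  rw [sin_eq_half θ, h4, tan_eq_sin_div_cos]
  field_simp
  linear_combination 2 * sin_sq_add_cos_sq (θ / 2)

theorem half_cot_le (hθ : θ ∈ Ioo 0 π) : (1 + cos θ) / (2 * sin θ) * θ ≤ 1 := by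
  have p2 := sin_pos_of_mem hθ
  have p4 := tan_half_pos hθ
  have : θ / 2 ≤ tan (θ / 2) := le_tan (by linarith [hθ.1]) (by linarith [hθ.2])
  have h2 := sin_mul_tan_half hθ
  have : (1 + cos θ) * tan (θ / 2) = sin θ := by
    have : sin θ * ((1 + cos θ) * tan (θ / 2)) = sin θ * sin θ := by
      linear_combination (1 + cos θ) * h2 - sin_sq_add_cos_sq θ
    grind
  rw [div_mul_eq_mul_div, div_le_one (by positivity)]
  nlinarith

theorem arc_lintegral_const (c : ENNReal) :
    ∫⁻ _, c ∂arcMeasure = c * ofReal π := by rw [lintegral_const]; simp [arcMeasure]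

instance : SFinite arcMeasure := by unfold arcMeasure; infer_instance

/-- Admissible frequencies of a mode. -/
def IsFreq (κ : ℝ) : Prop := κ = 1 / 2 ∨ 3 / 2 ≤ κ

theorem IsFreq.half_le (h : IsFreq κ) : 1 / 2 ≤ κ := by rcases h with h | h <;> linarith

theorem IsFreq.pos (h : IsFreq κ) : 0 < κ := by linarith [h.half_le]

/-- The Volterra operator with kernel `volK α κ`. -/
def volOp (α κ : ℝ) : ArcL2 →L[ℂ] ArcL2 := kernelOp arcMeasure (volK α κ)

/-- The adjoint of `volOp α κ`. -/
def volStar (α κ : ℝ) : ArcL2 →L[ℂ] ArcL2 := kernelOp arcMeasure fun θ s => volK α κ s θ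

variable (hα : 0 ≤ α)
include hα

theorem exp_row (hκ : 0 < κ) (hθ : θ ∈ Ioo 0 π) :
    ∫⁻ s in Ioo 0 θ, ofReal (tortD α s * exp (-(κ * (tort α θ - tort α s)))) ≤ ofReal (1 / κ) := by
  have hsub : ∀ s ∈ Ioo 0 θ, s ∈ Ioo 0 π := fun s hs => ⟨hs.1, hs.2.trans hθ.2⟩
  refine (lintegral_deriv_le (m := 0) (M := 1 / κ)
    (u := fun s => 1 / κ * exp (-(κ * (tort α θ - tort α s)))) hθ.1
    (fun s hs => ?_) (fun s hs => ?_) (fun s hs => ⟨by positivity, ?_⟩)).trans_eq (by rw [sub_zero])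
  · have h1 := ((((tort_hasDerivAt hα (hsub s hs)).const_sub (tort α θ)).const_mul κ).neg.exp).const_mul
      (1 / κ)
    refine h1.congr_deriv ?_
    simp only [Pi.neg_apply]
    field_simp
  · have := one_le_tortD hα (hsub s hs); positivity
  · refine mul_le_of_le_one_right (by positivity) (exp_le_one_iff.mpr ?_)
    have := (tort_strictMonoOn hα) (hsub s hs) hθ hs.2
    nlinarith

theorem exp_col (hκ : 0 < κ) (hs : s ∈ Ioo 0 π) :
    ∫⁻ θ in Ioo s π, ofReal (tortD α θ * exp (-(κ * (tort α θ - tort α s)))) ≤ ofReal (1 / κ) := by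
  have h := exp_row hα hκ (pi_sub_mem hs)
  rw [← sub_self π, ← lintegral_reflect] at h
  simpa only [tort_reflect, tortD_reflect, neg_sub_neg] using h

theorem volK_row (hκ : 0 < κ) (hθ : θ ∈ Ioo 0 π) :
    ∫⁻ s, ‖volK α κ θ s‖ₑ ∂arcMeasure ≤ ofReal (1 / κ) := by
  refine (lintegral_arc_le (x := 0) (y := θ) (fun s hs => ⟨hs.1, hs.2.trans hθ.2⟩)
    (fun s hs => enorm_real_le (volK_nonneg hα) ((volK_le hα hs.2).trans ?_))
    (fun s hs hs' => ?_)).trans (exp_row hα hκ hθ)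
  · exact le_mul_of_one_le_left (exp_pos _).le
      (one_le_tortD hα ⟨hs.1, hs.2.trans hθ.2⟩)
  · rw [volK, if_neg (fun h => hs' ⟨hs.1, h⟩), enorm_zero]

theorem volK_col (hκ : 0 < κ) (hs : s ∈ Ioo 0 π) :
    ∫⁻ θ, ‖volK α κ θ s‖ₑ ∂arcMeasure ≤ ofReal (1 / κ) := by
  rw [← lintegral_arc_reflect]
  refine (lintegral_congr fun θ => ?_).trans_le (volK_row hα hκ (pi_sub_mem hs))
  rw [← volK_reflect, sub_sub_cancel]

theorem isSchur_volK (hκ : 0 < κ) : IsSchur arcMeasure (volK α κ) (1 / κ) where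
  meas := volK_measurable hα κ
  pos := by positivity
  row := ae_arc fun _ h => volK_row hα hκ h
  col := ae_arc fun _ h => volK_col hα hκ h

theorem volW_measurable (κ : ℝ) : Measurable (Function.uncurry (volW α κ)) := by
  have h1 : Measurable fun θ : ℝ => (κ + cos θ / 2) / sin θ :=
    ((measurable_cos.div_const 2).const_add κ).div measurable_sin
  exact (h1.comp measurable_fst).mul (volK_measurable hα κ)

theorem volW_nonneg (hκ : 1 / 2 ≤ κ) (hθ : θ ∈ Ioo 0 π) :
    0 ≤ volW α κ θ s := mul_nonneg (weight_nonneg hκ hθ) (volK_nonneg hα)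

theorem volW_col (hκ : 1 / 2 ≤ κ) (hs : s ∈ Ioo 0 π) :
    ∫⁻ θ, ‖volW α κ θ s‖ₑ ∂arcMeasure ≤ ofReal 3 := by
  have hκ0 : 0 < κ := by linarith
  have h1 : ∫⁻ θ in Ioo s π, ofReal (κ + 1 / 2) * ofReal
      (tortD α θ * exp (-(κ * (tort α θ - tort α s)))) ≤ ofReal 3 := by
    rw [lintegral_const_mul' _ _ ofReal_ne_top]
    refine (mul_le_mul_right (exp_col hα hκ0 hs) _).trans ?_
    rw [← ofReal_mul (by linarith)]
    refine ofReal_le_ofReal ?_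
    rw [mul_one_div, div_le_iff₀ hκ0]
    linarith
  refine (lintegral_arc_le (x := s) (y := π) (fun θ hθ => ⟨hs.1.trans hθ.1, hθ.2⟩)
    (fun θ hθ => ?_) (fun θ hθ hθ' => ?_)).trans h1
  · have hθ' : θ ∈ Ioo 0 π := ⟨hs.1.trans hθ.1, hθ.2⟩
    rw [← ofReal_mul (by linarith)]
    refine enorm_real_le (volW_nonneg hα hκ hθ') ?_
    rw [volW, ← mul_assoc]
    refine mul_le_mul ?_ (volK_le hα hθ.1) (volK_nonneg hα) ?_
    · rw [div_eq_mul_inv]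
      refine mul_le_mul (by linarith [cos_le_one θ]) (inv_sin_le_tortD hα hθ')
        (inv_nonneg.mpr (sin_pos_of_mem hθ').le) (by linarith)
    · have := one_le_tortD hα hθ'; positivity
  · rw [volW, volK, if_neg (fun h => hθ' ⟨h, hθ.2⟩), mul_zero, enorm_zero]

theorem inv_sin_mul_exp_le (hs : s ∈ Ioo 0 π) (hθ : θ ∈ Ioo 0 π)
    (h : s < θ) : (sin θ)⁻¹ * exp (-(tort α θ - tort α s)) ≤ tortD α s := by
  refine le_trans ?_ (inv_sin_le_tortD hα hs)
  have : exp (-(tort α θ - tort α s)) ≤ tan (s / 2) / tan (θ / 2) := by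
    have := log_tan_sub_le hα hs hθ h.le
    calc exp (-(tort α θ - tort α s))
        ≤ exp (log (tan (s / 2)) - log (tan (θ / 2))) := exp_le_exp.mpr (by linarith)
      _ = _ := by rw [exp_sub, exp_log (tan_half_pos hs), exp_log (tan_half_pos hθ)]
  have : sin s * tan (s / 2) ≤ sin θ * tan (θ / 2) := by
    rw [sin_mul_tan_half hs, sin_mul_tan_half hθ]
    have := cos_lt_cos_of_nonneg_of_le_pi hs.1.le hθ.2.le h
    linarith
  have p1 := sin_pos_of_mem hs
  have p2 := sin_pos_of_mem hθ
  have p4 := tan_half_pos hθ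
  calc (sin θ)⁻¹ * exp (-(tort α θ - tort α s))
      ≤ (sin θ)⁻¹ * (tan (s / 2) / tan (θ / 2)) := by gcongr
    _ ≤ (sin s)⁻¹ := by
        rw [inv_mul_eq_div, div_div, inv_eq_one_div, div_le_div_iff₀ (by positivity) p1]
        linarith

theorem volW_row (hκ : κ = 1 / 2 ∨ 3 / 2 ≤ κ) (hθ : θ ∈ Ioo 0 π) :
    ∫⁻ s, ‖volW α κ θ s‖ₑ ∂arcMeasure ≤ ofReal 3 := by
  have hκ' : 1 / 2 ≤ κ := by grind
  have hsub : ∀ s ∈ Ioo 0 θ, s ∈ Ioo 0 π := fun s hs => ⟨hs.1, hs.2.trans hθ.2⟩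
  have psin := sin_pos_of_mem hθ
  have := neg_one_le_cos θ
  have key : ∫⁻ s in Ioo 0 θ, (ofReal (κ - 1 / 2) * ofReal
      (tortD α s * exp (-((κ - 1) * (tort α θ - tort α s)))) +
      ofReal ((1 + cos θ) / (2 * sin θ))) ≤ ofReal 3 := by
    rw [lintegral_add_right _ measurable_const, lintegral_const_mul' _ _ ofReal_ne_top,
      setLIntegral_const, volume_Ioo, sub_zero,
      ← ofReal_mul (div_nonneg (by linarith) (by linarith)),
      show (3 : ℝ) = 2 + 1 by norm_num, ofReal_add (by norm_num) (by norm_num)]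
    refine add_le_add ?_ (ofReal_le_ofReal (half_cot_le hθ))
    rcases hκ with h | h
    · rw [h, sub_self, ENNReal.ofReal_zero, zero_mul]; exact zero_le
    · refine (mul_le_mul_right (exp_row hα (by linarith) hθ) _).trans ?_
      rw [← ofReal_mul (by linarith)]
      refine ofReal_le_ofReal ?_
      rw [mul_one_div, div_le_iff₀ (by linarith)]
      linarith
  refine (lintegral_arc_le (x := 0) (y := θ) hsub (fun s hs => ?_) (fun s hs hs' => ?_)).trans key
  · rw [← ofReal_mul (by linarith),
      ← ofReal_add (mul_nonneg (by linarith) ?_) (div_nonneg (by linarith) (by linarith))]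
    · refine enorm_real_le (volW_nonneg hα hκ' hθ) ?_
      have hK := volK_le (κ := κ) hα hs.2
      have := tort_strictMonoOn hα (hsub s hs) hθ hs.2
      have h1 : volK α κ θ s ≤ 1 := hK.trans (exp_le_one_iff.mpr (by nlinarith))
      have h2 : (sin θ)⁻¹ * volK α κ θ s
          ≤ tortD α s * exp (-((κ - 1) * (tort α θ - tort α s))) := by
        refine (mul_le_mul_of_nonneg_left hK (inv_nonneg.mpr psin.le)).trans ?_
        have h3 : exp (-(κ * (tort α θ - tort α s))) = exp (-(tort α θ - tort α s)) *
            exp (-((κ - 1) * (tort α θ - tort α s))) := by rw [← exp_add]; congr 1; ring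
        rw [h3, ← mul_assoc]
        exact mul_le_mul_of_nonneg_right (inv_sin_mul_exp_le hα (hsub s hs) hθ hs.2) (exp_pos _).le
      have h4 : volW α κ θ s = (κ - 1 / 2) * ((sin θ)⁻¹ * volK α κ θ s)
          + (1 + cos θ) / (2 * sin θ) * volK α κ θ s := by unfold volW; field_simp; ring
      rw [h4]
      refine add_le_add (mul_le_mul_of_nonneg_left h2 (by linarith)) ?_
      exact mul_le_of_le_one_right (div_nonneg (by linarith) (by linarith)) h1
    · have := one_le_tortD hα (hsub s hs); positivity
  · rw [volW, volK, if_neg (fun h => hs' ⟨hs.1, h⟩), mul_zero, enorm_zero]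

theorem volOp_spec (hκ : 0 < κ) :
    ‖volOp α κ‖ ≤ 1 / κ ∧ IsKernelOp arcMeasure (volK α κ) (volOp α κ) :=
  ⟨(isSchur_volK hα hκ).norm_kernelOp_le, (isSchur_volK hα hκ).isKernelOp⟩

theorem volStar_spec (hκ : 0 < κ) :
    ‖volStar α κ‖ ≤ 1 / κ ∧ IsKernelOp arcMeasure (fun θ s => volK α κ s θ) (volStar α κ) :=
  ⟨(isSchur_volK hα hκ).swap.norm_kernelOp_le, (isSchur_volK hα hκ).swap.isKernelOp⟩

theorem volOp_inner (hκ : 0 < κ) (u v : ArcL2) :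
    inner ℂ (volOp α κ u) v = inner ℂ u (volStar α κ v) :=
  (isSchur_volK hα hκ).inner_eq u v

theorem isSchur_volW (hκ : IsFreq κ) : IsSchur arcMeasure (volW α κ) 3 where
  meas := volW_measurable hα κ
  pos := by norm_num
  row := ae_arc fun _ h => volW_row hα hκ h
  col := ae_arc fun _ h => volW_col hα hκ.half_le h

theorem exists_weighted (hκ : IsFreq κ) : ∃ W : ArcL2 →L[ℂ] ArcL2, ‖W‖ ≤ 3 ∧ ∀ v, W v =ᵐ[arcMeasure]
      fun θ => (((κ + cos θ / 2) / sin θ : ℝ) : ℂ) * volOp α κ v θ := by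
  obtain ⟨W, h1, h2⟩ := (isSchur_volW hα hκ).exists_op
  exact ⟨W, h1, fun v => (volOp_spec hα hκ.pos).2.weight h2 v⟩

theorem exists_weighted_star (hκ : IsFreq κ) :
    ∃ W : ArcL2 →L[ℂ] ArcL2, ‖W‖ ≤ 3 ∧ ∀ v, W v =ᵐ[arcMeasure]
      fun θ => (((κ - cos θ / 2) / sin θ : ℝ) : ℂ) * volStar α κ v θ := by
  have hk : ∀ θ s, volW α κ (π - θ) (π - s) = (κ - cos θ / 2) / sin θ * volK α κ s θ := by
    intro θ s
    rw [volW, volK_reflect, cos_pi_sub, sin_pi_sub]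
    ring
  have hm : Measurable (Function.uncurry fun θ s => volW α κ (π - θ) (π - s)) := by
    have h2 := (volW_measurable hα κ).comp
      (by fun_prop : Measurable fun z : ℝ × ℝ => (π - z.1, π - z.2))
    fun_prop
  have hS : IsSchur arcMeasure (fun θ s => volW α κ (π - θ) (π - s)) 3 := ⟨hm, by norm_num,
    ae_arc fun θ h => (lintegral_arc_reflect fun s => ‖volW α κ (π - θ) s‖ₑ).trans_le
      (volW_row hα hκ (pi_sub_mem h)),
    ae_arc fun s h => (lintegral_arc_reflect fun θ => ‖volW α κ θ (π - s)‖ₑ).trans_le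
      (volW_col hα hκ.half_le (pi_sub_mem h))⟩
  obtain ⟨W, h1, h2⟩ := hS.exists_op
  simp only [hk] at h2
  exact ⟨W, h1, fun v => (volStar_spec hα hκ.pos).2.weight h2 v⟩

omit hα in
theorem volOp_continuous (hκ : 0 < κ) : Continuous fun α : NNReal => volOp α κ := by
  let F : NNReal → Icc 0 π × Icc 0 π → ℝ := fun α p =>
    quart α p.1 * quart α p.2 * exp (-(κ * (α * sinPrim α p.1 - α * sinPrim α p.2)))
  have hd : Continuous fun p : NNReal × ℝ => dlt p.1 p.2 := by unfold dlt; fun_prop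
  have hq : Continuous fun p : NNReal × ℝ => quart p.1 p.2 := by
    unfold quart
    refine (hd.sqrt.sqrt).inv₀ fun p => ?_
    exact (sqrt_pos.mpr (sqrt_pos.mpr (dlt_pos p.1.2))).ne'
  have hs : Continuous fun p : NNReal × ℝ => sinPrim p.1 p.2 := by
    refine intervalIntegral.continuous_parametric_intervalIntegral_of_continuous
      (f := fun (p : NNReal × ℝ) s => sin s / dlt p.1 s) ?_ continuous_snd
    have h1 : Continuous fun z : (NNReal × ℝ) × ℝ => dlt z.1.1 z.2 :=
      hd.comp (by fun_prop : Continuous fun z : (NNReal × ℝ) × ℝ => (z.1.1, z.2))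
    exact (by fun_prop : Continuous fun z : (NNReal × ℝ) × ℝ => sin z.2).div h1
      fun z => (dlt_pos z.1.1.2).ne'
  have hF : Continuous ↿F := by
    have c1 : Continuous fun z : NNReal × (Icc 0 π × Icc 0 π) =>
      ((z.1, (z.2.1 : ℝ)) : NNReal × ℝ) := by fun_prop
    have c2 : Continuous fun z : NNReal × (Icc 0 π × Icc 0 π) =>
      ((z.1, (z.2.2 : ℝ)) : NNReal × ℝ) := by fun_prop
    have q1 := hq.comp c1
    have q2 := hq.comp c2
    have s1 := hs.comp c1
    have s2 := hs.comp c2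
    fun_prop
  rw [continuous_iff_continuousAt]
  intro α₀
  have hU := Continuous.tendstoUniformly F hF α₀
  rw [Metric.tendstoUniformly_iff] at hU
  rw [ContinuousAt, Metric.tendsto_nhds]
  intro ε hε
  have := pi_pos
  filter_upwards [hU (ε / (2 * π)) (by positivity)] with α hα
  rw [dist_eq_norm]
  have hb : ∀ θ ∈ Ioo 0 π, ∀ s ∈ Ioo 0 π, ‖volK α κ θ s - volK α₀ κ θ s‖ ≤ ε / (2 * π) := by
    intro θ hθ s hs
    by_cases h : s < θ
    · have h1 := hα (⟨θ, Ioo_subset_Icc_self hθ⟩, ⟨s, Ioo_subset_Icc_self hs⟩)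
      have e : ∀ β : NNReal, volK β κ θ s
          = F β (⟨θ, Ioo_subset_Icc_self hθ⟩, ⟨s, Ioo_subset_Icc_self hs⟩) *
            exp (-(κ * (log (tan (θ / 2)) - log (tan (s / 2))))) := by
        intro β
        rw [volK, if_pos h]
        simp only [F]
        rw [mul_assoc, mul_assoc, mul_assoc, ← exp_add]
        congr 3
        unfold tort
        ring
      rw [e, e, ← sub_mul, norm_mul]
      rw [dist_comm, dist_eq_norm] at h1
      have h2 : ‖exp (-(κ * (log (tan (θ / 2)) - log (tan (s / 2)))))‖ ≤ 1 := by
        rw [norm_of_nonneg (exp_pos _).le, exp_le_one_iff]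
        have := log_le_log (tan_half_pos hs) (tan_lt_tan_of_lt_of_lt_pi_div_two
          (x := s / 2) (y := θ / 2) (by linarith [hs.1]) (by linarith [hθ.2]) (by linarith)).le
        nlinarith
      exact (mul_le_of_le_one_right (norm_nonneg _) h2).trans h1.le
    · rw [volK, volK, if_neg h, if_neg h, sub_self, norm_zero]; positivity
  have hlt : ε / (2 * π) * π = ε / 2 := by field_simp
  have hint : ∀ f : ℝ → ℝ, (∀ s ∈ Ioo 0 π, ‖f s‖ ≤ ε / (2 * π)) →
      ∫⁻ s, ‖f s‖ₑ ∂arcMeasure ≤ ofReal (ε / 2) := by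
    intro f hf
    refine (lintegral_mono_ae (ae_arc (p := fun s => ‖f s‖ₑ ≤ ofReal (ε / (2 * π)))
      fun s hs => ?_)).trans_eq ?_
    · rw [← ofReal_norm]; exact ofReal_le_ofReal (hf s hs)
    · rw [arc_lintegral_const, ← ofReal_mul (by positivity), hlt]
  have hS : IsSchur arcMeasure (fun θ s => volK α κ θ s - volK α₀ κ θ s) (ε / 2) :=
    ⟨(volK_measurable α.2 κ).sub (volK_measurable α₀.2 κ), by positivity,
      ae_arc fun θ hθ => hint _ fun s hs => hb θ hθ s hs,
      ae_arc fun s hs => hint _ fun θ hθ => hb θ hθ s hs⟩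
  refine (hS.norm_le ((volOp_spec α.2 hκ).2.sub (volOp_spec α₀.2 hκ).2)).trans_lt (by linarith)

end Volterra

section ArcTests

variable {α κ c θ s : ℝ} {χ : ℝ → ℂ}

/-- Smooth functions vanishing near `0` and `π`. -/
structure IsArcTest (χ : ℝ → ℂ) : Prop where
  smooth : ContDiff ℝ (⊤ : ℕ∞) χ
  support : ∃ ε > 0, ∀ θ, θ ∉ Icc ε (π - ε) → χ θ = 0

theorem eventually_eq_zero_of_notMem {F : Type*} [Zero F] {f : ℝ → F} {x y : ℝ}
    (h : ∀ θ, θ ∉ Icc x y → f θ = 0) (hθ : θ ∉ Icc x y) : f =ᶠ[𝓝 θ] fun _ => 0 :=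
  Filter.eventually_of_mem (isClosed_Icc.isOpen_compl.mem_nhds hθ) fun y hy => h y hy

theorem IsArcTest.mul (h : IsArcTest χ) {m : ℝ → ℂ}
    (hm : ∀ θ ∈ Ioo 0 π, ContDiffAt ℝ (⊤ : ℕ∞) m θ) : IsArcTest fun θ => m θ * χ θ := by
  obtain ⟨ε, hε, hs⟩ := h.support
  refine ⟨contDiff_iff_contDiffAt.mpr fun θ => ?_, ε, hε, fun θ hθ => by simp [hs θ hθ]⟩
  by_cases hθ : θ ∈ Icc ε (π - ε)
  · exact (hm θ ⟨hε.trans_le hθ.1, by linarith [hθ.2]⟩).mul h.smooth.contDiffAt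
  · refine contDiffAt_const (c := (0 : ℂ)) |>.congr_of_eventuallyEq ?_
    filter_upwards [eventually_eq_zero_of_notMem hs hθ] with x hx
    rw [hx, mul_zero]

theorem IsArcTest.deriv (h : IsArcTest χ) : IsArcTest (deriv χ) := by
  obtain ⟨ε, hε, hs⟩ := h.support
  refine ⟨(contDiff_infty_iff_deriv.mp h.smooth).2, ε, hε, fun θ hθ => ?_⟩
  rw [(eventually_eq_zero_of_notMem hs hθ).deriv_eq]
  simp

theorem IsArcTest.differentiable (h : IsArcTest χ) : Differentiable ℝ χ :=
  h.smooth.differentiable (by simp)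

theorem IsArcTest.memLp (h : IsArcTest χ) : MemLp χ 2 arcMeasure := by
  obtain ⟨C, hC⟩ := isCompact_Icc.exists_bound_of_continuousOn
    (h.smooth.continuous.continuousOn (s := Icc 0 π))
  exact MemLp.of_bound h.smooth.continuous.aestronglyMeasurable C
    (ae_arc fun θ hθ => hC θ (Ioo_subset_Icc_self hθ))

/-- The element of `L²(0, π)` defined by a test function. -/
def IsArcTest.toLp (h : IsArcTest χ) : ArcL2 := h.memLp.toLp

theorem IsArcTest.inner_toLp (h : IsArcTest χ) (v : ArcL2) :
    inner ℂ h.toLp v = ∫ θ, inner ℂ (χ θ) (v θ) ∂arcMeasure := by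
  rw [L2.inner_def]
  refine integral_congr_ae ?_
  filter_upwards [h.memLp.coeFn_toLp] with θ hθ
  rw [IsArcTest.toLp, hθ]

theorem isArcTest_of_tsupport {g : ℝ → ℝ} (hg : ContDiff ℝ (⊤ : ℕ∞) g) (hc : HasCompactSupport g)
    (hs : tsupport g ⊆ Ioo 0 π) : IsArcTest fun θ => (g θ : ℂ) := by
  refine ⟨ofRealCLM.contDiff.comp hg, ?_⟩
  rcases (tsupport g).eq_empty_or_nonempty with h0 | hne
  · refine ⟨1, one_pos, fun θ _ => ?_⟩
    have : θ ∉ tsupport g := by grind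
    simp [image_eq_zero_of_notMem_tsupport this]
  · obtain ⟨x, hx, hxm⟩ := IsCompact.exists_isLeast (s := tsupport g) hc hne
    obtain ⟨y, hy, hym⟩ := IsCompact.exists_isGreatest (s := tsupport g) hc hne
    refine ⟨min x (π - y), lt_min (hs hx).1 (by linarith [(hs hy).2]), fun θ hθ => ?_⟩
    have : θ ∉ tsupport g := fun h => hθ ⟨(min_le_left _ _).trans (hxm h), by
      have h1 := hym h
      grind⟩
    simp [image_eq_zero_of_notMem_tsupport this]

theorem arc_ae_of_volume {p : ℝ → Prop} (h : ∀ᵐ θ, θ ∈ Ioo 0 π → p θ) : ∀ᵐ θ ∂arcMeasure, p θ :=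
  (ae_restrict_iff' measurableSet_Ioo).mpr h

theorem lp_integrable (v : ArcL2) : IntegrableOn (v : ℝ → ℂ) (Ioo 0 π) :=
  (Lp.memLp v).integrable one_le_two

theorem arc_integral_eq {F : Type*} [NormedAddCommGroup F] [NormedSpace ℝ F] (f : ℝ → F) :
    ∫ θ, f θ ∂arcMeasure = ∫ θ in (0 : ℝ)..Real.pi, f θ := by
  rw [integral_of_le pi_pos.le, integral_Ioc_eq_integral_Ioo]
  rfl

theorem arc_integral_eq_volume {F : Type*} [NormedAddCommGroup F] [NormedSpace ℝ F] {f : ℝ → F}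
    (h : ∀ θ, θ ∉ Ioo 0 π → f θ = 0) : ∫ θ, f θ ∂arcMeasure = ∫ θ, f θ :=
  setIntegral_eq_integral_of_forall_compl_eq_zero fun θ hθ => h θ hθ

theorem eq_zero_of_arcTest {v : ArcL2}
    (h : ∀ χ, IsArcTest χ → ∫ θ, inner ℂ (χ θ) (v θ) ∂arcMeasure = 0) : v = 0 := by
  have h1 : ∀ᵐ θ, θ ∈ Ioo 0 π → v θ = 0 := by
    refine isOpen_Ioo.ae_eq_zero_of_integral_contDiff_smul_eq_zero
      (lp_integrable v).locallyIntegrableOn fun g hg hc hs => ?_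
    have h2 := h _ (isArcTest_of_tsupport hg hc hs)
    rw [arc_integral_eq_volume] at h2
    · rw [← h2]
      refine integral_congr_ae (.of_forall fun θ => ?_)
      simp [RCLike.inner_apply, mul_comm]
    · intro θ hθ; simp [image_eq_zero_of_notMem_tsupport (fun h => hθ (hs h))]
  refine Lp.ext ?_
  filter_upwards [arc_ae_of_volume h1, Lp.coeFn_zero ℂ 2 arcMeasure] with θ e1 e2
  rw [e1, e2, Pi.zero_apply]

/-- The lemma of du Bois-Reymond on `(0, π)`. -/
theorem ae_eq_const_of_weak_deriv {f : ℝ → ℂ} (hf : LocallyIntegrableOn f (Ioo 0 π))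
    (h : ∀ ψ : ℝ → ℂ, IsArcTest ψ → ∫ θ in Ioo 0 π, deriv ψ θ * f θ = 0) :
    ∃ K : ℂ, ∀ᵐ θ, θ ∈ Ioo 0 π → f θ = K := by
  have := pi_gt_three
  let b : ContDiffBump (π / 2) := ⟨1 / 2, 1, by norm_num, by norm_num⟩
  have hbs : tsupport (b.normed volume) ⊆ Ioo 0 π := by
    rw [b.tsupport_normed_eq, closedBall_eq_Icc]
    grind
  have hbc : IsArcTest fun θ => ((b.normed volume θ : ℝ) : ℂ) :=
    isArcTest_of_tsupport (b.contDiff_normed (n := ⊤)) b.hasCompactSupport_normed hbs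
  set K : ℂ := ∫ θ in Ioo 0 π, ((b.normed volume θ : ℝ) : ℂ) * f θ with hK
  refine ⟨K, ?_⟩
  have hmul : ∀ χ, IsArcTest χ → IntegrableOn (fun θ => χ θ * f θ) (Ioo 0 π) := by
    intro χ hχ
    obtain ⟨ε, hε, hs⟩ := hχ.support
    have h1 : IntegrableOn (fun θ => χ θ * f θ) (Icc ε (π - ε)) := by
      have h2 : LocallyIntegrableOn (fun θ => χ θ * f θ) (Ioo 0 π) :=
        hf.continuousOn_mul hχ.smooth.continuous.continuousOn isOpen_Ioo.isLocallyClosed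
      exact h2.integrableOn_compact_subset
        (fun x hx => ⟨hε.trans_le hx.1, by linarith [hx.2]⟩) isCompact_Icc
    have h3 : IntegrableOn (fun θ => χ θ * f θ) univ := by
      refine h1.of_forall_sdiff_eq_zero MeasurableSet.univ fun x hx => ?_
      grind
    exact h3.mono_set (subset_univ _)
  have : ∀ᵐ θ, θ ∈ Ioo 0 π → f θ - K = 0 := by
    refine isOpen_Ioo.ae_eq_zero_of_integral_contDiff_smul_eq_zero
      (hf.sub ((locallyIntegrable_const K).locallyIntegrableOn _)) fun g hg hc hs => ?_
    have hgt := isArcTest_of_tsupport hg hc hs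
    set m : ℂ := ∫ θ, (g θ : ℂ) with hm
    let η : ℝ → ℂ := fun θ => (g θ : ℂ) - m * ((b.normed volume θ : ℝ) : ℂ)
    have hη : ContDiff ℝ (⊤ : ℕ∞) η := hgt.smooth.sub (contDiff_const.mul hbc.smooth)
    obtain ⟨ε₁, hε₁, hs₁⟩ := hgt.support
    obtain ⟨ε₂, hε₂, hs₂⟩ := hbc.support
    have hη0 : ∀ θ, θ ∉ Icc (min ε₁ ε₂) (π - min ε₁ ε₂) → η θ = 0 := by grind
    have hεm : 0 < min ε₁ ε₂ := lt_min hε₁ hε₂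
    have hηint : ∫ θ in (0 : ℝ)..Real.pi, η θ = 0 := by
      rw [← arc_integral_eq, arc_integral_eq_volume fun θ hθ => hη0 θ fun h =>
        hθ ⟨hεm.trans_le h.1, by linarith [h.2]⟩]
      have i1 : Integrable fun θ => (g θ : ℂ) :=
        (hg.continuous.integrable_of_hasCompactSupport hc).ofReal
      have i2 : Integrable fun θ => ((b.normed volume θ : ℝ) : ℂ) := b.integrable_normed.ofReal
      simp only [η]
      rw [integral_sub i1 (i2.const_mul m), integral_const_mul, ← hm]
      have i3 : ∫ θ, ((b.normed volume θ : ℝ) : ℂ) = 1 := by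
        rw [integral_complex_ofReal, b.integral_normed, Complex.ofReal_one]
      grind
    let ψ : ℝ → ℂ := fun x => ∫ θ in (0 : ℝ)..x, η θ
    have hd : ∀ x, HasDerivAt ψ (η x) x := fun x =>
      integral_hasDerivAt_right (hη.continuous.intervalIntegrable _ _)
        (hη.continuous.stronglyMeasurableAtFilter _ _) hη.continuous.continuousAt
    have hdψ : deriv ψ = η := funext fun x => (hd x).deriv
    have hψ : IsArcTest ψ := by
      refine ⟨contDiff_infty_iff_deriv.mpr ⟨fun x => (hd x).differentiableAt, hdψ ▸ hη⟩,
        min ε₁ ε₂, hεm, fun x hx => ?_⟩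
      by_cases hx1 : x < min ε₁ ε₂
      · refine intervalIntegral.integral_zero_ae (.of_forall fun y hy => hη0 y fun h => ?_)
        rcases le_total 0 x with h0 | h0
        · rw [uIoc_of_le h0] at hy; linarith [hy.2, h.1]
        · rw [uIoc_of_ge h0] at hy; linarith [hy.2, h.1]
      · have : π - min ε₁ ε₂ < x := by by_contra h; exact hx ⟨not_lt.mp hx1, not_lt.mp h⟩
        have h3 : ψ x = (∫ θ in (0 : ℝ)..Real.pi, η θ) + ∫ θ in π..x, η θ :=
          (integral_add_adjacent_intervals
            (hη.continuous.intervalIntegrable _ _) (hη.continuous.intervalIntegrable _ _)).symm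
        rw [h3, hηint, zero_add]
        refine intervalIntegral.integral_zero_ae (.of_forall fun y hy => hη0 y fun h => ?_)
        rcases le_total π x with h0 | h0
        · rw [uIoc_of_le h0] at hy; linarith [hy.1, h.2]
        · rw [uIoc_of_ge h0] at hy; linarith [hy.1, h.2]
    have h4 := h ψ hψ
    rw [hdψ] at h4
    have h5 : ∫ θ in Ioo 0 π, η θ * f θ = (∫ θ in Ioo 0 π, (g θ : ℂ) * f θ) - m * K := by
      rw [hK, ← integral_const_mul, ← integral_sub (hmul _ hgt) ((hmul _ hbc).const_mul m)]
      refine integral_congr_ae (.of_forall fun θ => ?_)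
      simp only [η]
      ring
    rw [h5] at h4
    have h6 : ∫ θ, g θ • (f θ - K) = ∫ θ in Ioo 0 π, ((g θ : ℂ) * f θ - (g θ : ℂ) * K) := by
      rw [← setIntegral_eq_integral_of_forall_compl_eq_zero (s := Ioo 0 π)]
      · refine integral_congr_ae (.of_forall fun θ => ?_); simp only [Complex.real_smul]; ring
      · intro θ hθ; rw [image_eq_zero_of_notMem_tsupport (fun h => hθ (hs h)), zero_smul]
    have h7 : ∫ θ in Ioo 0 π, (g θ : ℂ) = m :=
      setIntegral_eq_integral_of_forall_compl_eq_zero fun θ hθ => by grind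
    have i3 : IntegrableOn (fun θ => (g θ : ℂ)) (Ioo 0 π) :=
      (hg.continuous.integrable_of_hasCompactSupport hc).ofReal.integrableOn
    rw [h6, integral_sub (hmul _ hgt) (i3.mul_const K), integral_mul_const, h7]
    exact h4
  grind

end ArcTests

section Weights

variable {α κ c θ s : ℝ} {χ : ℝ → ℂ}

/-- The weight `Δ^{-1/4} exp (c g)`, `g` the tortoise coordinate. -/
def wgt (α c θ : ℝ) : ℝ := quart α θ * exp (c * tort α θ)

theorem wgt_mul_neg : wgt α c θ * wgt α (-c) θ = quart α θ ^ 2 := by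
  unfold wgt
  rw [mul_mul_mul_comm, ← exp_add, neg_mul, add_neg_cancel, exp_zero, mul_one, pow_two]

/-- The first order operator `q⁻¹ e^{-c g} ∂ q⁻¹ e^{c g}`, `q = Δ^{-1/4}`. -/
def rad (α c : ℝ) (χ : ℝ → ℂ) (θ : ℝ) : ℂ :=
  (wgt α c θ : ℂ)⁻¹ * deriv (fun x => (wgt α (-c) x : ℂ)⁻¹ * χ x) θ

theorem sinPrim_half_pi (α : ℝ) : sinPrim α (π / 2) = 0 := by unfold sinPrim; exact integral_same

theorem dlt_hasDerivAt (α θ : ℝ) : HasDerivAt (dlt α) (-(α * sin (2 * θ))) θ := by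
  have := (((hasDerivAt_cos θ).pow 2).const_mul α).const_add 1
  refine this.congr_deriv ?_
  rw [sin_two_mul]
  push_cast
  ring

variable (hα : 0 ≤ α)
include hα

theorem wgt_pos : 0 < wgt α c θ := mul_pos (quart_pos hα) (exp_pos _)

theorem wgt_contDiffAt (hθ : θ ∈ Ioo 0 π) : ContDiffAt ℝ (⊤ : ℕ∞) (wgt α c) θ :=
  (quart_contDiff hα).contDiffAt.mul (contDiffAt_const.mul (tort_contDiffAt hα hθ)).exp

theorem wgt_continuousOn : ContinuousOn (wgt α c) (Ioo 0 π) :=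
  fun _ hθ => (wgt_contDiffAt hα hθ).continuousAt.continuousWithinAt

theorem wgtC_contDiffAt (hθ : θ ∈ Ioo 0 π) : ContDiffAt ℝ (⊤ : ℕ∞) (fun x => (wgt α c x : ℂ)) θ :=
  ofRealCLM.contDiff.contDiffAt.comp θ (wgt_contDiffAt hα hθ)

theorem wgtC_ne : (wgt α c θ : ℂ) ≠ 0 := ofReal_ne_zero.mpr (wgt_pos hα).ne'

theorem wgtC_inv_contDiffAt (hθ : θ ∈ Ioo 0 π) :
    ContDiffAt ℝ (⊤ : ℕ∞) (fun x => (wgt α c x : ℂ)⁻¹) θ :=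
  (wgtC_contDiffAt hα hθ).inv (wgtC_ne hα)

theorem wgtC_continuousOn : ContinuousOn (fun x => (wgt α c x : ℂ)) (Ioo 0 π) :=
  Complex.continuous_ofReal.comp_continuousOn (wgt_continuousOn hα)

omit hα in
theorem IsArcTest.wgt_inv (h : IsArcTest χ) (hα : 0 ≤ α) (c : ℝ) :
    IsArcTest fun θ => (wgt α c θ : ℂ)⁻¹ * χ θ :=
  h.mul fun _ hθ => wgtC_inv_contDiffAt hα hθ

omit hα in
theorem IsArcTest.rad (h : IsArcTest χ) (hα : 0 ≤ α) (c : ℝ) : IsArcTest (rad α c χ) :=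
  (h.wgt_inv hα (-c)).deriv.mul fun _ hθ => wgtC_inv_contDiffAt hα hθ

theorem sin_two_div (θ : ℝ) : HasDerivAt (fun x => (quart α x)⁻¹)
    (-(√(dlt α θ) * (α * sin (2 * θ) / (4 * dlt α θ)) * quart α θ)) θ := by
  have hp := dlt_pos (θ := θ) hα
  have hp2 := sqrt_pos.mpr hp
  have := sqrt_pos.mpr hp2
  have h1 := ((dlt_hasDerivAt α θ).sqrt hp.ne').sqrt hp2.ne'
  have e : (fun x => (quart α x)⁻¹) = fun x => √(√(dlt α x)) := by funext x; rw [quart, inv_inv]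
  rw [e]
  refine h1.congr_deriv ?_
  rw [quart]
  grind

theorem rad_eq (h : Differentiable ℝ χ) (hθ : θ ∈ Ioo 0 π) :
    rad α c χ θ = (√(dlt α θ) : ℂ) * (deriv χ θ - ((α * sin (2 * θ) / (4 * dlt α θ) : ℝ) : ℂ)
      * χ θ + ((c * tortD α θ : ℝ) : ℂ) * χ θ) := by
  have h1 : HasDerivAt (fun x => (wgt α (-c) x)⁻¹)
      (wgt α c θ * √(dlt α θ) * (c * tortD α θ - α * sin (2 * θ) / (4 * dlt α θ))) θ := by
    have e : (fun x => (wgt α (-c) x)⁻¹) = fun x => (quart α x)⁻¹ * exp (c * tort α x) := by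
      funext x
      rw [wgt, mul_inv, ← exp_neg, neg_mul, neg_neg]
    rw [e]
    refine ((sin_two_div hα θ).mul ((tort_hasDerivAt hα hθ).const_mul c).exp).congr_deriv ?_
    have hq := quart_sq (α := α) (θ := θ)
    have := quart_pos (θ := θ) hα
    have := sqrt_pos.mpr (dlt_pos (θ := θ) hα)
    have e3 : (quart α θ)⁻¹ = quart α θ * √(dlt α θ) := by grind
    rw [e3, wgt]
    ring
  have h2 := (h1.ofReal_comp).mul (h θ).hasDerivAt
  have e4 : (fun x => (wgt α (-c) x : ℂ)⁻¹ * χ x) = (fun x => (((wgt α (-c) x)⁻¹ : ℝ) : ℂ)) * χ := by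
    funext x
    simp
  rw [rad, e4, h2.deriv]
  have e5 : (((wgt α (-c) θ)⁻¹ : ℝ) : ℂ) = (wgt α c θ : ℂ) * (√(dlt α θ) : ℂ) := by
    rw [← Complex.ofReal_mul]
    congr 1
    have hq := quart_sq (α := α) (θ := θ)
    rw [inv_eq_iff_eq_inv, mul_inv, ← hq, ← wgt_mul_neg (c := c)]
    have := wgt_pos (c := c) (θ := θ) hα
    field_simp
  rw [e5]
  have := wgtC_ne (c := c) (θ := θ) hα
  push_cast
  field_simp
  ring

end Weights

section WeightedPrimitive

variable {α κ c θ s x₀ : ℝ} {χ : ℝ → ℂ}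

/-- The primitive of `wgt α c * f` vanishing at `x₀`. -/
def wint (α c x₀ : ℝ) (f : ℝ → ℂ) (θ : ℝ) : ℂ := ∫ s in x₀..θ, (wgt α c s : ℂ) * f s

theorem wint_congr {f g : ℝ → ℂ} (hx₀ : x₀ ∈ Icc 0 π) (h : f =ᵐ[arcMeasure] g)
    (hθ : θ ∈ Icc 0 π) : wint α c x₀ f θ = wint α c x₀ g θ := by
  refine intervalIntegral.integral_congr_ae ?_
  have h1 : ∀ᵐ s, s ∈ Ioo 0 π → f s = g s := (ae_restrict_iff' measurableSet_Ioo).mp h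
  have h2 : ∀ᵐ s : ℝ, s ≠ π := by simp [ae_iff]
  filter_upwards [h1, h2] with s hs hs2 hm
  grind

theorem wint_continuousOn {f : ℝ → ℂ}
    (hI : ∀ θ ∈ Ioo 0 π, IntervalIntegrable (fun s => (wgt α c s : ℂ) * f s) volume x₀ θ) :
    ContinuousOn (wint α c x₀ f) (Ioo 0 π) := by
  intro θ hθ
  obtain ⟨y, hy⟩ := exists_between hθ.1
  obtain ⟨z, hz⟩ := exists_between hθ.2
  have hym : y ∈ Ioo 0 π := ⟨hy.1, hy.2.trans hθ.2⟩
  have hzm : z ∈ Ioo 0 π := ⟨hθ.1.trans hz.1, hz.2⟩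
  have hyz : y < z := hy.2.trans hz.1
  have h1 := continuousOn_primitive_interval' (a := y)
    ((hI y hym).symm.trans (hI z hzm)) left_mem_uIcc
  rw [uIcc_of_le hyz.le] at h1
  have h2 : ContinuousAt (fun b => ∫ s in y..b, (wgt α c s : ℂ) * f s) θ :=
    h1.continuousAt (Icc_mem_nhds hy.2 hz.1)
  refine ContinuousAt.continuousWithinAt ?_
  refine (continuousAt_const (y := wint α c x₀ f y)).add h2 |>.congr ?_
  filter_upwards [isOpen_Ioo.mem_nhds hθ] with x hx
  exact integral_add_adjacent_intervals (hI y hym) ((hI y hym).symm.trans (hI x hx))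

theorem IsArcTest.zero_left (h : IsArcTest χ) : χ 0 = 0 := by obtain ⟨ε, hε, hs⟩ := h.support; grind

theorem IsArcTest.zero_right (h : IsArcTest χ) : χ π = 0 := by
  obtain ⟨ε, hε, hs⟩ := h.support
  grind

variable (hα : 0 ≤ α)
include hα

theorem wgt_measurable : Measurable (wgt α c) :=
  (quart_contDiff hα (n := 0)).continuous.measurable.mul
    (measurable_exp.comp ((measurable_tort hα).const_mul c))

theorem wgt_le_exp : wgt α c θ ≤ exp (c * tort α θ) :=
  mul_le_of_le_one_left (exp_pos _).le (quart_le_one hα)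

theorem wgt_integrable_of_bound {v : ArcL2} {A : Set ℝ} (hA : MeasurableSet A)
    (hsub : A ⊆ Ioo 0 π) {M : ℝ} (hM : ∀ s ∈ A, wgt α c s ≤ M) :
    IntegrableOn (fun s => (wgt α c s : ℂ) * v s) A := by
  have hv : IntegrableOn (v : ℝ → ℂ) A := (lp_integrable v).mono_set hsub
  refine Integrable.mono' (hv.norm.const_mul M) ?_ ?_
  · exact (Complex.measurable_ofReal.comp (wgt_measurable hα)).aestronglyMeasurable.mul
      hv.aestronglyMeasurable
  · filter_upwards [ae_restrict_mem hA] with s hs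
    rw [norm_mul, norm_real, norm_of_nonneg (wgt_pos hα).le]
    bound

theorem wint_hasDerivAt {f g : ℝ → ℂ}
    (hI : ∀ θ ∈ Ioo 0 π, IntervalIntegrable (fun s => (wgt α c s : ℂ) * f s) volume x₀ θ)
    (hfg : f =ᵐ[arcMeasure] g) (hg : ContinuousOn g (Ioo 0 π)) (hθ : θ ∈ Ioo 0 π) :
    HasDerivAt (wint α c x₀ f) ((wgt α c θ : ℂ) * g θ) θ := by
  have hc : ContinuousOn (fun s => (wgt α c s : ℂ) * g s) (Ioo 0 π) := (wgtC_continuousOn hα).mul hg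
  obtain ⟨y, hy⟩ := exists_between hθ.1
  have hym : y ∈ Ioo 0 π := ⟨hy.1, hy.2.trans hθ.2⟩
  have h1 : IntervalIntegrable (fun s => (wgt α c s : ℂ) * g s) volume y θ := by
    refine (hc.mono fun x hx => ?_).intervalIntegrable
    rw [uIcc_of_le hy.2.le] at hx
    grind
  have h2 := integral_hasDerivAt_right h1
    (hc.stronglyMeasurableAtFilter isOpen_Ioo θ hθ) (hc.continuousAt (isOpen_Ioo.mem_nhds hθ))
  refine (h2.const_add (wint α c x₀ f y)).congr_of_eventuallyEq ?_
  filter_upwards [isOpen_Ioo.mem_nhds hθ] with x hx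
  have h3 : wint α c y f x = wint α c y g x :=
    wint_congr (Ioo_subset_Icc_self hym) hfg (Ioo_subset_Icc_self hx)
  rw [wint, wint] at h3
  rw [← h3]
  exact (integral_add_adjacent_intervals (hI y hym) ((hI y hym).symm.trans (hI x hx))).symm

theorem wint_rad (h : IsArcTest χ) (hx₀ : χ x₀ = 0) (c θ : ℝ) :
    wint α c x₀ (rad α c χ) θ = (wgt α (-c) θ : ℂ)⁻¹ * χ θ := by
  have h1 := h.wgt_inv hα (-c)
  have e : ∀ s, (wgt α c s : ℂ) * rad α c χ s = deriv (fun x => (wgt α (-c) x : ℂ)⁻¹ * χ x) s := by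
    intro s
    rw [rad, mul_inv_cancel_left₀ (wgtC_ne hα)]
  rw [wint]
  simp only [e]
  rw [intervalIntegral.integral_deriv_eq_sub (fun x _ => h1.differentiable x)
    (h1.deriv.smooth.continuous.intervalIntegrable _ _), hx₀, mul_zero, sub_zero]

variable (hκ : 0 < κ)
include hκ

theorem wgt_le_left (hθ : θ ∈ Ioo 0 π) (hs : s ∈ Ioc 0 θ) : wgt α κ s ≤ exp (κ * tort α θ) := by
  refine (wgt_le_exp hα).trans (exp_le_exp.mpr (mul_le_mul_of_nonneg_left ?_ hκ.le))
  exact (tort_strictMonoOn hα).monotoneOn ⟨hs.1, hs.2.trans_lt hθ.2⟩ hθ hs.2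

theorem wgt_le_right (hθ : θ ∈ Ioo 0 π) (hs : s ∈ Ico θ π) :
    wgt α (-κ) s ≤ exp (-κ * tort α θ) := by
  refine (wgt_le_exp hα).trans (exp_le_exp.mpr ?_)
  have := (tort_strictMonoOn hα).monotoneOn hθ ⟨hθ.1.trans_le hs.1, hs.2⟩ hs.1
  nlinarith

theorem wint_left_integrable (v : ArcL2) :
    ∀ θ ∈ Ioo 0 π, IntervalIntegrable (fun s => (wgt α κ s : ℂ) * v s) volume 0 θ := by
  intro θ hθ
  rw [intervalIntegrable_iff_integrableOn_Ioo_of_le hθ.1.le]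
  exact wgt_integrable_of_bound hα measurableSet_Ioo (fun s hs => ⟨hs.1, hs.2.trans hθ.2⟩)
    fun s hs => wgt_le_left hα hκ hθ ⟨hs.1, hs.2.le⟩

theorem wint_right_integrable (v : ArcL2) : ∀ θ ∈ Ioo 0 π,
      IntervalIntegrable (fun s => (wgt α (-κ) s : ℂ) * v s) volume π θ := by
  intro θ hθ
  refine IntervalIntegrable.symm ?_
  rw [intervalIntegrable_iff_integrableOn_Ioo_of_le hθ.2.le]
  exact wgt_integrable_of_bound hα measurableSet_Ioo (fun s hs => ⟨hθ.1.trans hs.1, hs.2⟩)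
    fun s hs => wgt_le_right hα hκ hθ ⟨hs.1.le, hs.2⟩

theorem volOp_eq (v : ArcL2) :
    volOp α κ v =ᵐ[arcMeasure] fun θ => (wgt α (-κ) θ : ℂ) * wint α κ 0 v θ := by
  filter_upwards [((volOp_spec hα hκ).2 v).2, ae_restrict_mem measurableSet_Ioo] with θ h hθ
  rw [h, wint, integral_of_le hθ.1.le, integral_Ioc_eq_integral_Ioo, ← integral_const_mul]
  have h1 : ∫ y, (volK α κ θ y : ℂ) * v y ∂arcMeasure = ∫ y in Ioo 0 θ, (volK α κ θ y : ℂ) * v y :=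
    setIntegral_eq_of_subset_of_forall_sdiff_eq_zero measurableSet_Ioo
      (fun s hs => ⟨hs.1, hs.2.trans hθ.2⟩) fun s hs => by
        rw [volK, if_neg (fun h => hs.2 ⟨hs.1.1, h⟩), Complex.ofReal_zero, zero_mul]
  rw [h1]
  refine setIntegral_congr_fun measurableSet_Ioo fun s hs => ?_
  have e : volK α κ θ s = wgt α (-κ) θ * wgt α κ s := by
    rw [volK, if_pos hs.2, wgt, wgt, mul_mul_mul_comm, ← exp_add]
    congr 2
    ring
  simp only [e]
  push_cast
  ring

theorem volStar_eq (v : ArcL2) :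
    volStar α κ v =ᵐ[arcMeasure] fun θ => -((wgt α κ θ : ℂ) * wint α (-κ) π v θ) := by
  filter_upwards [((volStar_spec hα hκ).2 v).2, ae_restrict_mem measurableSet_Ioo] with θ h hθ
  rw [h, wint, integral_symm, integral_of_le hθ.2.le,
    integral_Ioc_eq_integral_Ioo, mul_neg, neg_neg, ← integral_const_mul]
  have h1 : ∫ y, (volK α κ y θ : ℂ) * v y ∂arcMeasure = ∫ y in Ioo θ π, (volK α κ y θ : ℂ) * v y :=
    setIntegral_eq_of_subset_of_forall_sdiff_eq_zero measurableSet_Ioo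
      (fun s hs => ⟨hθ.1.trans hs.1, hs.2⟩) fun s hs => by
        rw [volK, if_neg (fun h => hs.2 ⟨h, hs.1.2⟩), Complex.ofReal_zero, zero_mul]
  rw [h1]
  refine setIntegral_congr_fun measurableSet_Ioo fun s hs => ?_
  have e : volK α κ s θ = wgt α κ θ * wgt α (-κ) s := by
    rw [volK, if_pos hs.1, wgt, wgt, mul_mul_mul_comm, ← exp_add, mul_comm (quart α s)]
    congr 2
    ring
  simp only [e]
  push_cast
  ring

theorem volOp_rad (h : IsArcTest χ) : volOp α κ (h.rad hα κ).toLp = h.toLp := by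
  refine Lp.ext ?_
  filter_upwards [volOp_eq hα hκ (h.rad hα κ).toLp, h.memLp.coeFn_toLp,
    ae_restrict_mem measurableSet_Ioo] with θ h1 h2 hθ
  rw [h1, show h.toLp θ = χ θ from h2, IsArcTest.toLp, wint_congr ⟨le_rfl, pi_pos.le⟩
    ((h.rad hα κ).memLp.coeFn_toLp) (Ioo_subset_Icc_self hθ), wint_rad hα h h.zero_left,
    mul_inv_cancel_left₀ (wgtC_ne hα)]

theorem volStar_rad (h : IsArcTest χ) : volStar α κ (h.rad hα (-κ)).toLp = -h.toLp := by
  refine Lp.ext ?_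
  filter_upwards [volStar_eq hα hκ (h.rad hα (-κ)).toLp, h.memLp.coeFn_toLp,
    ae_restrict_mem measurableSet_Ioo, Lp.coeFn_neg h.toLp] with θ h1 h2 hθ h3
  rw [h1, h3, Pi.neg_apply, show h.toLp θ = χ θ from h2, IsArcTest.toLp, wint_congr ⟨pi_pos.le, le_rfl⟩
    ((h.rad hα (-κ)).memLp.coeFn_toLp) (Ioo_subset_Icc_self hθ), wint_rad hα h h.zero_right,
    neg_neg, mul_inv_cancel_left₀ (wgtC_ne hα)]

theorem inner_rad_volStar (h : IsArcTest χ) (v : ArcL2) :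
    inner ℂ (h.rad hα κ).toLp (volStar α κ v) = inner ℂ h.toLp v := by
  rw [← volOp_inner hα hκ, volOp_rad hα hκ h]

theorem inner_rad_volOp (h : IsArcTest χ) (v : ArcL2) :
    inner ℂ (h.rad hα (-κ)).toLp (volOp α κ v) = -inner ℂ h.toLp v := by
  rw [← inner_conj_symm, volOp_inner hα hκ, volStar_rad hα hκ h, inner_conj_symm, inner_neg_left]

theorem volOp_injective {v : ArcL2} (hv : volOp α κ v = 0) : v = 0 := by
  refine eq_zero_of_arcTest fun χ h => ?_
  have := inner_rad_volOp hα hκ h v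
  rw [hv, inner_zero_right, eq_comm, neg_eq_zero] at this
  rw [← h.inner_toLp, this]

theorem volStar_injective {v : ArcL2} (hv : volStar α κ v = 0) : v = 0 := by
  refine eq_zero_of_arcTest fun χ h => ?_
  have := inner_rad_volStar hα hκ h v
  rw [hv, inner_zero_right, eq_comm] at this
  rw [← h.inner_toLp, this]

end WeightedPrimitive

section WeakUniqueness

variable {α κ c θ s : ℝ}

theorem tort_tendsto (hα : 0 ≤ α) : Tendsto (tort α) (𝓝[<] π) atTop := by
  have h1 : Tendsto (fun θ : ℝ => θ / 2) (𝓝[<] π) (𝓝[<] (π / 2)) := by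
    refine tendsto_nhdsWithin_of_tendsto_nhds_of_eventually_within _ ?_ ?_
    · exact ((continuous_id.div_const 2).tendsto π).mono_left nhdsWithin_le_nhds
    · filter_upwards [self_mem_nhdsWithin] with θ hθ; grind
  refine tendsto_atTop_mono' _ ?_ (tendsto_log_atTop.comp (tendsto_tan_pi_div_two.comp h1))
  filter_upwards [Ioo_mem_nhdsLT (show π / 2 < π by linarith [pi_pos])] with θ hθ
  have h2 := sinPrim_monotoneOn hα ⟨by linarith [pi_pos], by linarith [pi_pos]⟩
    (show θ ∈ Icc 0 π from ⟨by grind, hθ.2.le⟩) hθ.1.le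
  rw [sinPrim_half_pi] at h2
  simp only [Function.comp_apply, tort]
  nlinarith

theorem wgt_sq_not_integrable (hα : 0 ≤ α) (hκ : 1 / 2 ≤ κ) :
    ¬ IntegrableOn (fun θ => wgt α κ θ ^ 2) (Ioo 0 π) := by
  have hpi := pi_pos
  refine not_integrableOn_of_tendsto_norm_atTop_of_deriv_isBigO_filter (f := tort α)
    (𝓝[<] π) (Ioo_mem_nhdsLT hpi) ?_ ?_ ?_
  · filter_upwards [Ioo_mem_nhdsLT hpi] with θ hθ; exact (tort_hasDerivAt hα hθ).differentiableAt
  · exact tendsto_norm_atTop_atTop.comp (tort_tendsto hα)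
  · refine Asymptotics.IsBigO.of_bound ((1 + α) ^ 2) ?_
    filter_upwards [Ioo_mem_nhdsLT (show π / 2 < π by linarith)] with θ hθ
    have hθ' : θ ∈ Ioo 0 π := ⟨by linarith [hθ.1], hθ.2⟩
    have psin := sin_pos_of_mem hθ'
    have ptan := tan_half_pos hθ'
    rw [(tort_hasDerivAt hα hθ').deriv, norm_of_nonneg (zero_le_one.trans (one_le_tortD hα hθ')),
      norm_of_nonneg (by positivity)]
    have h2 := sinPrim_monotoneOn hα ⟨by linarith, by linarith⟩ (Ioo_subset_Icc_self hθ') hθ.1.le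
    rw [sinPrim_half_pi] at h2
    have : cos θ ≤ 0 := cos_nonpos_of_pi_div_two_le_of_le hθ.1.le (by linarith [hθ.2])
    have := sin_mul_tan_half hθ'
    have htan1 : 1 ≤ tan (θ / 2) := by nlinarith [sin_le_one θ]
    have : 0 ≤ log (tan (θ / 2)) := log_nonneg htan1
    have : log (tan (θ / 2)) ≤ κ * tort α θ * 2 := by unfold tort; nlinarith [mul_nonneg hα h2]
    have : (sin θ)⁻¹ ≤ exp (κ * tort α θ) ^ 2 := by
      rw [← exp_nat_mul, Nat.cast_ofNat]
      calc (sin θ)⁻¹ ≤ tan (θ / 2) := by rw [inv_le_iff_one_le_mul₀ psin]; linarith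
        _ = exp (log (tan (θ / 2))) := (exp_log ptan).symm
        _ ≤ _ := exp_le_exp.mpr (by linarith)
    have : 1 ≤ (1 + α) * quart α θ ^ 2 := by
      rw [quart_sq, ← div_eq_mul_inv, one_le_div (sqrt_pos.mpr (dlt_pos hα))]
      refine le_trans ?_ (dlt_le (θ := θ) hα)
      rw [sqrt_le_left (dlt_pos hα).le]
      exact le_self_pow₀ (one_le_dlt hα) two_ne_zero
    have h7 : tortD α θ ≤ (1 + α) * (sin θ)⁻¹ := by
      unfold tortD
      rw [div_eq_mul_inv, mul_inv]
      refine mul_le_mul_of_nonneg_left ?_ (by linarith)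
      exact mul_le_of_le_one_left (inv_nonneg.mpr psin.le) (inv_le_one_of_one_le₀ (one_le_dlt hα))
    calc tortD α θ ≤ (1 + α) * (sin θ)⁻¹ := h7
      _ ≤ (1 + α) * exp (κ * tort α θ) ^ 2 := by gcongr
      _ ≤ (1 + α) * (((1 + α) * quart α θ ^ 2) * exp (κ * tort α θ) ^ 2) := by
          refine mul_le_mul_of_nonneg_left ?_ (by linarith)
          nlinarith
      _ = (1 + α) ^ 2 * wgt α κ θ ^ 2 := by rw [wgt]; ring

theorem wgt_reflect (α c θ : ℝ) : wgt α c (π - θ) = wgt α (-c) θ := by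
  rw [wgt, wgt, quart_reflect, tort_reflect, neg_mul, mul_neg]

theorem wgt_neg_sq_not_integrable (hα : 0 ≤ α) (hκ : 1 / 2 ≤ κ) :
    ¬ IntegrableOn (fun θ => wgt α (-κ) θ ^ 2) (Ioo 0 π) := by
  intro h
  refine wgt_sq_not_integrable hα hκ ?_
  have hmp : MeasurePreserving (fun s : ℝ => π - s) volume volume :=
    Measure.measurePreserving_sub_left volume π
  have hme : MeasurableEmbedding (fun s : ℝ => π - s) :=
    (MeasurableEquiv.subLeft π).measurableEmbedding
  have h1 := (hmp.integrableOn_comp_preimage hme (f := fun θ => wgt α (-κ) θ ^ 2)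
    (s := Ioo 0 π)).mpr h
  have h2 : (fun s : ℝ => π - s) ⁻¹' Ioo 0 π = Ioo 0 π := by simp
  rw [h2] at h1
  refine h1.congr_fun (fun θ _ => ?_) measurableSet_Ioo
  simp only [Function.comp_apply, wgt_reflect, neg_neg]

theorem weak_unique_aux (hα : 0 ≤ α)
    (hni : ¬ IntegrableOn (fun θ => wgt α c θ ^ 2) (Ioo 0 π)) {v : ArcL2}
    (h : ∀ χ (hχ : IsArcTest χ), inner ℂ (hχ.rad hα c).toLp v = 0) : v = 0 := by
  have hloc : LocallyIntegrableOn (fun θ => (wgt α c θ : ℂ)⁻¹ * v θ) (Ioo 0 π) :=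
    (lp_integrable v).locallyIntegrableOn.continuousOn_mul
      ((wgtC_continuousOn hα).inv₀ fun _ _ => wgtC_ne hα) isOpen_Ioo.isLocallyClosed
  obtain ⟨K, hK⟩ := ae_eq_const_of_weak_deriv hloc fun ψ hψ => by
    have hχ : IsArcTest fun θ => (wgt α (-c) θ : ℂ) * starRingEnd ℂ (ψ θ) := by
      have h0 : IsArcTest fun θ => starRingEnd ℂ (ψ θ) := ⟨conjCLE.contDiff.comp hψ.smooth, by
          obtain ⟨ε, hε, hs⟩ := hψ.support
          grind⟩
      exact h0.mul fun _ hθ => wgtC_contDiffAt hα hθ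
    have h1 := h _ hχ
    rw [(hχ.rad hα c).inner_toLp] at h1
    rw [← h1]
    refine integral_congr_ae (.of_forall fun θ => ?_)
    have e1 : (fun x => (wgt α (-c) x : ℂ)⁻¹ * ((wgt α (-c) x : ℂ) * starRingEnd ℂ (ψ x)))
        = fun x => starRingEnd ℂ (ψ x) := by funext x; rw [inv_mul_cancel_left₀ (wgtC_ne hα)]
    have e2 : deriv (fun x => starRingEnd ℂ (ψ x)) θ = starRingEnd ℂ (deriv ψ θ) :=
      (conjCLE.toContinuousLinearMap.hasFDerivAt.comp_hasDerivAt θ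
        (hψ.differentiable θ).hasDerivAt).deriv
    simp only [rad, e1, e2, RCLike.inner_apply, map_mul, map_inv₀, conj_ofReal, Complex.conj_conj]
    ring
  have hv : v =ᵐ[arcMeasure] fun θ => K * (wgt α c θ : ℂ) := by
    refine arc_ae_of_volume (hK.mono fun θ h1 hθ => ?_)
    simp only [← h1 hθ]
    rw [mul_comm, mul_inv_cancel_left₀ (wgtC_ne hα)]
  by_cases hK0 : K = 0
  · refine Lp.ext ?_
    filter_upwards [hv, Lp.coeFn_zero ℂ 2 arcMeasure] with θ e1 e2
    rw [e1, e2, hK0, zero_mul, Pi.zero_apply]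
  · refine absurd ?_ hni
    have h1 : Integrable (fun θ => ‖v θ‖ ^ 2) arcMeasure := (Lp.memLp v).integrable_norm_pow two_ne_zero
    refine (h1.const_mul ((‖K‖ ^ 2)⁻¹)).congr ?_
    filter_upwards [hv] with θ e1
    have : ‖K‖ ≠ 0 := norm_ne_zero_iff.mpr hK0
    rw [e1, norm_mul, norm_real, norm_of_nonneg (wgt_pos hα).le]
    field_simp

theorem weak_unique (hα : 0 ≤ α) (hκ : 1 / 2 ≤ κ) (hc : c = κ ∨ c = -κ) {v : ArcL2}
    (h : ∀ χ (hχ : IsArcTest χ), inner ℂ (hχ.rad hα c).toLp v = 0) : v = 0 := by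
  rcases hc with rfl | rfl
  · exact weak_unique_aux hα (wgt_sq_not_integrable hα hκ) h
  · exact weak_unique_aux hα (wgt_neg_sq_not_integrable hα hκ) h

end WeakUniqueness

section RadialSystem

variable {α κ θ : ℝ}

theorem tendsto_integral_zero_left (v : ArcL2) :
    Tendsto (fun θ => ∫ s in (0 : ℝ)..θ, ‖v s‖) (𝓝[>] 0) (𝓝 0) := by
  have hpi := pi_pos
  have h1 : IntervalIntegrable (fun s => ‖v s‖) volume 0 π :=
    (intervalIntegrable_iff_integrableOn_Ioo_of_le hpi.le).mpr (lp_integrable v).norm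
  have h2 := continuousOn_primitive_interval' h1 (left_mem_uIcc)
  have h3 := h2 0 left_mem_uIcc
  rw [ContinuousWithinAt, integral_same] at h3
  refine h3.mono_left ?_
  rw [uIcc_of_le hpi.le]
  exact nhdsWithin_le_of_mem (mem_of_superset (Ioo_mem_nhdsGT hpi) Ioo_subset_Icc_self)

theorem tendsto_integral_zero_right (v : ArcL2) :
    Tendsto (fun θ => ∫ s in θ..Real.pi, ‖v s‖) (𝓝[<] π) (𝓝 0) := by
  have hpi := pi_pos
  have h1 : IntervalIntegrable (fun s => ‖v s‖) volume 0 π :=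
    (intervalIntegrable_iff_integrableOn_Ioo_of_le hpi.le).mpr (lp_integrable v).norm
  have h2 := continuousOn_primitive_interval' h1 (right_mem_uIcc)
  have h3 := h2 π right_mem_uIcc
  rw [ContinuousWithinAt, integral_same] at h3
  have h4 := (h3.mono_left (show 𝓝[<] π ≤ 𝓝[uIcc 0 π] π by
    rw [uIcc_of_le hpi.le]
    exact nhdsWithin_le_of_mem (mem_of_superset (Ioo_mem_nhdsLT hpi) Ioo_subset_Icc_self))).neg
  rw [neg_zero] at h4
  refine h4.congr fun θ => ?_
  rw [integral_symm, neg_neg]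

theorem wint_left_bound (hα : 0 ≤ α) (hκ : 0 < κ) (v : ArcL2) (hθ : θ ∈ Ioo 0 π) :
    ‖wint α κ 0 v θ‖ * exp (-κ * tort α θ) ≤ ∫ s in (0 : ℝ)..θ, ‖v s‖ := by
  have h1 : IntervalIntegrable (fun s => ‖v s‖) volume 0 θ :=
    (intervalIntegrable_iff_integrableOn_Ioo_of_le hθ.1.le).mpr
      (IntegrableOn.mono_set (lp_integrable v).norm fun s hs => ⟨hs.1, hs.2.trans hθ.2⟩)
  have h2 : ‖wint α κ 0 v θ‖ ≤ ∫ s in (0 : ℝ)..θ, exp (κ * tort α θ) * ‖v s‖ := by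
    refine intervalIntegral.norm_integral_le_of_norm_le hθ.1.le ?_ (h1.const_mul _)
    refine .of_forall fun s hs => ?_
    rw [norm_mul, norm_real, norm_of_nonneg (wgt_pos hα).le]
    exact mul_le_mul_of_nonneg_right (wgt_le_left hα hκ hθ hs) (norm_nonneg _)
  rw [intervalIntegral.integral_const_mul] at h2
  calc ‖wint α κ 0 v θ‖ * exp (-κ * tort α θ)
      ≤ exp (κ * tort α θ) * (∫ s in (0 : ℝ)..θ, ‖v s‖) * exp (-κ * tort α θ) := by gcongr
    _ = (∫ s in (0 : ℝ)..θ, ‖v s‖) * (exp (κ * tort α θ) * exp (-κ * tort α θ)) := by ring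
    _ = _ := by rw [← exp_add, neg_mul, add_neg_cancel, exp_zero, mul_one]

theorem wint_right_bound (hα : 0 ≤ α) (hκ : 0 < κ) (v : ArcL2) (hθ : θ ∈ Ioo 0 π) :
    ‖wint α (-κ) π v θ‖ * exp (κ * tort α θ) ≤ ∫ s in θ..Real.pi, ‖v s‖ := by
  have h1 : IntervalIntegrable (fun s => ‖v s‖) volume θ π :=
    (intervalIntegrable_iff_integrableOn_Ioo_of_le hθ.2.le).mpr
      (IntegrableOn.mono_set (lp_integrable v).norm fun s hs => ⟨hθ.1.trans hs.1, hs.2⟩)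
  have h2 : ‖wint α (-κ) π v θ‖ ≤ ∫ s in θ..Real.pi, exp (-κ * tort α θ) * ‖v s‖ := by
    rw [wint, integral_symm, norm_neg]
    refine intervalIntegral.norm_integral_le_of_norm_le hθ.2.le ?_ (h1.const_mul _)
    have h2 : ∀ᵐ s : ℝ, s ≠ π := by simp [ae_iff]
    filter_upwards [h2] with s hsπ hs
    rw [norm_mul, norm_real, norm_of_nonneg (wgt_pos hα).le]
    exact mul_le_mul_of_nonneg_right (wgt_le_right hα hκ hθ ⟨hs.1.le, lt_of_le_of_ne hs.2 hsπ⟩)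
      (norm_nonneg _)
  rw [intervalIntegral.integral_const_mul] at h2
  calc ‖wint α (-κ) π v θ‖ * exp (κ * tort α θ)
      ≤ exp (-κ * tort α θ) * (∫ s in θ..Real.pi, ‖v s‖) * exp (κ * tort α θ) := by gcongr
    _ = (∫ s in θ..Real.pi, ‖v s‖) * (exp (-κ * tort α θ) * exp (κ * tort α θ)) := by ring
    _ = _ := by rw [← exp_add, neg_mul, neg_add_cancel, exp_zero, mul_one]

/-- The data of a classical solution of the radial system. -/
structure IsRadialSol (α κ ν t : ℝ) (b : ℝ → ℝ) (u₀ u₁ : ArcL2) (P Q : ℝ → ℂ) : Prop where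
  left : u₀ =ᵐ[arcMeasure] fun θ => (wgt α (-κ) θ : ℂ) * P θ
  right : u₁ =ᵐ[arcMeasure] fun θ => (wgt α κ θ : ℂ) * Q θ
  derivP : ∀ θ ∈ Ioo 0 π, HasDerivAt P (I * ν * (wgt α κ θ : ℂ) ^ 2 * Q θ
    + ((t * b θ * quart α θ ^ 2 : ℝ) : ℂ) * P θ) θ
  derivQ : ∀ θ ∈ Ioo 0 π, HasDerivAt Q (I * ν * (wgt α (-κ) θ : ℂ) ^ 2 * P θ
    - ((t * b θ * quart α θ ^ 2 : ℝ) : ℂ) * Q θ) θ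
  limP : Tendsto (fun θ => ‖P θ‖ * exp (-κ * tort α θ)) (𝓝[>] 0) (𝓝 0)
  limQ : Tendsto (fun θ => ‖Q θ‖ * exp (κ * tort α θ)) (𝓝[<] π) (𝓝 0)
  bddQ : ∃ M, ∀ θ ∈ Ioo 0 π, ‖Q θ‖ * exp (κ * tort α θ) ≤ M

theorem exists_radialSol (hα : 0 ≤ α) (hκ : 0 < κ) {ν t : ℝ} {b : ℝ → ℝ} (hb : Continuous b)
    {u₀ u₁ w₀ w₁ : ArcL2} (h0 : u₀ = I • volOp α κ w₁)
    (h1 : u₁ = -I • volStar α κ w₀)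
    (hw0 : w₀ =ᵐ[arcMeasure] fun θ => (ν : ℂ) * u₀ θ + I * ((t * b θ : ℝ) : ℂ) * u₁ θ)
    (hw1 : w₁ =ᵐ[arcMeasure] fun θ => (ν : ℂ) * u₁ θ - I * ((t * b θ : ℝ) : ℂ) * u₀ θ) :
    ∃ P Q, IsRadialSol α κ ν t b u₀ u₁ P Q := by
  have hI := I_mul_I
  let P : ℝ → ℂ := fun θ => I * wint α κ 0 w₁ θ
  let Q : ℝ → ℂ := fun θ => I * wint α (-κ) π w₀ θ
  have e0 : u₀ =ᵐ[arcMeasure] fun θ => (wgt α (-κ) θ : ℂ) * P θ := by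
    have := Lp.coeFn_smul I (volOp α κ w₁)
    rw [← h0] at this
    filter_upwards [this, volOp_eq hα hκ w₁] with θ e e'
    rw [e, Pi.smul_apply, e', smul_eq_mul]
    grind
  have e1 : u₁ =ᵐ[arcMeasure] fun θ => (wgt α κ θ : ℂ) * Q θ := by
    have := Lp.coeFn_smul (-I) (volStar α κ w₀)
    rw [← h1] at this
    filter_upwards [this, volStar_eq hα hκ w₀] with θ e e'
    rw [e, Pi.smul_apply, e', smul_eq_mul]
    grind
  have hil := wint_left_integrable hα hκ w₁
  have hir := wint_right_integrable hα hκ w₀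
  have hPc : ContinuousOn P (Ioo 0 π) := continuousOn_const.mul (wint_continuousOn hil)
  have hQc : ContinuousOn Q (Ioo 0 π) := continuousOn_const.mul (wint_continuousOn hir)
  have hbc : ContinuousOn (fun θ => I * ((t * b θ : ℝ) : ℂ)) (Ioo 0 π) := by fun_prop
  have c0 : ContinuousOn (fun θ => (ν : ℂ) * ((wgt α (-κ) θ : ℂ) * P θ)
      + I * ((t * b θ : ℝ) : ℂ) * ((wgt α κ θ : ℂ) * Q θ)) (Ioo 0 π) :=
    (continuousOn_const.mul ((wgtC_continuousOn hα).mul hPc)).add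
      (hbc.mul ((wgtC_continuousOn hα).mul hQc))
  have c1 : ContinuousOn (fun θ => (ν : ℂ) * ((wgt α κ θ : ℂ) * Q θ)
      - I * ((t * b θ : ℝ) : ℂ) * ((wgt α (-κ) θ : ℂ) * P θ)) (Ioo 0 π) :=
    (continuousOn_const.mul ((wgtC_continuousOn hα).mul hQc)).sub
      (hbc.mul ((wgtC_continuousOn hα).mul hPc))
  have hw0' : w₀ =ᵐ[arcMeasure] fun θ => (ν : ℂ) * ((wgt α (-κ) θ : ℂ) * P θ)
      + I * ((t * b θ : ℝ) : ℂ) * ((wgt α κ θ : ℂ) * Q θ) := by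
    filter_upwards [hw0, e0, e1] with θ e e' e''
    rw [e, e', e'']
  have hw1' : w₁ =ᵐ[arcMeasure] fun θ => (ν : ℂ) * ((wgt α κ θ : ℂ) * Q θ)
      - I * ((t * b θ : ℝ) : ℂ) * ((wgt α (-κ) θ : ℂ) * P θ) := by
    filter_upwards [hw1, e0, e1] with θ e e' e''
    rw [e, e', e'']
  have hq : ∀ θ, (wgt α κ θ : ℂ) * (wgt α (-κ) θ : ℂ) = (quart α θ : ℂ) ^ 2 := fun θ => by
    exact_mod_cast wgt_mul_neg (α := α) (c := κ) (θ := θ)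
  refine ⟨P, Q, e0, e1, fun θ hθ => ?_, fun θ hθ => ?_, ?_, ?_, ?_⟩
  · refine ((wint_hasDerivAt hα hil hw1' c1 hθ).const_mul I).congr_deriv ?_; push_cast; grind
  · refine ((wint_hasDerivAt hα hir hw0' c0 hθ).const_mul I).congr_deriv ?_; push_cast; grind
  · refine squeeze_zero' (.of_forall fun θ => by positivity) ?_
      (tendsto_integral_zero_left w₁)
    filter_upwards [Ioo_mem_nhdsGT pi_pos] with θ hθ
    simp only [P, norm_mul, norm_I, one_mul]
    exact wint_left_bound hα hκ w₁ hθ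
  · refine squeeze_zero' (.of_forall fun θ => by positivity) ?_
      (tendsto_integral_zero_right w₀)
    filter_upwards [Ioo_mem_nhdsLT pi_pos] with θ hθ
    simp only [Q, norm_mul, norm_I, one_mul]
    exact wint_right_bound hα hκ w₀ hθ
  · refine ⟨∫ s in (0 : ℝ)..Real.pi, ‖w₀ s‖, fun θ hθ => ?_⟩
    simp only [Q, norm_mul, norm_I, one_mul]
    refine (wint_right_bound hα hκ w₀ hθ).trans ?_
    rw [integral_of_le hθ.2.le, integral_of_le pi_pos.le]
    refine setIntegral_mono_set ?_ (.of_forall fun s => norm_nonneg _)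
      (LE.le.eventuallyLE (Ioc_subset_Ioc_left hθ.1.le))
    rw [integrableOn_Ioc_iff_integrableOn_Ioo]
    exact (lp_integrable w₀).norm

theorem const_of_deriv_zero {f : ℝ → ℂ} (hf : ∀ θ ∈ Ioo 0 π, HasDerivAt f 0 θ) :
    ∃ c, ∀ θ ∈ Ioo 0 π, f θ = c := by
  refine ⟨f (π / 2), fun θ hθ => ?_⟩
  exact isOpen_Ioo.is_const_of_deriv_eq_zero isPreconnected_Ioo
    (fun x hx => (hf x hx).differentiableAt.differentiableWithinAt)
    (fun x hx => (hf x hx).deriv) hθ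
    ⟨by linarith [pi_pos], by linarith [pi_pos]⟩

theorem lp_eq_zero_of {w : ℝ → ℝ} {u : ArcL2} {P : ℝ → ℂ}
    (h : u =ᵐ[arcMeasure] fun θ => (w θ : ℂ) * P θ) (hP : ∀ θ ∈ Ioo 0 π, P θ = 0) :
    u = 0 := by
  refine Lp.ext ?_
  filter_upwards [h, Lp.coeFn_zero ℂ 2 arcMeasure, ae_restrict_mem measurableSet_Ioo] with θ e1 e2 hθ
  rw [e1, e2, hP θ hθ, mul_zero, Pi.zero_apply]

theorem eq_zero_of_hasDerivAt_mul (hα : 0 ≤ α) {f : ℝ → ℂ} {r x : ℝ} {l : Filter ℝ} [l.NeBot]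
    (hl : l ≤ 𝓝 x) (hm : Ioo 0 π ∈ l)
    (hf : ∀ θ ∈ Ioo 0 π, HasDerivAt f (((r * (sin θ / dlt α θ) : ℝ) : ℂ) * f θ) θ)
    (h0 : Tendsto (fun θ => ‖f θ‖) l (𝓝 0)) : ∀ θ ∈ Ioo 0 π, f θ = 0 := by
  have hS : ∀ θ : ℝ, HasDerivAt (fun x => Complex.exp ((-r * sinPrim α x : ℝ) : ℂ))
      (Complex.exp ((-r * sinPrim α θ : ℝ) : ℂ) * ((-r * (sin θ / dlt α θ) : ℝ) : ℂ)) θ :=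
    fun θ => (((sinPrim_hasDerivAt hα θ).const_mul (-r)).ofReal_comp).cexp
  obtain ⟨c, hc⟩ := const_of_deriv_zero
    (f := fun θ => Complex.exp ((-r * sinPrim α θ : ℝ) : ℂ) * f θ) fun θ hθ => by
      refine ((hS θ).mul (hf θ hθ)).congr_deriv ?_
      push_cast
      ring
  have hlim := (((hS x).continuousAt.norm).tendsto.mono_left hl).mul h0
  rw [mul_zero] at hlim
  have hc0 : ‖c‖ = 0 := by
    refine tendsto_nhds_unique (tendsto_const_nhds.congr' ?_) hlim
    filter_upwards [hm] with θ hθ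
    rw [← norm_mul, hc θ hθ]
  intro θ hθ
  have := hc θ hθ
  rw [norm_eq_zero.mp hc0] at this
  exact (mul_eq_zero.mp this).resolve_left (Complex.exp_ne_zero _)

theorem half_pi_mem : π / 2 ∈ Ioo 0 π := ⟨by linarith [pi_pos], by linarith [pi_pos]⟩

theorem tort_half_pi (α : ℝ) : tort α (π / 2) = 0 := by
  have h := tort_reflect α (π / 2)
  rw [sub_half] at h
  linarith

theorem IsRadialSol.eq_zero (hα : 0 ≤ α) (hκ : 0 < κ) {t a : ℝ} {b : ℝ → ℝ}
    (hb : ∀ θ, b θ * quart α θ ^ 2 = a * (sin θ / dlt α θ)) {u₀ u₁ : ArcL2} {P Q : ℝ → ℂ}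
    (h : IsRadialSol α κ 0 t b u₀ u₁ P Q) : u₀ = 0 ∧ u₁ = 0 := by
  have hb' : ∀ θ, t * b θ * quart α θ ^ 2 = t * a * (sin θ / dlt α θ) := fun θ => by grind
  have hlt := fun θ (hθ : θ ∈ Ioo 0 π) => (tort_strictMonoOn hα).lt_iff_lt hθ half_pi_mem
  have hgt := fun θ (hθ : θ ∈ Ioo 0 π) => (tort_strictMonoOn hα).lt_iff_lt half_pi_mem hθ
  rw [tort_half_pi] at hlt hgt
  constructor
  · refine lp_eq_zero_of h.left (eq_zero_of_hasDerivAt_mul hα (r := t * a)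
      (nhdsWithin_le_nhds (s := Ioi 0)) (Ioo_mem_nhdsGT pi_pos) (fun θ hθ => ?_) ?_)
    · refine (h.derivP θ hθ).congr_deriv ?_; rw [hb']; simp
    · refine squeeze_zero' (.of_forall fun θ => norm_nonneg _) ?_ h.limP
      filter_upwards [Ioo_mem_nhdsGT half_pi_mem.1] with θ hθ
      refine le_mul_of_one_le_right (norm_nonneg _) (one_le_exp ?_)
      have := (hlt θ ⟨hθ.1, hθ.2.trans half_pi_mem.2⟩).2 hθ.2
      nlinarith
  · refine lp_eq_zero_of h.right (eq_zero_of_hasDerivAt_mul hα (r := -(t * a))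
      (nhdsWithin_le_nhds (s := Iio π)) (Ioo_mem_nhdsLT pi_pos) (fun θ hθ => ?_) ?_)
    · refine (h.derivQ θ hθ).congr_deriv ?_; rw [hb']; simp
    · refine squeeze_zero' (.of_forall fun θ => norm_nonneg _) ?_ h.limQ
      filter_upwards [Ioo_mem_nhdsLT half_pi_mem.2] with θ hθ
      refine le_mul_of_one_le_right (norm_nonneg _) (one_le_exp ?_)
      have := (hgt θ ⟨half_pi_mem.1.trans hθ.1, hθ.2⟩).2 hθ.1
      nlinarith

theorem linear_system_unique {E : Type*} [NormedAddCommGroup E] [NormedSpace ℂ E]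
    {A : ℝ → E →L[ℂ] E} (hA : ContinuousOn A (Ioo 0 π)) {f : ℝ → E}
    (hf : ∀ θ ∈ Ioo 0 π, HasDerivAt f (A θ (f θ)) θ) {x₀ : ℝ} (hx₀ : x₀ ∈ Ioo 0 π)
    (h0 : f x₀ = 0) : ∀ θ ∈ Ioo 0 π, f θ = 0 := by
  intro θ hθ
  obtain ⟨y, hy0, hy⟩ := exists_between (lt_min hx₀.1 hθ.1)
  obtain ⟨z, hz, hzπ⟩ := exists_between (max_lt hx₀.2 hθ.2)
  have hsub : Icc y z ⊆ Ioo 0 π := fun x hx => ⟨hy0.trans_le hx.1, hx.2.trans_lt hzπ⟩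
  obtain ⟨M, hM⟩ := isCompact_Icc.exists_bound_of_continuousOn (hA.mono hsub)
  exact ODE_solution_unique_of_mem_Ioo (a := y) (b := z) (t₀ := x₀)
    (v := fun x p => A x p) (s := fun _ => univ) (K := M.toNNReal) (g := fun _ => 0)
    (fun x hx => ((A x).lipschitz.weaken
      (NNReal.le_toNNReal_of_coe_le (hM x (Ioo_subset_Icc_self hx)))).lipschitzOnWith)
    ⟨hy.trans_le (min_le_left _ _), (le_max_left _ _).trans_lt hz⟩
    (fun x hx => ⟨hf x (hsub (Ioo_subset_Icc_self hx)), mem_univ _⟩)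
    (fun x _ => ⟨(hasDerivAt_const x (0 : E)).congr_deriv (map_zero _).symm, mem_univ _⟩) h0
    ⟨hy.trans_le (min_le_right _ _), (le_max_right _ _).trans_lt hz⟩

theorem IsRadialSol.proportional (hα : 0 ≤ α) {ν t : ℝ} {b : ℝ → ℝ}
    (hb : Continuous b) {u₀ u₁ v₀ v₁ : ArcL2} {P Q P' Q' : ℝ → ℂ}
    (h : IsRadialSol α κ ν t b u₀ u₁ P Q) (h' : IsRadialSol α κ ν t b v₀ v₁ P' Q')
    (hu : u₀ ≠ 0 ∨ u₁ ≠ 0) : ∃ c : ℂ, v₀ = c • u₀ ∧ v₁ = c • u₁ := by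
  have hpi := pi_pos
  obtain ⟨M, hM⟩ := h.bddQ
  obtain ⟨M', hM'⟩ := h'.bddQ
  -- the Wronskian vanishes
  obtain ⟨w, hw⟩ := const_of_deriv_zero (f := fun θ => P θ * Q' θ - P' θ * Q θ) fun θ hθ => by
    refine (((h.derivP θ hθ).mul (h'.derivQ θ hθ)).sub
      ((h'.derivP θ hθ).mul (h.derivQ θ hθ))).congr_deriv ?_
    ring
  have hw0 : w = 0 := by
    have hlim : Tendsto (fun θ => ‖P θ‖ * exp (-κ * tort α θ) * M'
        + ‖P' θ‖ * exp (-κ * tort α θ) * M) (𝓝[>] 0) (𝓝 0) := by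
      simpa using (h.limP.mul_const M').add (h'.limP.mul_const M)
    have hle : ‖w‖ ≤ 0 := by
      refine ge_of_tendsto hlim ?_
      filter_upwards [Ioo_mem_nhdsGT hpi] with θ hθ
      have hE : exp (-κ * tort α θ) * exp (κ * tort α θ) = 1 := by
        rw [← exp_add, neg_mul, neg_add_cancel, exp_zero]
      have e : ∀ p q : ℂ, ‖p * q‖ = ‖p‖ * exp (-κ * tort α θ) * (‖q‖ * exp (κ * tort α θ)) := by
        intro p q
        rw [norm_mul]
        grind
      rw [← hw θ hθ]
      refine (norm_sub_le _ _).trans ?_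
      rw [e, e]
      bound
    exact norm_le_zero_iff.mp hle
  have cw : ∀ c, ContinuousOn (fun θ => I * ν * (wgt α c θ : ℂ) ^ 2) (Ioo 0 π) :=
    fun c => continuousOn_const.mul ((wgtC_continuousOn hα).pow 2)
  have cb : ContinuousOn (fun θ => ((t * b θ * quart α θ ^ 2 : ℝ) : ℂ)) (Ioo 0 π) := by
    have := (quart_contDiff hα (n := 0)).continuous
    fun_prop
  have huniq : ∀ X Y : ℝ → ℂ, (∀ θ ∈ Ioo 0 π, HasDerivAt X (I * ν * (wgt α κ θ : ℂ) ^ 2 * Y θ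
        + ((t * b θ * quart α θ ^ 2 : ℝ) : ℂ) * X θ) θ) →
      (∀ θ ∈ Ioo 0 π, HasDerivAt Y (I * ν * (wgt α (-κ) θ : ℂ) ^ 2 * X θ
        - ((t * b θ * quart α θ ^ 2 : ℝ) : ℂ) * Y θ) θ) →
      X (π / 2) = 0 → Y (π / 2) = 0 → ∀ θ ∈ Ioo 0 π, X θ = 0 ∧ Y θ = 0 := by
    intro X Y hX hY hX0 hY0
    let e₁ := ContinuousLinearMap.inl ℂ ℂ ℂ
    let e₂ := ContinuousLinearMap.inr ℂ ℂ ℂ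
    let p₁ := fst ℂ ℂ ℂ
    let p₂ := snd ℂ ℂ ℂ
    have := linear_system_unique (f := fun θ => (X θ, Y θ))
      ((((cw κ).smul (continuousOn_const (c := e₁ ∘L p₂))).add
        (cb.smul (continuousOn_const (c := e₁ ∘L p₁ - e₂ ∘L p₂)))).add
        ((cw (-κ)).smul (continuousOn_const (c := e₂ ∘L p₁))))
      (fun θ hθ => ((hX θ hθ).prodMk (hY θ hθ)).congr_deriv (by
        ext <;> simp [e₁, e₂, p₁, p₂]; ring)) half_pi_mem (Prod.ext hX0 hY0)
    exact fun θ hθ => Prod.ext_iff.1 (this θ hθ)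
  have hne : P (π / 2) ≠ 0 ∨ Q (π / 2) ≠ 0 := by
    by_contra hcon
    rw [not_or, not_not, not_not] at hcon
    have h0 := huniq P Q h.derivP h.derivQ hcon.1 hcon.2
    rcases hu with hu | hu
    · exact hu (lp_eq_zero_of h.left fun θ hθ => (h0 θ hθ).1)
    · exact hu (lp_eq_zero_of h.right fun θ hθ => (h0 θ hθ).2)
  have hW := hw _ half_pi_mem
  rw [hw0] at hW
  obtain ⟨c, hc1, hc2⟩ : ∃ c : ℂ, P' (π / 2) = c * P (π / 2) ∧ Q' (π / 2) = c * Q (π / 2) := by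
    rcases hne with h0 | h0
    · refine ⟨P' (π / 2) / P (π / 2), by field_simp, ?_⟩
      grind
    · refine ⟨Q' (π / 2) / Q (π / 2), ?_, by field_simp⟩
      grind
  have h0 := huniq (fun θ => P' θ - c * P θ) (fun θ => Q' θ - c * Q θ)
    (fun θ hθ => ((h'.derivP θ hθ).sub ((h.derivP θ hθ).const_mul c)).congr_deriv (by ring))
    (fun θ hθ => ((h'.derivQ θ hθ).sub ((h.derivQ θ hθ).const_mul c)).congr_deriv (by ring))
    (by rw [hc1, sub_self]) (by rw [hc2, sub_self])
  refine ⟨c, Lp.ext ?_, Lp.ext ?_⟩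
  · filter_upwards [h.left, h'.left, Lp.coeFn_smul c u₀, ae_restrict_mem measurableSet_Ioo]
      with θ e1 e2 e3 hθ
    rw [e2, e3, Pi.smul_apply, e1, smul_eq_mul, sub_eq_zero.mp (h0 θ hθ).1]
    ring
  · filter_upwards [h.right, h'.right, Lp.coeFn_smul c u₁, ae_restrict_mem measurableSet_Ioo]
      with θ e1 e2 e3 hθ
    rw [e2, e3, Pi.smul_apply, e1, smul_eq_mul, sub_eq_zero.mp (h0 θ hθ).2]
    ring

end RadialSystem

section VolterraBound

variable {x N θ s : ℝ}

theorem arg_mem (hN : 0 < N) (hs : s ∈ Icc x (x + π / (2 * N))) : N * (s - x) ∈ Icc 0 (π / 2) := by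
  have e : N * (π / (2 * N)) = π / 2 := by field_simp
  refine ⟨mul_nonneg hN.le (by linarith [hs.1]), ?_⟩
  rw [← e]
  exact mul_le_mul_of_nonneg_left (by linarith [hs.2]) hN.le

theorem lintegral_cos_le (hN : 0 < N) (hθ : θ ∈ Ioo x (x + π / (2 * N))) :
    ∫⁻ s in Ioo x θ, ofReal (cos (N * (s - x))) ≤ ofReal (1 / N) * ofReal (sin (N * (θ - x))) := by
  have := pi_pos
  have hmem : ∀ s ∈ Ioo x θ, N * (s - x) ∈ Icc 0 (π / 2) := fun s hs =>
    arg_mem hN ⟨hs.1.le, (hs.2.trans hθ.2).le⟩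
  have hθm := arg_mem hN (Ioo_subset_Icc_self hθ)
  rw [← ofReal_mul (by positivity)]
  refine (lintegral_deriv_le (m := 0) (M := 1 / N * sin (N * (θ - x)))
    (u := fun s => 1 / N * sin (N * (s - x))) hθ.1 (fun s _ => ?_) (fun s hs => ?_)
    (fun s hs => ⟨?_, ?_⟩)).trans_eq (by rw [sub_zero])
  · refine ((((hasDerivAt_id s).sub_const x).const_mul N).sin.const_mul (1 / N)).congr_deriv ?_
    grind
  · exact cos_nonneg_of_mem_Icc ⟨by grind, (hmem s hs).2⟩
  · exact mul_nonneg (by positivity) (sin_nonneg_of_nonneg_of_le_pi (hmem s hs).1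
      (by grind))
  · refine mul_le_mul_of_nonneg_left ?_ (by positivity)
    exact sin_le_sin_of_le_of_le_pi_div_two (by grind) hθm.2
      (mul_le_mul_of_nonneg_left (by linarith [hs.2]) hN.le)

theorem lintegral_sin_le (hN : 0 < N) (hs : s ∈ Ioo x (x + π / (2 * N))) :
    ∫⁻ θ in Ioo s (x + π / (2 * N)), ofReal (sin (N * (θ - x)))
      ≤ ofReal (1 / N) * ofReal (cos (N * (s - x))) := by
  have := pi_pos
  have hmem : ∀ θ ∈ Ioo s (x + π / (2 * N)), N * (θ - x) ∈ Icc 0 (π / 2) :=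
    fun θ hθ => arg_mem hN ⟨(hs.1.trans hθ.1).le, hθ.2.le⟩
  have hsm := arg_mem hN (Ioo_subset_Icc_self hs)
  rw [← ofReal_mul (by positivity)]
  refine (lintegral_deriv_le (m := -(1 / N * cos (N * (s - x)))) (M := 0)
    (u := fun θ => -(1 / N * cos (N * (θ - x)))) hs.2 (fun θ _ => ?_) (fun θ hθ => ?_)
    (fun θ hθ => ⟨?_, ?_⟩)).trans_eq (by congr 1; ring)
  · refine ((((hasDerivAt_id θ).sub_const x).const_mul N).cos.const_mul (1 / N)).neg.congr_deriv ?_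
    grind
  · exact sin_nonneg_of_nonneg_of_le_pi (hmem θ hθ).1 (by grind)
  · refine neg_le_neg (mul_le_mul_of_nonneg_left ?_ (by positivity))
    exact cos_le_cos_of_nonneg_of_le_pi hsm.1 (by grind)
      (mul_le_mul_of_nonneg_left (by linarith [hθ.1]) hN.le)
  · refine neg_nonpos.mpr (mul_nonneg (by positivity) ?_)
    exact cos_nonneg_of_mem_Icc ⟨by grind, (hmem θ hθ).2⟩

theorem ite_lintegral {y z a b : ℝ} {p : ℝ → Prop} [DecidablePred p]
    (hp : MeasurableSet {s | p s}) (h : ∀ s, s ∈ Ioo a b ↔ s ∈ Ioo y z ∧ p s) (g : ℝ → ENNReal) :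
    ∫⁻ s in Ioo y z, (if p s then 1 else 0) * g s = ∫⁻ s in Ioo a b, g s := by
  have e : Ioo a b = {s | p s} ∩ Ioo y z := by ext s; rw [h, and_comm]; rfl
  rw [e, ← setLIntegral_indicator hp]
  refine lintegral_congr fun s => ?_
  by_cases hs : p s <;> simp [hs]

theorem ae_cos_pos (hN : 0 < N) : ∀ᵐ s ∂volume.restrict (Ioo x (x + π / (2 * N))),
    ofReal (cos (N * (s - x))) ≠ 0 := by
  filter_upwards [ae_restrict_mem measurableSet_Ioo] with s hs
  rw [ne_eq, ENNReal.ofReal_eq_zero, not_le]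
  have e : N * (π / (2 * N)) = π / 2 := by field_simp
  refine cos_pos_of_mem_Ioo ⟨?_, ?_⟩ <;> nlinarith [hs.1, hs.2, pi_pos]

theorem volterra_left (hN : 0 < N) {v : ℝ → ENNReal} (hv : Measurable v) :
    ∫⁻ θ in Ioo x (x + π / (2 * N)), (∫⁻ s in Ioo x θ, v s) ^ 2
      ≤ ofReal (1 / N) ^ 2 * ∫⁻ s in Ioo x (x + π / (2 * N)), v s ^ 2 := by
  have hc : Measurable fun s => ofReal (cos (N * (s - x))) :=
    (Continuous.measurable (by fun_prop)).ennreal_ofReal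
  have hs : Measurable fun s => ofReal (sin (N * (s - x))) :=
    (Continuous.measurable (by fun_prop)).ennreal_ofReal
  have hrow : ∀ (g : ℝ → ENNReal), ∀ θ ∈ Ioo x (x + π / (2 * N)),
      ∫⁻ s in Ioo x (x + π / (2 * N)), (if s < θ then 1 else 0) * g s = ∫⁻ s in Ioo x θ, g s :=
    fun g θ hθ => ite_lintegral measurableSet_Iio
      (fun s => ⟨fun h => ⟨⟨h.1, h.2.trans hθ.2⟩, h.2⟩, fun h => ⟨h.1.1, h.2⟩⟩) g
  have key := schur_test (μ := volume.restrict (Ioo x (x + π / (2 * N))))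
    (ν := volume.restrict (Ioo x (x + π / (2 * N))))
    (k := fun θ s => if s < θ then 1 else 0)
    (Measurable.ite (measurableSet_lt measurable_snd measurable_fst) measurable_const
      measurable_const) hs hc hv.aemeasurable (ae_cos_pos hN) (by simp)
    (A := ofReal (1 / N)) (B := ofReal (1 / N))
    (by
      filter_upwards [ae_restrict_mem measurableSet_Ioo] with θ hθ
      exact (hrow _ θ hθ).trans_le (lintegral_cos_le hN hθ))
    (by
      filter_upwards [ae_restrict_mem measurableSet_Ioo] with s hs
      exact (ite_lintegral measurableSet_Ioi (fun θ => ⟨fun h => ⟨⟨hs.1.trans h.1, h.2⟩, h.1⟩,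
        fun h => ⟨h.2, h.1.2⟩⟩) _).trans_le (lintegral_sin_le hN hs))
  rw [pow_two (ofReal (1 / N))]
  refine (setLIntegral_congr_fun measurableSet_Ioo fun θ hθ => ?_).trans_le key
  simp only [hrow v θ hθ]

theorem volterra_right (hN : 0 < N) {v : ℝ → ENNReal} (hv : Measurable v) :
    ∫⁻ θ in Ioo x (x + π / (2 * N)), (∫⁻ s in Ioo θ (x + π / (2 * N)), v s) ^ 2
      ≤ ofReal (1 / N) ^ 2 * ∫⁻ s in Ioo x (x + π / (2 * N)), v s ^ 2 := by
  have h := volterra_left (x := π - (x + π / (2 * N))) hN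
    (v := fun s => v (π - s)) (hv.comp (measurable_const.sub measurable_id))
  have e : π - (x + π / (2 * N)) + π / (2 * N) = π - x := by ring
  rw [e] at h
  simp only [lintegral_reflect (fun s => v s ^ 2), lintegral_reflect v, sub_sub_cancel] at h
  refine le_trans (le_of_eq ?_) h
  have := lintegral_reflect (fun θ => (∫⁻ s in Ioo θ (x + π / (2 * N)), v s) ^ 2)
    (π - (x + π / (2 * N))) (π - x)
  rw [sub_sub_cancel, sub_sub_cancel] at this
  exact this.symm

end VolterraBound

section Counting

variable {α κ θ s x y : ℝ}

theorem jordan {m : ℝ} (h1 : π / 2 * m ≤ θ) (h2 : π / 2 * m ≤ π - θ)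
    (hθ : θ ∈ Ioo 0 π) : m ≤ sin θ := by
  have hpi := pi_pos
  rcases le_total θ (π / 2) with h | h
  · have := mul_le_sin hθ.1.le h
    refine le_trans ?_ this
    rw [div_mul_eq_mul_div, le_div_iff₀ hpi]
    linarith
  · have := mul_le_sin (x := π - θ) (by linarith [hθ.2]) (by linarith)
    rw [sin_pi_sub] at this
    refine le_trans ?_ this
    rw [div_mul_eq_mul_div, le_div_iff₀ hpi]
    linarith

theorem lintegral_Ioo_sum (f : ℝ → ENNReal) {h : ℝ} (hh : 0 < h) (M : ℕ) :
    ∫⁻ s in Ioo 0 (M * h), f s = ∑ m ∈ Finset.range M, ∫⁻ s in Ioo (m * h) (m * h + h), f s := by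
  have hIoc : ∀ a b : ℝ, ∫⁻ s in Ioo a b, f s = ∫⁻ s in Ioc a b, f s := fun a b =>
    setLIntegral_congr Ioo_ae_eq_Ioc
  simp only [hIoc]
  induction M with
  | zero => simp
  | succ M ih =>
    rw [Finset.sum_range_succ, ← ih]
    have e : Ioc 0 (((M + 1 : ℕ) : ℝ) * h) = Ioc 0 (M * h) ∪ Ioc (M * h) (M * h + h) := by
      rw [Ioc_union_Ioc_eq_Ioc (by positivity) (by linarith)]
      grind
    rw [e, lintegral_union measurableSet_Ioc]
    simp

variable (hα : 0 ≤ α)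
include hα

theorem exists_representer (hκ : 0 < κ) (hx : x ∈ Ico 0 π) :
    ∃ f : ArcL2, ∀ w : ArcL2, inner ℂ f w = wint α κ 0 w x := by
  rcases hx.1.eq_or_lt with h0 | h0
  · refine ⟨0, fun w => ?_⟩; rw [← h0, inner_zero_left, wint, integral_same]
  have hx' : x ∈ Ioo 0 π := ⟨h0, hx.2⟩
  have hm : MemLp ((Ioo 0 x).indicator fun s => (wgt α κ s : ℂ)) 2 arcMeasure := by
    refine MemLp.of_bound ?_ (exp (κ * tort α x)) (.of_forall fun s => ?_)
    · exact ((Complex.measurable_ofReal.comp (wgt_measurable hα)).indicator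
        measurableSet_Ioo).aestronglyMeasurable
    · by_cases hs : s ∈ Ioo 0 x
      · rw [indicator_of_mem hs, norm_real, norm_of_nonneg (wgt_pos hα).le]
        exact wgt_le_left hα hκ hx' (Ioo_subset_Ioc_self hs)
      · rw [indicator_of_notMem hs, norm_zero]; exact (exp_pos _).le
  refine ⟨hm.toLp, fun w => ?_⟩
  rw [L2.inner_def, wint, integral_of_le h0.le, integral_Ioc_eq_integral_Ioo]
  have h1 : ∫ s, inner ℂ ((hm.toLp _ : ArcL2) s) (w s) ∂arcMeasure
      = ∫ s in Ioo 0 π, (Ioo 0 x).indicator (fun s => (wgt α κ s : ℂ) * w s) s := by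
    refine integral_congr_ae ?_
    filter_upwards [hm.coeFn_toLp] with s hs
    rw [hs, RCLike.inner_apply]
    by_cases h : s ∈ Ioo 0 x
    · rw [indicator_of_mem h, indicator_of_mem h]; simp [mul_comm]
    · rw [indicator_of_notMem h, indicator_of_notMem h]; simp
  rw [h1, setIntegral_indicator measurableSet_Ioo,
    inter_eq_right.mpr (Ioo_subset_Ioo_right hx.2.le)]

theorem wgt_mul_le : wgt α (-κ) θ * wgt α κ s ≤ exp (κ * (tort α s - tort α θ)) := by
  calc wgt α (-κ) θ * wgt α κ s ≤ exp (-κ * tort α θ) * exp (κ * tort α s) :=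
        mul_le_mul (wgt_le_exp hα) (wgt_le_exp hα) (wgt_pos hα).le (exp_pos _).le
    _ = _ := by rw [← exp_add]; congr 1; ring

theorem enorm_weighted_le {w : ℝ → ℂ} {c : ℝ} {A : Set ℝ} (hA : MeasurableSet A)
    (h : ∀ s ∈ A, exp (κ * (tort α s - tort α θ)) ≤ c) :
    ‖(wgt α (-κ) θ : ℂ) * ∫ s in A, (wgt α κ s : ℂ) * w s‖ₑ ≤ ofReal c * ∫⁻ s in A, ‖w s‖ₑ := by
  rw [← integral_const_mul, ← lintegral_const_mul' _ _ ofReal_ne_top]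
  refine (enorm_integral_le_lintegral_enorm _).trans (setLIntegral_mono' hA fun s hs => ?_)
  rw [← mul_assoc, enorm_mul, ← Complex.ofReal_mul, ← ofReal_norm (_ : ℂ), norm_real,
    norm_of_nonneg (mul_nonneg (wgt_pos hα).le (wgt_pos hα).le)]
  exact mul_le_mul_left (ofReal_le_ofReal ((wgt_mul_le hα).trans (h s hs))) _

theorem piece_left (hκ : 0 < κ) {N : ℝ} (hN : 0 < N) (w : ArcL2) (hx : 0 ≤ x)
    (hxπ : x + π / (2 * N) ≤ π) (hw : wint α κ 0 w x = 0) {c : ℝ} (hc : 1 ≤ c) :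
    ∫⁻ θ in Ioo x (x + π / (2 * N)), ‖(wgt α (-κ) θ : ℂ) * wint α κ 0 w θ‖ₑ ^ 2
      ≤ ofReal (c / N) ^ 2 * ∫⁻ s in Ioo x (x + π / (2 * N)), ‖w s‖ₑ ^ 2 := by
  have hI := wint_left_integrable hα hκ w
  have h1 := volterra_left (x := x) hN (v := fun s => ‖w s‖ₑ)
    (Lp.stronglyMeasurable w).measurable.enorm
  have h2 : ofReal (c / N) ^ 2 = ofReal c ^ 2 * ofReal (1 / N) ^ 2 := by
    rw [← mul_pow, ← ofReal_mul (by linarith), mul_one_div]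
  rw [h2, mul_assoc]
  refine le_trans ?_ (mul_le_mul_right h1 _)
  rw [← lintegral_const_mul' _ _ (by finiteness)]
  refine setLIntegral_mono' measurableSet_Ioo fun θ hθ => ?_
  have hθm : θ ∈ Ioo 0 π := ⟨hx.trans_lt hθ.1, hθ.2.trans_le hxπ⟩
  rw [← mul_pow]
  refine ENNReal.pow_le_pow_left ?_
  have h3 : wint α κ 0 w θ = ∫ s in Ioo x θ, (wgt α κ s : ℂ) * w s := by
    have hIx : IntervalIntegrable (fun s => (wgt α κ s : ℂ) * w s) volume 0 x := by
      rcases hx.eq_or_lt with h0 | h0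
      · rw [← h0]
      grind
    have h4 := integral_add_adjacent_intervals hIx (hIx.symm.trans (hI θ hθm))
    rw [wint] at hw
    rw [hw, zero_add] at h4
    rw [wint, ← h4, integral_of_le hθ.1.le, integral_Ioc_eq_integral_Ioo]
  rw [h3]
  refine enorm_weighted_le hα measurableSet_Ioo fun s hs => le_trans ?_ hc
  rw [exp_le_one_iff]
  have := (tort_strictMonoOn hα) (show s ∈ Ioo 0 π from
    ⟨hx.trans_lt hs.1, hs.2.trans hθm.2⟩) hθm hs.2
  nlinarith

theorem piece_right (hκ : 0 < κ) {N : ℝ} (hN : 0 < N) (w : ArcL2) (hx : 0 ≤ x)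
    (hxπ : x + π / (2 * N) < π) (hw : wint α κ 0 w (x + π / (2 * N)) = 0) {c : ℝ}
    (hc0 : 0 ≤ c) (hc : ∀ θ s, x < θ → θ < s → s < x + π / (2 * N) →
      exp (κ * (tort α s - tort α θ)) ≤ c) :
    ∫⁻ θ in Ioo x (x + π / (2 * N)), ‖(wgt α (-κ) θ : ℂ) * wint α κ 0 w θ‖ₑ ^ 2
      ≤ ofReal (c / N) ^ 2 * ∫⁻ s in Ioo x (x + π / (2 * N)), ‖w s‖ₑ ^ 2 := by
  have : 0 < π / (2 * N) := by have := pi_pos; positivity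
  have hI := wint_left_integrable hα hκ w
  have h1 := volterra_right (x := x) hN (v := fun s => ‖w s‖ₑ)
    (Lp.stronglyMeasurable w).measurable.enorm
  have h2 : ofReal (c / N) ^ 2
      = ofReal c ^ 2 * ofReal (1 / N) ^ 2 := by rw [← mul_pow, ← ofReal_mul hc0, mul_one_div]
  rw [h2, mul_assoc]
  refine le_trans ?_ (mul_le_mul_right h1 _)
  rw [← lintegral_const_mul' _ _ (by finiteness)]
  refine setLIntegral_mono' measurableSet_Ioo fun θ hθ => ?_
  have hθm : θ ∈ Ioo 0 π := ⟨hx.trans_lt hθ.1, hθ.2.trans hxπ⟩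
  have hxm : x + π / (2 * N) ∈ Ioo 0 π := ⟨by linarith, hxπ⟩
  rw [← mul_pow]
  refine ENNReal.pow_le_pow_left ?_
  have h3 : wint α κ 0 w θ = -∫ s in Ioo θ (x + π / (2 * N)), (wgt α κ s : ℂ) * w s := by
    have h4 := integral_add_adjacent_intervals (hI θ hθm) ((hI θ hθm).symm.trans (hI _ hxm))
    rw [wint] at hw
    rw [hw, integral_of_le hθ.2.le, integral_Ioc_eq_integral_Ioo] at h4
    exact eq_neg_of_add_eq_zero_left h4
  rw [h3, mul_neg, enorm_neg]
  exact enorm_weighted_le hα measurableSet_Ioo fun s hs => hc θ s hθ.1 hs.1 hs.2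

theorem tort_sub_le {G : ℝ} (h0 : 0 < θ) (hs : s < π) (hθs : θ < s)
    (hG : ∀ ξ ∈ Ioo θ s, tortD α ξ ≤ G) : tort α s - tort α θ ≤ G * (s - θ) := by
  have hsub : Icc θ s ⊆ Ioo 0 π := fun ξ hξ => ⟨h0.trans_le hξ.1, hξ.2.trans_lt hs⟩
  obtain ⟨ξ, hξ, he⟩ := exists_hasDerivAt_eq_slope (tort α) (tortD α) hθs
    ((tort_continuousOn hα).mono hsub)
    (fun ξ hξ => tort_hasDerivAt hα (hsub (Ioo_subset_Icc_self hξ)))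
  have := hG ξ hξ
  rw [he, div_le_iff₀ (by linarith)] at this
  exact this

theorem tortD_le {m : ℝ} (hm : 0 < m) (h : m ≤ sin θ) : tortD α θ ≤ (1 + α) / m := by
  unfold tortD
  have := one_le_dlt (θ := θ) hα
  refine div_le_div_of_nonneg_left (by linarith) hm ?_
  nlinarith

/-- The Volterra operator is small on a subspace of small codimension. -/
theorem exists_small_codim (hα' : α ≤ 1 / 4) (hκ : 0 < κ) {N J : ℕ} (hN : 1 ≤ N) (hJ : 26 * κ ≤ J) :
    ∃ U : Submodule ℂ ArcL2, FiniteDimensional ℂ U ∧ finrank ℂ U ≤ N + 2 * J ∧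
      ∀ w : ArcL2, (∀ u ∈ U, inner ℂ u w = 0) → ‖volOp α κ w‖ ≤ exp (1 / 26) / N * ‖w‖ := by
  classical
  have hpi := pi_pos
  have hN0 : (0 : ℝ) < N := by exact_mod_cast hN
  set h : ℝ := π / (2 * N) with hh
  have hh0 : 0 < h := by positivity
  have h2N : (2 * N : ℝ) * h = π := by rw [hh]; field_simp
  have hmem : ∀ m : ℕ, m < 2 * N → (m : ℝ) * h ∈ Ico 0 π := by
    intro m hm
    refine ⟨by positivity, ?_⟩
    rw [← h2N]
    have : (m : ℝ) < 2 * N := by exact_mod_cast hm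
    exact mul_lt_mul_of_pos_right this hh0
  let f : ℕ → ArcL2 := fun m => if hm : m < 2 * N then
    (exists_representer hα hκ (hmem m hm)).choose else 0
  have hf : ∀ m, m < 2 * N → ∀ w, inner ℂ (f m) w = wint α κ 0 w (m * h) := by grind
  let bad : Finset ℕ := (Finset.range N).filter fun j => j < J ∨ N < j + 1 + J
  have hbad : bad.card ≤ 2 * J := by
    have hsub : bad ⊆ Finset.range J ∪ Finset.Ico (N - J) N := by grind
    refine (Finset.card_le_card hsub).trans ((Finset.card_union_le _ _).trans ?_)
    rw [Finset.card_range, Nat.card_Ico]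
    omega
  let B : Finset ArcL2 := (Finset.range N).image (fun j => f (2 * j + 1)) ∪
    bad.image fun j => f (2 * j)
  have hB : B.card ≤ N + 2 * J := by grind
  refine ⟨Submodule.span ℂ B, FiniteDimensional.span_finset ℂ B,
    (finrank_span_finset_le_card B).trans hB, fun w hw => ?_⟩
  have hodd : ∀ j < N, wint α κ 0 w ((2 * j + 1 : ℕ) * h) = 0 := by
    intro j hj
    rw [← hf _ (by omega)]
    refine hw _ (Submodule.subset_span ?_)
    grind
  have hev : ∀ j ∈ bad, wint α κ 0 w ((2 * j : ℕ) * h) = 0 := by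
    intro j hj
    have : j < N := by simp only [bad, Finset.mem_filter, Finset.mem_range] at hj; exact hj.1
    rw [← hf _ (by omega)]
    refine hw _ (Submodule.subset_span ?_)
    grind
  set c : ℝ := exp (1 / 26) with hc
  have hc1 : 1 ≤ c := one_le_exp (by norm_num)
  have hpiece : ∀ m < 2 * N,
      ∫⁻ θ in Ioo (m * h) (m * h + h), ‖(wgt α (-κ) θ : ℂ) * wint α κ 0 w θ‖ₑ ^ 2
        ≤ ofReal (c / N) ^ 2 * ∫⁻ s in Ioo (m * h) (m * h + h), ‖w s‖ₑ ^ 2 := by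
    intro m hm
    have hx0 : 0 ≤ (m : ℝ) * h := (hmem m hm).1
    have hxπ : (m : ℝ) * h + h ≤ π := by
      rw [← h2N]
      have : (m : ℝ) + 1 ≤ 2 * N := by exact_mod_cast hm
      nlinarith
    by_cases hlow : wint α κ 0 w (m * h) = 0
    · exact piece_left hα hκ hN0 w hx0 hxπ hlow hc1
    · obtain ⟨j, hj | hj⟩ := Nat.even_or_odd' m
      · have hjN : j < N := by omega
        have hjb : j ∉ bad := fun hb => hlow (by rw [hj]; exact hev j hb)
        have hgood : J ≤ j ∧ j + 1 + J ≤ N := by grind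
        have hup : wint α κ 0 w (m * h + h) = 0 := by
          have := hodd j hjN
          rw [← this]
          congr 1
          rw [hj]
          grind
        have hJ0 : (0 : ℝ) < J := by nlinarith
        have hmj : (m : ℝ) = 2 * j := by rw [hj]; push_cast; ring
        have g1 : (J : ℝ) ≤ j := by exact_mod_cast hgood.1
        have g2 : (j : ℝ) + 1 + J ≤ N := by exact_mod_cast hgood.2
        refine piece_right hα hκ hN0 w hx0 ?_ hup (by linarith) fun θ s hθ hθs hs => ?_
        · change (m : ℝ) * h + h < π; rw [← h2N, hmj]; nlinarith
        · have hs' : s < m * h + h := hs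
          rw [hmj] at hθ hs'
          have hb : ∀ ξ ∈ Ioo θ s, tortD α ξ ≤ (1 + α) / (2 * J / N) := by
            intro ξ hξ
            have hξm : ξ ∈ Ioo 0 π := ⟨by nlinarith [hξ.1], by grind⟩
            refine tortD_le hα (by positivity) (jordan ?_ ?_ hξm)
            · have e : π / 2 * (2 * J / N) = 2 * J * h := by rw [hh]; field_simp
              rw [e]
              nlinarith [hξ.1]
            · have e : π / 2 * (2 * J / N) = 2 * J * h := by rw [hh]; field_simp
              rw [e, ← h2N]
              nlinarith [hξ.2]
          have h5 := tort_sub_le hα (by nlinarith) (by linarith) hθs hb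
          refine exp_le_exp.mpr ?_
          have h6 : (1 + α) / (2 * J / N) * (s - θ) ≤ 1 / J := by
            have h7 : s - θ ≤ h := by linarith
            calc (1 + α) / (2 * J / N) * (s - θ) ≤ (1 + α) / (2 * J / N) * h := by gcongr
              _ = (1 + α) * π / 4 * (1 / J) := by rw [hh]; field_simp; ring
              _ ≤ 1 * (1 / J) := by gcongr; nlinarith [pi_lt_d2]
              _ = 1 / J := one_mul _
          calc κ * (tort α s - tort α θ) ≤ κ * (1 / J) :=
                mul_le_mul_of_nonneg_left (h5.trans h6) hκ.le
            _ ≤ 1 / 26 := by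
                rw [mul_one_div, div_le_div_iff₀ hJ0 (by norm_num)]
                linarith
      · refine absurd ?_ hlow; rw [hj]; grind
  have htot : ∫⁻ θ, ‖volOp α κ w θ‖ₑ ^ 2 ∂arcMeasure
      ≤ ofReal (c / N) ^ 2 * ∫⁻ s, ‖w s‖ₑ ^ 2 ∂arcMeasure := by
    have e1 : ∫⁻ θ, ‖volOp α κ w θ‖ₑ ^ 2 ∂arcMeasure
        = ∫⁻ θ in Ioo 0 (((2 * N : ℕ) : ℝ) * h), ‖(wgt α (-κ) θ : ℂ) * wint α κ 0 w θ‖ₑ ^ 2 := by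
      push_cast
      rw [h2N]
      refine lintegral_congr_ae ?_
      filter_upwards [volOp_eq hα hκ w] with θ hθ
      rw [hθ]
    have e2 : ∫⁻ s, ‖w s‖ₑ ^ 2 ∂arcMeasure
        = ∫⁻ s in Ioo 0 (((2 * N : ℕ) : ℝ) * h), ‖w s‖ₑ ^ 2 := by push_cast; rw [h2N]; rfl
    rw [e1, e2, lintegral_Ioo_sum _ hh0, lintegral_Ioo_sum _ hh0, Finset.mul_sum]
    exact Finset.sum_le_sum fun m hm => hpiece m (Finset.mem_range.mp hm)
  have hcN : 0 ≤ c / N := by positivity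
  have hfin := eLpNorm_two_le_of_sq (μ := arcMeasure) (ν := arcMeasure) (f := volOp α κ w)
    (g := w) hcN (by rw [ofReal_pow hcN]; exact htot)
  rw [Lp.norm_def, Lp.norm_def, ← ENNReal.toReal_ofReal hcN, ← ENNReal.toReal_mul]
  exact ENNReal.toReal_mono (ENNReal.mul_ne_top ofReal_ne_top (Lp.eLpNorm_ne_top w)) hfin

end Counting

section RealFunctions

theorem norm_sq_toLp_real {f : ℝ → ℝ} (hf : MemLp (fun θ => (f θ : ℂ)) 2 arcMeasure) :
    ‖hf.toLp‖ ^ 2 = ∫ θ, f θ ^ 2 ∂arcMeasure := by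
  have h : (inner ℂ hf.toLp hf.toLp : ℂ) = ((∫ θ, f θ ^ 2 ∂arcMeasure : ℝ) : ℂ) := by
    rw [L2.inner_def]
    refine Eq.trans (integral_congr_ae (g := fun θ => ((f θ ^ 2 : ℝ) : ℂ)) ?_) integral_ofReal
    filter_upwards [hf.coeFn_toLp] with θ hθ
    rw [hθ, RCLike.inner_apply]
    simp [pow_two]
  have h2 : (inner ℂ hf.toLp hf.toLp : ℂ) = ((‖hf.toLp‖ ^ 2 : ℝ) : ℂ) := by
    rw [inner_self_eq_norm_sq_to_K]
    norm_cast
  exact Complex.ofReal_injective (h2.symm.trans h)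

theorem inner_eq_zero_of_disjoint {u v : ArcL2} {s t : Set ℝ} (hst : Disjoint s t)
    (hu : ∀ᵐ θ ∂arcMeasure, θ ∉ s → u θ = 0) (hv : ∀ᵐ θ ∂arcMeasure, θ ∉ t → v θ = 0) :
    inner ℂ u v = 0 := by
  rw [L2.inner_def, ← integral_zero ℝ ℂ (μ := arcMeasure)]
  refine integral_congr_ae ?_
  filter_upwards [hu, hv] with θ h1 h2
  by_cases h : θ ∈ s
  · rw [h2 (Set.disjoint_left.mp hst h), inner_zero_right]
  · rw [h1 h, inner_zero_left]

theorem memLp_indicator {f : ℝ → ℝ} (hf : Measurable f) {x y M : ℝ}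
    (hM : ∀ θ ∈ Ioo x y, |f θ| ≤ M) :
    MemLp (fun θ => (((Ioo x y).indicator f θ : ℝ) : ℂ)) 2 arcMeasure := by
  refine MemLp.of_bound ?_ (max M 0) (.of_forall fun θ => ?_)
  · exact (Complex.measurable_ofReal.comp (hf.indicator measurableSet_Ioo)).aestronglyMeasurable
  · rw [norm_real, norm_eq_abs]
    by_cases h : θ ∈ Ioo x y
    · rw [indicator_of_mem h]; exact (hM θ h).trans (le_max_left _ _)
    · rw [indicator_of_notMem h, abs_zero]; exact le_max_right _ _

theorem integral_indicator_sq (f : ℝ → ℝ) {x y : ℝ} (hx : 0 ≤ x) (hy : y ≤ π) :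
    ∫ θ, ((Ioo x y).indicator f θ) ^ 2 ∂arcMeasure = ∫ θ in Ioo x y, f θ ^ 2 := by
  have h : ∀ θ, ((Ioo x y).indicator f θ) ^ 2 = (Ioo x y).indicator (fun θ => f θ ^ 2) θ := by
    intro θ
    by_cases h : θ ∈ Ioo x y
    · rw [indicator_of_mem h, indicator_of_mem h]
    · rw [indicator_of_notMem h, indicator_of_notMem h, zero_pow two_ne_zero]
  simp only [h]
  rw [arcMeasure, setIntegral_indicator measurableSet_Ioo, inter_eq_right.mpr (Ioo_subset_Ioo hx hy)]

end RealFunctions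

theorem integrableOn_Ioo {f : ℝ → ℝ} (hf : Continuous f) {x y : ℝ} : IntegrableOn f (Ioo x y) :=
  hf.integrableOn_Icc.mono_set Ioo_subset_Icc_self

section Bumps

variable {α κ c x h s₀ θ : ℝ}

theorem integral_half_wave (hh : 0 < h) :
    (∫ θ in Ioo x (x + h), sin (π / h * (θ - x)) ^ 2 = h / 2) ∧
    ∫ θ in Ioo x (x + h), cos (π / h * (θ - x)) ^ 2 = h / 2 := by
  have hb : π / h ≠ 0 := by positivity
  have e : π / h * (x + h - x) = π := by rw [add_sub_cancel_left]; field_simp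
  have key : ∀ f : ℝ → ℝ, ∫ θ in Ioo x (x + h), f (π / h * (θ - x))
      = h / π * ∫ s in (0 : ℝ)..Real.pi, f s := by
    intro f
    rw [← integral_Ioc_eq_integral_Ioo, ← integral_of_le (by linarith)]
    have := intervalIntegral.integral_comp_mul_sub (a := x) (b := x + h) f hb (π / h * x)
    simp only [← mul_sub] at this
    rw [this, e, sub_self, mul_zero, smul_eq_mul, inv_div]
  constructor
  · rw [key fun s => sin s ^ 2, integral_sin_sq]; simp; field_simp
  · rw [key fun s => cos s ^ 2, integral_cos_sq]; simp; field_simp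

def bumpW (α c x h θ : ℝ) : ℝ := (quart α θ)⁻¹ * (π / h * cos (π / h * (θ - x))
    + c * tortD α θ * sin (π / h * (θ - x)))

/-- The constant in the upper bounds for the eigenvalues. -/
def trialConst (α κ : ℝ) (l : ℕ) : ℝ := √(1 + α) * (l * π / (π - 1 / 100) + κ * ((1 + α) * 400))

variable (hα : 0 ≤ α)
include hα

theorem measurable_quart : Measurable (quart α) :=
  (quart_contDiff hα (n := 0)).continuous.measurable

theorem measurable_bumpW : Measurable (bumpW α c x h) := by
  have h1 : Measurable (tortD α) := by
    unfold tortD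
    exact measurable_const.div ((dlt_continuous (α := α)).measurable.mul measurable_sin)
  have h2 : Measurable fun θ => cos (π / h * (θ - x)) := Continuous.measurable (by fun_prop)
  have h3 : Measurable fun θ => sin (π / h * (θ - x)) := Continuous.measurable (by fun_prop)
  exact (measurable_quart hα).inv.mul ((h2.const_mul _).add ((h1.const_mul c).mul h3))

theorem quart_sq_bounds : (√(1 + α))⁻¹ ≤ quart α θ ^ 2 ∧ ((quart α θ)⁻¹) ^ 2 ≤ √(1 + α) := by
  have h1 : √(dlt α θ) ≤ √(1 + α) := sqrt_le_sqrt (dlt_le hα)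
  have h2 : 0 < √(dlt α θ) := sqrt_pos.mpr (dlt_pos hα)
  rw [inv_pow, quart_sq, inv_inv]
  exact ⟨inv_anti₀ h2 h1, h1⟩

theorem bumpW_sq_le (hh : 0 < h) {D : ℝ} (hD : |c| * tortD α θ ≤ D) (ht : 0 ≤ tortD α θ) :
    bumpW α c x h θ ^ 2 ≤ √(1 + α) * (π / h + D) * (π / h * cos (π / h * (θ - x)) ^ 2
        + D * sin (π / h * (θ - x)) ^ 2) := by
  have hβ : 0 < π / h := by positivity
  set β := π / h
  set C := cos (β * (θ - x))
  set S := sin (β * (θ - x))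
  have hD0 : 0 ≤ D := le_trans (by positivity) hD
  have h1 : |β * C + c * tortD α θ * S| ≤ β * |C| + D * |S| := by
    refine (abs_add_le _ _).trans ?_
    rw [abs_mul, abs_mul, abs_mul, abs_of_pos hβ, abs_of_nonneg ht]
    gcongr
  have h2 : (β * C + c * tortD α θ * S) ^ 2 ≤ (β + D) * (β * C ^ 2 + D * S ^ 2) := by
    rw [← sq_abs, ← sq_abs C, ← sq_abs S]
    refine (pow_le_pow_left₀ (abs_nonneg _) h1 2).trans ?_
    nlinarith [mul_nonneg (mul_nonneg hβ.le hD0) (sq_nonneg (|C| - |S|))]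
  rw [bumpW, mul_pow, mul_assoc (√(1 + α))]
  exact mul_le_mul (quart_sq_bounds hα).2 h2 (sq_nonneg _) (sqrt_nonneg _)

theorem wint_bump (hx : 0 < x) (hh : 0 < h) (hxh : x + h < π) {x₀ : ℝ}
    (hx₀ : x₀ ≤ x ∨ x + h ≤ x₀) (θ : ℝ)
    (hI : IntervalIntegrable (fun s => wgt α c s * (Ioo x (x + h)).indicator (bumpW α c x h) s)
      volume x₀ θ) :
    wint α c x₀ (fun s => (((Ioo x (x + h)).indicator (bumpW α c x h) s : ℝ) : ℂ)) θ
      = (((Ioo x (x + h)).indicator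
        (fun s => exp (c * tort α s) * sin (π / h * (s - x))) θ : ℝ) : ℂ) := by
  have e1 : sin (π / h * (x + h - x)) = 0 := by
    rw [add_sub_cancel_left, div_mul_cancel₀ _ hh.ne', sin_pi]
  let F : ℝ → ℝ := fun s => exp (c * tort α s) * sin (π / h * (s - x))
  let H : ℝ → ℝ := fun s => F (max x (min s (x + h)))
  have hsub : ∀ s ∈ Icc x (x + h), s ∈ Ioo 0 π := fun s hs =>
    ⟨hx.trans_le hs.1, hs.2.trans_lt hxh⟩
  have hFd : ∀ s ∈ Icc x (x + h), HasDerivAt F (wgt α c s * bumpW α c x h s) s := by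
    intro s hs
    have h1 := ((tort_hasDerivAt hα (hsub s hs)).const_mul c).exp
    have h2 := (((hasDerivAt_id s).sub_const x).const_mul (π / h)).sin
    refine (h1.mul h2).congr_deriv ?_
    have := (quart_pos (θ := s) hα).ne'
    simp only [id, wgt, bumpW]
    field_simp
    ring
  have hproj : ∀ s, max x (min s (x + h)) ∈ Icc x (x + h) := fun s =>
    ⟨le_max_left _ _, max_le (by linarith) (min_le_right _ _)⟩
  have hF : ContinuousOn F (Icc x (x + h)) := fun s hs =>
    (hFd s hs).continuousAt.continuousWithinAt
  have hH : Continuous H := by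
    rw [← continuousOn_univ]
    exact hF.comp (Continuous.continuousOn (by fun_prop)) fun s _ => hproj s
  have hHe : ∀ s, H s = (Ioo x (x + h)).indicator F s := by
    intro s
    by_cases hs : s ∈ Ioo x (x + h)
    · rw [indicator_of_mem hs]; simp only [H]; rw [min_eq_left hs.2.le, max_eq_right hs.1.le]
    · rw [indicator_of_notMem hs]
      simp only [H, F]
      rcases le_or_gt s x with h1 | h1
      · rw [min_eq_left (by linarith), max_eq_left h1]
        simp
      · have h2 : x + h ≤ s := not_lt.mp fun h2 => hs ⟨h1, h2⟩
        rw [min_eq_right h2, max_eq_right (by linarith), e1, mul_zero]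
  have hHd : ∀ s, s ∉ ({x, x + h} : Set ℝ) →
      HasDerivAt H (wgt α c s * (Ioo x (x + h)).indicator (bumpW α c x h) s) s := by
    intro s hs
    simp only [mem_insert_iff, mem_singleton_iff, not_or] at hs
    by_cases hm : s ∈ Ioo x (x + h)
    · rw [indicator_of_mem hm]
      refine (hFd s (Ioo_subset_Icc_self hm)).congr_of_eventuallyEq ?_
      filter_upwards [isOpen_Ioo.mem_nhds hm] with r hr
      rw [hHe, indicator_of_mem hr]
    · rw [indicator_of_notMem hm, mul_zero]
      have hm' : s ∈ (Icc x (x + h))ᶜ := fun h' =>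
        hm ⟨lt_of_le_of_ne h'.1 (Ne.symm hs.1), lt_of_le_of_ne h'.2 hs.2⟩
      refine (hasDerivAt_const s (0 : ℝ)).congr_of_eventuallyEq ?_
      filter_upwards [isClosed_Icc.isOpen_compl.mem_nhds hm'] with r hr
      rw [hHe, indicator_of_notMem fun h' => hr (Ioo_subset_Icc_self h')]
  have h0 : H x₀ = 0 := by
    rw [hHe, indicator_of_notMem]
    rintro ⟨h1, h2⟩
    rcases hx₀ with h3 | h3 <;> linarith
  have key := integral_eq_of_hasDerivAt_off_countable
    (a := x₀) (b := θ) H _ (s := {x, x + h}) (by simp)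
    hH.continuousOn (fun s hs => hHd s hs.2) hI
  rw [h0, sub_zero, hHe] at key
  rw [wint, ← key, ← intervalIntegral.integral_ofReal]
  simp only [Complex.ofReal_mul]

theorem exists_bump (hκ : 0 < κ) (hx : 0 < x) (hh : 0 < h) (hxh : x + h < π)
    (hs₀ : 0 < s₀) (hs : ∀ θ ∈ Ioo x (x + h), s₀ ≤ sin θ) :
    ∃ v g g' : ArcL2, v ≠ 0 ∧ volOp α κ g = v ∧ volStar α κ g' = -v ∧
      ‖g‖ ≤ √(1 + α) * (π / h + κ * ((1 + α) / s₀)) * ‖v‖ ∧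
      ‖g'‖ ≤ √(1 + α) * (π / h + κ * ((1 + α) / s₀)) * ‖v‖ ∧
      (∀ᵐ θ ∂arcMeasure, θ ∉ Ioo x (x + h) → v θ = 0) ∧
      (∀ᵐ θ ∂arcMeasure, θ ∉ Ioo x (x + h) → g θ = 0) ∧
      ∀ᵐ θ ∂arcMeasure, θ ∉ Ioo x (x + h) → g' θ = 0 := by
  have hpi := pi_pos
  have hsub : ∀ θ ∈ Ioo x (x + h), θ ∈ Ioo 0 π := fun θ hθ =>
    ⟨hx.trans hθ.1, hθ.2.trans hxh⟩
  set D := κ * ((1 + α) / s₀) with hD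
  have hD0 : 0 < D := by positivity
  set R := √(1 + α) * (π / h + D) with hR
  have ht0 : ∀ θ ∈ Ioo x (x + h), 0 ≤ tortD α θ := fun θ hθ =>
    div_nonneg (by linarith) (mul_nonneg (dlt_pos hα).le (sin_pos_of_mem (hsub θ hθ)).le)
  have htD : ∀ θ ∈ Ioo x (x + h), ∀ c, |c| = κ → |c| * tortD α θ ≤ D := fun θ hθ c hc => by
    rw [hc]
    exact mul_le_mul_of_nonneg_left (tortD_le hα hs₀ (hs θ hθ)) hκ.le
  have hV : MemLp (fun θ => (((Ioo x (x + h)).indicator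
      (fun s => quart α s * sin (π / h * (s - x))) θ : ℝ) : ℂ)) 2 arcMeasure := by
    refine memLp_indicator (M := 1) ((measurable_quart hα).mul
      (Continuous.measurable (by fun_prop))) fun θ _ => ?_
    rw [Pi.mul_apply, abs_mul, abs_of_pos (quart_pos hα)]
    exact mul_le_one₀ (quart_le_one hα) (abs_nonneg _) (abs_sin_le_one _)
  have hsin1 : ∀ s, sin s ^ 2 ≤ 1 := sin_sq_le_one
  have hcos1 : ∀ s, cos s ^ 2 ≤ 1 := cos_sq_le_one
  have hWb : ∀ c, |c| = κ → ∀ θ ∈ Ioo x (x + h), bumpW α c x h θ ^ 2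
      ≤ R * (π / h * cos (π / h * (θ - x)) ^ 2 + D * sin (π / h * (θ - x)) ^ 2) := fun c hc θ hθ =>
    bumpW_sq_le hα hh (htD θ hθ c hc) (ht0 θ hθ)
  have hW : ∀ c, |c| = κ → MemLp (fun θ => (((Ioo x (x + h)).indicator (bumpW α c x h) θ : ℝ) : ℂ))
      2 arcMeasure := fun c hc => by
    refine memLp_indicator (M := √(R * (π / h * 1 + D * 1))) (measurable_bumpW hα) fun θ hθ => ?_
    refine abs_le_sqrt ((hWb c hc θ hθ).trans ?_)
    gcongr
    · exact hcos1 _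
    · exact hsin1 _
  have hvn : (√(1 + α))⁻¹ * (h / 2) ≤ ‖hV.toLp‖ ^ 2 := by
    rw [norm_sq_toLp_real, integral_indicator_sq _ hx.le hxh.le, ← (integral_half_wave hh).1,
      ← integral_const_mul]
    refine setIntegral_mono_on ?_ ?_ measurableSet_Ioo fun θ _ => ?_
    · exact integrableOn_Ioo (by fun_prop)
    · have := (quart_contDiff hα (n := 0)).continuous; exact integrableOn_Ioo (by fun_prop)
    · rw [mul_pow]; exact mul_le_mul_of_nonneg_right (quart_sq_bounds hα).1 (sq_nonneg _)
  have hwn : ∀ c (hc : |c| = κ), ‖(hW c hc).toLp‖ ^ 2 ≤ R * ((π / h + D) * (h / 2)) := by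
    intro c hc
    rw [norm_sq_toLp_real, integral_indicator_sq _ hx.le hxh.le]
    have e : R * ((π / h + D) * (h / 2)) = ∫ θ in Ioo x (x + h),
        R * (π / h * cos (π / h * (θ - x)) ^ 2
        + D * sin (π / h * (θ - x)) ^ 2) := by
      rw [integral_const_mul, integral_add, integral_const_mul, integral_const_mul,
        (integral_half_wave hh).1, (integral_half_wave hh).2]
      · ring
      · exact integrableOn_Ioo (by fun_prop)
      · exact integrableOn_Ioo (by fun_prop)
    rw [e]
    refine integral_mono_of_nonneg (.of_forall fun θ => sq_nonneg _) ?_ ?_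
    · exact integrableOn_Ioo (by fun_prop)
    · exact (ae_restrict_mem measurableSet_Ioo).mono fun θ hθ => hWb c hc θ hθ
  have hfinal : ∀ c (hc : |c| = κ), ‖(hW c hc).toLp‖ ≤ R * ‖hV.toLp‖ := by
    intro c hc
    refine abs_le_of_sq_le_sq' ?_ (by positivity) |>.2
    refine (hwn c hc).trans ?_
    rw [mul_pow]
    refine le_trans ?_ (mul_le_mul_of_nonneg_left hvn (sq_nonneg R))
    rw [hR]
    refine le_of_eq ?_
    field_simp
  have hsupp : ∀ {f : ℝ → ℝ} (hf : MemLp (fun θ => (((Ioo x (x + h)).indicator f θ : ℝ) : ℂ)) 2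
      arcMeasure), ∀ᵐ θ ∂arcMeasure, θ ∉ Ioo x (x + h) → (hf.toLp _ : ArcL2) θ = 0 := by
    intro f hf
    filter_upwards [hf.coeFn_toLp] with θ hθ hn
    rw [hθ, indicator_of_notMem hn, Complex.ofReal_zero]
  have hk : |κ| = κ := abs_of_pos hκ
  have hk' : |-κ| = κ := by rw [abs_neg, hk]
  have hmul : ∀ c θ, wgt α (-c) θ * (Ioo x (x + h)).indicator
      (fun s => exp (c * tort α s) * sin (π / h * (s - x))) θ
      = (Ioo x (x + h)).indicator (fun s => quart α s * sin (π / h * (s - x))) θ := by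
    intro c θ
    by_cases hθ : θ ∈ Ioo x (x + h)
    · rw [indicator_of_mem hθ, indicator_of_mem hθ, wgt]
      have : exp (-c * tort α θ) * exp (c * tort α θ) = 1 := by
        rw [← exp_add, neg_mul, neg_add_cancel, exp_zero]
      linear_combination quart α θ * sin (π / h * (θ - x)) * this
    · rw [indicator_of_notMem hθ, indicator_of_notMem hθ, mul_zero]
  have hint : ∀ c (hc : |c| = κ) x₀ θ, x₀ ∈ Icc 0 π → θ ∈ Ioo 0 π →
      IntervalIntegrable (fun s => wgt α c s * (Ioo x (x + h)).indicator (bumpW α c x h) s)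
        volume x₀ θ := by
    intro c hc x₀ θ hx₀ hθ
    have e : (fun s => wgt α c s * (Ioo x (x + h)).indicator (bumpW α c x h) s)
        = (Ioo x (x + h)).indicator fun s => wgt α c s * bumpW α c x h s := by
      ext s
      rw [indicator_mul_right]
    rw [e]
    have hsc : IntegrableOn (fun s => wgt α c s * bumpW α c x h s) (Ioo x (x + h)) := by
      have hcts : ContinuousOn (fun s => wgt α c s * bumpW α c x h s) (Icc x (x + h)) := by
        have hq := (quart_contDiff hα (n := 0)).continuous
        have hd := dlt_continuous (α := α)
        have hsub' : Icc x (x + h) ⊆ Ioo 0 π := fun s hs =>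
          ⟨hx.trans_le hs.1, hs.2.trans_lt hxh⟩
        refine ((wgt_continuousOn hα).mono hsub').mul ?_
        unfold bumpW tortD
        refine (hq.continuousOn.inv₀ fun s _ => (quart_pos hα).ne').mul
          (ContinuousOn.add (by fun_prop) (ContinuousOn.mul (ContinuousOn.mul (by fun_prop)
            (ContinuousOn.div (by fun_prop) (by fun_prop) fun s hs => ?_)) (by fun_prop)))
        exact mul_ne_zero (dlt_pos hα).ne' (sin_pos_of_mem (hsub' hs)).ne'
      exact hcts.integrableOn_Icc.mono_set Ioo_subset_Icc_self
    exact ((integrable_indicator_iff measurableSet_Ioo).mpr hsc).intervalIntegrable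
  refine ⟨hV.toLp, (hW κ hk).toLp, (hW (-κ) hk').toLp, ?_, ?_, ?_, hfinal κ hk, hfinal _ hk',
    hsupp hV, hsupp _, hsupp _⟩
  · intro h0
    rw [h0, norm_zero] at hvn
    have : 0 < (√(1 + α))⁻¹ * (h / 2) := by positivity
    linarith
  · refine Lp.ext ?_
    filter_upwards [volOp_eq hα hκ (hW κ hk).toLp, hV.coeFn_toLp,
      ae_restrict_mem measurableSet_Ioo] with θ h1 h2 hθ
    rw [h1, h2, wint_congr ⟨le_rfl, hpi.le⟩ (hW κ hk).coeFn_toLp (Ioo_subset_Icc_self hθ),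
      wint_bump hα hx hh hxh (Or.inl hx.le) θ (hint κ hk 0 θ ⟨le_rfl, hpi.le⟩ hθ),
      ← Complex.ofReal_mul, hmul]
  · refine Lp.ext ?_
    filter_upwards [volStar_eq hα hκ (hW (-κ) hk').toLp, hV.coeFn_toLp, Lp.coeFn_neg hV.toLp,
      ae_restrict_mem measurableSet_Ioo] with θ h1 h2 h3 hθ
    have := hmul (-κ) θ
    rw [neg_neg] at this
    rw [h1, h3, Pi.neg_apply, h2, wint_congr ⟨hpi.le, le_rfl⟩ (hW (-κ) hk').coeFn_toLp
      (Ioo_subset_Icc_self hθ), wint_bump hα hx hh hxh (Or.inr hxh.le) θ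
      (hint (-κ) hk' π θ ⟨hpi.le, le_rfl⟩ hθ), ← Complex.ofReal_mul, this]

theorem exists_bumps (hκ : 0 < κ) (l : ℕ) :
    ∃ v g g' : Fin l → ArcL2, (∀ i, v i ≠ 0) ∧ (∀ i, volOp α κ (g i) = v i) ∧
      (∀ i, volStar α κ (g' i) = -v i) ∧ (∀ i, ‖g i‖ ≤ trialConst α κ l * ‖v i‖) ∧
      (∀ i, ‖g' i‖ ≤ trialConst α κ l * ‖v i‖) ∧ (∀ i j, i ≠ j → inner ℂ (v i) (v j) = 0) ∧
      (∀ i j, i ≠ j → inner ℂ (g i) (g j) = 0) ∧ ∀ i j, i ≠ j → inner ℂ (g' i) (g' j) = 0 := by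
  rcases Nat.eq_zero_or_pos l with rfl | hl
  · exact ⟨Fin.elim0, Fin.elim0, Fin.elim0, fun i => i.elim0, fun i => i.elim0, fun i => i.elim0,
      fun i => i.elim0, fun i => i.elim0, fun i => i.elim0, fun i => i.elim0, fun i => i.elim0⟩
  have := pi_gt_three
  have := pi_lt_four
  have hl0 : (0 : ℝ) < l := by exact_mod_cast hl
  set h : ℝ := (π - 1 / 100) / l with hh
  have hh0 : 0 < h := div_pos (by linarith) hl0
  have : l * h = π - 1 / 100 := by rw [hh]; field_simp
  let x : Fin l → ℝ := fun i => 1 / 200 + i * h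
  have hx0 : ∀ i, 1 / 200 ≤ x i := fun i => by
    have : 0 ≤ (i : ℝ) * h := by positivity
    simp only [x]; linarith
  have hx1 : ∀ i, x i + h ≤ π - 1 / 200 := fun i => by
    have h1 : ((i : ℕ) : ℝ) + 1 ≤ l := by exact_mod_cast i.2
    have h2 := mul_le_mul_of_nonneg_right h1 hh0.le
    simp only [x]; linarith
  have hsin : ∀ i, ∀ θ ∈ Ioo (x i) (x i + h), (1 / 400 : ℝ) ≤ sin θ := by
    intro i θ hθ
    have h1 := hx0 i
    have h2 := hx1 i
    exact jordan (by linarith [hθ.1]) (by linarith [hθ.2]) ⟨by linarith [hθ.1], by linarith [hθ.2]⟩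
  have hdisj : ∀ i j, i ≠ j → Disjoint (Ioo (x i) (x i + h)) (Ioo (x j) (x j + h)) := by
    have key : ∀ i j, i < j → Disjoint (Ioo (x i) (x i + h)) (Ioo (x j) (x j + h)) := by
      intro i j hij
      rw [Set.disjoint_left]
      intro θ h1 h2
      have h3 : ((i : ℕ) : ℝ) + 1 ≤ (j : ℕ) := by exact_mod_cast hij
      have h4 := mul_le_mul_of_nonneg_right h3 hh0.le
      have h5 := h1.2
      have h6 := h2.1
      simp only [x] at h5 h6
      linarith
    intro i j hij
    rcases lt_or_gt_of_ne hij with h1 | h1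
    · exact key i j h1
    · exact (key j i h1).symm
  choose v g g' h1 h2 h3 h4 h5 h6 h7 h8 using fun i =>
    exists_bump hα hκ (by linarith [hx0 i]) hh0 (by linarith [hx1 i]) (by norm_num) (hsin i)
  have hC : √(1 + α) * (π / h + κ * ((1 + α) / (1 / 400))) = trialConst α κ l := by
    rw [trialConst, hh, div_div_eq_mul_div, div_div_eq_mul_div, div_one, mul_comm π]
  rw [hC] at h4 h5
  exact ⟨v, g, g', h1, h2, h3, h4, h5,
    fun i j hij => inner_eq_zero_of_disjoint (hdisj i j hij) (h6 i) (h6 j),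
    fun i j hij => inner_eq_zero_of_disjoint (hdisj i j hij) (h7 i) (h7 j),
    fun i j hij => inner_eq_zero_of_disjoint (hdisj i j hij) (h8 i) (h8 j)⟩

end Bumps

section OffDiag

variable {E : Type*} [NormedAddCommGroup E] [InnerProductSpace ℂ E] [CompleteSpace E]

local notation "⟪" x ", " y "⟫" => inner ℂ x y

theorem exists_finRank_pair {C C' : E →L[ℂ] E} (hadj : ∀ u v, ⟪C u, v⟫ = ⟪u, C' v⟫)
    {U : Submodule ℂ E} [FiniteDimensional ℂ U] {c : ℝ} (hc : 0 ≤ c)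
    (h : ∀ w, (∀ u ∈ U, ⟪u, w⟫ = 0) → ‖C w‖ ≤ c * ‖w‖) :
    ∃ F F' : E →L[ℂ] E, FinRank F ∧ FinRank F' ∧ finrank ℂ (lrange F.toLinearMap) ≤ finrank ℂ U ∧
      finrank ℂ (lrange F'.toLinearMap) ≤ finrank ℂ U ∧
      ‖C - F‖ ≤ c ∧ ∀ u v, ⟪F u, v⟫ = ⟪u, F' v⟫ := by
  let P : E →L[ℂ] E := U.starProjection
  have hr : lrange (C ∘L P).toLinearMap ≤ U.map C.toLinearMap := by
    rintro _ ⟨w, rfl⟩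
    exact ⟨P w, U.starProjection_apply_mem w, rfl⟩
  have hr' : lrange (P ∘L C').toLinearMap ≤ U := by
    rintro _ ⟨w, rfl⟩
    exact U.starProjection_apply_mem _
  refine ⟨C ∘L P, P ∘L C', ?_, ?_, ?_, ?_, ?_, ?_⟩
  · exact Submodule.finiteDimensional_of_le hr
  · exact Submodule.finiteDimensional_of_le hr'
  · exact (Submodule.finrank_mono hr).trans (Submodule.finrank_map_le _ _)
  · exact Submodule.finrank_mono hr'
  · refine opNorm_le_bound _ hc fun w => ?_
    have e : (C - C ∘L P) w = C (w - P w) := by rw [map_sub]; rfl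
    have hw : w - P w ∈ Uᗮ := U.sub_starProjection_mem_orthogonal w
    rw [e]
    refine (h _ fun u hu => (Submodule.mem_orthogonal _ _).mp hw u hu).trans ?_
    gcongr
    have e2 : w - P w = Uᗮ.starProjection w := by rw [Submodule.starProjection_orthogonal']; rfl
    rw [e2]
    exact Submodule.norm_starProjection_apply_le _ _
  · intro u v
    change ⟪C (P u), v⟫ = ⟪u, P (C' v)⟫
    rw [hadj]
    exact U.inner_starProjection_left_eq_right _ _

/-- The operator `(v₀, v₁) ↦ (t v₁, s v₀)`. -/
def offDiag (t s : E →L[ℂ] E) : WithLp 2 (E × E) →L[ℂ] WithLp 2 (E × E) :=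
  (WithLp.prodContinuousLinearEquiv 2 ℂ E E).symm.toContinuousLinearMap ∘L
    ((t ∘L ContinuousLinearMap.snd ℂ E E).prod (s ∘L ContinuousLinearMap.fst ℂ E E)) ∘L
    (WithLp.prodContinuousLinearEquiv 2 ℂ E E).toContinuousLinearMap

/-- The operator `(v₀, v₁) ↦ (v₀, -v₁)`. -/
def chirality : WithLp 2 (E × E) →L[ℂ] WithLp 2 (E × E) :=
  (WithLp.prodContinuousLinearEquiv 2 ℂ E E).symm.toContinuousLinearMap ∘L
    ((fst ℂ E E).prod (-snd ℂ E E)) ∘L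
    (WithLp.prodContinuousLinearEquiv 2 ℂ E E).toContinuousLinearMap

variable {t s : E →L[ℂ] E}

theorem offDiag_fst (t s : E →L[ℂ] E) (x : WithLp 2 (E × E)) : (offDiag t s x).fst = t x.snd := rfl

theorem offDiag_snd (t s : E →L[ℂ] E) (x : WithLp 2 (E × E)) : (offDiag t s x).snd = s x.fst := rfl

theorem two_ext {x y : WithLp 2 (E × E)} (h : x.fst = y.fst) (h' : x.snd = y.snd) : x = y :=
  WithLp.ofLp_injective 2 (Prod.ext h h')

theorem chirality_chirality (x : WithLp 2 (E × E)) : chirality (chirality x) = x :=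
  two_ext rfl (neg_neg _)

theorem chirality_offDiag (t s : E →L[ℂ] E) (x : WithLp 2 (E × E)) :
    chirality (offDiag t s x) = -offDiag t s (chirality x) := by
  refine two_ext ?_ rfl
  change t x.snd = -t (-x.snd)
  rw [map_neg, neg_neg]

theorem two_inner (x y : WithLp 2 (E × E)) : ⟪x, y⟫ = ⟪x.fst, y.fst⟫ + ⟪x.snd, y.snd⟫ :=
  WithLp.prod_inner_apply x y

theorem two_norm_sq (x : WithLp 2 (E × E)) : ‖x‖ ^ 2 = ‖x.fst‖ ^ 2 + ‖x.snd‖ ^ 2 :=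
  WithLp.prod_norm_sq_eq_of_L2 x

theorem norm_offDiag_le {c : ℝ} (ht : ‖t‖ ≤ c) (hs : ‖s‖ ≤ c) : ‖offDiag t s‖ ≤ c := by
  have hc : 0 ≤ c := (norm_nonneg _).trans ht
  refine opNorm_le_bound _ hc fun x => ?_
  refine abs_le_of_sq_le_sq' ?_ (by positivity) |>.2
  rw [mul_pow, two_norm_sq, two_norm_sq, offDiag_fst, offDiag_snd, mul_add, add_comm, ← mul_pow,
    ← mul_pow]
  exact add_le_add (pow_le_pow_left₀ (norm_nonneg _) (s.le_of_opNorm_le hs _) 2)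
    (pow_le_pow_left₀ (norm_nonneg _) (t.le_of_opNorm_le ht _) 2)

theorem offDiag_sub (t s t' s' : E →L[ℂ] E) :
    offDiag t s - offDiag t' s' = offDiag (t - t') (s - s') := by ext1 x; exact two_ext rfl rfl

theorem offDiag_symm (h : ∀ u v, ⟪t u, v⟫ = ⟪u, s v⟫) (x y : WithLp 2 (E × E)) :
    ⟪offDiag t s x, y⟫ = ⟪x, offDiag t s y⟫ := by
  have h' : ∀ u v, ⟪s u, v⟫ = ⟪u, t v⟫ := fun u v => by rw [← inner_conj_symm, ← h, inner_conj_symm]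
  rw [two_inner, two_inner, offDiag_fst, offDiag_snd, offDiag_fst, offDiag_snd, h, h', add_comm]

theorem eq_adjoint (h : ∀ u v, ⟪t u, v⟫ = ⟪u, s v⟫) : s = adjoint t := by
  rw [ContinuousLinearMap.eq_adjoint_iff]
  intro u v
  rw [← inner_conj_symm, ← h, inner_conj_symm]

theorem offDiag_finRank (ht : FinRank t) (hs : FinRank s) :
    FinRank (offDiag t s) ∧ finrank ℂ (lrange (offDiag t s).toLinearMap) ≤
      finrank ℂ (lrange t.toLinearMap) + finrank ℂ (lrange s.toLinearMap) := by
  have : FiniteDimensional ℂ (lrange t.toLinearMap) := ht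
  have : FiniteDimensional ℂ (lrange s.toLinearMap) := hs
  let e := (WithLp.prodContinuousLinearEquiv 2 ℂ E E).toLinearMap
  let i : (lrange t.toLinearMap × lrange s.toLinearMap) →ₗ[ℂ]
      WithLp 2 (E × E) := (WithLp.prodContinuousLinearEquiv 2 ℂ E E).symm.toLinearMap ∘ₗ
    (LinearMap.prodMap (lrange t.toLinearMap).subtype (lrange s.toLinearMap).subtype)
  have hsub : lrange (offDiag t s).toLinearMap ≤ lrange i := by
    rintro _ ⟨x, rfl⟩
    exact ⟨(⟨t x.snd, x.snd, rfl⟩, ⟨s x.fst, x.fst, rfl⟩), rfl⟩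
  refine ⟨Submodule.finiteDimensional_of_le hsub, (Submodule.finrank_mono hsub).trans ?_⟩
  refine (LinearMap.finrank_range_le i).trans ?_
  rw [Module.finrank_prod]

end OffDiag

section Radial

local notation "⟪" x ", " y "⟫" => inner ℂ x y

/-- The Hilbert space of the modes. -/
abbrev ModeL2 : Type := WithLp 2 (ArcL2 × ArcL2)

/-- The inverse of the angular operator on a mode. -/
def modeT (α κ : ℝ) : ModeL2 →L[ℂ] ModeL2 := offDiag (I • volOp α κ) (-I • volStar α κ)

/-- `a sin θ / √Δ`. -/
def rot (α a θ : ℝ) : ℝ := a * sin θ / √(dlt α θ)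

def rotMul (α a : ℝ) : ArcL2 →L[ℂ] ArcL2 :=
  multOp arcMeasure fun θ => (rot α a θ : ℂ) • ContinuousLinearMap.id ℂ ℂ

/-- Multiplication by `a sin θ / √Δ σ₂` on a mode. -/
def modeB (α a : ℝ) : ModeL2 →L[ℂ] ModeL2 := offDiag (-I • rotMul α a) (I • rotMul α a)

variable {α κ a : ℝ}

theorem norm_unit_smul {G : Type*} [NormedAddCommGroup G] [NormedSpace ℂ G] (A : G) :
    ‖I • A‖ = ‖A‖ ∧ ‖-I • A‖ = ‖A‖ := by constructor <;> simp [norm_smul]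

theorem volStar_continuous (hκ : 0 < κ) : Continuous fun α : NNReal => volStar α κ := by
  have h : (fun α : NNReal => volStar α κ) = fun α : NNReal => adjoint (volOp α κ) :=
    funext fun α => eq_adjoint (volOp_inner α.2 hκ)
  rw [h]
  exact adjoint.continuous.comp (volOp_continuous hκ)

theorem modeT_continuous (hκ : 0 < κ) : Continuous fun α : NNReal => modeT α κ := by
  have := volOp_continuous hκ
  have := volStar_continuous hκ
  unfold modeT offDiag
  have e : Continuous fun α : NNReal =>
    ((I • volOp α κ) ∘L ContinuousLinearMap.snd ℂ ArcL2 ArcL2).prod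
      ((-I • volStar α κ) ∘L ContinuousLinearMap.fst ℂ ArcL2 ArcL2) := by
    have h3 : Continuous fun α : NNReal =>
      (I • volOp α κ) ∘L ContinuousLinearMap.snd ℂ ArcL2 ArcL2 := by fun_prop
    have h4 : Continuous fun α : NNReal =>
      (-I • volStar α κ) ∘L ContinuousLinearMap.fst ℂ ArcL2 ArcL2 := by fun_prop
    exact (ContinuousLinearMap.prodₗᵢ ℂ (𝕜 := ℂ) (E := ArcL2 × ArcL2) (F := ArcL2) (G := ArcL2)
      ).continuous.comp (h3.prodMk h4)
  fun_prop

theorem dlt_dist_le {α β θ : ℝ} : |dlt α θ - dlt β θ| ≤ |α - β| := by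
  have : dlt α θ - dlt β θ = (α - β) * cos θ ^ 2 := by unfold dlt; ring
  rw [this, abs_mul, abs_of_nonneg (sq_nonneg (cos θ))]
  exact mul_le_of_le_one_right (abs_nonneg _) (cos_sq_le_one θ)

variable (hα : 0 ≤ α)
include hα

theorem rot_continuous : Continuous (rot α a) := by
  have := dlt_continuous (α := α)
  unfold rot
  exact Continuous.div (by fun_prop) (by fun_prop) fun θ => (sqrt_pos.mpr (dlt_pos hα)).ne'

theorem abs_rot_le (θ : ℝ) : |rot α a θ| ≤ |a| := by
  have h1 : 1 ≤ √(dlt α θ) := one_le_sqrt.mpr (one_le_dlt hα)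
  rw [rot, abs_div, abs_mul, abs_of_pos (one_pos.trans_le h1)]
  refine div_le_of_le_mul₀ (by linarith) (abs_nonneg _) ?_
  exact mul_le_mul_of_nonneg_left ((abs_sin_le_one θ).trans h1) (abs_nonneg _)

theorem rot_mul_quart (θ : ℝ) : rot α a θ * quart α θ ^ 2 = a * (sin θ / dlt α θ) := by
  have h1 := dlt_pos (θ := θ) hα
  rw [quart_sq, rot, ← div_eq_mul_inv, div_div, mul_self_sqrt h1.le, mul_div_assoc]

theorem rotMul_measurable : AEStronglyMeasurable
    (fun θ => (rot α a θ : ℂ) • ContinuousLinearMap.id ℂ ℂ) arcMeasure := by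
  have := rot_continuous (a := a) hα
  fun_prop

omit hα in
theorem norm_rot_smul {G : Type*} [NormedAddCommGroup G] [NormedSpace ℂ G] {A : G →L[ℂ] G}
    (hA : ‖A‖ ≤ 1) (hα : 0 ≤ α) (θ : ℝ) : ‖(rot α a θ : ℂ) • A‖ ≤ |a| := by
  rw [norm_smul, norm_real, norm_eq_abs]
  exact (mul_le_mul (abs_rot_le hα θ) hA (norm_nonneg _) (abs_nonneg _)).trans_eq (mul_one _)

theorem rotMul_ae (u : ArcL2) : rotMul α a u =ᵐ[arcMeasure] fun θ => (rot α a θ : ℂ) * u θ :=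
  multOp_ae (rotMul_measurable hα) (.of_forall fun θ =>
    norm_rot_smul norm_id_le hα θ) u

theorem norm_rotMul_le : ‖rotMul α a‖ ≤ |a| :=
  multOp_norm_le (rotMul_measurable hα) (abs_nonneg _) (.of_forall fun θ =>
    norm_rot_smul norm_id_le hα θ)

theorem rotMul_symm (u v : ArcL2) : ⟪rotMul α a u, v⟫ = ⟪u, rotMul α a v⟫ := by
  rw [L2.inner_def, L2.inner_def]
  refine integral_congr_ae ?_
  filter_upwards [rotMul_ae hα u, rotMul_ae hα v] with θ h1 h2
  rw [h1, h2, RCLike.inner_apply, RCLike.inner_apply, map_mul, conj_ofReal]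
  ring

theorem modeT_symm (hκ : 0 < κ) (x y : ModeL2) : ⟪modeT α κ x, y⟫ = ⟪x, modeT α κ y⟫ :=
  offDiag_symm (fun u v => by
    simp only [_root_.smul_apply, inner_smul_left, inner_smul_right, conj_I, volOp_inner hα hκ]) x y

theorem modeB_symm (x y : ModeL2) : ⟪modeB α a x, y⟫ = ⟪x, modeB α a y⟫ :=
  offDiag_symm (fun u v => by
    simp only [_root_.smul_apply, inner_smul_left, inner_smul_right, map_neg, conj_I,
      rotMul_symm hα, neg_neg]) x y

theorem norm_modeT_le (hκ : 0 < κ) : ‖modeT α κ‖ ≤ 1 / κ :=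
  norm_offDiag_le ((norm_unit_smul _).1.le.trans (volOp_spec hα hκ).1)
    ((norm_unit_smul _).2.le.trans (volStar_spec hα hκ).1)

theorem norm_modeB_le : ‖modeB α a‖ ≤ |a| :=
  norm_offDiag_le ((norm_unit_smul _).2.le.trans (norm_rotMul_le hα))
    ((norm_unit_smul _).1.le.trans (norm_rotMul_le hα))

theorem modeT_inj (hκ : 0 < κ) (x : ModeL2) (hx : modeT α κ x = 0) : x = 0 := by
  have h0 : I • volOp α κ x.snd = 0 := congrArg WithLp.fst hx
  have h1 : -I • volStar α κ x.fst = 0 := congrArg WithLp.snd hx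
  rw [smul_eq_zero_iff_right I_ne_zero] at h0
  rw [smul_eq_zero_iff_right (neg_ne_zero.mpr I_ne_zero)] at h1
  exact two_ext (volStar_injective hα hκ h1) (volOp_injective hα hκ h0)

theorem exists_modeT_approx (hα' : α ≤ 1 / 4) (hκ : 0 < κ) {N J : ℕ} (hN : 1 ≤ N)
    (hJ : 26 * κ ≤ J) : ∃ F : ModeL2 →L[ℂ] ModeL2, FinRank F ∧
      finrank ℂ (lrange F.toLinearMap) ≤ 2 * (N + 2 * J) ∧
      ‖modeT α κ - F‖ ≤ exp (1 / 26) / N := by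
  obtain ⟨U, hU, hUn, hw⟩ := exists_small_codim hα hα' hκ hN hJ
  obtain ⟨F, F', h1, h2, h3, h4, h5, h6⟩ := exists_finRank_pair (volOp_inner hα hκ)
    (by positivity) hw
  have hF1 : FinRank (I • F) := by
    have := h1.comp_left (I • ContinuousLinearMap.id ℂ ArcL2)
    exact this
  have hF2 : FinRank (-I • F') := by
    have := h2.comp_left (-I • ContinuousLinearMap.id ℂ ArcL2)
    exact this
  obtain ⟨h7, h8⟩ := offDiag_finRank hF1 hF2
  refine ⟨_, h7, h8.trans ?_, ?_⟩
  · have e1 : (I • F).toLinearMap = I • F.toLinearMap := rfl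
    have e2 : (-I • F').toLinearMap = (-I) • F'.toLinearMap := rfl
    rw [e1, e2, LinearMap.range_smul _ _ I_ne_zero,
      LinearMap.range_smul _ _ (neg_ne_zero.mpr I_ne_zero)]
    omega
  · rw [modeT, offDiag_sub, ← smul_sub, ← smul_sub]
    refine norm_offDiag_le ((norm_unit_smul _).1.le.trans h5) ((norm_unit_smul _).2.le.trans ?_)
    rw [eq_adjoint h6, eq_adjoint (volOp_inner hα hκ), ← map_sub]
    exact (adjoint.norm_map _).trans_le h5

theorem modeT_finApprox (hα' : α ≤ 1 / 4) (hκ : 0 < κ) : FinApprox (modeT α κ) := by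
  refine Metric.mem_closure_iff.2 fun ε hε => ?_
  obtain ⟨J, hJ⟩ := exists_nat_ge (26 * κ)
  obtain ⟨N, hN⟩ := exists_nat_gt (exp (1 / 26) / ε)
  have hN0 : (0 : ℝ) < N := lt_of_le_of_lt (by positivity) hN
  obtain ⟨F, h1, -, h2⟩ := exists_modeT_approx hα hα' hκ (N := N) (by exact_mod_cast hN0) hJ
  refine ⟨F, h1, (dist_eq_norm _ _).trans_lt (h2.trans_lt ?_)⟩
  rwa [div_lt_comm₀ hN0 hε]

theorem modeT_isPencil (hα' : α ≤ 1 / 4) (hκ : 0 < κ) (a : ℝ) :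
    IsPencil (modeT α κ) (modeB α a) |a| where
  symT := modeT_symm hα hκ
  symB := modeB_symm hα
  inj := modeT_inj hα hκ
  fin := modeT_finApprox hα hα' hκ
  normB := norm_modeB_le hα

theorem exists_modeRadialSol (hκ : 0 < κ) {ν t : ℝ} {u : ModeL2}
    (hu : u = modeT α κ ((ν : ℂ) • u - (t : ℂ) • modeB α a u)) :
    ∃ P Q, IsRadialSol α κ ν t (rot α a) u.fst u.snd P Q := by
  have key : ∀ (c : ℂ) (x y : ArcL2), ((ν : ℂ) • x - (t : ℂ) • c • rotMul α a y : ArcL2)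
      =ᵐ[arcMeasure] fun θ => ν * x θ - t * (c * (rot α a θ * y θ)) := by
    intro c x y
    filter_upwards [Lp.coeFn_sub ((ν : ℂ) • x) ((t : ℂ) • c • rotMul α a y),
      Lp.coeFn_smul (ν : ℂ) x, Lp.coeFn_smul (t : ℂ) (c • rotMul α a y),
      Lp.coeFn_smul c (rotMul α a y), rotMul_ae (a := a) hα y] with θ h1 h2 h3 h4 h5
    rw [h1, Pi.sub_apply, h2, h3, Pi.smul_apply, Pi.smul_apply, h4, Pi.smul_apply, h5]
    rfl
  refine exists_radialSol hα hκ (rot_continuous hα) (congrArg WithLp.fst hu)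
    (congrArg WithLp.snd hu) ((key (-I) u.fst u.snd).trans ?_) ((key I u.snd u.fst).trans ?_) <;>
  · refine .of_forall fun θ => ?_; push_cast; ring

theorem exists_modeTrial (hκ : 0 < κ) (l : ℕ) :
    ∃ v w : Fin (2 * l) → ModeL2, (∀ i, modeT α κ (w i) = v i) ∧ (∀ i, v i ≠ 0) ∧
      (∀ i j, i ≠ j → ⟪v i, v j⟫ = 0) ∧ (∀ i j, i ≠ j → ⟪w i, w j⟫ = 0) ∧
      ∀ i, ‖w i‖ ≤ trialConst α κ l * ‖v i‖ := by
  obtain ⟨f, g, g', h1, h2, h3, h4, h5, h6, h7, h8⟩ := exists_bumps hα hκ l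
  let i₀ : ArcL2 → ModeL2 := fun u => WithLp.toLp 2 (u, 0)
  let i₁ : ArcL2 → ModeL2 := fun u => WithLp.toLp 2 (0, u)
  have n0 : ∀ u, ‖i₀ u‖ = ‖u‖ := fun u => by simp [i₀]
  have n1 : ∀ u, ‖i₁ u‖ = ‖u‖ := fun u => by simp [i₁]
  have hT0 : ∀ u, modeT α κ (i₀ u) = i₁ (-I • volStar α κ u) := fun u =>
    two_ext (by simp [modeT, offDiag_fst, i₀, i₁]) rfl
  have hT1 : ∀ u, modeT α κ (i₁ u) = i₀ (I • volOp α κ u) := fun u =>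
    two_ext rfl (by simp [modeT, offDiag_snd, i₀, i₁])
  let v : Fin l ⊕ Fin l → ModeL2 := Sum.elim (i₀ ∘ f) (i₁ ∘ f)
  let w : Fin l ⊕ Fin l → ModeL2 := Sum.elim (fun j => i₁ (-I • g j)) fun j => i₀ (-I • g' j)
  let e : Fin (2 * l) ≃ Fin l ⊕ Fin l := (finCongr (two_mul l)).trans finSumFinEquiv.symm
  suffices key : (∀ p, modeT α κ (w p) = v p) ∧ (∀ p, v p ≠ 0) ∧
      (∀ p q, p ≠ q → ⟪v p, v q⟫ = 0) ∧ (∀ p q, p ≠ q → ⟪w p, w q⟫ = 0) ∧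
      ∀ p, ‖w p‖ ≤ trialConst α κ l * ‖v p‖ by
    obtain ⟨k1, k2, k3, k4, k5⟩ := key
    exact ⟨v ∘ e, w ∘ e, fun i => k1 _, fun i => k2 _, fun i j h => k3 _ _ (e.injective.ne h),
      fun i j h => k4 _ _ (e.injective.ne h), fun i => k5 _⟩
  refine ⟨?_, ?_, ?_, ?_, ?_⟩
  · rintro (j | j)
    · simp [v, w, hT1, h2, smul_smul, -neg_smul]
    · simp [v, w, hT0, h3, smul_smul]
  · rintro (j | j) h
    · exact h1 j (congrArg WithLp.fst h)
    · exact h1 j (congrArg WithLp.snd h)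
  · rintro (i | i) (j | j) hij <;>
      simp only [v, Sum.elim_inl, Sum.elim_inr, Function.comp_apply, two_inner, i₀, i₁] <;>
      simp_all
  · rintro (i | i) (j | j) hij <;>
      simp only [w, Sum.elim_inl, Sum.elim_inr, two_inner, i₀, i₁] <;>
      simp_all [inner_smul_left, inner_smul_right]
  · rintro (j | j)
    · simpa [v, w, n0, n1, norm_smul, -neg_smul] using h4 j
    · simpa [v, w, n0, n1, norm_smul, -neg_smul] using h5 j

theorem trialConst_pos (hκ : 0 < κ) (l : ℕ) : 0 < trialConst α κ l := by
  have := pi_gt_three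
  have : 0 ≤ l * π / (π - 1 / 100) := div_nonneg (by positivity) (by linarith)
  unfold trialConst
  positivity

theorem modeT_unbounded (hκ : 0 < κ) (l : ℕ) :
    ∃ (c : ℝ) (v w : Fin l → ModeL2), 0 < c ∧ (∀ i, modeT α κ (w i) = v i) ∧
    (∀ i, v i ≠ 0) ∧ (∀ i j, i ≠ j → ⟪v i, v j⟫ = 0) ∧ (∀ i j, i ≠ j → ⟪w i, w j⟫ = 0) ∧
    ∀ i, ‖w i‖ ≤ c * ‖v i‖ := by
  obtain ⟨v, w, h1, h2, h3, h4, h5⟩ := exists_modeTrial hα hκ l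
  have hi : Function.Injective (Fin.castLE (show l ≤ 2 * l by omega)) := Fin.castLE_injective _
  exact ⟨trialConst α κ l, fun j => v (Fin.castLE (by omega) j), fun j => w (Fin.castLE (by omega) j),
    trialConst_pos hα hκ l, fun j => h1 _, fun j => h2 _,
    fun j k h => h3 _ _ (hi.ne h), fun j k h => h4 _ _ (hi.ne h), fun j => h5 _⟩

theorem modeT_isSimplePencil (hα' : α ≤ 1 / 4) (hκ : 0 < κ) (a : ℝ) :
    IsSimplePencil (modeT α κ) (modeB α a) chirality |a| where
  toIsPencil := modeT_isPencil hα hα' hκ a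
  flip := chirality_chirality
  flipT := chirality_offDiag _ _
  flipB := chirality_offDiag _ _
  noZero t := by
    rintro ⟨u, hu0, hu⟩
    have hu' : u = modeT α κ (((0 : ℝ) : ℂ) • u - (t : ℂ) • modeB α a u) := by
      rw [Complex.ofReal_zero]; exact hu
    obtain ⟨P, Q, h⟩ := exists_modeRadialSol hα hκ hu'
    obtain ⟨h0, h1⟩ := h.eq_zero hα hκ (rot_mul_quart hα)
    exact hu0 (two_ext h0 h1)
  simple t ν u v hu0 hu hv := by
    obtain ⟨P, Q, h⟩ := exists_modeRadialSol hα hκ hu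
    obtain ⟨P', Q', h'⟩ := exists_modeRadialSol hα hκ hv
    have hne : u.fst ≠ 0 ∨ u.snd ≠ 0 := by by_contra! h0; exact hu0 (two_ext h0.1 h0.2)
    obtain ⟨c, h0, h1⟩ := h.proportional hα (rot_continuous hα) h' hne
    exact ⟨c, two_ext h0 h1⟩
  unbounded := modeT_unbounded hα hκ

theorem mode_nth_le (hα' : α ≤ 1 / 4) (hκ : 0 < κ) {a t m : ℝ} {l : ℕ}
    (hm : IsNthPos (modeT α κ) (modeB α a) t l m) : m ≤ trialConst α κ l + |a| * |t| := by
  have h := modeT_isSimplePencil hα hα' hκ a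
  obtain ⟨v, w, h1, h2, h3, h4, h5⟩ := exists_modeTrial hα hκ l
  refine le_of_forall_gt_imp_ge_of_dense fun d hd => h.nth_le hm ?_
  exact h.le_posEig_of_trial t (trialConst_pos hα hκ l) h1 h2 h3 h4 h5 hd

theorem mode_le_nth (hα' : α ≤ 1 / 4) (hκ : 0 < κ) {a t m : ℝ} {l J : ℕ}
    (hJ : 26 * κ ≤ J) (hm : IsNthPos (modeT α κ) (modeB α a) t l m) :
    exp (-(1 / 26)) * ((l : ℝ) - 2 * J - 1) - |a| * |t| ≤ m := by
  have h := modeT_isSimplePencil hα hα' hκ a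
  by_contra! hlt
  have hat : 0 ≤ |a| * |t| := by positivity
  have hpos : 0 < exp (-(1 / 26)) * ((l : ℝ) - 2 * J - 1) := by linarith [hm.1]
  have hl : (0 : ℝ) < (l : ℝ) - 2 * J - 1 := (mul_pos_iff_of_pos_left (exp_pos _)).mp hpos
  have hl' : 2 * J + 1 < l := by
    have : ((2 * J + 1 : ℕ) : ℝ) < l := by push_cast; linarith
    exact_mod_cast this
  obtain ⟨N, hN⟩ : ∃ N, l = N + 2 * J + 1 := ⟨l - (2 * J + 1), by omega⟩
  have hN1 : 1 ≤ N := by omega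
  have hNr : (l : ℝ) - 2 * J - 1 = N := by rw [hN]; push_cast; ring
  obtain ⟨F, hF, hFr, hFn⟩ := exists_modeT_approx hα hα' hκ hN1 hJ
  have key := h.ncard_le (t := t) (c := m) hF hFr (by
    rw [hNr] at hlt
    calc ‖modeT α κ - F‖ * (m + |a| * |t|) ≤ exp (1 / 26) / N * (m + |a| * |t|) := by
          gcongr
          linarith [hm.1]
      _ < exp (1 / 26) / N * (exp (-(1 / 26)) * N) := by gcongr; linarith
      _ = 1 := by rw [exp_neg]; field_simp)
  rw [hm.2.2] at key
  omega

theorem rot_dist_le {β b θ : ℝ} (hβ : 0 ≤ β) :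
    |rot α a θ - rot β b θ| ≤ |a - b| + |b| * |α - β| := by
  have h1 : 1 ≤ √(dlt α θ) := one_le_sqrt.mpr (one_le_dlt hα)
  have h2 : 1 ≤ √(dlt β θ) := one_le_sqrt.mpr (one_le_dlt hβ)
  have p1 := one_pos.trans_le h1
  have e : rot α a θ - rot β b θ = (a - b) * (sin θ / √(dlt α θ))
      - b * (sin θ * ((dlt α θ - dlt β θ)
        / (√(dlt α θ) * √(dlt β θ) * (√(dlt α θ) + √(dlt β θ))))) := by
    have e1 : dlt α θ - dlt β θ = (√(dlt α θ) + √(dlt β θ)) * (√(dlt α θ) - √(dlt β θ)) := by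
      have s1 := mul_self_sqrt (dlt_pos (θ := θ) hα).le
      have s2 := mul_self_sqrt (dlt_pos (θ := θ) hβ).le
      linear_combination s2 - s1
    rw [e1, rot, rot]
    field_simp
    ring
  rw [e]
  refine (abs_sub _ _).trans (add_le_add ?_ ?_)
  · rw [abs_mul]
    refine mul_le_of_le_one_right (abs_nonneg _) ?_
    rw [abs_div, abs_of_pos p1, div_le_one p1]
    exact (abs_sin_le_one θ).trans h1
  · rw [abs_mul, abs_mul, abs_div]
    refine mul_le_mul_of_nonneg_left ?_ (abs_nonneg _)
    have q : 1 ≤ √(dlt α θ) * √(dlt β θ) * (√(dlt α θ) + √(dlt β θ)) := by bound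
    rw [abs_of_pos (one_pos.trans_le q)]
    calc |sin θ| * (|dlt α θ - dlt β θ| / _)
        ≤ 1 * (|α - β| / 1) := by
          refine mul_le_mul (abs_sin_le_one θ) ?_ (by positivity) zero_le_one
          exact div_le_div₀ (abs_nonneg _) dlt_dist_le one_pos q
      _ = |α - β| := by rw [div_one, one_mul]

theorem rotMul_dist_le {β b : ℝ} (hβ : 0 ≤ β) :
    ‖rotMul α a - rotMul β b‖ ≤ |a - b| + |b| * |α - β| := by
  refine opNorm_le_bound _ (by positivity) fun u => ?_
  refine Lp.norm_le_mul_norm_of_ae_le_mul ?_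
  filter_upwards [Lp.coeFn_sub (rotMul α a u) (rotMul β b u), rotMul_ae (a := a) hα u,
    rotMul_ae (a := b) hβ u] with θ h1 h2 h3
  rw [_root_.sub_apply, h1, Pi.sub_apply, h2, h3, ← sub_mul, norm_mul, ← ofReal_sub, norm_real]
  exact mul_le_mul_of_nonneg_right (rot_dist_le hα hβ) (norm_nonneg _)

theorem modeB_dist_le {β b : ℝ} (hβ : 0 ≤ β) :
    ‖modeB α a - modeB β b‖ ≤ |a - b| + |b| * |α - β| := by
  rw [modeB, modeB, offDiag_sub, ← smul_sub, ← smul_sub]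
  exact norm_offDiag_le ((norm_unit_smul _).2.le.trans (rotMul_dist_le hα hβ))
    ((norm_unit_smul _).1.le.trans (rotMul_dist_le hα hβ))

omit hα in
theorem modeB_continuous {X : Type*} [TopologicalSpace X] {f : X → NNReal} {g : X → ℝ}
    (hf : Continuous f) (hg : Continuous g) : Continuous fun x => modeB (f x) (g x) := by
  rw [continuous_iff_continuousAt]
  intro x
  rw [ContinuousAt, tendsto_iff_norm_sub_tendsto_zero]
  have h0 : Tendsto (fun y => |g y - g x| + |g x| * |(f y : ℝ) - f x|) (𝓝 x) (𝓝 0) := by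
    have : Continuous fun y => |g y - g x| + |g x| * |(f y : ℝ) - f x| := by fun_prop
    simpa using this.tendsto x
  exact squeeze_zero (fun y => norm_nonneg _) (fun y => modeB_dist_le (f y).2 (f x).2) h0

end Radial

section Blocks

variable {E H : Type*} [NormedAddCommGroup E] [InnerProductSpace ℂ E] [CompleteSpace E]
  [NormedAddCommGroup H] [InnerProductSpace ℂ H] [CompleteSpace H] {U : ℤ → E →ₗᵢ[ℂ] H}

theorem block_ext (hU : IsHilbertSum ℂ (fun _ : ℤ => E) U) {F : Type*} [NormedAddCommGroup F]
    [NormedSpace ℂ F] {D D' : H →L[ℂ] F} (h : ∀ j v, D (U j v) = D' (U j v)) : D = D' := by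
  ext1 x
  have hx := hU.hasSum_linearIsometryEquiv_symm (hU.linearIsometryEquiv x)
  rw [LinearIsometryEquiv.symm_apply_apply] at hx
  have h1 := D.hasSum hx
  have h2 := D'.hasSum hx
  simp only [h] at h1
  exact h1.unique h2

theorem exists_block (hU : IsHilbertSum ℂ (fun _ : ℤ => E) U) {A : ℤ → E →L[ℂ] E} {c : ℝ}
    (hc : 0 ≤ c) (hA : ∀ j, ‖A j‖ ≤ c) :
    ∃ D : H →L[ℂ] H, ‖D‖ ≤ c ∧ ∀ j v, D (U j v) = U j (A j v) := by
  classical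
  let V := hU.linearIsometryEquiv
  have hle : ∀ (w : lp (fun _ : ℤ => E) 2) j, ‖A j (w j)‖ ≤ ‖((c : ℂ) • w) j‖ := fun w j => by
    rw [lp.coeFn_smul, Pi.smul_apply, norm_smul, norm_real, norm_of_nonneg hc]
    exact (A j).le_of_opNorm_le (hA j) _
  let L : lp (fun _ : ℤ => E) 2 →ₗ[ℂ] lp (fun _ : ℤ => E) 2 :=
    { toFun := fun w => ⟨fun j => A j (w j), (lp.memℓp ((c : ℂ) • w)).mono' (hle w)⟩
      map_add' := fun _ _ => by ext j; exact map_add (A j) _ _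
      map_smul' := fun _ _ => by ext j; exact map_smul (A j) _ _ }
  have hL : ∀ w, ‖L w‖ ≤ c * ‖w‖ := fun w => by
    refine (lp.norm_mono two_ne_zero (x := L w) (hle w)).trans_eq ?_
    rw [norm_smul, norm_real, norm_of_nonneg hc]
  let D : H →L[ℂ] H := V.symm.toContinuousLinearEquiv.toContinuousLinearMap ∘L
    L.mkContinuous c hL ∘L V.toContinuousLinearEquiv.toContinuousLinearMap
  have hD : ∀ x, D x = V.symm (L (V x)) := fun x => rfl
  refine ⟨D, opNorm_le_bound _ hc fun x => ?_, fun j v => ?_⟩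
  · rw [hD, LinearIsometryEquiv.norm_map]
    exact (hL _).trans_eq (by rw [LinearIsometryEquiv.norm_map])
  · have h1 : V (U j v) = lp.single 2 j v := by
      rw [← hU.linearIsometryEquiv_symm_apply_single, LinearIsometryEquiv.apply_symm_apply]
    have h2 : L (lp.single 2 j v) = lp.single 2 j (A j v) := by
      ext i
      change A i ((lp.single 2 j v : lp (fun _ : ℤ => E) 2) i) = _
      by_cases hij : i = j
      · bound
      · rw [lp.single_apply_ne _ _ _ hij, lp.single_apply_ne _ _ _ hij, map_zero]
    rw [hD, h1, h2, hU.linearIsometryEquiv_symm_apply_single]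

/-- The component in the `j`-th summand. -/
def coord (U : ℤ → E →ₗᵢ[ℂ] H) (j : ℤ) : H →L[ℂ] E := adjoint (U j).toContinuousLinearMap

theorem inner_coord (U : ℤ → E →ₗᵢ[ℂ] H) (j : ℤ) (v : E) (x : H) :
    inner ℂ v (coord U j x) = inner ℂ (U j v) x :=
  adjoint_inner_right _ _ _

theorem coord_same (U : ℤ → E →ₗᵢ[ℂ] H) (j : ℤ) (v : E) : coord U j (U j v) = v :=
  ext_inner_left ℂ fun w => by rw [inner_coord, LinearIsometry.inner_map_map]

theorem coord_ne (hU : IsHilbertSum ℂ (fun _ : ℤ => E) U) {i j : ℤ} (hij : i ≠ j) (v : E) :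
    coord U i (U j v) = 0 :=
  ext_inner_left ℂ fun w => by rw [inner_coord, inner_zero_right]; exact hU.OrthogonalFamily hij w v

theorem coord_ext (hU : IsHilbertSum ℂ (fun _ : ℤ => E) U) {x y : H}
    (h : ∀ j, coord U j x = coord U j y) : x = y := by
  have : innerSL ℂ (x - y) = 0 := block_ext hU fun j v => by
    rw [innerSL_apply_apply, _root_.zero_apply, ← inner_conj_symm, ← inner_coord, map_sub, h, sub_self,
      inner_zero_right, map_zero]
  rw [← sub_eq_zero, ← inner_self_eq_zero (𝕜 := ℂ), ← innerSL_apply_apply, this, _root_.zero_apply]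

variable {D : H →L[ℂ] H} {A : ℤ → E →L[ℂ] E}

theorem coord_block (hU : IsHilbertSum ℂ (fun _ : ℤ => E) U) (hD : ∀ j v, D (U j v) = U j (A j v))
    (j : ℤ) (x : H) : coord U j (D x) = A j (coord U j x) := by
  have : coord U j ∘L D = A j ∘L coord U j := block_ext hU fun i v => by
    rw [comp_apply, comp_apply, hD]
    by_cases hij : j = i
    · subst hij; rw [coord_same, coord_same]
    · rw [coord_ne hU hij, coord_ne hU hij, map_zero]
  exact congrArg (fun L : H →L[ℂ] E => L x) this

theorem eq_of_coord (hU : IsHilbertSum ℂ (fun _ : ℤ => E) U) {j : ℤ} {x : H}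
    (h : ∀ i, i ≠ j → coord U i x = 0) : x = U j (coord U j x) :=
  coord_ext hU fun i => by
    by_cases hij : i = j
    · subst hij; rw [coord_same]
    · rw [h i hij, coord_ne hU hij]

theorem block_symm (hU : IsHilbertSum ℂ (fun _ : ℤ => E) U) (hD : ∀ j v, D (U j v) = U j (A j v))
    (hA : ∀ j x y, inner ℂ (A j x) y = inner ℂ x (A j y)) (x y : H) :
    inner ℂ (D x) y = inner ℂ x (D y) := by
  have : innerSL ℂ (D x) = innerSL ℂ x ∘L D := block_ext hU fun j v => by
    rw [innerSL_apply_apply, comp_apply, innerSL_apply_apply, hD,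
      ← inner_conj_symm, ← inner_coord, coord_block hU hD, ← hA, inner_coord, inner_conj_symm]
  exact congrArg (fun L : H →L[ℂ] ℂ => L y) this

theorem block_finApprox (hU : IsHilbertSum ℂ (fun _ : ℤ => E) U)
    (hD : ∀ j v, D (U j v) = U j (A j v)) (hA : ∀ j, FinApprox (A j))
    (hs : ∀ ε > 0, ∃ s : Finset ℤ, ∀ j ∉ s, ‖A j‖ ≤ ε) : FinApprox D := by
  classical
  refine FinApprox.of_approx fun ε hε => ?_
  obtain ⟨s, hs⟩ := hs ε hε
  obtain ⟨D', h1, h2⟩ := exists_block hU (A := fun j => if j ∈ s then 0 else A j) hε.le fun j => by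
    split_ifs with h
    · rw [norm_zero]; exact hε.le
    · exact hs j h
  refine ⟨∑ j ∈ s, ((U j).toContinuousLinearMap ∘L A j) ∘L coord U j,
    FinApprox.sum s fun j _ => ((hA j).comp_left _).comp_right _, ?_⟩
  have e : D - ∑ j ∈ s, ((U j).toContinuousLinearMap ∘L A j) ∘L coord U j = D' :=
    block_ext hU fun j v => by
      rw [_root_.sub_apply, hD, h2, _root_.sum_apply]
      have h3 : ∀ i, (((U i).toContinuousLinearMap ∘L A i) ∘L coord U i) (U j v)
          = if i = j then U j (A j v) else 0 := fun i => by
        change U i (A i (coord U i (U j v))) = _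
        split_ifs with hij
        · rw [hij, coord_same]
        · rw [coord_ne hU hij, map_zero, map_zero]
      simp only [h3]
      rw [Finset.sum_ite_eq']
      split_ifs <;> simp
  rw [e]
  exact h1

end Blocks

section Embedding

/-- Lebesgue measure on `(0, 2π)`. -/
def circMeasure : Measure ℝ := volume.restrict (Ioo 0 (2 * π))

instance : IsFiniteMeasure circMeasure := by unfold circMeasure; infer_instance

theorem sphereMeasure_eq : sphereMeasure = arcMeasure.prod circMeasure := by
  rw [sphereMeasure, arcMeasure, circMeasure, Measure.prod_restrict]
  rfl

theorem sphere_ae_of_arc {p : ℝ → Prop} (h : ∀ᵐ θ ∂arcMeasure, p θ) :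
    ∀ᵐ x ∂sphereMeasure, p x.1 := by
  rw [sphereMeasure_eq]
  exact Measure.quasiMeasurePreserving_fst.ae h

theorem sphere_ae_mem : ∀ᵐ x ∂sphereMeasure, x.1 ∈ Ioo 0 π :=
  sphere_ae_of_arc (ae_restrict_mem measurableSet_Ioo)

/-- `e^{ikφ} / √(2π)`. -/
def expo (k φ : ℝ) : ℂ := Complex.exp (I * k * φ) / √(2 * π)

theorem expo_continuous (k : ℝ) : Continuous (expo k) := by unfold expo; fun_prop

theorem norm_expo (k φ : ℝ) : ‖expo k φ‖ = (√(2 * π))⁻¹ := by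
  have : I * k * φ = ((k * φ : ℝ) : ℂ) * I := by push_cast; ring
  rw [expo, norm_div, this, norm_exp_ofReal_mul_I, norm_real,
    norm_of_nonneg (sqrt_nonneg _), one_div]

theorem exists_emb (k : ℝ) (i : Fin 2) : ∃ M : ArcL2 →L[ℂ] L2S, ‖M‖ ≤ 1 ∧
    ∀ v : ArcL2, M v =ᵐ[sphereMeasure] fun x => single i (expo k x.2 * v x.1) := by
  have : ∀ v : ArcL2, AEStronglyMeasurable (fun x : ℝ × ℝ => expo k x.2 * v x.1)
      sphereMeasure := fun v => by
    rw [sphereMeasure_eq]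
    exact ((expo_continuous k).comp continuous_snd).aestronglyMeasurable.mul
      (Lp.aestronglyMeasurable v).comp_fst
  refine exists_clm_of_ae _ (fun u v => ?_) (fun c u => ?_) (fun v => ?_) zero_le_one fun v => ?_
  · filter_upwards [sphere_ae_of_arc (Lp.coeFn_add u v)] with x hx
    rw [hx, Pi.add_apply, mul_add]
    ext l
    simp only [PiLp.single_apply, PiLp.add_apply]
    split_ifs <;> simp
  · filter_upwards [sphere_ae_of_arc (Lp.coeFn_smul c u)] with x hx
    rw [hx, Pi.smul_apply, smul_eq_mul]
    ext l
    simp only [PiLp.single_apply, PiLp.smul_apply, smul_eq_mul]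
    split_ifs <;> ring
  · have : Continuous fun z : ℂ => (single i z : Spinor) :=
      (LinearIsometry.mk (LinearMap.toSpanSingleton ℂ Spinor (single i 1))
        fun z => by simp [norm_smul]).continuous.congr fun z => by ext l; simp [PiLp.single_apply]
    fun_prop
  · refine eLpNorm_two_le_of_sq zero_le_one ?_
    have e : ∀ x : ℝ × ℝ, ‖(single i (expo k x.2 * v x.1) : Spinor)‖ₑ ^ 2
        = ‖v x.1‖ₑ ^ 2 * ofReal ((2 * π)⁻¹) := fun x => by
      rw [← ofReal_norm, PiLp.norm_single, norm_mul, norm_expo,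
        ofReal_mul (by positivity), ofReal_norm, mul_pow, mul_comm,
        ← ofReal_pow (by positivity), inv_pow, sq_sqrt (by positivity)]
    simp only [e]
    rw [sphereMeasure_eq, lintegral_prod_mul
      ((Lp.aestronglyMeasurable v).enorm.pow_const 2) aemeasurable_const, lintegral_const,
      mul_comm]
    refine mul_le_mul_left (le_of_eq ?_) _
    rw [circMeasure, Measure.restrict_apply_univ, volume_Ioo, sub_zero,
      ← ofReal_mul (by positivity), inv_mul_cancel₀ (by positivity), one_pow]

/-- The map `v ↦ e^{ikφ} v e_i / √(2π)`. -/
def emb (k : ℝ) (i : Fin 2) : ArcL2 →L[ℂ] L2S := (exists_emb k i).choose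

theorem emb_ae (k : ℝ) (i : Fin 2) (v : ArcL2) :
    emb k i v =ᵐ[sphereMeasure] fun x => single i (expo k x.2 * v x.1) :=
  (exists_emb k i).choose_spec.2 v

theorem inner_emb_left (k : ℝ) (i : Fin 2) (v : ArcL2) (u : L2S) :
    Integrable (fun x : ℝ × ℝ => starRingEnd ℂ (u x i) * (expo k x.2 * v x.1))
      (arcMeasure.prod circMeasure) ∧
    inner ℂ u (emb k i v)
      = ∫ x, starRingEnd ℂ (u x i) * (expo k x.2 * v x.1) ∂(arcMeasure.prod circMeasure) := by
  have h : (fun x => inner ℂ (u x) (emb k i v x)) =ᵐ[sphereMeasure]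
      fun x => starRingEnd ℂ (u x i) * (expo k x.2 * v x.1) := by
    filter_upwards [emb_ae k i v] with x hx
    rw [hx, EuclideanSpace.inner_single_right, mul_comm]
  have h2 := L2.integrable_inner (𝕜 := ℂ) u (emb k i v)
  rw [← sphereMeasure_eq]
  exact ⟨h2.congr h, by rw [L2.inner_def]; exact integral_congr_ae h⟩

theorem integral_circ {F : Type*} [NormedAddCommGroup F] [NormedSpace ℝ F] (f : ℝ → F) :
    ∫ φ, f φ ∂circMeasure = ∫ φ in (0 : ℝ)..(2 * π), f φ := by
  rw [integral_of_le (by positivity), integral_Ioc_eq_integral_Ioo]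
  rfl

theorem integral_expo {k k' : ℝ} (n : ℤ) (hn : k' - k = n) :
    ∫ φ, starRingEnd ℂ (expo k φ) * expo k' φ ∂circMeasure = if k = k' then 1 else 0 := by
  have hpi := pi_pos
  have hs : ((√(2 * π) : ℝ) : ℂ) * ((√(2 * π) : ℝ) : ℂ) = 2 * π := by
    rw [← Complex.ofReal_mul, mul_self_sqrt (by positivity)]
    push_cast
    rfl
  have e : ∀ φ : ℝ, starRingEnd ℂ (expo k φ) * expo k' φ
      = Complex.exp (I * n * φ) / (2 * π) := fun φ => by
    rw [expo, expo, map_div₀, ← Complex.exp_conj, conj_ofReal, div_mul_div_comm,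
      ← Complex.exp_add, hs]
    congr 2
    have : (n : ℂ) = k' - k := by rw [← Complex.ofReal_intCast, ← hn]; push_cast; rfl
    rw [this]
    simp only [map_mul, conj_I, conj_ofReal]
    ring
  simp only [e]
  rw [integral_circ, intervalIntegral.integral_div]
  split_ifs with h
  · have : n = 0 := by rw [h, sub_self] at hn; exact_mod_cast hn.symm
    simp [this, hpi.ne']
  · have hn0 : (n : ℂ) ≠ 0 := by
      intro h0
      apply h
      have : n = 0 := by exact_mod_cast h0
      rw [this, Int.cast_zero] at hn
      linarith
    rw [integral_exp_mul_complex (mul_ne_zero I_ne_zero hn0)]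
    have : I * n * ((2 * π : ℝ) : ℂ) = n * (2 * π * I) := by push_cast; ring
    rw [this, exp_int_mul_two_pi_mul_I]
    simp

theorem inner_emb_emb {k k' : ℝ} (n : ℤ) (hn : k' - k = n) (i i' : Fin 2) (u v : ArcL2) :
    inner ℂ (emb k i u) (emb k' i' v) = if k = k' ∧ i = i' then inner ℂ u v else 0 := by
  rw [(inner_emb_left k' i' v _).2]
  have h : (fun x : ℝ × ℝ => starRingEnd ℂ (emb k i u x i') * (expo k' x.2 * v x.1))
      =ᵐ[arcMeasure.prod circMeasure] fun x => (starRingEnd ℂ (u x.1) * v x.1) *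
        ((if i = i' then 1 else 0) * (starRingEnd ℂ (expo k x.2) * expo k' x.2)) := by
    rw [← sphereMeasure_eq]
    filter_upwards [emb_ae k i u] with x hx
    rw [hx, PiLp.single_apply]
    by_cases hi : i = i'
    · rw [if_pos hi, if_pos hi.symm, map_mul]; ring
    · rw [if_neg hi, if_neg (Ne.symm hi), map_zero]; ring
  rw [integral_congr_ae h, integral_prod_mul (fun θ => starRingEnd ℂ (u θ) * v θ) fun φ =>
    (if i = i' then 1 else 0) * (starRingEnd ℂ (expo k φ) * expo k' φ), integral_const_mul,
    integral_expo n hn, L2.inner_def]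
  have e : ∀ θ, inner ℂ (u θ) (v θ) = starRingEnd ℂ (u θ) * v θ := fun θ => by
    rw [RCLike.inner_apply, mul_comm]
  grind

/-- The half-integer `j + 1/2`. -/
def freq (j : ℤ) : ℝ := j + 1 / 2

theorem freq_sub (i j : ℤ) : freq j - freq i = ((j - i : ℤ) : ℝ) := by unfold freq; push_cast; ring

theorem freq_injective : Function.Injective freq := fun i j h => by
  unfold freq at h
  exact_mod_cast add_right_cancel h

theorem eq_zero_of_integral_expo {g : ℝ → ℂ} (hg : MemLp g 2 circMeasure)
    (h : ∀ j, ∫ φ, g φ * expo (freq j) φ ∂circMeasure = 0) : ∫ φ, ‖g φ‖ ^ 2 ∂circMeasure = 0 := by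
  have hpi := pi_pos
  have hab : (0 : ℝ) < 2 * π := by positivity
  let f : ℝ → ℂ := fun φ => g φ * Complex.exp (I / 2 * φ)
  have hn : ∀ φ : ℝ, ‖Complex.exp (I / 2 * φ)‖ = 1 := fun φ => by
    have : I / 2 * φ = ((φ / 2 : ℝ) : ℂ) * I := by push_cast; ring
    rw [this, norm_exp_ofReal_mul_I]
  have hfn : ∀ φ, ‖f φ‖ = ‖g φ‖ := fun φ => by simp only [f]; rw [norm_mul, hn, mul_one]
  have hc : Continuous fun φ : ℝ => Complex.exp (I / 2 * φ) := by fun_prop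
  have hf : MemLp f 2 (volume.restrict (Ioc 0 (2 * π))) := by
    rw [← restrict_Ioo_eq_restrict_Ioc]
    exact hg.congr_norm (hg.1.mul hc.aestronglyMeasurable) (.of_forall fun φ => (hfn φ).symm)
  have key := hasSum_sq_fourierCoeffOn hab hf
  have hz : ∀ n, fourierCoeffOn hab f n = 0 := fun n => by
    rw [fourierCoeffOn_eq_integral]
    have e : ∀ φ : ℝ, fourier (-n) (φ : AddCircle (2 * π - 0)) • f φ
        = (√(2 * π) : ℝ) * (g φ * expo (freq (-n)) φ) := fun φ => by
      have h0 : ((√(2 * π) : ℝ) : ℂ) ≠ 0 := ofReal_ne_zero.mpr (sqrt_pos.mpr hab).ne'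
      rw [fourier_coe_apply, smul_eq_mul, expo]
      simp only [f]
      rw [mul_left_comm, ← Complex.exp_add, mul_div_assoc', mul_div_cancel₀ _ h0]
      congr 2
      unfold freq
      push_cast
      have : (π : ℂ) ≠ 0 := ofReal_ne_zero.mpr hpi.ne'
      field_simp
      ring
    simp only [e]
    rw [intervalIntegral.integral_const_mul, ← integral_circ, h, mul_zero, smul_zero]
  simp only [hz, norm_zero, zero_pow two_ne_zero, hfn] at key
  have := key.unique hasSum_zero
  rw [sub_zero, smul_eq_zero_iff_right (by positivity)] at this
  rw [integral_circ, this]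

theorem emb_total {u : L2S} (h : ∀ j i v, inner ℂ u (emb (freq j) i v) = 0) : u = 0 := by
  have hu : MemLp (fun x => u x) 2 (arcMeasure.prod circMeasure) := by
    have key : ∀ f : ℝ × ℝ → Spinor, MemLp f 2 sphereMeasure → MemLp f 2 (arcMeasure.prod circMeasure) :=
      fun f hf => by rwa [← sphereMeasure_eq]
    exact key _ (Lp.memLp u)
  have hui : ∀ i, MemLp (fun x => starRingEnd ℂ (u x i)) 2 (arcMeasure.prod circMeasure) := fun i =>
    (hu.eval_piLp i).star
  have hF : ∀ i j, ∀ᵐ θ ∂arcMeasure,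
      ∫ φ, starRingEnd ℂ (u (θ, φ) i) * expo (freq j) φ ∂circMeasure = 0 := by
    intro i j
    have hint : ∀ v : ArcL2, ∫ θ, (∫ φ, starRingEnd ℂ (u (θ, φ) i) * expo (freq j) φ ∂circMeasure)
        * v θ ∂arcMeasure = 0 := fun v => by
      have h1 := inner_emb_left (freq j) i v u
      rw [← h j i v, h1.2, integral_prod _ h1.1]
      refine integral_congr_ae (.of_forall fun θ => ?_)
      simp only [← mul_assoc]
      rw [integral_mul_const]
    have hone : MemLp (fun _ : ℝ => (1 : ℂ)) 2 arcMeasure := memLp_const 1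
    have h1 := (inner_emb_left (freq j) i hone.toLp u).1
    have h2 : Integrable (fun x : ℝ × ℝ => starRingEnd ℂ (u x i) * expo (freq j) x.2)
        (arcMeasure.prod circMeasure) := by
      refine h1.congr ?_
      rw [← sphereMeasure_eq]
      filter_upwards [sphere_ae_of_arc hone.coeFn_toLp] with x hx
      rw [hx, mul_one]
    refine h2.integral_prod_left.ae_eq_zero_of_forall_setIntegral_eq_zero fun s hs _ => ?_
    have hind : MemLp (s.indicator fun _ : ℝ => (1 : ℂ)) 2 arcMeasure := hone.indicator hs
    rw [← hint hind.toLp, ← integral_indicator hs]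
    refine integral_congr_ae ?_
    filter_upwards [hind.coeFn_toLp] with θ hθ
    rw [hθ]
    by_cases hm : θ ∈ s
    · rw [indicator_of_mem hm, indicator_of_mem hm, mul_one]
    · rw [indicator_of_notMem hm, indicator_of_notMem hm, mul_zero]
  have hz : ∀ i, ∀ᵐ x ∂sphereMeasure, u x i = 0 := by
    intro i
    have hsq : Integrable (fun x => ‖starRingEnd ℂ (u x i)‖ ^ 2) (arcMeasure.prod circMeasure) :=
      (hui i).integrable_norm_pow two_ne_zero
    have h0 : ∫ x, ‖starRingEnd ℂ (u x i)‖ ^ 2 ∂(arcMeasure.prod circMeasure) = 0 := by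
      rw [integral_prod _ hsq]
      refine integral_eq_zero_of_ae ?_
      filter_upwards [ae_all_iff.mpr (hF i), hsq.prod_right_ae, (hui i).1.prodMk_left]
        with θ h1 h2 h3
      refine eq_zero_of_integral_expo ?_ h1
      exact (memLp_two_iff_integrable_sq_norm h3).mpr h2
    rw [integral_eq_zero_iff_of_nonneg (fun x => by positivity) hsq, ← sphereMeasure_eq] at h0
    filter_upwards [h0] with x hx
    simpa using hx
  refine Lp.ext ?_
  filter_upwards [hz 0, hz 1, Lp.coeFn_zero Spinor 2 sphereMeasure] with x h0 h1 h2
  rw [h2]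
  ext i
  fin_cases i
  · exact h0
  · exact h1

/-- The sign of `j + 1/2`. -/
def fsgn (j : ℤ) : ℝ := if 0 ≤ j then 1 else -1

/-- The component in which the first function of a mode is placed. -/
def slot (j : ℤ) : Fin 2 := if 0 ≤ j then 0 else 1

theorem abs_freq (j : ℤ) : |freq j| = fsgn j * freq j := by
  unfold fsgn freq
  split_ifs with h
  · have : (0 : ℝ) ≤ j := by exact_mod_cast h
    grind
  · have : (j : ℝ) ≤ -1 := by exact_mod_cast (by omega : j ≤ -1)
    grind

theorem isFreq_abs (j : ℤ) : IsFreq |freq j| := by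
  rw [abs_freq]
  unfold fsgn freq IsFreq
  split_ifs with h
  · rcases h.eq_or_lt with h | h
    · left; rw [← h]; norm_num
    · right
      have : (1 : ℝ) ≤ j := by exact_mod_cast h
      linarith
  · rcases (by omega : j = -1 ∨ j ≤ -2) with h | h
    · left; rw [h]; norm_num
    · right
      have : (j : ℝ) ≤ -2 := by exact_mod_cast h
      linarith

theorem slot_ne (j : ℤ) : slot j ≠ slot j + 1 := by unfold slot; split_ifs <;> decide

/-- The embedding of the space of the mode `j + 1/2`. -/
def modeEmb (j : ℤ) : ModeL2 →ₗᵢ[ℂ] L2S := LinearMap.isometryOfInner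
    ((emb (freq j) (slot j)).toLinearMap ∘ₗ WithLp.fstₗ 2 ℂ ArcL2 ArcL2
      + (emb (freq j) (slot j + 1)).toLinearMap ∘ₗ WithLp.sndₗ 2 ℂ ArcL2 ArcL2)
    fun x y => by
      have h : freq j - freq j = ((0 : ℤ) : ℝ) := by simp
      change inner ℂ (emb (freq j) (slot j) x.fst + emb (freq j) (slot j + 1) x.snd)
        (emb (freq j) (slot j) y.fst + emb (freq j) (slot j + 1) y.snd) = _
      simp only [inner_add_left, inner_add_right, inner_emb_emb 0 h, two_inner]
      simp [(slot_ne j).symm]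

theorem modeEmb_apply (j : ℤ) (v : ModeL2) : modeEmb j v
    = emb (freq j) (slot j) v.fst + emb (freq j) (slot j + 1) v.snd := rfl

theorem modeEmb_isHilbertSum : IsHilbertSum ℂ (fun _ : ℤ => ModeL2) modeEmb := by
  refine IsHilbertSum.mk (fun i j hij x y => ?_) ?_
  · rw [modeEmb_apply, modeEmb_apply]
    have : freq i ≠ freq j := freq_injective.ne hij
    simp only [inner_add_left, inner_add_right, inner_emb_emb _ (freq_sub i j)]
    simp [this]
  · rw [top_le_iff, Submodule.topologicalClosure_eq_top_iff, Submodule.eq_bot_iff]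
    intro u hu
    have h : ∀ j v, inner ℂ u (modeEmb j v) = 0 := fun j v => by
      rw [← inner_conj_symm, (Submodule.mem_orthogonal _ _).mp hu, map_zero]
      exact Submodule.mem_iSup_of_mem j ⟨v, rfl⟩
    refine emb_total fun j i v => ?_
    by_cases hi : i = slot j
    · have := h j (WithLp.toLp 2 (v, 0)); rw [modeEmb_apply] at this; simpa [hi] using this
    · have hi' : i = slot j + 1 := by unfold slot at hi ⊢; split_ifs at hi ⊢ <;> omega
      have := h j (WithLp.toLp 2 (0, v))
      rw [modeEmb_apply] at this
      simpa [hi'] using this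

end Embedding

section Fields

/-- Continuous away from the poles and zero near them. -/
def IsPairable (g : ℝ × ℝ → Spinor) : Prop := ContinuousOn g (Ioo 0 π ×ˢ univ) ∧
    ∃ ε > 0, ∀ x : ℝ × ℝ, x.1 ∉ Icc ε (π - ε) → g x = 0

variable {g h ψ χ : ℝ × ℝ → Spinor}

instance : IsFiniteMeasure sphereMeasure := by rw [sphereMeasure_eq]; infer_instance

theorem IsPairable.memLp (hg : IsPairable g) : MemLp g 2 sphereMeasure := by
  obtain ⟨hg, ε, hε, hs⟩ := hg
  have hmeas : AEStronglyMeasurable g sphereMeasure :=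
    (hg.mono (prod_mono_right (subset_univ _))).aestronglyMeasurable
      (measurableSet_Ioo.prod measurableSet_Ioo)
  have hcont : ContinuousOn g (Icc ε (π - ε) ×ˢ Icc 0 (2 * π)) := by refine hg.mono ?_; grind
  obtain ⟨C, hC⟩ := (isCompact_Icc.prod isCompact_Icc).exists_bound_of_continuousOn hcont
  refine MemLp.of_bound hmeas (max C 0) ?_
  refine (ae_restrict_mem (measurableSet_Ioo.prod measurableSet_Ioo)).mono ?_
  rintro ⟨x, y⟩ ⟨hx, hy⟩
  by_cases h : x ∈ Icc ε (π - ε)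
  · grind
  · rw [hs (x, y) h, norm_zero]; exact le_max_right _ _

open Classical in
/-- The element of `L²(S²)` defined by a field. -/
def fld (g : ℝ × ℝ → Spinor) : L2S := if h : MemLp g 2 sphereMeasure then h.toLp else 0

theorem IsPairable.fld_ae (hg : IsPairable g) : fld g =ᵐ[sphereMeasure] g := by
  rw [fld, dif_pos hg.memLp]
  exact hg.memLp.coeFn_toLp

theorem IsPairable.inner_fld (hg : IsPairable g) (u : L2S) :
    inner ℂ (fld g) u = ∫ x, inner ℂ (g x) (u x) ∂sphereMeasure := by
  rw [L2.inner_def]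
  refine integral_congr_ae ?_
  filter_upwards [hg.fld_ae] with x hx
  rw [hx]

theorem fld_congr (hgh : ∀ x : ℝ × ℝ, x.1 ∈ Ioo 0 π → g x = h x) : fld g = fld h := by
  have e : g =ᵐ[sphereMeasure] h := sphere_ae_mem.mono fun x hx => hgh x hx
  by_cases hg : MemLp g 2 sphereMeasure
  · rw [fld, fld, dif_pos hg, dif_pos ((memLp_congr_ae e).mp hg)]; exact MemLp.toLp_congr _ _ e
  · rw [fld, fld, dif_neg hg, dif_neg fun hh => hg ((memLp_congr_ae e).mpr hh)]

theorem IsPairable.add (hg : IsPairable g) (hh : IsPairable h) : IsPairable fun x => g x + h x := by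
  obtain ⟨h1, ε, hε, h2⟩ := hg
  obtain ⟨h3, δ, hδ, h4⟩ := hh
  refine ⟨h1.add h3, min ε δ, lt_min hε hδ, fun x hx => ?_⟩
  beta_reduce
  rw [h2 x fun h => hx ⟨(min_le_left _ _).trans h.1, h.2.trans (by linarith [min_le_left ε δ])⟩,
    h4 x fun h => hx ⟨(min_le_right _ _).trans h.1, h.2.trans (by linarith [min_le_right ε δ])⟩,
    add_zero]

theorem IsPairable.smul (hg : IsPairable g) (c : ℂ) : IsPairable fun x => c • g x := by
  obtain ⟨h1, ε, hε, h2⟩ := hg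
  exact ⟨h1.const_smul c, ε, hε, fun x hx => by beta_reduce; rw [h2 x hx, smul_zero]⟩

theorem fld_add (hg : IsPairable g) (hh : IsPairable h) :
    fld (fun x => g x + h x) = fld g + fld h := by
  refine Lp.ext ?_
  filter_upwards [(hg.add hh).fld_ae, hg.fld_ae, hh.fld_ae, Lp.coeFn_add (fld g) (fld h)]
    with x h1 h2 h3 h4
  rw [h1, h4, Pi.add_apply, h2, h3]

theorem fld_smul (hg : IsPairable g) (c : ℂ) : fld (fun x => c • g x) = c • fld g := by
  refine Lp.ext ?_
  filter_upwards [(hg.smul c).fld_ae, hg.fld_ae, Lp.coeFn_smul c (fld g)] with x h1 h2 h3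
  rw [h1, h3, Pi.smul_apply, h2]

/-- The action of a matrix on spinors as a continuous linear map. -/
def actL (M : Matrix (Fin 2) (Fin 2) ℂ) : Spinor →L[ℂ] Spinor := Matrix.toEuclideanCLM (𝕜 := ℂ) M

theorem actL_apply (M : Matrix (Fin 2) (Fin 2) ℂ) (v : Spinor) : actL M v = act M v := rfl

theorem inner_act {M : Matrix (Fin 2) (Fin 2) ℂ} (hM : M.IsHermitian) (v w : Spinor) :
    inner ℂ (act M v) w = inner ℂ v (act M w) := by
  rw [← actL_apply, ← actL_apply, ← adjoint_inner_right]
  congr 2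
  rw [actL, ← ContinuousLinearMap.star_eq_adjoint, ← map_star, Matrix.star_eq_conjTranspose, hM]

theorem sigma1_isHermitian : sigma1.IsHermitian := by
  ext i j
  fin_cases i <;> fin_cases j <;> simp [sigma1]

theorem sigma2_isHermitian : sigma2.IsHermitian := by
  ext i j
  fin_cases i <;> fin_cases j <;> simp [sigma2]

theorem sigma3_isHermitian : sigma3.IsHermitian := by
  ext i j
  fin_cases i <;> fin_cases j <;> simp [sigma3]

theorem act_sigma1_zero (v : Spinor) : act sigma1 v 0 = v 1 := by simp [act, dotProduct, sigma1]

theorem act_sigma1_one (v : Spinor) : act sigma1 v 1 = v 0 := by simp [act, dotProduct, sigma1]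

theorem act_sigma2_zero (v : Spinor) : act sigma2 v 0 = -I * v 1 := by
  simp [act, dotProduct, sigma2]

theorem act_sigma2_one (v : Spinor) : act sigma2 v 1 = I * v 0 := by simp [act, dotProduct, sigma2]

theorem act_sigma3_zero (v : Spinor) : act sigma3 v 0 = v 0 := by simp [act, dotProduct, sigma3]

theorem act_sigma3_one (v : Spinor) : act sigma3 v 1 = -v 1 := by simp [act, dotProduct, sigma3]

theorem act_one (v : Spinor) : act 1 v = v := by simp [act]

theorem spinor_ext {v w : Spinor} (h0 : v 0 = w 0) (h1 : v 1 = w 1) : v = w := by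
  ext i
  fin_cases i
  · exact h0
  · exact h1

theorem spinor_norm_sq (v : Spinor) : ‖v‖ ^ 2 = ‖v 0‖ ^ 2 + ‖v 1‖ ^ 2 := by
  rw [EuclideanSpace.norm_sq_eq, Fin.sum_univ_two]

theorem norm_act_sigma2 (v : Spinor) : ‖act sigma2 v‖ = ‖v‖ := by
  rw [← sq_eq_sq₀ (norm_nonneg _) (norm_nonneg _), spinor_norm_sq, spinor_norm_sq,
    act_sigma2_zero, act_sigma2_one]
  simp [add_comm]

/-- Multiplication of spinor fields by the matrix function `c(θ) M`. -/
def mulOp (c : ℝ → ℝ) (M : Matrix (Fin 2) (Fin 2) ℂ) : L2S →L[ℂ] L2S :=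
  multOp sphereMeasure fun x => (c x.1 : ℂ) • actL M

/-- The field `c(θ) M ψ`. -/
def scale (c : ℝ → ℝ) (M : Matrix (Fin 2) (Fin 2) ℂ) (ψ : ℝ × ℝ → Spinor) (x : ℝ × ℝ) : Spinor :=
  (c x.1 : ℂ) • act M (ψ x)

variable {c : ℝ → ℝ} {M : Matrix (Fin 2) (Fin 2) ℂ}

theorem mulOp_measurable (hc : Continuous c) :
    AEStronglyMeasurable (fun x : ℝ × ℝ => (c x.1 : ℂ) • actL M) sphereMeasure :=
  Continuous.aestronglyMeasurable (by fun_prop)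

theorem mulOp_ae (hc : Continuous c) (u : L2S) :
    mulOp c M u =ᵐ[sphereMeasure] fun x => (c x.1 : ℂ) • act M (u x) := by
  obtain ⟨C, hC⟩ := isCompact_Icc.exists_bound_of_continuousOn (hc.continuousOn (s := Icc 0 π))
  refine multOp_ae (mulOp_measurable hc) (c := C * ‖actL M‖) (sphere_ae_mem.mono fun x hx => ?_) u
  rw [norm_smul, norm_real]
  exact mul_le_mul_of_nonneg_right (hC _ (Ioo_subset_Icc_self hx)) (norm_nonneg _)

theorem mulOp_symm (hc : Continuous c) (hM : M.IsHermitian) (u v : L2S) :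
    inner ℂ (mulOp c M u) v = inner ℂ u (mulOp c M v) := by
  rw [L2.inner_def, L2.inner_def]
  refine integral_congr_ae ?_
  filter_upwards [mulOp_ae (M := M) hc u, mulOp_ae (M := M) hc v] with x hx hy
  rw [hx, hy, inner_smul_left, inner_smul_right, inner_act hM, conj_ofReal]

theorem fld_scale (hc : Continuous c) (hg : IsPairable g) :
    IsPairable (scale c M g) ∧ fld (scale c M g) = mulOp c M (fld g) := by
  have hp : IsPairable (scale c M g) := by
    obtain ⟨h1, ε, hε, h2⟩ := hg
    have h3 : Continuous fun x : ℝ × ℝ => (c x.1 : ℂ) := by fun_prop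
    refine ⟨h3.continuousOn.smul ((act_continuous M).comp_continuousOn h1), ε, hε, fun x hx => ?_⟩
    rw [scale, h2 x hx, ← actL_apply, map_zero, smul_zero]
  refine ⟨hp, Lp.ext ?_⟩
  filter_upwards [hp.fld_ae, hg.fld_ae, mulOp_ae (M := M) hc (fld g)] with x h1 h2 h3
  rw [h1, h3, h2, scale]

theorem IsTestField.pairable (h : IsTestField ψ) : IsPairable ψ := test_ok h

theorem IsTestField.dTheta_pairable (h : IsTestField ψ) : IsPairable (dTheta ψ) := by
  obtain ⟨ε, hε, hs⟩ := deriv_support h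
  exact ⟨(dTheta_continuous h).continuousOn, ε, hε, fun x hx => (hs x hx).2.1⟩

theorem IsTestField.dPhi_pairable (h : IsTestField ψ) : IsPairable (dPhi ψ) := by
  obtain ⟨ε, hε, hs⟩ := deriv_support h
  exact ⟨(dPhi_continuous h).continuousOn, ε, hε, fun x hx => (hs x hx).2.2⟩

theorem IsTestField.scale (h : IsTestField ψ) (hc : ∀ θ ∈ Ioo 0 π, ContDiffAt ℝ (⊤ : ℕ∞) c θ)
    (M : Matrix (Fin 2) (Fin 2) ℂ) : IsTestField (scale c M ψ) := by
  obtain ⟨ε, hε, hs⟩ := h.support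
  have hz : ∀ x : ℝ × ℝ, x.1 ∉ Icc ε (π - ε) → KerrAngular.scale c M ψ x = 0 := fun x hx => by
    rw [KerrAngular.scale, hs x hx, ← actL_apply, map_zero, smul_zero]
  refine ⟨contDiff_iff_contDiffAt.mpr fun x => ?_, fun θ φ => ?_, ε, hε, hz⟩
  · by_cases hx : x.1 ∈ Icc ε (π - ε)
    · have h1 : ContDiffAt ℝ (⊤ : ℕ∞) (fun y : ℝ × ℝ => c y.1) x :=
        (hc x.1 ⟨by linarith [hx.1], by linarith [hx.2]⟩).comp x contDiffAt_fst
      have h2 : ContDiffAt ℝ (⊤ : ℕ∞) (fun y : ℝ × ℝ => (c y.1 : ℂ)) x :=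
        ofRealCLM.contDiff.contDiffAt.comp x h1
      exact h2.smul (((actL M).restrictScalars ℝ).contDiff.contDiffAt.comp x h.smooth.contDiffAt)
    · have ho : IsOpen {y : ℝ × ℝ | y.1 ∉ Icc ε (π - ε)} :=
        (isClosed_Icc.preimage continuous_fst).isOpen_compl
      exact contDiffAt_const.congr_of_eventuallyEq
        (Filter.eventually_of_mem (ho.mem_nhds hx) fun y hy => hz y hy)
  · rw [KerrAngular.scale, KerrAngular.scale, h.antiperiodic, ← actL_apply, map_neg, smul_neg]; rfl

theorem IsTestField.scale_derivs (h : IsTestField ψ) {x : ℝ × ℝ} {c' : ℝ}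
    (hc : HasDerivAt c c' x.1) (M : Matrix (Fin 2) (Fin 2) ℂ) :
    dTheta (KerrAngular.scale c M ψ) x = (c' : ℂ) • act M (ψ x) + (c x.1 : ℂ) • act M (dTheta ψ x) ∧
      dPhi (KerrAngular.scale c M ψ) x = (c x.1 : ℂ) • act M (dPhi ψ x) := by
  have h1 : HasFDerivAt (fun y : ℝ × ℝ => (c y.1 : ℂ)) (ofRealCLM ∘L (c' • fst ℝ ℝ ℝ)) x := by
    have := hc.hasFDerivAt.comp x (hasFDerivAt_fst (𝕜 := ℝ) (E := ℝ) (F := ℝ) (p := x))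
    refine (ofRealCLM.hasFDerivAt.comp x this).congr_fderiv ?_
    ext <;> simp
  have h2 := ((actL M).restrictScalars ℝ).hasFDerivAt.comp x
    (h.smooth.differentiable (by simp) x).hasFDerivAt
  have h3 := (h1.smul h2).fderiv
  have e : (KerrAngular.scale c M ψ) = ((fun y : ℝ × ℝ => (c y.1 : ℂ)) •
      (⇑((actL M).restrictScalars ℝ) ∘ ψ)) := rfl
  constructor
  · rw [dTheta, e, h3]; simp [actL_apply, dTheta, add_comm]
  · rw [dPhi, e, h3]; simp [actL_apply, dPhi]

theorem integral_fderiv_eq_zero {F : ℝ × ℝ → ℂ} (hF : ContDiff ℝ (⊤ : ℕ∞) F)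
    (hper : ∀ θ φ, F (θ, φ + 2 * π) = F (θ, φ))
    (hs : ∃ ε > 0, ∀ x : ℝ × ℝ, x.1 ∉ Icc ε (π - ε) → F x = 0) :
    ∫ x, fderiv ℝ F x (1, 0) ∂sphereMeasure = 0 ∧ ∫ x, fderiv ℝ F x (0, 1) ∂sphereMeasure = 0 := by
  have hpi := pi_pos
  have hd : ∀ x, HasFDerivAt F (fderiv ℝ F x) x := fun x =>
    (hF.differentiable (by simp) x).hasFDerivAt
  have h0 : ∀ x : ℝ × ℝ, HasFDerivAt (fun _ : ℝ × ℝ => (0 : ℂ)) (0 : ℝ × ℝ →L[ℝ] ℂ) x :=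
    fun x => hasFDerivAt_const _ _
  have hcd := hF.continuous_fderiv (by simp)
  have hz : ∀ x : ℝ × ℝ, x.1 = 0 ∨ x.1 = π → F x = 0 := fun x hx => by grind
  have hI : ∀ f : ℝ × ℝ → ℂ, ∫ x, f x ∂sphereMeasure
      = ∫ x in Icc ((0 : ℝ), (0 : ℝ)) (π, 2 * π), f x := fun f => by
    rw [sphereMeasure_eq, arcMeasure, circMeasure, restrict_Ioo_eq_restrict_Icc,
      restrict_Ioo_eq_restrict_Icc, Measure.prod_restrict, Icc_prod_Icc]
    rfl
  have hle : ((0 : ℝ), (0 : ℝ)) ≤ (π, 2 * π) := ⟨hpi.le, by positivity⟩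
  constructor
  · rw [hI]
    have := integral_divergence_prod_Icc_of_hasFDerivAt_off_countable_of_le F (fun _ => 0)
      (fun x => fderiv ℝ F x) (fun _ => 0) _ _ hle ∅ countable_empty hF.continuous.continuousOn
      continuousOn_const (fun x _ => hd x) (fun x _ => h0 x)
      (Continuous.continuousOn (by fun_prop)).integrableOn_Icc
    simpa [hz] using this
  · rw [hI]
    have := integral_divergence_prod_Icc_of_hasFDerivAt_off_countable_of_le (fun _ => 0) F
      (fun _ => 0) (fun x => fderiv ℝ F x) _ _ hle ∅ countable_empty continuousOn_const
      hF.continuous.continuousOn (fun x _ => h0 x) (fun x _ => hd x)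
      (Continuous.continuousOn (by fun_prop)).integrableOn_Icc
    have hp : ∀ θ, F (θ, 2 * π) = F (θ, 0) := fun θ => by rw [← hper θ 0, zero_add]
    simpa [hp] using this

theorem inner_derivs (hψ : IsTestField ψ) (hχ : IsTestField χ) :
    inner ℂ (fld (dTheta ψ)) (fld χ) = -inner ℂ (fld ψ) (fld (dTheta χ)) ∧
      inner ℂ (fld (dPhi ψ)) (fld χ) = -inner ℂ (fld ψ) (fld (dPhi χ)) := by
  have hF : ContDiff ℝ (⊤ : ℕ∞) fun x => inner ℂ (ψ x) (χ x) := hψ.smooth.inner ℂ hχ.smooth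
  have hper : ∀ θ φ, (inner ℂ (ψ (θ, φ + 2 * π)) (χ (θ, φ + 2 * π)) : ℂ)
      = inner ℂ (ψ (θ, φ)) (χ (θ, φ)) := fun θ φ => by
    rw [hψ.antiperiodic, hχ.antiperiodic, inner_neg_neg]
  obtain ⟨ε, hε, hs⟩ := hψ.support
  obtain ⟨h1, h2⟩ := integral_fderiv_eq_zero hF hper ⟨ε, hε, fun x hx => by
    rw [hs x hx, inner_zero_left]⟩
  have hd : ∀ x v, fderiv ℝ (fun x => (inner ℂ (ψ x) (χ x) : ℂ)) x v
      = inner ℂ (ψ x) (fderiv ℝ χ x v) + inner ℂ (fderiv ℝ ψ x v) (χ x) := fun x v =>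
    fderiv_inner_apply ℂ (hψ.smooth.differentiable (by simp) x)
      (hχ.smooth.differentiable (by simp) x) v
  simp only [hd] at h1 h2
  have key : ∀ g g' : ℝ × ℝ → Spinor, IsPairable g → IsPairable g' →
      ∫ x, (inner ℂ (ψ x) (g' x) + inner ℂ (g x) (χ x)) ∂sphereMeasure = 0 →
      inner ℂ (fld g) (fld χ) = -inner ℂ (fld ψ) (fld g') := by
    intro g g' hg hg' h
    rw [eq_neg_iff_add_eq_zero, L2.inner_def, L2.inner_def,
      ← integral_add (L2.integrable_inner _ _) (L2.integrable_inner _ _), ← h]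
    refine integral_congr_ae ?_
    filter_upwards [hg.fld_ae, hg'.fld_ae, hψ.pairable.fld_ae, hχ.pairable.fld_ae]
      with x e1 e2 e3 e4
    rw [e1, e2, e3, e4, add_comm]
  exact ⟨key _ _ hψ.dTheta_pairable hχ.dTheta_pairable h1,
    key _ _ hψ.dPhi_pairable hχ.dPhi_pairable h2⟩

end Fields

section ModeTests

variable {k : ℝ} {i : Fin 2} {χ : ℝ → ℂ} {ψ : ℝ × ℝ → Spinor} {a Λ : ℝ}

local notation "ϰ" => a ^ 2 * Λ / 3

/-- The field `e^{ikφ} χ(θ) e_i / √(2π)`. -/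
def modeTest (k : ℝ) (i : Fin 2) (χ : ℝ → ℂ) (x : ℝ × ℝ) : Spinor := single i (expo k x.2 * χ x.1)

theorem single_eq_smul (i : Fin 2) (z : ℂ) :
    (single i z : Spinor) = z • single i 1 := by ext l; simp

theorem modeTest_eq (k : ℝ) (i : Fin 2) (χ : ℝ → ℂ) :
    modeTest k i χ = fun x => (expo k x.2 * χ x.1) • (single i 1 : Spinor) :=
  funext fun _ => single_eq_smul _ _

theorem expo_contDiff (k : ℝ) : ContDiff ℝ (⊤ : ℕ∞) (expo k) := by
  unfold expo
  have : ContDiff ℝ (⊤ : ℕ∞) fun φ : ℝ => (φ : ℂ) := ofRealCLM.contDiff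
  fun_prop

theorem expo_hasDerivAt (k φ : ℝ) : HasDerivAt (expo k) (I * k * expo k φ) φ := by
  have h := (((ofRealCLM.hasDerivAt (x := φ)).const_mul (I * k)).cexp).div_const
    ((√(2 * π) : ℝ) : ℂ)
  refine h.congr_deriv ?_
  simp only [expo, Complex.ofRealCLM_apply, Complex.ofReal_one, mul_one]
  ring

theorem expo_antiperiodic (j : ℤ) (φ : ℝ) : expo (freq j) (φ + 2 * π) = -expo (freq j) φ := by
  have : I * (freq j : ℝ) * ((φ + 2 * π : ℝ) : ℂ)
      = I * (freq j : ℝ) * φ + j * (2 * π * I) + π * I := by unfold freq; push_cast; ring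
  rw [expo, this, Complex.exp_add, Complex.exp_add, exp_int_mul_two_pi_mul_I,
    Complex.exp_pi_mul_I, expo]
  ring

theorem modeTest_isTestField (hχ : IsArcTest χ) (j : ℤ) (i : Fin 2) :
    IsTestField (modeTest (freq j) i χ) := by
  obtain ⟨ε, hε, hs⟩ := hχ.support
  rw [modeTest_eq]
  refine ⟨?_, fun θ φ => ?_, ε, hε, fun x hx => ?_⟩
  · exact (((expo_contDiff _).comp contDiff_snd).mul (hχ.smooth.comp contDiff_fst)).smul
      contDiff_const
  · rw [expo_antiperiodic, neg_mul, neg_smul]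
  · rw [hs _ hx, mul_zero, zero_smul]

theorem modeTest_derivs (hχ : Differentiable ℝ χ) (k : ℝ) (i : Fin 2) (x : ℝ × ℝ) :
    dTheta (modeTest k i χ) x = modeTest k i (deriv χ) x ∧
      dPhi (modeTest k i χ) x = (I * k) • modeTest k i χ x := by
  have h1 := (expo_hasDerivAt k x.2).hasFDerivAt.comp x
    (hasFDerivAt_snd (𝕜 := ℝ) (E := ℝ) (F := ℝ) (p := x))
  have h2 := (hχ x.1).hasDerivAt.hasFDerivAt.comp x
    (hasFDerivAt_fst (𝕜 := ℝ) (E := ℝ) (F := ℝ) (p := x))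
  have h3 := ((h1.mul h2).smul_const (single i 1 : Spinor)).fderiv
  have e : modeTest k i χ = fun y => ((expo k ∘ Prod.snd) * (χ ∘ Prod.fst) : ℝ × ℝ → ℂ) y •
    (single i 1 : Spinor) := modeTest_eq k i χ
  constructor
  · rw [dTheta, e, h3, modeTest_eq]; simp
  · rw [dPhi, e, h3]
    simp only [Function.comp_apply, ContinuousLinearMap.smulRight_apply, _root_.add_apply,
      _root_.smul_apply, comp_apply, ContinuousLinearMap.coe_fst',
      ContinuousLinearMap.coe_snd', map_zero, smul_eq_mul, smul_smul]
    congr 1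
    simp
    ring

theorem fld_modeTest (hχ : IsArcTest χ) (j : ℤ) (i : Fin 2) :
    fld (modeTest (freq j) i χ) = emb (freq j) i hχ.toLp := by
  refine Lp.ext ?_
  filter_upwards [(modeTest_isTestField hχ j i).pairable.fld_ae, emb_ae (freq j) i hχ.toLp,
    sphere_ae_of_arc hχ.memLp.coeFn_toLp] with x h1 h2 h3
  rw [h1, h2, modeTest]
  congr 2
  exact h3.symm

theorem eq_zero_of_modeTest {u : L2S} {j : ℤ} {i : Fin 2}
    (h : ∀ χ, IsArcTest χ → inner ℂ (fld (modeTest (freq j) i χ)) u = 0) (v : ArcL2) :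
    inner ℂ u (emb (freq j) i v) = 0 := by
  have : adjoint (emb (freq j) i) u = 0 := eq_zero_of_arcTest fun χ hχ => by
    rw [← hχ.inner_toLp, adjoint_inner_right, ← fld_modeTest hχ, h χ hχ]
  rw [← adjoint_inner_left, this, inner_zero_left]

theorem eq_zero_of_test {u : L2S} (h : ∀ ψ, IsTestField ψ → inner ℂ (fld ψ) u = 0) : u = 0 :=
  emb_total fun j i => eq_zero_of_modeTest fun _ hχ => h _ (modeTest_isTestField hχ j i)

theorem eq_of_test {u v : L2S} (h : ∀ ψ, IsTestField ψ → inner ℂ (fld ψ) u = inner ℂ (fld ψ) v) :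
    u = v :=
  sub_eq_zero.mp <| eq_zero_of_test fun ψ hψ => by rw [inner_sub_right, h ψ hψ, sub_self]

/-- `1` and `-1` on the two components, the diagonal of `σ₃`. -/
def esgn (i : Fin 2) : ℝ := if i = 0 then 1 else -1

theorem act_sigma3_apply (v : Spinor) (i : Fin 2) : act sigma3 v i = (esgn i : ℂ) * v i := by
  fin_cases i
  · simp [esgn, act_sigma3_zero]
  · simp [esgn, act_sigma3_one]

theorem esgn_slot (j : ℤ) : esgn (slot j) = fsgn j := by
  unfold esgn slot fsgn
  split_ifs <;> simp_all

theorem esgn_add_one (i : Fin 2) : esgn (i + 1) = -esgn i := by fin_cases i <;> simp [esgn]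

theorem fsgn_mul_self (j : ℤ) : fsgn j * fsgn j = 1 := by unfold fsgn; split_ifs <;> norm_num

theorem freq_eq (j : ℤ) : freq j = fsgn j * |freq j| := by
  rw [abs_freq, ← mul_assoc, fsgn_mul_self, one_mul]

/-- `α sin 2θ / (4 Δ)`. -/
def shift (α θ : ℝ) : ℝ := α * sin (2 * θ) / (4 * dlt α θ)

theorem shift_continuous {α : ℝ} (hα : 0 ≤ α) : Continuous (shift α) := by
  have := dlt_continuous (α := α)
  unfold shift
  exact Continuous.div (by fun_prop) (by fun_prop) fun θ => by
    have := dlt_pos (θ := θ) hα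
    positivity

theorem sqrt_dlt_hasDerivAt {α : ℝ} (hα : 0 ≤ α) (θ : ℝ) :
    HasDerivAt (fun x => √(dlt α x)) (-(2 * shift α θ * √(dlt α θ))) θ := by
  have h := dlt_pos (θ := θ) hα
  refine ((dlt_hasDerivAt α θ).sqrt h.ne').congr_deriv ?_
  unfold shift
  grind

theorem sqrt_dlt_contDiff {α : ℝ} (hα : 0 ≤ α) : ContDiff ℝ (⊤ : ℕ∞) fun θ => √(dlt α θ) :=
  dlt_contDiff.sqrt fun _ => (dlt_pos hα).ne'

/-- `(1 + α) / (√Δ sin θ)`. -/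
def azim (α θ : ℝ) : ℝ := (1 + α) / (√(dlt α θ) * sin θ)

theorem azim_contDiffAt {α θ : ℝ} (hα : 0 ≤ α) (hθ : θ ∈ Ioo 0 π) :
    ContDiffAt ℝ (⊤ : ℕ∞) (azim α) θ :=
  contDiffAt_const.div ((sqrt_dlt_contDiff hα).contDiffAt.mul contDiff_sin.contDiffAt)
    (mul_pos (sqrt_pos.mpr (dlt_pos hα)) (sin_pos_of_mem hθ)).ne'

theorem inner_scale {c : ℝ → ℝ} {M : Matrix (Fin 2) (Fin 2) ℂ} (hM : M.IsHermitian)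
    {g h : ℝ × ℝ → Spinor} (hg : IsPairable g) (hh : IsPairable h) (hcg : IsPairable (scale c M g))
    (hch : IsPairable (scale c M h)) :
    inner ℂ (fld (scale c M g)) (fld h) = inner ℂ (fld g) (fld (scale c M h)) := by
  rw [L2.inner_def, L2.inner_def]
  refine integral_congr_ae ?_
  filter_upwards [hg.fld_ae, hh.fld_ae, hcg.fld_ae, hch.fld_ae] with x h1 h2 h3 h4
  rw [h1, h2, h3, h4, scale, scale, inner_smul_left, inner_smul_right, inner_act hM, conj_ofReal]

variable (hα : 0 ≤ a ^ 2 * Λ / 3)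
include hα

theorem angularExpr_eq (hψ : IsTestField ψ) {x : ℝ × ℝ} (hx : x.1 ∈ Ioo 0 π) :
    angularExpr a Λ 0 ψ x = (-I) • scale (fun θ => √(dlt ϰ θ)) sigma1 (dTheta ψ) x
      + (I • dPhi (scale (azim ϰ) sigma2 ψ) x + I • scale (fun θ => √(dlt ϰ θ)) sigma1
            (scale (shift ϰ) 1 ψ) x) := by
  have hd := dlt_pos (θ := x.1) hα
  have hq := sqrt_pos.mpr hd
  have hsin := sin_pos_of_mem hx
  rw [(hψ.scale_derivs ((azim_contDiffAt hα hx).differentiableAt (by simp)).hasDerivAt sigma2).2,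
    angularExpr]
  have e1 : Λ * a ^ 2 * sin (2 * x.1) / (12 * DeltaTheta a Λ x.1) = shift ϰ x.1 := by
    have : DeltaTheta a Λ x.1 = dlt ϰ x.1 := rfl
    rw [this, shift]
    field_simp
    ring
  have e2 : (1 + ϰ) / (DeltaTheta a Λ x.1 * sin x.1) = azim ϰ x.1 / √(dlt ϰ x.1) := by
    have : DeltaTheta a Λ x.1 = √(dlt ϰ x.1) * √(dlt ϰ x.1) := (mul_self_sqrt hd.le).symm
    rw [this, azim]
    field_simp
  have e3 : DeltaTheta a Λ x.1 = dlt ϰ x.1 := rfl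
  rw [e1, e2, e3]
  have hqc : ((√(dlt ϰ x.1) : ℝ) : ℂ) ≠ 0 := ofReal_ne_zero.mpr hq.ne'
  simp only [scale, act_one]
  refine spinor_ext ?_ ?_ <;>
  · simp only [PiLp.add_apply, PiLp.sub_apply, PiLp.smul_apply, smul_eq_mul, act_sigma1_zero,
      act_sigma2_zero, act_sigma1_one, act_sigma2_one]
    push_cast
    field_simp
    ring

theorem angularExpr_pairable (hψ : IsTestField ψ) :
    IsPairable (angularExpr a Λ 0 ψ) ∧ fld (angularExpr a Λ 0 ψ)
      = (-I) • mulOp (fun θ => √(dlt ϰ θ)) sigma1 (fld (dTheta ψ))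
        + (I • fld (dPhi (scale (azim ϰ) sigma2 ψ)) + I • mulOp (fun θ => √(dlt ϰ θ)) sigma1
            (mulOp (shift ϰ) 1 (fld ψ))) := by
  have hc := (sqrt_dlt_contDiff hα).continuous
  have h1 := fld_scale (M := sigma1) hc hψ.dTheta_pairable
  have h2 := (hψ.scale (fun θ hθ => azim_contDiffAt hα hθ) sigma2).dPhi_pairable
  have h3 := fld_scale (M := 1) (shift_continuous hα) hψ.pairable
  have h4 := fld_scale (M := sigma1) hc h3.1
  have h5 := (h2.smul I).add (h4.1.smul I)
  have h6 := (h1.1.smul (-I)).add h5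
  have e := fun (x : ℝ × ℝ) (hx : x.1 ∈ Ioo 0 π) => angularExpr_eq (a := a) (Λ := Λ) hα hψ hx
  obtain ⟨ε, hε, hs⟩ := deriv_support hψ
  refine ⟨⟨h6.1.congr fun x hx => e x hx.1, ε, hε, fun x hx => ?_⟩, ?_⟩
  · obtain ⟨z1, z2, z3⟩ := hs x hx; simp only [angularExpr, z1, z2, z3, ← actL_apply]; simp
  · rw [fld_congr e, fld_add (h1.1.smul _) h5, fld_add (h2.smul _) (h4.1.smul _), fld_smul h1.1,
      fld_smul h2, fld_smul h4.1, h1.2, h4.2, h3.2]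

theorem fld_angularExpr_adjoint (hψ : IsTestField ψ) : fld (angularExpr a Λ 0 ψ)
      = (-I) • fld (dTheta (scale (fun θ => √(dlt ϰ θ)) sigma1 ψ))
        + (I • fld (dPhi (scale (azim ϰ) sigma2 ψ)) + (-I) • mulOp (shift ϰ) 1
            (mulOp (fun θ => √(dlt ϰ θ)) sigma1 (fld ψ))) := by
  have hc := (sqrt_dlt_contDiff hα).continuous
  have h1 := (hψ.scale (fun θ _ => (sqrt_dlt_contDiff hα).contDiffAt) sigma1).dTheta_pairable
  have h2 := (hψ.scale (fun θ hθ => azim_contDiffAt hα hθ) sigma2).dPhi_pairable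
  have h3 := fld_scale (M := sigma1) hc hψ.pairable
  have h4 := fld_scale (M := 1) (shift_continuous hα) h3.1
  have h5 := (h2.smul I).add (h4.1.smul (-I))
  rw [← h3.2, ← h4.2, ← fld_smul h1, ← fld_smul h2, ← fld_smul h4.1, ← fld_add (h2.smul _) (h4.1.smul _),
    ← fld_add (h1.smul _) h5]
  refine fld_congr fun x hx => ?_
  rw [angularExpr_eq hα hψ hx, (hψ.scale_derivs (sqrt_dlt_hasDerivAt hα x.1) sigma1).1]
  simp only [scale, act_one]
  refine spinor_ext ?_ ?_ <;>
  · simp only [PiLp.add_apply, PiLp.smul_apply, smul_eq_mul, act_sigma1_zero, act_sigma1_one]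
    push_cast
    ring

theorem angularExpr_symm {χ : ℝ × ℝ → Spinor} (hψ : IsTestField ψ) (hχ : IsTestField χ) :
    inner ℂ (fld (angularExpr a Λ 0 ψ)) (fld χ) = inner ℂ (fld ψ) (fld (angularExpr a Λ 0 χ)) := by
  have hc := (sqrt_dlt_contDiff hα).continuous
  have hz := fun θ hθ => azim_contDiffAt (θ := θ) hα hθ
  have e1 := (inner_derivs (hψ.scale (fun θ _ => (sqrt_dlt_contDiff hα).contDiffAt) sigma1) hχ).1
  have e2 := (inner_derivs (hψ.scale hz sigma2) hχ).2
  have e4 : fld (dPhi (scale (azim ϰ) sigma2 χ))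
      = fld (scale (azim ϰ) sigma2 (dPhi χ)) := fld_congr fun x hx =>
    (hχ.scale_derivs ((hz x.1 hx).differentiableAt (by simp)).hasDerivAt sigma2).2
  have e3 : inner ℂ (fld (scale (azim ϰ) sigma2 ψ)) (fld (dPhi χ))
      = inner ℂ (fld ψ) (fld (dPhi (scale (azim ϰ) sigma2 χ))) := by
    rw [e4]
    refine inner_scale sigma2_isHermitian hψ.pairable hχ.dPhi_pairable
      (hψ.scale hz sigma2).pairable ?_
    have hp := (hχ.scale hz sigma2).dPhi_pairable
    obtain ⟨ε, hε, hs⟩ := deriv_support hχ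
    refine ⟨hp.1.congr fun x hx => ((hχ.scale_derivs
      ((hz x.1 hx.1).differentiableAt (by simp)).hasDerivAt sigma2).2).symm, ε, hε, fun x hx => ?_⟩
    rw [scale, (hs x hx).2.2, ← actL_apply, map_zero, smul_zero]
  rw [fld_angularExpr_adjoint hα hψ, (angularExpr_pairable hα hχ).2]
  simp only [inner_add_left, inner_add_right, inner_smul_left, inner_smul_right, e1, e2, e3,
    mulOp_symm (shift_continuous hα) Matrix.isHermitian_one, mulOp_symm hc sigma1_isHermitian,
    (fld_scale (M := sigma1) hc hψ.pairable).2]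
  simp only [map_neg, conj_I]
  ring

theorem angularExpr_modeTest (hχ : IsArcTest χ) (j : ℤ) (i : Fin 2) :
    fld (angularExpr a Λ 0 (modeTest (freq j) i χ)) = (-I) •
      emb (freq j) (i + 1) (hχ.rad hα (esgn i * freq j)).toLp := by
  have hr := hχ.rad hα (esgn i * freq j)
  have ht := modeTest_isTestField hr j (i + 1)
  rw [← fld_modeTest hr, ← fld_smul ht.pairable]
  refine fld_congr fun x hx => ?_
  have hd := dlt_pos (θ := x.1) hα
  have hq := sqrt_pos.mpr hd
  have := sin_pos_of_mem hx
  have hz := fun θ hθ => azim_contDiffAt (θ := θ) hα hθ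
  have e2 : azim ϰ x.1 = √(dlt ϰ x.1) * tortD ϰ x.1 := by
    rw [azim, tortD, ← mul_div_assoc, div_eq_div_iff (by positivity) (by positivity)]
    nth_rewrite 1 [← mul_self_sqrt hd.le]
    ring
  rw [angularExpr_eq hα (modeTest_isTestField hχ j i) hx,
    ((modeTest_isTestField hχ j i).scale_derivs
      ((hz x.1 hx).differentiableAt (by simp)).hasDerivAt sigma2).2]
  simp only [scale, act_one, (modeTest_derivs (hχ.smooth.differentiable (by simp)) _ _ _).1,
    (modeTest_derivs (hχ.smooth.differentiable (by simp)) _ _ _).2, e2]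
  rw [modeTest, modeTest, modeTest, rad_eq hα (hχ.smooth.differentiable (by simp)) hx]
  have e3 : ((ϰ * sin (2 * x.1) / (4 * dlt ϰ x.1) : ℝ) : ℂ) = shift ϰ x.1 := rfl
  rw [e3]
  have hI := Complex.I_sq
  set z := I * (√(dlt ϰ x.1) : ℂ) * expo (freq j) x.2 *
    (tortD ϰ x.1 : ℂ) * (freq j : ℂ) * χ x.1 with hz'
  fin_cases i <;> refine spinor_ext ?_ ?_ <;>
    simp [act_sigma1_zero, act_sigma2_zero, act_sigma1_one, act_sigma2_one, esgn]
  · linear_combination z * hI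
  · linear_combination -z * hI

end ModeTests

section AngularInverse

variable {α a Λ : ℝ} {ψ : ℝ × ℝ → Spinor} {χ : ℝ → ℂ} {i : Fin 2} {j : ℤ}

local notation "ϰ" => a ^ 2 * Λ / 3

theorem half_le_abs_freq (j : ℤ) : 1 / 2 ≤ |freq j| := (isFreq_abs j).half_le

theorem abs_freq_pos (j : ℤ) : 0 < |freq j| := (isFreq_abs j).pos

theorem eq_slot (j : ℤ) (i : Fin 2) : i = slot j ∨ i = slot j + 1 := by
  unfold slot
  split_ifs <;> omega

theorem slot_add_two (j : ℤ) : slot j + 1 + 1 = slot j := by unfold slot; split_ifs <;> rfl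

theorem esgn_mul_freq (j : ℤ) : esgn (slot j) * freq j = |freq j| ∧
    esgn (slot j + 1) * freq j = -|freq j| := by
  rw [esgn_add_one, esgn_slot, abs_freq]
  exact ⟨rfl, by ring⟩

theorem emb_slot (j : ℤ) (v : ArcL2) : emb (freq j) (slot j) v = modeEmb j (WithLp.toLp 2 (v, 0)) := by
  rw [modeEmb_apply]
  simp

theorem emb_slot_add_one (j : ℤ) (v : ArcL2) :
    emb (freq j) (slot j + 1) v = modeEmb j (WithLp.toLp 2 (0, v)) := by rw [modeEmb_apply]; simp

theorem eq_zero_of_angularExpr (hα : 0 ≤ ϰ) {u : L2S} (h : ∀ j i χ, IsArcTest χ →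
      inner ℂ (fld (angularExpr a Λ 0 (modeTest (freq j) i χ))) u = 0) : u = 0 := by
  have key : ∀ j i v, inner ℂ u (emb (freq j) (i + 1) v) = 0 := fun j i v => by
    have : adjoint (emb (freq j) (i + 1)) u = 0 := by
      refine weak_unique hα (half_le_abs_freq j) (c := esgn i * freq j) ?_ fun χ hχ => ?_
      · rcases eq_slot j i with rfl | rfl
        · exact Or.inl (esgn_mul_freq j).1
        · exact Or.inr (esgn_mul_freq j).2
      · have := h j i χ hχ
        rw [angularExpr_modeTest hα hχ, inner_smul_left] at this
        rw [adjoint_inner_right]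
        exact (mul_eq_zero.mp this).resolve_left (by simp)
    rw [← adjoint_inner_left, this, inner_zero_left]
  refine emb_total fun j i v => ?_
  have : i + 1 + 1 = i := by omega
  rw [← this]
  exact key j (i + 1) v

theorem exists_angT (hα : 0 ≤ α) : ∃ T : L2S →L[ℂ] L2S,
    ∀ j v, T (modeEmb j v) = modeEmb j (modeT α |freq j| v) := by
  obtain ⟨T, -, hT⟩ := exists_block modeEmb_isHilbertSum (A := fun j => modeT α |freq j|)
    zero_le_two fun j => (norm_modeT_le hα (abs_freq_pos j)).trans <| by
      rw [div_le_iff₀ (abs_freq_pos j)]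
      linarith [half_le_abs_freq j]
  exact ⟨T, hT⟩

/-- The inverse of `A(0)` as an operator of `L²(S²)`. -/
def angT (α : ℝ) : L2S →L[ℂ] L2S :=
  Classical.epsilon fun T => ∀ j v, T (modeEmb j v) = modeEmb j (modeT α |freq j| v)

theorem angT_modeEmb (hα : 0 ≤ α) (j : ℤ) (v : ModeL2) :
    angT α (modeEmb j v) = modeEmb j (modeT α |freq j| v) :=
  Classical.epsilon_spec (exists_angT hα) j v

theorem angT_symm (hα : 0 ≤ α) (x y : L2S) : inner ℂ (angT α x) y = inner ℂ x (angT α y) :=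
  block_symm modeEmb_isHilbertSum (angT_modeEmb hα) (fun j => modeT_symm hα (abs_freq_pos j)) x y

theorem angT_angularExpr_modeTest (hα : 0 ≤ ϰ) (hχ : IsArcTest χ) (j : ℤ) (i : Fin 2) :
    angT ϰ (fld (angularExpr a Λ 0 (modeTest (freq j) i χ))) = fld (modeTest (freq j) i χ) := by
  rw [angularExpr_modeTest hα hχ, map_smul, fld_modeTest hχ]
  obtain ⟨e1, e2⟩ := esgn_mul_freq j
  rcases eq_slot j i with rfl | rfl
  · rw [emb_slot_add_one, angT_modeEmb hα, emb_slot, ← map_smul]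
    congr 1
    refine two_ext ?_ ?_
    · change (-I) • I • volOp _ _ (hχ.rad hα (esgn (slot j) * freq j)).toLp = hχ.toLp
      simp only [e1]
      rw [volOp_rad hα (abs_freq_pos j) hχ, smul_smul]
      simp
    · change (-I) • (-I) • volStar _ _ (0 : ArcL2) = 0; simp
  · rw [slot_add_two, emb_slot, angT_modeEmb hα, emb_slot_add_one, ← map_smul]
    congr 1
    refine two_ext ?_ ?_
    · change (-I) • I • volOp _ _ (0 : ArcL2) = 0; simp
    · change (-I) • (-I) • volStar _ _
        (hχ.rad hα (esgn (slot j + 1) * freq j)).toLp = hχ.toLp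
      simp only [e2]
      rw [volStar_rad hα (abs_freq_pos j) hχ, smul_smul]
      simp

theorem angT_angularExpr (hα : 0 ≤ ϰ) (hψ : IsTestField ψ) :
    angT ϰ (fld (angularExpr a Λ 0 ψ)) = fld ψ := by
  rw [← sub_eq_zero]
  refine eq_zero_of_angularExpr hα fun j i χ hχ => ?_
  rw [inner_sub_right, ← angT_symm hα, angT_angularExpr_modeTest hα hχ,
    angularExpr_symm hα (modeTest_isTestField hχ j i) hψ, sub_self]

theorem dPhi_modeTest (hχ : IsArcTest χ) (j : ℤ) (i : Fin 2) :
    fld (dPhi (modeTest (freq j) i χ)) = (I * freq j) • fld (modeTest (freq j) i χ) := by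
  rw [← fld_smul (modeTest_isTestField hχ j i).pairable]
  exact congrArg fld (funext fun x =>
    (modeTest_derivs (hχ.smooth.differentiable (by simp)) _ _ x).2)

theorem dPhi_emb (hψ : IsTestField ψ) (j : ℤ) (i : Fin 2) (v : ArcL2) :
    inner ℂ (fld (dPhi ψ)) (emb (freq j) i v) = inner ℂ ((I * freq j) • fld ψ) (emb (freq j) i v) := by
  rw [← sub_eq_zero, ← inner_sub_left]
  refine eq_zero_of_modeTest (fun χ hχ => ?_) v
  have h := (inner_derivs (modeTest_isTestField hχ j i) hψ).2
  rw [dPhi_modeTest hχ, inner_smul_left] at h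
  rw [inner_sub_right, inner_smul_right, ← neg_eq_iff_eq_neg.mpr h]
  simp

theorem dPhi_modeEmb (hψ : IsTestField ψ) (j : ℤ) (v : ModeL2) :
    inner ℂ (fld (dPhi ψ)) (modeEmb j v) = inner ℂ ((I * freq j) • fld ψ) (modeEmb j v) := by
  rw [modeEmb_apply, inner_add_right, inner_add_right, dPhi_emb hψ, dPhi_emb hψ]

theorem mem_modeSpace_iff {k : ℝ} {u : L2S} : u ∈ modeSpace k ↔ ∀ ψ, IsTestField ψ →
    inner ℂ (fld (dPhi ψ)) u = inner ℂ ((I * k) • fld ψ) u := by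
  refine forall₂_congr fun ψ hψ => ?_
  have hp : IsPairable fun x => (-I) • dPhi ψ x - (k : ℂ) • ψ x := dPhi_sub_ok hψ k
  have e : fld (fun x => (-I) • dPhi ψ x - (k : ℂ) • ψ x)
      = (-I) • (fld (dPhi ψ) - (I * k) • fld ψ) := by
    have : (fun x => (-I) • dPhi ψ x - (k : ℂ) • ψ x)
        = fun x => (-I) • dPhi ψ x + (-(k : ℂ)) • ψ x := funext fun x => by
      rw [neg_smul (k : ℂ), sub_eq_add_neg]
    rw [this, fld_add (hψ.dPhi_pairable.smul _) (hψ.pairable.smul _), fld_smul hψ.dPhi_pairable,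
      fld_smul hψ.pairable, smul_sub, smul_smul, sub_eq_add_neg, ← neg_smul]
    congr 2
    linear_combination (-(k : ℂ)) * I_mul_I
  rw [← hp.inner_fld, e, inner_smul_left, mul_eq_zero, inner_sub_left, sub_eq_zero]
  simp

theorem modeEmb_mem (j : ℤ) (v : ModeL2) : modeEmb j v ∈ modeSpace (freq j) :=
  mem_modeSpace_iff.mpr fun _ hψ => dPhi_modeEmb hψ j v

theorem eq_modeEmb_coord {u : L2S} (hu : u ∈ modeSpace (freq j)) :
    u = modeEmb j (coord modeEmb j u) := by
  refine eq_of_coord modeEmb_isHilbertSum fun l hl => ?_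
  refine ext_inner_right ℂ fun v => ?_
  rw [inner_zero_left, ← inner_conj_symm, inner_coord, inner_conj_symm]
  have key : ∀ i w, inner ℂ u (emb (freq l) i w) = 0 := fun i w => by
    refine eq_zero_of_modeTest (fun χ hχ => ?_) w
    have h := mem_modeSpace_iff.mp hu _ (modeTest_isTestField hχ l i)
    rw [dPhi_modeTest hχ, inner_smul_left, inner_smul_left, mul_eq_mul_right_iff] at h
    refine h.resolve_left fun h => hl (freq_injective ?_)
    simpa using h
  rw [modeEmb_apply, inner_add_right, key, key, add_zero]

theorem sin_inv_contDiffAt {θ : ℝ} (hθ : θ ∈ Ioo 0 π) :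
    ContDiffAt ℝ (⊤ : ℕ∞) (fun x => (sin x)⁻¹) θ :=
  contDiff_sin.contDiffAt.inv (sin_pos_of_mem hθ).ne'

theorem nablaPhi_modeEmb (hψ : IsTestField ψ) (j : ℤ) (v : ModeL2) {w : L2S}
    (hw : w =ᵐ[sphereMeasure] fun x => (((sin x.1)⁻¹ : ℝ) : ℂ) • ((I * freq j) • modeEmb j v x
        + (I / 2 * ((cos x.1 : ℝ) : ℂ)) • act sigma3 (modeEmb j v x))) :
    inner ℂ (fld ψ) w = -inner ℂ (fld (nablaPhi ψ)) (modeEmb j v) := by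
  have ht := hψ.scale (fun θ hθ => sin_inv_contDiffAt hθ) 1
  have hs := fld_scale (M := sigma3) continuous_cos ht.pairable
  have e : fld (nablaPhi ψ) = fld (dPhi (scale (fun θ => (sin θ)⁻¹) 1 ψ))
      + (I / 2) • fld (scale cos sigma3 (scale (fun θ => (sin θ)⁻¹) 1 ψ)) := by
    rw [← fld_smul hs.1, ← fld_add ht.dPhi_pairable (hs.1.smul _)]
    refine fld_congr fun x hx => ?_
    rw [(hψ.scale_derivs ((sin_inv_contDiffAt hx).differentiableAt (by simp)).hasDerivAt 1).2,
      nablaPhi]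
    simp only [scale, act_one]
    refine spinor_ext ?_ ?_ <;>
    · simp only [PiLp.add_apply, PiLp.smul_apply, smul_eq_mul, act_sigma3_zero, act_sigma3_one]
      ring
  rw [e, inner_add_left, dPhi_modeEmb ht, ← inner_add_left, eq_neg_iff_add_eq_zero,
    ← fld_smul ht.pairable, ← fld_smul hs.1, ← fld_add (ht.pairable.smul _) (hs.1.smul _),
    L2.inner_def, L2.inner_def, ← integral_add (L2.integrable_inner _ _) (L2.integrable_inner _ _)]
  refine integral_eq_zero_of_ae ?_
  filter_upwards [hw, hψ.pairable.fld_ae,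
    ((ht.pairable.smul (I * freq j)).add (hs.1.smul (I / 2))).fld_ae] with x h1 h2 h3
  rw [h1, h2, h3]
  simp only [scale, act_one]
  simp only [PiLp.inner_apply, Fin.sum_univ_two, RCLike.inner_apply, PiLp.add_apply,
    PiLp.smul_apply, smul_eq_mul, act_sigma3_zero, act_sigma3_one, map_add, map_mul, map_div₀,
    conj_I, conj_ofReal, map_neg, Pi.zero_apply, map_ofNat]
  ring

theorem exists_angW (hα : 0 ≤ α) : ∃ W : L2S →L[ℂ] L2S, ∀ j v, W (modeEmb j v) =ᵐ[sphereMeasure]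
    fun x => (((sin x.1)⁻¹ : ℝ) : ℂ) • ((I * freq j) • modeEmb j (modeT α |freq j| v) x
        + (I / 2 * ((cos x.1 : ℝ) : ℂ)) • act sigma3 (modeEmb j (modeT α |freq j| v) x)) := by
  choose P hP hP' using fun j => exists_weighted hα (isFreq_abs j)
  choose Q hQ hQ' using fun j => exists_weighted_star hα (isFreq_abs j)
  have hs : ∀ j, ‖(fsgn j : ℂ)‖ = 1 := fun j => by unfold fsgn; split_ifs <;> simp
  obtain ⟨W, -, hW⟩ := exists_block modeEmb_isHilbertSum
    (A := fun j => offDiag (-(fsgn j : ℂ) • P j) ((fsgn j : ℂ) • Q j)) (by norm_num : (0 : ℝ) ≤ 3)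
    fun j => norm_offDiag_le (by rw [norm_smul, norm_neg, hs, one_mul]; exact hP j)
      (by rw [norm_smul, hs, one_mul]; exact hQ j)
  refine ⟨W, fun j v => ?_⟩
  rw [hW, modeEmb_apply, modeEmb_apply]
  have n1 := slot_ne j
  have e1 : (freq j : ℂ) = fsgn j * (|freq j| : ℝ) := by rw [← Complex.ofReal_mul, ← freq_eq]
  filter_upwards [emb_ae (freq j) (slot j) ((-(fsgn j : ℂ) • P j) v.snd),
    emb_ae (freq j) (slot j + 1) (((fsgn j : ℂ) • Q j) v.fst),
    emb_ae (freq j) (slot j) ((I • volOp α |freq j|) v.snd),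
    emb_ae (freq j) (slot j + 1) ((-I • volStar α |freq j|) v.fst),
    Lp.coeFn_add (emb (freq j) (slot j) ((-(fsgn j : ℂ) • P j) v.snd))
      (emb (freq j) (slot j + 1) (((fsgn j : ℂ) • Q j) v.fst)),
    Lp.coeFn_add (emb (freq j) (slot j) ((I • volOp α |freq j|) v.snd))
      (emb (freq j) (slot j + 1) ((-I • volStar α |freq j|) v.fst)),
    sphere_ae_of_arc (hP' j v.snd), sphere_ae_of_arc (hQ' j v.fst),
    sphere_ae_of_arc (Lp.coeFn_smul (-(fsgn j : ℂ)) (P j v.snd)),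
    sphere_ae_of_arc (Lp.coeFn_smul (fsgn j : ℂ) (Q j v.fst)),
    sphere_ae_of_arc (Lp.coeFn_smul I (volOp α |freq j| v.snd)),
    sphere_ae_of_arc (Lp.coeFn_smul (-I) (volStar α |freq j| v.fst))]
    with x h1 h2 h3 h4 h5 h6 h7 h8 h9 h10 h11 h12
  simp only [offDiag_fst, offDiag_snd, modeT]
  rw [h5, h6]
  simp only [Pi.add_apply]
  rw [h1, h2, h3, h4]
  simp only [_root_.smul_apply]
  rw [h9, h10, h11, h12]
  simp only [Pi.smul_apply, smul_eq_mul]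
  rw [h7, h8]
  ext i
  simp only [PiLp.add_apply, PiLp.smul_apply, smul_eq_mul, act_sigma3_apply, PiLp.single_apply]
  rcases eq_slot j i with rfl | rfl
  · simp only [↓reduceIte, if_neg n1, esgn_slot, e1]
    push_cast
    linear_combination (-(expo (freq j) x.2 * fsgn j * volOp α |freq j| v.snd x.1 *
      (Complex.sin x.1)⁻¹ * ((|freq j| : ℝ) + Complex.cos x.1 / 2))) * I_mul_I
  · simp only [↓reduceIte, if_neg n1.symm, esgn_add_one, esgn_slot, e1]
    push_cast
    linear_combination (expo (freq j) x.2 * fsgn j * volStar α |freq j| v.fst x.1 *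
      (Complex.sin x.1)⁻¹ * ((|freq j| : ℝ) - Complex.cos x.1 / 2)) * I_mul_I

end AngularInverse

section SobolevInverse

variable {α a Λ : ℝ} {ψ χ : ℝ × ℝ → Spinor}

local notation "ϰ" => a ^ 2 * Λ / 3

/-- The operator `∇_φ A(0)⁻¹` of `L²(S²)`. -/
def angW (α : ℝ) : L2S →L[ℂ] L2S := Classical.epsilon fun W => ∀ j v, W (modeEmb j v)
  =ᵐ[sphereMeasure] fun x => (((sin x.1)⁻¹ : ℝ) : ℂ) •
    ((I * freq j) • modeEmb j (modeT α |freq j| v) x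
      + (I / 2 * ((cos x.1 : ℝ) : ℂ)) • act sigma3 (modeEmb j (modeT α |freq j| v) x))

theorem inner_angW (hα : 0 ≤ α) (hψ : IsTestField ψ) (f : L2S) :
    inner ℂ (fld ψ) (angW α f) = -inner ℂ (fld (nablaPhi ψ)) (angT α f) := by
  have h := Classical.epsilon_spec (exists_angW hα)
  have e : innerSL ℂ (fld ψ) ∘L angW α = -(innerSL ℂ (fld (nablaPhi ψ)) ∘L angT α) :=
    block_ext modeEmb_isHilbertSum fun j v => by
      rw [comp_apply, innerSL_apply_apply, _root_.neg_apply,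
        comp_apply, innerSL_apply_apply, angT_modeEmb hα,
        ← nablaPhi_modeEmb hψ j (modeT α |freq j| v) (h j v), angW]
  exact congrArg (fun L : L2S →L[ℂ] ℂ => L f) e

theorem angT_weak (hα : 0 ≤ ϰ) (hψ : IsTestField ψ) (f : L2S) :
    inner ℂ (fld (angularExpr a Λ 0 ψ)) (angT ϰ f) = inner ℂ (fld ψ) f := by
  rw [← angT_symm hα, angT_angularExpr hα hψ]

/-- `(1 + α) / Δ`. -/
def aniso (α θ : ℝ) : ℝ := (1 + α) / dlt α θ

theorem aniso_contDiff (hα : 0 ≤ α) : ContDiff ℝ (⊤ : ℕ∞) (aniso α) :=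
  contDiff_const.div dlt_contDiff fun _ => (dlt_pos hα).ne'

theorem inv_sqrt_dlt_contDiff (hα : 0 ≤ α) : ContDiff ℝ (⊤ : ℕ∞) fun θ => (√(dlt α θ))⁻¹ :=
  (sqrt_dlt_contDiff hα).inv fun _ => (sqrt_pos.mpr (dlt_pos hα)).ne'

theorem cot_mul_aniso {θ : ℝ} (hα : 0 ≤ α) (hθ : θ ∈ Ioo 0 π) :
    cos θ / sin θ * (aniso α θ - 1) = 2 * shift α θ := by
  have := (dlt_pos (θ := θ) hα).ne'
  have := (sin_pos_of_mem hθ).ne'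
  have h3 : dlt α θ = 1 + α - α * sin θ ^ 2 := by rw [dlt, sin_sq]; ring
  rw [aniso, shift, sin_two_mul]
  field_simp
  rw [h3]
  ring

theorem adjNablaTheta_pairable (h : IsTestField ψ) : IsPairable (adjNablaTheta ψ) :=
  adjNablaTheta_ok h

theorem nablaPhi_pairable (h : IsTestField ψ) : IsPairable (nablaPhi ψ) := nablaPhi_ok h

theorem fld_angularExpr_nabla (hα : 0 ≤ ϰ) (hψ : IsTestField ψ)
    (hχ : χ = scale (fun θ => √(dlt ϰ θ)) sigma1 ψ) :
    fld (angularExpr a Λ 0 ψ) = (-I) • fld (adjNablaTheta χ)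
      + (fld (nablaPhi (scale (aniso ϰ) sigma3 χ)) + (-(2 * I)) • mulOp (shift ϰ) 1 (fld χ)) := by
  have ht : IsTestField χ := by
    rw [hχ]
    exact hψ.scale (fun θ _ => (sqrt_dlt_contDiff hα).contDiffAt) sigma1
  have h1 := adjNablaTheta_pairable ht
  have h2 := nablaPhi_pairable (ht.scale (fun θ _ => (aniso_contDiff hα).contDiffAt) sigma3)
  have h3 := fld_scale (M := 1) (shift_continuous hα) ht.pairable
  rw [← h3.2, ← fld_smul h1, ← fld_smul h3.1, ← fld_add h2 (h3.1.smul _),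
    ← fld_add (h1.smul _) (h2.add (h3.1.smul _))]
  refine fld_congr fun x hx => ?_
  have hz := azim_contDiffAt hα hx
  have hrel : ((cos x.1 / sin x.1 : ℝ) : ℂ) * ((aniso ϰ x.1 : ℝ) - 1) = 2 * (shift ϰ x.1 : ℝ) := by
    rw [← Complex.ofReal_one, ← ofReal_sub, ← Complex.ofReal_mul, cot_mul_aniso hα hx]
    push_cast
    ring
  have haz : azim ϰ x.1 = aniso ϰ x.1 * √(dlt ϰ x.1) * (sin x.1)⁻¹ := by
    have hd := dlt_pos (θ := x.1) hα
    rw [azim, aniso]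
    field_simp
    rw [sq_sqrt hd.le]
  have hA := ((aniso_contDiff hα).differentiable (by simp) x.1).hasDerivAt
  rw [angularExpr_eq hα hψ hx, adjNablaTheta, nablaPhi,
    (hψ.scale_derivs (hz.differentiableAt (by simp)).hasDerivAt sigma2).2,
    (ht.scale_derivs hA sigma3).2]
  have e := hψ.scale_derivs (sqrt_dlt_hasDerivAt hα x.1) sigma1
  rw [← hχ] at e
  rw [e.1, e.2, hχ, haz]
  simp only [scale, act_one]
  push_cast at hrel ⊢
  refine spinor_ext ?_ ?_
  · simp only [PiLp.add_apply, PiLp.smul_apply, smul_eq_mul, act_sigma1_zero, act_sigma2_zero,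
      act_sigma3_zero]
    linear_combination (-(I / 2) * (√(dlt ϰ x.1) : ℝ) * ψ x 1) * hrel -
      (aniso ϰ x.1 : ℝ) * (√(dlt ϰ x.1) : ℝ) * (Complex.sin x.1)⁻¹ *
      dPhi ψ x 1 * I_mul_I
  · simp only [PiLp.add_apply, PiLp.smul_apply, smul_eq_mul, act_sigma1_one, act_sigma2_one,
      act_sigma3_one]
    linear_combination (-(I / 2) * (√(dlt ϰ x.1) : ℝ) * ψ x 0) * hrel +
      (aniso ϰ x.1 : ℝ) * (√(dlt ϰ x.1) : ℝ) * (Complex.sin x.1)⁻¹ *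
      dPhi ψ x 0 * I_mul_I

theorem mem_H1_iff {p : PiLp 2 fun _ : Fin 3 => L2S} : p ∈ H1 ↔ ∀ ψ, IsTestField ψ →
    inner ℂ (fld ψ) (p 1) = -inner ℂ (fld (adjNablaTheta ψ)) (p 0) ∧
      inner ℂ (fld ψ) (p 2) = -inner ℂ (fld (nablaPhi ψ)) (p 0) := by
  refine forall₂_congr fun ψ hψ => ?_
  rw [hψ.pairable.inner_fld, hψ.pairable.inner_fld, (adjNablaTheta_pairable hψ).inner_fld,
    (nablaPhi_pairable hψ).inner_fld]

/-- The components `u`, `∇_θ u`, `∇_φ u` of an element of `H¹(S²)`. -/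
def H1.comp (i : Fin 3) : H1 →L[ℂ] L2S :=
  (PiLp.proj 2 (𝕜 := ℂ) (fun _ : Fin 3 => L2S) i) ∘L H1.subtypeL

theorem H1.toL2_injective {u v : H1} (h : H1.toL2 u = H1.toL2 v) : u = v := by
  have h0 : H1.toL2 (u - v) = 0 := by rw [map_sub, h, sub_self]
  have hm := mem_H1_iff.mp (u - v).2
  have h0' : (u - v : H1).1 0 = 0 := h0
  have h1 : (u - v : H1).1 1 = 0 := eq_zero_of_test fun ψ hψ => by
    rw [(hm ψ hψ).1, h0', inner_zero_right, neg_zero]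
  have h2 : (u - v : H1).1 2 = 0 := eq_zero_of_test fun ψ hψ => by
    rw [(hm ψ hψ).2, h0', inner_zero_right, neg_zero]
  rw [← sub_eq_zero]
  refine Subtype.ext (PiLp.ext fun i => ?_)
  fin_cases i
  · exact h0'
  · exact h1
  · exact h2

/-- The operator `A(0) : H¹(S²) → L²(S²)`, up to multiplication by `√Δ σ₁`. -/
def angG (α : ℝ) : H1 →L[ℂ] L2S := (-I) • H1.comp 1 - mulOp (aniso α) sigma3 ∘L H1.comp 2
    + (2 * I) • (mulOp (shift α) 1 ∘L H1.comp 0)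

/-- The operator `A(0) : H¹(S²) → L²(S²)`. -/
def angF (α : ℝ) : H1 →L[ℂ] L2S := mulOp (fun θ => √(dlt α θ)) sigma1 ∘L angG α

/-- The three components of `A(0)⁻¹ f`. -/
def angInvAux (α : ℝ) : L2S →L[ℂ] PiLp 2 fun _ : Fin 3 => L2S :=
  (PiLp.continuousLinearEquiv 2 ℂ fun _ : Fin 3 => L2S).symm.toContinuousLinearMap ∘L
    ContinuousLinearMap.pi ![angT α,
      I • (mulOp (fun θ => (√(dlt α θ))⁻¹) sigma1 + mulOp (aniso α) sigma3 ∘L angW α)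
        + (2 : ℂ) • (mulOp (shift α) 1 ∘L angT α), angW α]

/-- Multiplication by `a sin θ / √Δ σ₂`. -/
def angB (α a : ℝ) : L2S →L[ℂ] L2S := mulOp (rot α a) sigma2

theorem norm_angB_le (hα : 0 ≤ α) : ‖angB α a‖ ≤ |a| :=
  multOp_norm_le (mulOp_measurable (rot_continuous hα)) (abs_nonneg _) (.of_forall fun x =>
    norm_rot_smul (opNorm_le_bound _ zero_le_one fun v => by
      rw [actL_apply, norm_act_sigma2, one_mul]) hα x.1)

theorem angB_symm (hα : 0 ≤ α) (x y : L2S) : inner ℂ (angB α a x) y = inner ℂ x (angB α a y) :=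
  mulOp_symm (rot_continuous hα) sigma2_isHermitian x y

theorem angB_emb (hα : 0 ≤ α) (k : ℝ) (i : Fin 2) (v : ArcL2) :
    angB α a (emb k i v) = emb k (i + 1) ((I * esgn i) • rotMul α a v) := by
  refine Lp.ext ?_
  filter_upwards [mulOp_ae (M := sigma2) (rot_continuous hα (a := a)) (emb k i v), emb_ae k i v,
    emb_ae k (i + 1) ((I * esgn i) • rotMul α a v),
    sphere_ae_of_arc (Lp.coeFn_smul (I * esgn i) (rotMul α a v)),
    sphere_ae_of_arc (rotMul_ae hα v)] with x h1 h2 h3 h4 h5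
  rw [angB, h1, h2, h3, h4, Pi.smul_apply, h5]
  fin_cases i <;> refine spinor_ext ?_ ?_ <;> simp [act_sigma2_zero, act_sigma2_one, esgn] <;> ring

theorem angB_modeEmb (hα : 0 ≤ α) (j : ℤ) (v : ModeL2) :
    angB α a (modeEmb j v) = modeEmb j (modeB α (fsgn j * a) v) := by
  have hr : ∀ w, rotMul α (fsgn j * a) w = (fsgn j : ℂ) • rotMul α a w := fun w => by
    refine Lp.ext ?_
    filter_upwards [rotMul_ae hα (a := fsgn j * a) w, rotMul_ae hα (a := a) w,
      Lp.coeFn_smul (fsgn j : ℂ) (rotMul α a w)] with θ h1 h2 h3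
    rw [h1, h3, Pi.smul_apply, h2, rot, rot]
    push_cast
    ring
  rw [modeEmb_apply, map_add, angB_emb hα, angB_emb hα, slot_add_two, esgn_add_one, esgn_slot,
    modeEmb_apply, add_comm]
  congr 2
  · change _ = (-I) • rotMul α (fsgn j * a) v.snd; rw [hr, smul_smul]; push_cast; ring_nf
  · change _ = I • rotMul α (fsgn j * a) v.fst; rw [hr, smul_smul]

/-- The operator `A(λ) - ω : H¹(S²) → L²(S²)`. -/
def angP (α a : ℝ) (p : ℂ × ℂ) : H1 →L[ℂ] L2S :=
  angF α + p.1 • (angB α a ∘L H1.toL2) - p.2 • H1.toL2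

variable (hα : 0 ≤ a ^ 2 * Λ / 3)
include hα

theorem angF_weak (hψ : IsTestField ψ) (u : H1) :
    inner ℂ (fld (angularExpr a Λ 0 ψ)) (H1.toL2 u) = inner ℂ (fld ψ) (angF ϰ u) := by
  have hc := (sqrt_dlt_contDiff hα).continuous
  have hA := (aniso_contDiff hα).continuous
  have ht := hψ.scale (fun θ _ => (sqrt_dlt_contDiff hα).contDiffAt) sigma1
  have h3 := ht.scale (fun θ _ => (aniso_contDiff hα).contDiffAt) sigma3
  have e1 := (mem_H1_iff.mp u.2 _ ht).1
  have e2 := (mem_H1_iff.mp u.2 _ h3).2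
  rw [(fld_scale hA ht.pairable).2, mulOp_symm hA sigma3_isHermitian] at e2
  rw [fld_angularExpr_nabla hα hψ rfl, angF, comp_apply,
    ← mulOp_symm hc sigma1_isHermitian, ← (fld_scale hc hψ.pairable).2]
  have e0 : H1.toL2 u = u.1 0 := rfl
  have eG : angG ϰ u = (-I) • u.1 1 - mulOp (aniso ϰ) sigma3 (u.1 2)
      + (2 * I) • mulOp (shift ϰ) 1 (u.1 0) := rfl
  rw [eG, e0]
  simp only [inner_add_left, inner_add_right, inner_sub_right, inner_smul_left, inner_smul_right,
    mulOp_symm (shift_continuous hα) Matrix.isHermitian_one, e1, e2]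
  simp only [map_neg, map_mul, conj_I, map_ofNat]
  ring

theorem angInvAux_mem (f : L2S) : angInvAux ϰ f ∈ H1 := by
  refine mem_H1_iff.mpr fun χ hχ => ?_
  have hτ := inv_sqrt_dlt_contDiff hα
  have hA := (aniso_contDiff hα).continuous
  have hψ := hχ.scale (fun θ _ => hτ.contDiffAt) sigma1
  have h3 := hχ.scale (fun θ _ => (aniso_contDiff hα).contDiffAt) sigma3
  have e : χ = scale (fun θ => √(dlt ϰ θ)) sigma1 (scale (fun θ => (√(dlt ϰ θ))⁻¹) sigma1 χ) := by
    funext x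
    have : ((√(dlt ϰ x.1) : ℝ) : ℂ) ≠ 0 := ofReal_ne_zero.mpr (sqrt_pos.mpr (dlt_pos hα)).ne'
    simp only [scale]
    refine spinor_ext ?_ ?_ <;>
    · simp only [PiLp.smul_apply, smul_eq_mul, act_sigma1_zero, act_sigma1_one]
      push_cast
      field_simp
  have h0 := angT_weak hα hψ f
  have h2 := inner_angW hα h3 f
  rw [fld_angularExpr_nabla hα hψ e, (fld_scale hτ.continuous hχ.pairable).2,
    mulOp_symm hτ.continuous sigma1_isHermitian] at h0
  rw [(fld_scale hA hχ.pairable).2, mulOp_symm hA sigma3_isHermitian] at h2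
  refine ⟨?_, inner_angW hα hχ f⟩
  have e1 : angInvAux ϰ f 1 = I • (mulOp (fun θ => (√(dlt ϰ θ))⁻¹) sigma1 f
        + mulOp (aniso ϰ) sigma3 (angW ϰ f))
        + (2 : ℂ) • mulOp (shift ϰ) 1 (angT ϰ f) := rfl
  have e0 : angInvAux ϰ f 0 = angT ϰ f := rfl
  rw [e1, e0]
  simp only [inner_add_left, inner_smul_left,
    mulOp_symm (shift_continuous hα) Matrix.isHermitian_one] at h0
  simp only [inner_add_right, inner_smul_right, ← h0, h2]
  simp only [map_neg, map_mul, conj_I, map_ofNat]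
  linear_combination (inner ℂ (fld (adjNablaTheta χ)) (angT ϰ f) + 2 *
    inner ℂ (fld χ) (mulOp (shift ϰ) 1 (angT ϰ f))) * I_mul_I

omit hα in
/-- The inverse of `A(0)` as an operator `L²(S²) → H¹(S²)`. -/
def angInv (hα : 0 ≤ ϰ) : L2S →L[ℂ] H1 := (angInvAux ϰ).codRestrict H1 (angInvAux_mem hα)

theorem toL2_angInv (f : L2S) : H1.toL2 (angInv hα f) = angT ϰ f := rfl

theorem angF_angInv (f : L2S) : angF ϰ (angInv hα f) = f :=
  eq_of_test fun ψ hψ => by rw [← angF_weak hα hψ, toL2_angInv, angT_weak hα hψ]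

theorem angInv_angF (u : H1) : angInv hα (angF ϰ u) = u := by
  refine H1.toL2_injective (sub_eq_zero.mp (eq_zero_of_angularExpr hα fun j i χ hχ => ?_))
  have ht := modeTest_isTestField hχ j i
  rw [inner_sub_right, toL2_angInv, angT_weak hα ht, angF_weak hα ht, sub_self]

theorem resolventEq_iff {p : ℂ × ℂ} {u : H1} {f : L2S} :
    ResolventEq a Λ p.1 p.2 u f ↔ f = angP ϰ a p u := by
  have hr := rot_continuous hα (a := a)
  have key : ∀ ψ, IsTestField ψ →
      ((∫ x, inner ℂ (ψ x) ((f + p.2 • H1.toL2 u : L2S) x) ∂sphereMeasure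
        = ∫ x, inner ℂ (angularExpr a Λ (starRingEnd ℂ p.1) ψ x) (H1.toL2 u x) ∂sphereMeasure) ↔
      inner ℂ (fld ψ) (f + p.2 • H1.toL2 u)
        = inner ℂ (fld ψ) (angF ϰ u + p.1 • angB ϰ a (H1.toL2 u))) := by
    intro ψ hψ
    have h0 := (angularExpr_pairable hα hψ).1
    have h1 := fld_scale (M := sigma2) hr hψ.pairable
    have e : angularExpr a Λ (starRingEnd ℂ p.1) ψ = fun x => angularExpr a Λ 0 ψ x
        + starRingEnd ℂ p.1 • scale (rot ϰ a) sigma2 ψ x := by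
      funext x
      rw [angularExpr, angularExpr, zero_mul, zero_smul, add_zero, scale, smul_smul]
      rfl
    rw [← hψ.pairable.inner_fld, e, ← (h0.add (h1.1.smul _)).inner_fld, fld_add h0 (h1.1.smul _),
      fld_smul h1.1, h1.2, inner_add_left, angF_weak hα hψ, inner_smul_left, RCLike.conj_conj,
      mulOp_symm hr sigma2_isHermitian, inner_add_right _ (angF ϰ u), inner_smul_right]
    rfl
  have e2 : f = angP ϰ a p u ↔ f + p.2 • H1.toL2 u
      = angF ϰ u + p.1 • angB ϰ a (H1.toL2 u) := eq_sub_iff_add_eq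
  rw [e2]
  exact ⟨fun h => eq_of_test fun ψ hψ => (key ψ hψ).mp (h ψ hψ), fun h ψ hψ => (key ψ hψ).mpr (by rw [h])⟩

theorem angP_angInv (p : ℂ × ℂ) (f : L2S) : angP ϰ a p (angInv hα f)
      = (1 - pencilN (angT ϰ) (angB ϰ a) p) f := by
  change angF _ (angInv hα f) + p.1 • angB _ a (H1.toL2 (angInv hα f)) - p.2 • H1.toL2 (angInv hα f)
    = f - pencilN _ _ p f
  rw [angF_angInv, toL2_angInv, pencilN_apply]
  abel

end SobolevInverse

section Resolvents

variable {a Λ : ℝ} {j : ℤ} {p : ℂ × ℂ}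

local notation "ϰ" => a ^ 2 * Λ / 3

/-- The pencil of the mode `j + 1/2`. -/
def modePencil (a Λ : ℝ) (j : ℤ) (p : ℂ × ℂ) : ModeL2 →L[ℂ] ModeL2 :=
  pencilN (modeT (a ^ 2 * Λ / 3) |freq j|) (modeB (a ^ 2 * Λ / 3) (fsgn j * a)) p

/-- The pencil on the whole sphere. -/
def spherePencil (a Λ : ℝ) (p : ℂ × ℂ) : L2S →L[ℂ] L2S := pencilN (angT (a ^ 2 * Λ / 3)) (angB (a ^ 2 * Λ / 3) a) p

theorem abs_fsgn_mul (j : ℤ) (a : ℝ) : |fsgn j * a| = |a| := by unfold fsgn; split_ifs <;> simp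

theorem angularResolvent_spec (hp : p ∈ regularSet a Λ) :
    IsTwoSidedInverse a Λ p (angularResolvent a Λ p) := by
  have h : ∃ R, IsTwoSidedInverse a Λ p R := hp
  rw [angularResolvent, dif_pos h]
  exact h.choose_spec

theorem modeResolvent_spec {k : ℝ} (hp : p ∈ modeRegularSet a Λ k) :
    IsModeInverse a Λ k p (modeResolvent a Λ k p) := by
  have h : ∃ R, IsModeInverse a Λ k p R := hp
  rw [modeResolvent, dif_pos h]
  exact h.choose_spec

/-- The component of an element of a mode. -/
def modeCoord (j : ℤ) : modeSpace (freq j) →L[ℂ] ModeL2 :=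
  coord modeEmb j ∘L (modeSpace (freq j)).subtypeL

theorem modeEmb_modeCoord (f : modeSpace (freq j)) : modeEmb j (modeCoord j f) = f :=
  (eq_modeEmb_coord f.2).symm

/-- The embedding into the space of a mode. -/
def modeIn (j : ℤ) : ModeL2 →L[ℂ] modeSpace (freq j) :=
  (modeEmb j).toContinuousLinearMap.codRestrict _ (modeEmb_mem j)

theorem coe_modeIn (v : ModeL2) : (modeIn j v : L2S) = modeEmb j v := rfl

theorem modeCoord_modeIn (v : ModeL2) : modeCoord j (modeIn j v) = v := by
  rw [modeCoord, comp_apply, Submodule.subtypeL_apply, coe_modeIn, coord_same]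

theorem modeIn_modeCoord (f : modeSpace (freq j)) : modeIn j (modeCoord j f) = f :=
  Subtype.ext (modeEmb_modeCoord f)

theorem norm_modeCoord (f : modeSpace (freq j)) : ‖modeCoord j f‖ = ‖f‖ := by
  rw [← (modeEmb j).norm_map, modeEmb_modeCoord]
  rfl

/-- The inverse of `A(0)` on a mode, as an operator into `H¹(S²)`. -/
def modeInv (hα : 0 ≤ ϰ) (j : ℤ) : ModeL2 →L[ℂ] H1 := angInv hα ∘L (modeEmb j).toContinuousLinearMap

theorem IsPencil.exists_isUnit {E : Type*} [NormedAddCommGroup E] [InnerProductSpace ℂ E]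
    [CompleteSpace E] {T B : E →L[ℂ] E} {b : ℝ} (h : IsPencil T B b) (lam : ℂ) :
    ∃ ω, IsUnit (1 - pencilN T B (lam, ω)) := by
  refine ⟨(1 + b * |lam.im| : ℝ) * I, h.isUnit_of_im ?_⟩
  have := mul_nonneg h.nonneg (abs_nonneg lam.im)
  rw [Complex.im_ofReal_mul, Complex.I_im, mul_one, abs_of_nonneg (add_nonneg zero_le_one this)]
  exact lt_one_add _

theorem IsMeromorphicFiniteRank.comp_right {U V W : Type*} [NormedAddCommGroup U]
    [NormedSpace ℂ U] [NormedAddCommGroup V] [NormedSpace ℂ V] [NormedAddCommGroup W]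
    [NormedSpace ℂ W] {Ω : Set (ℂ × ℂ)} {R : ℂ × ℂ → V →L[ℂ] W}
    (h : IsMeromorphicFiniteRank Ω R) (L : U →L[ℂ] V) {R' : ℂ × ℂ → U →L[ℂ] W}
    (hR : ∀ p ∈ Ω, R' p = R p ∘L L) : IsMeromorphicFiniteRank Ω R' := by
  intro p₀
  obtain ⟨S, F, K, hS, hF, hK, h0, he⟩ := h p₀
  let C : (V →L[ℂ] W) →L[ℂ] U →L[ℂ] W := (compL ℂ U V W).flip L
  refine ⟨fun p => C (S p), fun p => C (F p), K, (C.analyticAt _).comp hS, (C.analyticAt _).comp hF,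
    hK, h0, he.mono fun p hp => ⟨FinRank.comp_right hp.1 L, hp.2.1, fun hm => ?_⟩⟩
  rw [hR p hm, hp.2.2 hm]
  ext1 x
  rfl

variable (hα : 0 ≤ a ^ 2 * Λ / 3)
include hα

theorem spherePencil_modeEmb (j : ℤ) (p : ℂ × ℂ) (v : ModeL2) :
    (1 - spherePencil a Λ p) (modeEmb j v) = modeEmb j ((1 - modePencil a Λ j p) v) := by
  change modeEmb j v - spherePencil a Λ p (modeEmb j v) = modeEmb j (v - modePencil a Λ j p v)
  rw [spherePencil, modePencil, pencilN_apply, pencilN_apply, angT_modeEmb hα, angB_modeEmb hα,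
    map_sub, map_sub, map_smul, map_smul]

theorem sphere_isPencil (hα' : ϰ ≤ 1 / 4) : IsPencil (angT ϰ) (angB ϰ a) |a| where
  symT := angT_symm hα
  symB := angB_symm hα
  inj x hx := coord_ext modeEmb_isHilbertSum fun j => by
    rw [map_zero]
    refine modeT_inj hα (abs_freq_pos j) _ ?_
    rw [← coord_block modeEmb_isHilbertSum (angT_modeEmb hα), hx, map_zero]
  fin := by
    refine block_finApprox modeEmb_isHilbertSum (angT_modeEmb hα)
      (fun j => modeT_finApprox hα hα' (abs_freq_pos j)) fun ε hε => ?_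
    refine ⟨Finset.Icc (-⌈1 / ε + 1⌉) ⌈1 / ε + 1⌉, fun j hj => ?_⟩
    refine (norm_modeT_le hα (abs_freq_pos j)).trans ?_
    rw [one_div_le (abs_freq_pos j) hε]
    have := Int.le_ceil (1 / ε + 1)
    have : 0 < 1 / ε := by positivity
    rw [Finset.mem_Icc, not_and_or, not_le, not_le] at hj
    rcases hj with h | h
    · have h2 : (j : ℝ) < -(⌈1 / ε + 1⌉ : ℤ) := by exact_mod_cast h
      rw [abs_of_neg (by unfold freq; linarith), freq]
      linarith
    · have h2 : ((⌈1 / ε + 1⌉ : ℤ) : ℝ) < j := by exact_mod_cast h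
      refine le_trans ?_ (le_abs_self _)
      rw [freq]
      linarith
  normB := norm_angB_le hα

theorem mode_isSimplePencil (hα' : ϰ ≤ 1 / 4) (j : ℤ) :
    IsSimplePencil (modeT ϰ |freq j|) (modeB ϰ (fsgn j * a)) chirality |a| := by
  rw [← abs_fsgn_mul j a]
  exact modeT_isSimplePencil hα hα' (abs_freq_pos j) _

theorem isTwoSidedInverse_iff {R : L2S →L[ℂ] H1} :
    IsTwoSidedInverse a Λ p R ↔ IsUnit (1 - spherePencil a Λ p) ∧
      R = angInv hα ∘L inverse (1 - spherePencil a Λ p) := by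
  simp only [IsTwoSidedInverse, resolventEq_iff hα]
  constructor
  · rintro ⟨h1, h2⟩
    have e1 : (1 - spherePencil a Λ p) * (angF ϰ ∘L R) = 1 := by
      ext1 f
      change (1 - spherePencil a Λ p) (angF ϰ (R f)) = f
      rw [spherePencil, ← angP_angInv hα, angInv_angF, ← h1]
    have e2 : (angF ϰ ∘L R) * (1 - spherePencil a Λ p) = 1 := by
      ext1 f
      change angF ϰ (R ((1 - spherePencil a Λ p) f)) = f
      obtain ⟨g, hg, hg'⟩ := h2 (angInv hα f)
      rw [spherePencil, ← angP_angInv hα, ← hg, hg', angF_angInv]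
    obtain ⟨h3, h4⟩ := isUnit_of_inverse e1 e2
    refine ⟨h3, ?_⟩
    ext1 f
    rw [h4]
    exact (angInv_angF hα (R f)).symm
  · rintro ⟨h1, rfl⟩
    refine ⟨fun f => ?_, fun u => ⟨_, rfl, ?_⟩⟩
    · rw [comp_apply, angP_angInv hα]; exact (isUnit_apply_inverse h1 f).symm
    · nth_rewrite 1 [← angInv_angF hα u]
      rw [angP_angInv hα, comp_apply]
      exact (congrArg (angInv hα) (isUnit_inverse_apply h1 _)).trans (angInv_angF hα u)

theorem mem_regularSet_iff : p ∈ regularSet a Λ ↔ IsUnit (1 - spherePencil a Λ p) :=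
  ⟨fun ⟨_, h⟩ => ((isTwoSidedInverse_iff hα).mp h).1,
    fun h => ⟨_, (isTwoSidedInverse_iff hα).mpr ⟨h, rfl⟩⟩⟩

theorem eq_angInv_modeEmb {u : H1} (hu : H1.toL2 u ∈ modeSpace (freq j)) :
    u = angInv hα (modeEmb j (coord modeEmb j (angF ϰ u))) := by
  rw [← eq_of_coord modeEmb_isHilbertSum, angInv_angF]
  intro i hi
  refine modeT_inj hα (abs_freq_pos i) _ ?_
  rw [← coord_block modeEmb_isHilbertSum (angT_modeEmb hα), ← toL2_angInv hα, angInv_angF,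
    eq_modeEmb_coord hu, coord_ne modeEmb_isHilbertSum hi]

theorem angP_modeEmb (v : ModeL2) :
    angP ϰ a p (angInv hα (modeEmb j v)) = modeEmb j ((1 - modePencil a Λ j p) v) := by
  rw [angP_angInv hα, ← spherePencil_modeEmb hα]
  rfl

theorem toL2_modeEmb (v : ModeL2) :
    H1.toL2 (angInv hα (modeEmb j v)) = modeEmb j (modeT ϰ |freq j| v) := by
  rw [toL2_angInv, angT_modeEmb hα]

theorem isModeInverse_iff {R : modeSpace (freq j) →L[ℂ] H1} :
    IsModeInverse a Λ (freq j) p R ↔ IsUnit (1 - modePencil a Λ j p) ∧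
      R = (modeInv hα j ∘L inverse (1 - modePencil a Λ j p)) ∘L modeCoord j := by
  simp only [IsModeInverse, resolventEq_iff hα]
  constructor
  · rintro ⟨h1, h2⟩
    let X : ModeL2 →L[ℂ] ModeL2 := coord modeEmb j ∘L angF ϰ ∘L R ∘L modeIn j
    have hX : ∀ v, angInv hα (modeEmb j (X v)) = R (modeIn j v) := fun v =>
      (eq_angInv_modeEmb hα (h1 _).1).symm
    have e1 : (1 - modePencil a Λ j p) * X = 1 := by
      ext1 v
      refine (modeEmb j).injective ?_
      change modeEmb j ((1 - modePencil a Λ j p) (X v)) = modeEmb j v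
      rw [← angP_modeEmb hα, hX, ← (h1 _).2]
      rfl
    have e2 : X * (1 - modePencil a Λ j p) = 1 := by
      ext1 v
      have hm : H1.toL2 (angInv hα (modeEmb j v)) ∈ modeSpace (freq j) := by
        rw [toL2_modeEmb hα]
        exact modeEmb_mem j _
      obtain ⟨f, hf, hf'⟩ := h2 _ hm
      rw [angP_modeEmb hα] at hf
      have : modeIn j ((1 - modePencil a Λ j p) v) = f := Subtype.ext hf.symm
      change coord modeEmb j (angF _ (R (modeIn j ((1 - modePencil a Λ j p) v)))) = v
      rw [this, hf', angF_angInv, coord_same]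
    obtain ⟨h3, h4⟩ := isUnit_of_inverse e1 e2
    refine ⟨h3, ?_⟩
    ext1 f
    rw [h4]
    refine Eq.trans ?_ (hX (modeCoord j f)).symm
    rw [modeIn_modeCoord]
  · rintro ⟨h1, rfl⟩
    refine ⟨fun f => ⟨?_, ?_⟩, fun u hu => ?_⟩
    · change H1.toL2 (angInv hα (modeEmb j _)) ∈ _; rw [toL2_modeEmb hα]; exact modeEmb_mem j _
    · change _ = angP _ a p (angInv hα (modeEmb j _))
      rw [angP_modeEmb hα]
      exact (modeEmb_modeCoord f).symm.trans (congrArg _ (isUnit_apply_inverse h1 _).symm)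
    · have e := eq_angInv_modeEmb hα hu
      set w := coord modeEmb j (angF ϰ u)
      refine ⟨modeIn j ((1 - modePencil a Λ j p) w), ?_, ?_⟩
      · rw [e, angP_modeEmb hα]; rfl
      · change angInv hα (modeEmb j (inverse (1 - modePencil a Λ j p)
          (modeCoord j (modeIn j ((1 - modePencil a Λ j p) w))))) = u
        rw [modeCoord_modeIn, isUnit_inverse_apply h1, ← e]

theorem mem_modeRegularSet_iff :
    p ∈ modeRegularSet a Λ (freq j) ↔ IsUnit (1 - modePencil a Λ j p) :=
  ⟨fun ⟨_, h⟩ => ((isModeInverse_iff hα).mp h).1, fun h => ⟨_, (isModeInverse_iff hα).mpr ⟨h, rfl⟩⟩⟩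

theorem modeResolvent_eq (hp : IsUnit (1 - modePencil a Λ j p)) : modeResolvent a Λ (freq j) p
      = (modeInv hα j ∘L inverse (1 - modePencil a Λ j p)) ∘L modeCoord j :=
  ((isModeInverse_iff hα).mp (modeResolvent_spec ((mem_modeRegularSet_iff hα).mpr hp))).2

theorem modeResolvent_apply (hp : IsUnit (1 - modePencil a Λ j p))
    (f : modeSpace (freq j)) : modeResolvent a Λ (freq j) p f
      = angInv hα (modeEmb j (inverse (1 - modePencil a Λ j p) (modeCoord j f))) := by
  rw [modeResolvent_eq hα hp]
  rfl

theorem angularResolvent_meromorphic (hα' : ϰ ≤ 1 / 4) :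
    IsMeromorphicFiniteRank (regularSet a Λ) (angularResolvent a Λ) :=
  have h := sphere_isPencil hα hα'
  isMeromorphicFiniteRank_of_inverse (pencilN_analyticAt _ _) (pencilN_finApprox h.fin)
    h.exists_isUnit (angInv hα) (fun _ => mem_regularSet_iff hα) fun _ hp =>
      ((isTwoSidedInverse_iff hα).mp (angularResolvent_spec hp)).2

theorem modeResolvent_meromorphic (hα' : ϰ ≤ 1 / 4) (j : ℤ) :
    IsMeromorphicFiniteRank (modeRegularSet a Λ (freq j)) (modeResolvent a Λ (freq j)) :=
  have h := (mode_isSimplePencil hα hα' j).toIsPencil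
  (isMeromorphicFiniteRank_of_inverse (pencilN_analyticAt _ _) (pencilN_finApprox h.fin)
    h.exists_isUnit (modeInv hα j) (fun _ => mem_modeRegularSet_iff hα) fun _ _ => rfl).comp_right
      (modeCoord j) fun _ hp => modeResolvent_eq hα ((mem_modeRegularSet_iff hα).mp hp)

theorem modeResolvent_restrict (hα' : ϰ ≤ 1 / 4)
    (hp : p ∈ regularSet a Λ) : p ∈ modeRegularSet a Λ (freq j) ∧
      ∀ f : modeSpace (freq j), modeResolvent a Λ (freq j) p f = angularResolvent a Λ p f := by
  have h1 := (mem_regularSet_iff hα).mp hp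
  have h2 : IsUnit (1 - modePencil a Λ j p) := by
    refine isUnit_one_sub_of_injective
      (pencilN_finApprox (mode_isSimplePencil hα hα' j).fin p) fun v hv => ?_
    have h3 : (1 - spherePencil a Λ p) (modeEmb j v) = 0 := by
      rw [spherePencil_modeEmb hα]
      change modeEmb j (v - modePencil a Λ j p v) = 0
      have hv' : modePencil a Λ j p v = v := hv
      rw [hv', sub_self, map_zero]
    refine (map_eq_zero_iff _ (modeEmb j).injective).mp ?_
    rw [← isUnit_inverse_apply h1 (modeEmb j v), h3, map_zero]
  refine ⟨(mem_modeRegularSet_iff hα).mpr h2, fun f => ?_⟩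
  rw [modeResolvent_apply hα h2, ((isTwoSidedInverse_iff hα).mp (angularResolvent_spec hp)).2,
    comp_apply]
  congr 1
  rw [← isUnit_inverse_apply h1 (modeEmb j _), spherePencil_modeEmb hα, isUnit_apply_inverse h2,
    modeEmb_modeCoord]

theorem norm_modeResolvent_le (hp : IsUnit (1 - modePencil a Λ j p)) :
    ‖H1.toL2 ∘L modeResolvent a Λ (freq j) p‖
      ≤ ‖modeT ϰ |freq j| * inverse (1 - modePencil a Λ j p)‖ := by
  refine opNorm_le_bound _ (norm_nonneg _) fun f => ?_
  rw [comp_apply, modeResolvent_apply hα hp, toL2_modeEmb hα, LinearIsometry.norm_map, ← norm_modeCoord f]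
  exact ContinuousLinearMap.le_opNorm (modeT ϰ |freq j| * inverse (1 - modePencil a Λ j p)) _

theorem isEigenvalue_iff {lam μ : ℂ} : IsEigenvalue a Λ (freq j) lam μ ↔
      PEig (modeT ϰ |freq j|) (modeB ϰ (fsgn j * a)) lam μ := by
  have hr : ∀ u, ResolventEq a Λ lam μ u 0 ↔ 0 = angP ϰ a (lam, μ) u := fun u =>
    resolventEq_iff hα (p := (lam, μ))
  simp only [IsEigenvalue, hr]
  constructor
  · rintro ⟨u, hu0, hm, hu⟩
    have e := eq_angInv_modeEmb hα hm
    set w := coord modeEmb j (angF ϰ u)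
    rw [e, angP_modeEmb hα, eq_comm, map_eq_zero_iff _ (modeEmb j).injective] at hu
    have hw : w = modePencil a Λ j (lam, μ) w := sub_eq_zero.mp hu
    refine ⟨modeT ϰ |freq j| w, fun h0 => hu0 ?_, ?_⟩
    · rw [e, modeT_inj hα (abs_freq_pos j) w h0, map_zero, map_zero]
    · exact congrArg _ hw
  · rintro ⟨v, hv0, hv⟩
    set w := μ • v - lam • modeB ϰ (fsgn j * a) v with hw
    refine ⟨angInv hα (modeEmb j w), fun h0 => hv0 ?_, ?_, ?_⟩
    · have := toL2_modeEmb hα (j := j) w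
      rw [h0, map_zero, ← hv, eq_comm, map_eq_zero_iff _ (modeEmb j).injective] at this
      exact this
    · rw [toL2_modeEmb hα]; exact modeEmb_mem j _
    · rw [angP_modeEmb hα, eq_comm, map_eq_zero_iff _ (modeEmb j).injective]
      change w - modePencil a Λ j (lam, μ) w = 0
      rw [modePencil, pencilN_apply, ← hv, ← hw, sub_self]

end Resolvents

theorem AnalyticAt.sandwich {U V W X Y : Type*} [NormedAddCommGroup U] [NormedSpace ℂ U]
    [NormedAddCommGroup V] [NormedSpace ℂ V] [NormedAddCommGroup W] [NormedSpace ℂ W]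
    [NormedAddCommGroup X] [NormedSpace ℂ X] [NormedAddCommGroup Y] [NormedSpace ℂ Y]
    {Z : Y → X →L[ℂ] V} {p : Y} (hZ : AnalyticAt ℂ Z p) (P : V →L[ℂ] W) (L : U →L[ℂ] X) :
    AnalyticAt ℂ (fun y => (P ∘L Z y) ∘L L) p :=
  (((compL ℂ U X W).flip L ∘L compL ℂ X V W P).analyticAt _).comp hZ

section Branches

variable {E : Type*} [NormedAddCommGroup E] [InnerProductSpace ℂ E] [CompleteSpace E]

theorem exists_gap_bound {X : Type*} [TopologicalSpace X] [CompactSpace X] [Nonempty X]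
    {T B S : X → E →L[ℂ] E} {b : X → ℝ} (h : ∀ x, IsSimplePencil (T x) (B x) (S x) (b x))
    (hT : Continuous T) (hB : Continuous B) {n : ℕ} (hn : 1 ≤ n) :
    ∃ δ : ℝ → ℝ, Continuous δ ∧ (∀ t, 0 < δ t) ∧ ∀ x t, δ t ≤ eigGap (T x) (B x) t n := by
  have hc := fun i => continuous_eigSeq (fun x : ℝ × X => h x.2) continuous_fst
    (hT.comp continuous_snd) (hB.comp continuous_snd) i
  let g : ℝ → X → ℝ := fun t x => eigGap (T x) (B x) t n
  have hg : Continuous ↿g := ((hc (n + 1)).sub (hc n)).min ((hc n).sub (hc (n - 1)))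
  have hgt : ∀ t, Continuous (g t) := fun t => hg.comp (by fun_prop : Continuous fun x : X => (t, x))
  refine ⟨fun t => sInf (g t '' univ), isCompact_univ.continuous_sInf hg, fun t => ?_, fun x t => ?_⟩
  · obtain ⟨x, -, hx⟩ := (isCompact_univ.image (hgt t)).sInf_mem (univ_nonempty.image _)
    dsimp only
    rw [← hx]
    exact (h x).eigGap_pos t hn
  · exact csInf_le (isCompact_univ.image (hgt t)).bddBelow (mem_image_of_mem _ (mem_univ x))

/-- The `l`-th positive or the `|l|`-th negative eigenvalue. -/
def signedEig (T B : E →L[ℂ] E) (t : ℝ) (l : ℤ) : ℝ :=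
  if 0 < l then eigSeq T B t l.natAbs else -eigSeq T B t l.natAbs

theorem IsSimplePencil.exists_signed_branch {T B S : E →L[ℂ] E} {b : ℝ}
    (h : IsSimplePencil T B S b) {l : ℤ} (hl : l ≠ 0) {δ : ℝ → ℝ} (hδc : Continuous δ)
    (hδ : ∀ t, 0 < δ t) (hgap : ∀ t, δ t ≤ eigGap T B t l.natAbs) :
    ∃ (μ : ℂ → ℂ) (Z : ℂ × ℂ → E →L[ℂ] E), (∀ t : ℝ, μ t = signedEig T B t l) ∧
      AnalyticOnNhd ℂ μ {lam | b * |lam.im| < δ lam.re / 16} ∧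
      ∀ p : ℂ × ℂ, b * |p.1.im| < δ p.1.re / 16 → ‖p.2 - μ p.1‖ < δ p.1.re / 16 →
        AnalyticAt ℂ Z p ∧ (IsUnit (1 - pencilN T B p) ↔ p.2 ≠ μ p.1) ∧
        (p.2 ≠ μ p.1 → inverse (1 - pencilN T B p) = (p.2 - μ p.1)⁻¹ • Z p) := by
  have hn : 1 ≤ l.natAbs := by omega
  have hc : Continuous fun t => eigSeq T B t l.natAbs :=
    continuous_eigSeq (fun _ => h) continuous_id continuous_const continuous_const _
  refine h.exists_global_branch ?_ hδc hδ (fun t => ?_) fun t ν hν hne => (hgap t).trans ?_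
  · unfold signedEig; split_ifs; exacts [hc, hc.neg]
  · have h1 := (h.eigSeq_spec t hn).2.1
    unfold signedEig
    split_ifs
    · exact h1
    · rw [ofReal_neg]; exact h.neg_eig h1
  · unfold signedEig at hne ⊢
    split_ifs at hne ⊢
    · exact h.eigGap_le hn hν hne
    · have h1 := h.eigGap_le (t := t) hn (ν := -ν) (by rw [ofReal_neg]; exact h.neg_eig hν)
        fun h0 => hne (by rw [← h0, neg_neg])
      grind

end Branches

section Eigenvalues

variable {a Λ : ℝ} {j l : ℤ}

theorem Admissible.coupling (h : Admissible Λ a) :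
    0 ≤ a ^ 2 * Λ / 3 ∧ a ^ 2 * Λ / 3 ≤ 36 / 500 := by
  have := h.1
  refine ⟨by positivity, h.2.trans ?_⟩
  have : 1.732 ≤ √3 := le_sqrt_of_sq_le (by norm_num)
  linarith

theorem Admissible.abs_le (h : Admissible Λ a) : |a| ≤ 1 + 1 / Λ := by
  have hΛ : 0 < Λ := h.1
  refine abs_le_of_sq_le_sq ?_ (by positivity)
  have : a ^ 2 ≤ 1 / Λ := by rw [le_div_iff₀ hΛ]; linarith [h.coupling.2]
  nlinarith [one_div_pos.mpr hΛ]

theorem IsHalfInteger.exists_freq {k : ℝ} (h : IsHalfInteger k) : ∃ j, k = freq j := h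

theorem isNthEigenvalue_iff (hα : 0 ≤ a ^ 2 * Λ / 3) (hl : 0 < l) {t m : ℝ} :
    IsNthEigenvalue a Λ (freq j) l t m ↔ IsNthPos (modeT (a ^ 2 * Λ / 3) |freq j|)
      (modeB (a ^ 2 * Λ / 3) (fsgn j * a)) t l.natAbs m := by
  simp only [IsNthEigenvalue, isEigenvalue_iff hα, IsNthPos, posEig]
  grind

theorem isNthEigenvalue_neg (hα : 0 ≤ a ^ 2 * Λ / 3) (hα' : a ^ 2 * Λ / 3 ≤ 1 / 4) (hl : l < 0)
    {t m : ℝ} (hm : IsNthPos (modeT (a ^ 2 * Λ / 3) |freq j|)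
      (modeB (a ^ 2 * Λ / 3) (fsgn j * a)) t l.natAbs m) :
    IsNthEigenvalue a Λ (freq j) l t (-m : ℝ) := by
  have hs := mode_isSimplePencil hα hα' j
  have hneg : ∀ ν : ℝ, IsEigenvalue a Λ (freq j) t (-ν : ℝ) ↔ IsEigenvalue a Λ (freq j) t ν := by
    intro ν
    rw [isEigenvalue_iff hα, isEigenvalue_iff hα, ofReal_neg]
    exact ⟨fun h => by simpa using hs.neg_eig h, fun h => hs.neg_eig h⟩
  refine ⟨(hneg m).mpr ((isEigenvalue_iff hα).mpr hm.2.1), Or.inr ⟨hl, by linarith [hm.1], ?_⟩⟩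
  rw [← hm.2.2, ← ncard_image_of_injective _ neg_injective]
  congr 1
  ext ν
  simp only [image_neg_eq_neg, Set.mem_neg, mem_ofPred_eq, posEig, ← isEigenvalue_iff hα, hneg]
  grind

theorem exists_uniform_gap (hΛ : 0 < Λ) (j : ℤ) {n : ℕ} (hn : 1 ≤ n) :
    ∃ δ : ℝ → ℝ, Continuous δ ∧ (∀ t, 0 < δ t) ∧ ∀ a, Admissible Λ a → ∀ t,
      δ t ≤ eigGap (modeT (a ^ 2 * Λ / 3) |freq j|) (modeB (a ^ 2 * Λ / 3) (fsgn j * a)) t n := by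
  let K : Set ℝ := {a | a ^ 2 * Λ / 3 ≤ 7 - 4 * √3}
  have hK : IsCompact K := by
    refine IsCompact.of_isClosed_subset (isCompact_Icc (a := -(1 + 1 / Λ)) (b := 1 + 1 / Λ))
      (isClosed_le (by fun_prop) continuous_const) fun a ha => abs_le.mp (Admissible.abs_le ⟨hΛ, ha⟩)
  have : CompactSpace K := isCompact_iff_compactSpace.mp hK
  have : Nonempty K := ⟨0, by
    have : √3 ≤ 1.75 := (sqrt_le_left (by norm_num)).mpr (by norm_num)
    grind⟩
  have hadm : ∀ x : K, Admissible Λ x := fun x => ⟨hΛ, x.2⟩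
  let f : K → NNReal := fun x => ⟨(x : ℝ) ^ 2 * Λ / 3, (hadm x).coupling.1⟩
  have hf : Continuous f := Continuous.subtype_mk (by fun_prop) _
  obtain ⟨δ, h1, h2, h3⟩ := exists_gap_bound
    (T := fun x => modeT (f x) |freq j|) (B := fun x : K => modeB (f x) (fsgn j * (x : ℝ)))
    (fun x => mode_isSimplePencil (hadm x).coupling.1 (by linarith [(hadm x).coupling.2]) j)
    ((modeT_continuous (abs_freq_pos j)).comp hf) (modeB_continuous hf (by fun_prop)) hn
  exact ⟨δ, h1, h2, fun a ha t => h3 ⟨a, ha.2⟩ t⟩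

theorem exists_mode_branch (hΛ : 0 < Λ) (j : ℤ) (hl : l ≠ 0) :
    ∃ ρ : ℝ → ℝ, Continuous ρ ∧ (∀ t, 0 < ρ t) ∧ ∀ a : ℝ, Admissible Λ a →
      ∃ (μ : ℂ → ℂ) (S : ℂ × ℂ → modeSpace (freq j) →L[ℂ] H1),
        AnalyticOnNhd ℂ μ {lam | |lam.im| < ρ lam.re} ∧
        AnalyticOnNhd ℂ S {p | |p.1.im| < ρ p.1.re ∧ ‖p.2 - μ p.1‖ < ρ p.1.re} ∧
        (∀ t : ℝ, ∃ m : ℝ, μ t = m ∧ IsNthEigenvalue a Λ (freq j) l t m) ∧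
        ∀ lam ω : ℂ, |lam.im| < ρ lam.re → ‖ω - μ lam‖ < ρ lam.re →
          ((lam, ω) ∈ modeRegularSet a Λ (freq j) ↔ ω ≠ μ lam) ∧
          (ω ≠ μ lam → modeResolvent a Λ (freq j) (lam, ω) = (ω - μ lam)⁻¹ • S (lam, ω)) := by
  have hn : 1 ≤ l.natAbs := by omega
  obtain ⟨δ, hδc, hδ, hgap⟩ := exists_uniform_gap hΛ j hn
  have hA : 0 < 16 * (1 + 1 / Λ) := by positivity
  refine ⟨fun t => δ t / (16 * (1 + 1 / Λ)), hδc.div_const _, fun t => div_pos (hδ t) hA,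
    fun a ha => ?_⟩
  obtain ⟨hα, hα'⟩ := ha.coupling
  have hs := mode_isSimplePencil hα (by linarith) j
  have hle : ∀ x t : ℝ, 0 ≤ x → x < δ t / (16 * (1 + 1 / Λ)) →
      x < δ t / 16 ∧ |a| * x < δ t / 16 := fun x t hx h => by
    rw [lt_div_iff₀ hA] at h
    have h3 : |a| * x ≤ (1 + 1 / Λ) * x := mul_le_mul_of_nonneg_right ha.abs_le hx
    have h4 : 0 ≤ 1 / Λ * x := by positivity
    constructor <;> linarith
  have hm : ∀ t : ℝ, IsNthEigenvalue a Λ (freq j) l t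
      (signedEig (modeT (a ^ 2 * Λ / 3) |freq j|) (modeB (a ^ 2 * Λ / 3) (fsgn j * a)) t l) :=
    fun t => by
      unfold signedEig
      split_ifs with h
      · exact (isNthEigenvalue_iff hα h).mpr (hs.eigSeq_spec t hn)
      · exact isNthEigenvalue_neg hα (by linarith) (by omega) (hs.eigSeq_spec t hn)
  obtain ⟨μ, Z, hμ, hμa, hZ⟩ := hs.exists_signed_branch hl hδc hδ (hgap a ha)
  refine ⟨μ, fun p => (modeInv hα j ∘L Z p) ∘L modeCoord j, fun lam h => hμa lam (hle _ _ (abs_nonneg _) h).2,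
    fun p hp => ?_, fun t => ⟨_, hμ t, hm t⟩, fun lam ω h1 h2 => ?_⟩
  · exact AnalyticAt.sandwich (hZ p (hle _ _ (abs_nonneg _) hp.1).2
      (hle _ _ (norm_nonneg _) hp.2).1).1 _ _
  · obtain ⟨-, h3, h4⟩ := hZ (lam, ω) (hle _ _ (abs_nonneg _) h1).2 (hle _ _ (norm_nonneg _) h2).1
    refine ⟨(mem_modeRegularSet_iff hα).trans h3, fun hne => ?_⟩
    rw [modeResolvent_eq hα (h3.mpr hne), modePencil, h4 hne, ContinuousLinearMap.comp_smul,
      ContinuousLinearMap.smul_comp]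

theorem eigenvalue_bounds (ha : Admissible Λ a) (hl : 1 ≤ l) {t m : ℝ}
    (hm : IsNthEigenvalue a Λ (freq j) l t m) :
    (2 - exp (1 / 26)) * (|freq j| - 1 / 2 + l) - 500 * |freq j| - 10 - |a * t| ≤ m ∧
      m ≤ exp (1 / 26) * (|freq j| - 1 / 2 + l) + 500 * |freq j| + 10 + |a * t| := by
  obtain ⟨hα, hα'⟩ := ha.coupling
  have hN := (isNthEigenvalue_iff hα hl).mp hm
  have := half_le_abs_freq j
  have hn : ((l.natAbs : ℕ) : ℝ) = l := by rw [← Int.cast_natCast, Int.natAbs_of_nonneg (by omega)]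
  have : (1 : ℝ) ≤ l := by exact_mod_cast hl
  have hup := mode_nth_le hα (by linarith) (abs_freq_pos j) hN
  have hlo := mode_le_nth hα (by linarith) (abs_freq_pos j) (J := ⌈26 * |freq j|⌉₊)
    (Nat.le_ceil _) hN
  have := Nat.ceil_lt_add_one (by positivity : 0 ≤ 26 * |freq j|)
  rw [trialConst] at hup
  rw [abs_fsgn_mul, ← abs_mul, hn] at hup hlo
  set κ := |freq j|
  set e := exp (1 / 26) with he
  have he1 : 1 + 1 / 26 + (1 / 26) ^ 2 / 2 ≤ e := quadratic_le_exp_of_nonneg (by norm_num)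
  constructor
  · have hq0 := exp_pos (-(1 / 26) : ℝ)
    have hq1 : exp (-(1 / 26) : ℝ) ≤ 1 := exp_le_one_iff.mpr (by norm_num)
    have : exp (-(1 / 26) : ℝ) * e = 1 := by rw [he, ← exp_add]; norm_num
    set q := exp (-(1 / 26) : ℝ)
    have h2 : 2 - e ≤ q := by nlinarith [mul_nonneg hq0.le (sq_nonneg (e - 1))]
    have h3 : (2 - e) * l ≤ q * l := mul_le_mul_of_nonneg_right h2 (by linarith)
    have : q * (2 * (⌈26 * κ⌉₊ : ℝ) + 1) ≤ 1 * (2 * (⌈26 * κ⌉₊ : ℝ) + 1) :=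
      mul_le_mul_of_nonneg_right hq1 (by positivity)
    have : (2 - e) * (κ - 1 / 2) ≤ 1 * (κ - 1 / 2) :=
      mul_le_mul_of_nonneg_right (by linarith) (by linarith)
    linarith
  · have hr : √(1 + a ^ 2 * Λ / 3) ≤ 1.03538 :=
      (sqrt_le_left (by norm_num)).mpr (by norm_num; linarith)
    have hp : π / (π - 1 / 100) ≤ 1.0033 := by
      have := pi_gt_d2
      rw [div_le_iff₀ (by linarith)]
      linarith
    have hp0 : 0 ≤ π / (π - 1 / 100) := div_nonneg pi_pos.le (by linarith [pi_gt_three])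
    have h1 : l * π / (π - 1 / 100) + κ * ((1 + a ^ 2 * Λ / 3) * 400) ≤ 1.0033 * l + 430 * κ := by
      rw [mul_div_assoc]
      have h2 := mul_le_mul_of_nonneg_left hp (by linarith : (0 : ℝ) ≤ l)
      have h3 := mul_le_mul_of_nonneg_left (by linarith : (1 + a ^ 2 * Λ / 3) * 400 ≤ 430)
        (by linarith : 0 ≤ κ)
      linarith
    have h2 := mul_le_mul hr h1 (add_nonneg
      (by rw [mul_div_assoc]; exact mul_nonneg (by linarith) hp0)
      (mul_nonneg (by linarith) (by positivity))) (by norm_num)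
    have h3 := mul_le_mul_of_nonneg_right he1 (by linarith : 0 ≤ κ - 1 / 2 + l)
    norm_num at h2 h3
    linarith

end Eigenvalues

section Estimates

variable {a Λ k : ℝ} {lam ω : ℂ}

theorem modeResolvent_small (ha : Admissible Λ a) (hk : IsHalfInteger k) (hω : ‖ω‖ ≤ 0.4 * |k|)
    (hlam : 10 * ‖(a : ℂ) * lam‖ ≤ |k|) : (lam, ω) ∈ modeRegularSet a Λ k ∧
      ‖H1.toL2 ∘L modeResolvent a Λ k (lam, ω)‖ ≤ 10 / |k| := by
  obtain ⟨j, rfl⟩ := hk.exists_freq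
  obtain ⟨hα, hα'⟩ := ha.coupling
  have hκ := abs_freq_pos j
  rw [norm_mul, norm_real, norm_eq_abs] at hlam
  obtain ⟨h1, h2⟩ := (mode_isSimplePencil hα (by linarith) j).toIsPencil.small hκ
    (norm_modeT_le hα hκ) (p := (lam, ω)) (by dsimp only; linarith)
  refine ⟨(mem_modeRegularSet_iff hα).mpr h1, (norm_modeResolvent_le hα h1).trans (h2.trans ?_)⟩
  dsimp only
  rw [div_le_div_iff₀ (by linarith) hκ]
  linarith

theorem modeResolvent_im (ha : Admissible Λ a) (hk : IsHalfInteger k)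
    (h : |a| * |lam.im| < |ω.im|) : (lam, ω) ∈ modeRegularSet a Λ k ∧
      ‖H1.toL2 ∘L modeResolvent a Λ k (lam, ω)‖ ≤ 1 / (|ω.im| - |a| * |lam.im|) := by
  obtain ⟨j, rfl⟩ := hk.exists_freq
  obtain ⟨hα, hα'⟩ := ha.coupling
  have hp := (mode_isSimplePencil hα (by linarith) j).toIsPencil
  have h1 := hp.isUnit_of_im (p := (lam, ω)) h
  exact ⟨(mem_modeRegularSet_iff hα).mpr h1,
    (norm_modeResolvent_le hα h1).trans (hp.norm_le_of_im (p := (lam, ω)) h)⟩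

theorem modeResolvent_sector {ψ : ℝ} (hψ : 0 < ψ) (ha : Admissible Λ a) (hk : IsHalfInteger k)
    (h1 : ψ ≤ |ω.arg|) (h2 : |ω.arg| ≤ π - ψ)
    (h3 : 4 / sin (min ψ (π / 2)) * ‖(a : ℂ) * lam‖ ≤ ‖ω‖) :
    (lam, ω) ∈ modeRegularSet a Λ k ∧ ‖H1.toL2 ∘L modeResolvent a Λ k (lam, ω)‖
      ≤ 4 / sin (min ψ (π / 2)) / ‖ω‖ := by
  have hm : min ψ (π / 2) = ψ := min_eq_left (by linarith)
  rw [hm] at h3 ⊢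
  have hs : 0 < sin ψ := sin_pos_of_pos_of_lt_pi hψ (by linarith)
  have hω : 0 < ‖ω‖ := norm_pos_iff.mpr fun h0 => by
    rw [h0, Complex.arg_zero, abs_zero] at h1
    linarith
  have : ‖ω‖ * sin ψ ≤ |ω.im| := by
    rw [← Complex.norm_mul_sin_arg, abs_mul, abs_of_pos hω]
    refine mul_le_mul_of_nonneg_left ?_ hω.le
    have h5 : |sin ω.arg| = sin |ω.arg| := by
      rcases abs_cases ω.arg with ⟨h, h'⟩ | ⟨h, h'⟩ <;> rw [h]
      · exact abs_of_nonneg (sin_nonneg_of_nonneg_of_le_pi h' (by linarith))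
      · rw [← abs_neg, ← sin_neg]
        exact abs_of_nonneg (sin_nonneg_of_nonneg_of_le_pi (by linarith) (by linarith))
    rw [h5]
    rcases le_total |ω.arg| (π / 2) with h | h
    · exact sin_le_sin_of_le_of_le_pi_div_two (by linarith) h h1
    · rw [← sin_pi_sub |ω.arg|]
      exact sin_le_sin_of_le_of_le_pi_div_two (by linarith) (by linarith) (by linarith)
  have : |a| * |lam.im| ≤ ‖ω‖ * sin ψ / 4 := by
    rw [div_mul_eq_mul_div, div_le_iff₀ hs, norm_mul, norm_real, norm_eq_abs] at h3
    have := mul_le_mul_of_nonneg_left (abs_im_le_norm lam) (abs_nonneg a)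
    linarith
  have : 0 < ‖ω‖ * sin ψ := mul_pos hω hs
  obtain ⟨h8, h9⟩ := modeResolvent_im ha hk (lam := lam) (ω := ω) (by linarith)
  refine ⟨h8, h9.trans ?_⟩
  rw [div_div, div_le_div_iff₀ (by linarith) (by linarith)]
  linarith

end Estimates

end KerrAngular

end

open KerrAngular in
theorem proposition5p1 :
    -- `R(λ, ω)` is a two-sided inverse, meromorphic with poles of finite rank, also on each mode
    (∀ Λ a : ℝ, Admissible Λ a →
      (∀ p ∈ regularSet a Λ, IsTwoSidedInverse a Λ p (angularResolvent a Λ p)) ∧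
      IsMeromorphicFiniteRank (regularSet a Λ) (angularResolvent a Λ) ∧
      ∀ k : ℝ, IsHalfInteger k →
        (∀ p ∈ modeRegularSet a Λ k, IsModeInverse a Λ k p (modeResolvent a Λ k p)) ∧
        IsMeromorphicFiniteRank (modeRegularSet a Λ k) (modeResolvent a Λ k) ∧
        ∀ p ∈ regularSet a Λ, p ∈ modeRegularSet a Λ k ∧
          ∀ f : modeSpace k, modeResolvent a Λ k p f = angularResolvent a Λ p f) ∧
    -- the decomposition near `Im λ = 0`, `ω = μ_{k,l}(λ)`, in a neighbourhood independent of `a`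
    (∀ Λ : ℝ, 0 < Λ → ∀ k : ℝ, IsHalfInteger k → ∀ l : ℤ, l ≠ 0 →
      ∃ ρ : ℝ → ℝ, Continuous ρ ∧ (∀ t, 0 < ρ t) ∧
        ∀ a : ℝ, Admissible Λ a →
          ∃ (μ : ℂ → ℂ) (S : ℂ × ℂ → modeSpace k →L[ℂ] H1),
            AnalyticOnNhd ℂ μ {lam | |lam.im| < ρ lam.re} ∧
            AnalyticOnNhd ℂ S {p | |p.1.im| < ρ p.1.re ∧ ‖p.2 - μ p.1‖ < ρ p.1.re} ∧
            (∀ t : ℝ, ∃ m : ℝ, μ t = m ∧ IsNthEigenvalue a Λ k l t m) ∧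
            ∀ lam ω : ℂ, |lam.im| < ρ lam.re → ‖ω - μ lam‖ < ρ lam.re →
              ((lam, ω) ∈ modeRegularSet a Λ k ↔ ω ≠ μ lam) ∧
              (ω ≠ μ lam →
                modeResolvent a Λ k (lam, ω) = (ω - μ lam)⁻¹ • S (lam, ω))) ∧
    -- the bounds on the eigenvalues for real `λ`
    (∃ C₁ C₂ : ℝ, ∀ Λ a : ℝ, Admissible Λ a → ∀ k : ℝ, IsHalfInteger k →
      ∀ l : ℤ, 1 ≤ l → ∀ lam μ : ℝ, IsNthEigenvalue a Λ k l lam μ →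
        (2 - Real.exp (1 / 26)) * (|k| - 1 / 2 + l) - C₁ * |k| - C₂ - |a * lam| ≤ μ ∧
        μ ≤ Real.exp (1 / 26) * (|k| - 1 / 2 + l) + C₁ * |k| + C₂ + |a * lam|) ∧
    -- the bound for `|ω| ≤ 0.4 |k|`
    (∃ C : ℝ, 0 < C ∧ ∀ Λ a : ℝ, Admissible Λ a → ∀ k : ℝ, IsHalfInteger k →
      ∀ lam ω : ℂ, ‖ω‖ ≤ 0.4 * |k| → C * ‖(a : ℂ) * lam‖ ≤ |k| →
        (lam, ω) ∈ modeRegularSet a Λ k ∧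
        ‖H1.toL2 ∘L modeResolvent a Λ k (lam, ω)‖ ≤ C / |k|) ∧
    -- the bound away from the real axis
    (∀ Λ a : ℝ, Admissible Λ a → ∀ k : ℝ, IsHalfInteger k →
      ∀ lam ω : ℂ, 2 * |a| * |lam.im| < |ω.im| →
        (lam, ω) ∈ modeRegularSet a Λ k ∧
        ‖H1.toL2 ∘L modeResolvent a Λ k (lam, ω)‖ ≤ 1 / (|ω.im| - |a| * |lam.im|)) ∧
    -- the bound in sectors
    (∀ ψ : ℝ, 0 < ψ → ∃ C : ℝ, 0 < C ∧ ∀ Λ a : ℝ, Admissible Λ a →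
      ∀ k : ℝ, IsHalfInteger k → ∀ lam ω : ℂ,
        ψ ≤ |ω.arg| → |ω.arg| ≤ Real.pi - ψ → C * ‖(a : ℂ) * lam‖ ≤ ‖ω‖ →
          (lam, ω) ∈ modeRegularSet a Λ k ∧
          ‖H1.toL2 ∘L modeResolvent a Λ k (lam, ω)‖ ≤ C / ‖ω‖) := by
  refine ⟨fun Λ a ha => ?_, fun Λ hΛ k hk l hl => ?_, ⟨500, 10, fun Λ a ha k hk l hl lam μ hμ => ?_⟩,
    ⟨10, by norm_num, fun Λ a ha k hk lam ω h1 h2 => modeResolvent_small ha hk h1 h2⟩,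
    fun Λ a ha k hk lam ω h => modeResolvent_im ha hk ?_, fun ψ hψ => ?_⟩
  · obtain ⟨hα, hα'⟩ := ha.coupling
    refine ⟨fun p hp => angularResolvent_spec hp,
      angularResolvent_meromorphic hα (by linarith), fun k hk => ?_⟩
    obtain ⟨j, rfl⟩ := hk.exists_freq
    exact ⟨fun p hp => modeResolvent_spec hp, modeResolvent_meromorphic hα (by linarith) j,
      fun p hp => modeResolvent_restrict hα (by linarith) hp⟩
  · obtain ⟨j, rfl⟩ := hk.exists_freq
    exact exists_mode_branch hΛ j hl
  · obtain ⟨j, rfl⟩ := hk.exists_freq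
    exact eigenvalue_bounds ha hl hμ
  · have := mul_nonneg (abs_nonneg a) (abs_nonneg lam.im)
    linarith
  · have hm : 0 < min ψ (Real.pi / 2) := lt_min hψ (by positivity)
    have hs : 0 < Real.sin (min ψ (Real.pi / 2)) := Real.sin_pos_of_pos_of_lt_pi hm
      ((min_le_right _ _).trans_lt (by linarith [Real.pi_pos]))
    exact ⟨4 / Real.sin (min ψ (Real.pi / 2)), by positivity,
      fun Λ a ha k hk lam ω h1 h2 h3 => modeResolvent_sector hψ ha hk h1 h2 h3⟩
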